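/- Let $\varphi\in C_c^\infty(\mathbb{R}^3)$ with $\int\varphi=1$, and $\varphi_\epsilon(x)=\epsilon^{-3}\varphi(x/\epsilon)$. Let $\Omega\subset\mathbb{R}\times\mathbb{R}^3$ be open. By a cylinder $Q\subset\subset\Omega$ we mean $Q=I\times O$ with $I\subset\mathbb{R}$ an open interval and $O\subset\mathbb{R}^3$ open, such that $\overline Q$ is a compact subset of $\Omega$. For a divergence-free $\vec f\in L^2_{\rm loc}(\Omega)$, a vector field $\vec u$ is a *local weak solution* of the Navier--Stokes equations on $\Omega$ associated to the force $\vec f$ if for every cylinder $Q\subset\subset\Omega$ we have $\vec u\in L^\infty_tL^2_x(Q)\cap L^2_tH^1_x(Q)$, $\operatorname{div}\vec u=0$ on $Q$ and, for every divergence-free $\vec\phi\in\mathcal{D}(Q)$, $$\iint_Q \vec u\cdot(\partial_t\vec\phi+\Delta\vec\phi)+\vec u\cdot(\vec u\cdot\vec\nabla\vec\phi)+\vec f\cdot\vec\phi\,dt\,dx=0 .$$ Such a $\vec u$ is *dissipative* if, on every cylinder $Q\subset\subset\Omega$, the limit $$M(\vec u)=\lim_{\epsilon\to0^+}\Bigl(-\operatorname{div}(|\vec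 u|^2\vec u)+2\,(\varphi_\epsilon*\vec u)\cdot\bigl(\varphi_\epsilon*(\vec u\cdot\vec\nabla\vec u)\bigr)\Bigr)$$ (convolutions in the space variable $x$) exists in $\mathcal{D}'(Q)$ and is a non-negative distribution. **Theorem (Dissipative limits).** Let $(\vec f_n)$ be a sequence of divergence-free vector fields in $L^2_{\rm loc}(\Omega)$ and $(\vec u_n)$ a sequence of local weak solutions of the Navier--Stokes equations on $\Omega$, associated to the forces $\vec f_n$, such that, for each cylinder $Q\subset\subset\Omega$, - $\vec f_n\in L^2_tH^1_x(Q)$ and $\vec f_n$ converges weakly in $L^2_tH^1_x(Q)$ to a limit $\vec f$; - the sequence $\vec u_n$ is bounded in $L^\infty_tL^2_x(Q)\cap L^2_tH^1_x(Q)$ and converges weakly in $L^2_tH^1_x(Q)$ to a limit $\vec u$; - for every $n$, $\vec u_n$ is dissipative. Then $\vec f\in L^2_{\rm loc}(\Omega)$ is divergence-free, and $\vec u$ is a dissipative local weak solution on $\Omega$ of the Navier--Stokes equations associated to the force $\vec f$. -/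

import Mathlib

open Set Filter Topology MeasureTheory TopologicalSpace
open scoped ENNReal NNReal ContDiff Distributions

noncomputable section

namespace NavierStokes

/-- The physical space `ℝ³` with its Euclidean norm. -/
abbrev R3 : Type := EuclideanSpace ℝ (Fin 3)

/-- Space-time `ℝ × ℝ³`; points are `z = (t, x)`. -/
abbrev SpaceTime : Type := ℝ × R3

section Calculus

variable {F : Type*} [NormedAddCommGroup F] [NormedSpace ℝ F]

/-- The classical time derivative `∂ₜ φ` (used on test functions only). -/
def timeDeriv (φ : SpaceTime → F) (z : SpaceTime) : F :=
  fderiv ℝ φ z (1, 0)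

/-- The classical space derivative `∂ⱼ φ` (used on test functions only). -/
def spaceDeriv (j : Fin 3) (φ : SpaceTime → F) (z : SpaceTime) : F :=
  fderiv ℝ φ z (0, EuclideanSpace.single j 1)

/-- The Laplacian in the space variables, `Δ φ = ∑ⱼ ∂ⱼ ∂ⱼ φ`. -/
def laplacian (φ : SpaceTime → F) (z : SpaceTime) : F :=
  ∑ j, spaceDeriv j (spaceDeriv j φ) z

/-- The advection term `(v · ∇) φ = ∑ⱼ vⱼ ∂ⱼ φ`. -/
def advection (v : SpaceTime → R3) (φ : SpaceTime → F) (z : SpaceTime) : F :=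
  ∑ j, v z j • spaceDeriv j φ z

end Calculus

/-- The classical divergence in the space variables, `div φ = ∑ⱼ ∂ⱼ φⱼ`. -/
def divergence (φ : SpaceTime → R3) (z : SpaceTime) : ℝ :=
  ∑ j, spaceDeriv j φ z j

/-- A cylinder `Q = I × O` relatively compact in `Ω`: `I = (a, b)` is an open interval, `O` is an
open subset of `ℝ³`, and the closure of `Q` is a compact subset of `Ω`. -/
structure Cylinder (Ω : Opens SpaceTime) where
  a : ℝ
  b : ℝ
  O : Opens R3
  isCompact_closure : IsCompact (closure (Ioo a b ×ˢ (O : Set R3)))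
  closure_subset : closure (Ioo a b ×ˢ (O : Set R3)) ⊆ (Ω : Set SpaceTime)

/-- The open set `I × O` underlying a cylinder. -/
def Cylinder.toOpens {Ω : Opens SpaceTime} (Q : Cylinder Ω) : Opens SpaceTime :=
  ⟨Ioo Q.a Q.b ×ˢ (Q.O : Set R3), isOpen_Ioo.prod Q.O.isOpen⟩

/-- `div v = 0` in the sense of distributions on `W` (for `v` locally integrable on `W`). -/
def WeaklyDivFree (W : Opens SpaceTime) (v : SpaceTime → R3) : Prop :=
  ∀ ψ : 𝓓(W, ℝ), ∫ z in (W : Set SpaceTime), ∑ j, v z j * spaceDeriv j ψ z = 0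

/-- `v ∈ L²_loc(Ω)`. -/
def MemL2Loc (Ω : Opens SpaceTime) (v : SpaceTime → R3) : Prop :=
  ∀ K : Set SpaceTime, IsCompact K → K ⊆ Ω → MemLp v 2 (volume.restrict K)

/-- `v ∈ L²ₜ H¹ₓ(W)`, with weak space derivatives `∂ⱼ v = G j`: both `v` and the `G j` are in
`L²(W)`, and `∂ⱼ v = G j` in the sense of distributions on `W`. -/
structure HasL2H1Gradient (W : Opens SpaceTime) (v : SpaceTime → R3)
    (G : Fin 3 → SpaceTime → R3) : Prop where
  memLp : MemLp v 2 (volume.restrict (W : Set SpaceTime))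
  memLp_grad : ∀ j, MemLp (G j) 2 (volume.restrict (W : Set SpaceTime))
  weakDeriv : ∀ (j : Fin 3) (ψ : 𝓓(W, ℝ)),
    ∫ z in (W : Set SpaceTime), spaceDeriv j ψ z • v z =
      - ∫ z in (W : Set SpaceTime), ψ z • G j z

/-- `v ∈ L²ₜ H¹ₓ(W)`. -/
def MemL2H1 (W : Opens SpaceTime) (v : SpaceTime → R3) : Prop :=
  ∃ G, HasL2H1Gradient W v G

/-- `‖v‖²_{L²ₜ H¹ₓ(W)} ≤ C`. -/
def L2H1SqNormLE (W : Opens SpaceTime) (v : SpaceTime → R3) (C : ℝ≥0) : Prop :=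
  ∃ G, HasL2H1Gradient W v G ∧
    ∫⁻ z in (W : Set SpaceTime), (‖v z‖ₑ ^ 2 + ∑ j, ‖G j z‖ₑ ^ 2) ≤ C

/-- `‖v‖²_{L^∞ₜ L²ₓ(Q)} ≤ C`: for almost every `t ∈ I`, `∫_O |v(t, x)|² dx ≤ C`. -/
def LinftyL2SqNormLE {Ω : Opens SpaceTime} (Q : Cylinder Ω) (v : SpaceTime → R3)
    (C : ℝ≥0) : Prop :=
  ∀ᵐ t ∂(volume.restrict (Ioo Q.a Q.b)), ∫⁻ x in (Q.O : Set R3), ‖v (t, x)‖ₑ ^ 2 ≤ C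

/-- Weak convergence `vₙ ⇀ v` in `L²ₜ H¹ₓ(W)`. The space is a closed subspace of `L²(W)⁴` through
`v ↦ (v, ∂₁v, ∂₂v, ∂₃v)`, so its continuous linear functionals are exactly the maps
`v ↦ ∬ v · w + ∑ⱼ ∂ⱼv · Wⱼ` with `w, W₁, W₂, W₃` in `L²(W)`. -/
def WeakTendstoL2H1 (W : Opens SpaceTime) (vs : ℕ → SpaceTime → R3)
    (v : SpaceTime → R3) : Prop :=
  ∃ (Gs : ℕ → Fin 3 → SpaceTime → R3) (G : Fin 3 → SpaceTime → R3),
    (∀ n, HasL2H1Gradient W (vs n) (Gs n)) ∧ HasL2H1Gradient W v G ∧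
    ∀ (w : SpaceTime → R3) (w' : Fin 3 → SpaceTime → R3),
      MemLp w 2 (volume.restrict (W : Set SpaceTime)) →
      (∀ j, MemLp (w' j) 2 (volume.restrict (W : Set SpaceTime))) →
      Tendsto
        (fun n => ∫ z in (W : Set SpaceTime),
          (inner ℝ (vs n z) (w z) + ∑ j, inner ℝ (Gs n j z) (w' j z)))
        atTop
        (𝓝 (∫ z in (W : Set SpaceTime),
          (inner ℝ (v z) (w z) + ∑ j, inner ℝ (G j z) (w' j z))))

/-- `u` is a local weak solution on `Ω` of the Navier-Stokes equations associated to the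
divergence-free force `f ∈ L²_loc(Ω)`. -/
structure IsLocalWeakSolution (Ω : Opens SpaceTime) (f u : SpaceTime → R3) : Prop where
  force_memL2Loc : MemL2Loc Ω f
  force_divFree : WeaklyDivFree Ω f
  memLinftyL2 : ∀ Q : Cylinder Ω, ∃ C : ℝ≥0, LinftyL2SqNormLE Q u C
  memL2H1 : ∀ Q : Cylinder Ω, MemL2H1 Q.toOpens u
  divFree : ∀ Q : Cylinder Ω, WeaklyDivFree Q.toOpens u
  equation : ∀ (Q : Cylinder Ω) (φ : 𝓓(Q.toOpens, R3)), (∀ z, divergence φ z = 0) →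
    ∫ z in (Q.toOpens : Set SpaceTime),
      (inner ℝ (u z) (timeDeriv φ z + laplacian φ z) + inner ℝ (u z) (advection u φ z)
        + inner ℝ (f z) (φ z)) = 0

/-- A mollifying kernel on `ℝ³`: smooth, compactly supported, of integral `1`. -/
structure IsMollifier (φ : R3 → ℝ) : Prop where
  contDiff : ContDiff ℝ ∞ φ
  hasCompactSupport : HasCompactSupport φ
  integral_eq_one : ∫ y, φ y = 1

/-- Mollification in the space variable: `(φ_ε * v)(t, x) = ∫ φ_ε(y) v(t, x - y) dy` with
`φ_ε(y) = ε⁻³ φ(y / ε)`. -/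
def mollify (φ : R3 → ℝ) (ε : ℝ) (v : SpaceTime → R3) (z : SpaceTime) : R3 :=
  ∫ y, ((ε ^ 3)⁻¹ * φ (ε⁻¹ • y)) • v (z.1, z.2 - y)

/-- The pairing with `ψ ∈ 𝓓(W)` of
`M_ε(u) = - div(|u|² u) + 2 u_ε · (φ_ε * (u · ∇u))`,
where `u · ∇u = ∑ⱼ uⱼ ∂ⱼu` and `∂ⱼu = G j`. If `u` is only meaningful on `W`, this is meaningful
for `ε` small, depending on the support of `ψ`. -/
def energyDefectApprox (φ : R3 → ℝ) (W : Opens SpaceTime) (u : SpaceTime → R3)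
    (G : Fin 3 → SpaceTime → R3) (ε : ℝ) (ψ : 𝓓(W, ℝ)) : ℝ :=
  (∫ z in (W : Set SpaceTime), ‖u z‖ ^ 2 * ∑ j, u z j * spaceDeriv j ψ z)
  + ∫ z in (W : Set SpaceTime),
      ψ z * (2 * inner ℝ (mollify φ ε u z) (mollify φ ε (fun y => ∑ j, u y j • G j y) z))

/-- The distribution `T` on `W` is `M(u) = lim_{ε → 0⁺} M_ε(u)`, the limit being taken
in `𝓓'(W)`. -/
def IsEnergyDefect (φ : R3 → ℝ) (W : Opens SpaceTime) (u : SpaceTime → R3)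
    (T : 𝓓'(W, ℝ)) : Prop :=
  ∃ G, HasL2H1Gradient W u G ∧
    ∀ ψ : 𝓓(W, ℝ), Tendsto (fun ε => energyDefectApprox φ W u G ε ψ) (𝓝[>] 0) (𝓝 (T ψ))

/-- `u` is dissipative on `Ω`: on each cylinder `Q` relatively compact in `Ω`, the limit `M(u)`
exists in `𝓓'(Q)` and is non-negative. -/
def IsDissipative (φ : R3 → ℝ) (Ω : Opens SpaceTime) (u : SpaceTime → R3) : Prop :=
  ∀ Q : Cylinder Ω, ∃ T : 𝓓'(Q.toOpens, ℝ), IsEnergyDefect φ Q.toOpens u T ∧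
    ∀ ψ : 𝓓(Q.toOpens, ℝ), (∀ z, 0 ≤ ψ z) → 0 ≤ T ψ

end NavierStokes

end

open Set Filter Topology MeasureTheory TopologicalSpace
open scoped ENNReal NNReal ContDiff Distributions

noncomputable section

namespace NavierStokes

/-! ### Strong and weak convergence in L², and limits of products -/

section L2
variable {X ι : Type*} [MeasurableSpace X] {μ : Measure X} {l : Filter ι}

/-! The equation is tested on divergence-free fields only, so the time derivative of a solution is
known modulo a gradient, and a weakly convergent sequence of solutions need not be compact in L².
The remedy is to split u = R * u + v, where R is a fixed radial kernel in x of small support. Let E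
be a compactly supported parametrix of the Laplacian, ΔE = δ − R. For every test field Ψ, the field
Ψ − R * Ψ − ∇(E * div Ψ) is a divergence-free test field (`sol`), and a divergence-free c pairs with
it as c − R * c pairs with Ψ (`sum_integral_sol`). Hence v satisfies an equation that may be tested
with every Ψ (`equation_sol`); the pressure is replaced by a local operator acting on u · ∇u. The
curl of R * u satisfies such an equation as well. Therefore v and curl (R * u) have controlled time
derivatives (`exists_db_high`, `exists_db_curl`) and converge strongly in L² on smaller sets
(`strongL2_of_db`), whereas R * u converges only weakly but is bounded, together with its space
gradient.

The convection is handled by writing u · ∇u − ∇|R * u|²/2 as the sum of v · ∇u, (R * u) · ∇v and a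
product of R * u with its curl (`conv_sub_lowGrad`). The subtracted gradient is invisible to
divergence-free tests. In the first and last terms a strongly convergent factor meets a weakly
convergent one; in the middle one this holds after an integration by parts. So the difference
converges in the sense of distributions (`tendsto_conv_test`) and the limit is a solution
(`weakEq`).

For the energy, the equation of v is tested with vψ, through a mollification in time and space
(`work_identity`, `tendsto_work`). This is legitimate because u · ∇u lies in L² in time with values
in L¹, while convolution with ∇E maps L²ₜL⁴ₓ into L²ₜL^∞ₓ and localized fields of L²ₜH¹ₓ lie in
L²ₜL⁴ₓ (`nL24_le`, `sq_lintegral_K_le`). A diagonal argument removes the mollification in time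
(`tendsto_space_high`), and the bounded part R * u causes no difficulty (`tendsto_space_low`).
Consequently the limit M(u) exists, tested on each ψ, for every solution with the available bounds,
and has an explicit expression `defect`, arranged in `defect_eq` so that R * u is always accompanied
by something compact or by the distributionally convergent difference above.

In that expression every term passes to the limit, except −2|∇v|²ψ. For ψ ≥ 0 this one is upper
semicontinuous under weak convergence, because a convex quadratic form lies above its tangents
(`two_mul_integral_sub_le`); non-negativity is thus inherited (`defect_nonneg`). Finally a
non-negative linear form on test functions is automatically a distribution
(`exists_distribution_of_nonneg`), which provides M(u) as an element of the space of distributions.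
-/

theorem eLpNorm_two_sq (f : X → ℝ) : eLpNorm f 2 μ ^ 2 = ∫⁻ x, ‖f x‖ₑ ^ 2 ∂μ := by
  have h := eLpNorm_nnreal_pow_eq_lintegral (f := f) (μ := μ) (p := 2) (by norm_num)
  simpa using h

theorem memLp_two_of_lintegral {f : X → ℝ} (hf : AEStronglyMeasurable f μ)
    (h : ∫⁻ x, ‖f x‖ₑ ^ 2 ∂μ ≠ ⊤) : MemLp f 2 μ := by
  refine ⟨hf, ?_⟩
  rw [← eLpNorm_two_sq] at h
  by_contra h'
  rw [not_lt, top_le_iff] at h'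
  simp [h'] at h

theorem memLp_sub {f g : X → ℝ} (hf : MemLp f 2 μ) (hg : MemLp g 2 μ) :
    MemLp (fun x => f x - g x) 2 μ := hf.sub hg

theorem memLp_add {f g : X → ℝ} (hf : MemLp f 2 μ) (hg : MemLp g 2 μ) :
    MemLp (fun x => f x + g x) 2 μ := hf.add hg

theorem integrable_mul_of_memLp {f g : X → ℝ} (hf : MemLp f 2 μ) (hg : MemLp g 2 μ) :
    Integrable (fun x => f x * g x) μ := hf.integrable_mul hg

theorem abs_integral_mul_le {f g : X → ℝ} (hf : MemLp f 2 μ) (hg : MemLp g 2 μ) :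
    |∫ x, f x * g x ∂μ| ≤ (eLpNorm f 2 μ).toReal * (eLpNorm g 2 μ).toReal := by
  have h1 : eLpNorm (f • g) 1 μ ≤ eLpNorm f 2 μ * eLpNorm g 2 μ :=
    eLpNorm_smul_le_mul_eLpNorm (p := 2) (q := 2) (r := 1) hg.1 hf.1
  rw [← ENNReal.toReal_mul]
  refine (norm_integral_le_lintegral_norm (fun x => f x * g x)).trans ?_
  refine ENNReal.toReal_mono (ENNReal.mul_ne_top hf.2.ne hg.2.ne) ?_
  refine le_trans (le_of_eq ?_) h1
  rw [eLpNorm_one_eq_lintegral_enorm]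
  simp_rw [← ofReal_norm, Pi.smul_apply', smul_eq_mul]

theorem memLp_mul_bdd {f χ : X → ℝ} {M : ℝ} (hf : MemLp f 2 μ) (hχ : AEStronglyMeasurable χ μ)
    (hM : ∀ᵐ x ∂μ, |χ x| ≤ M) : MemLp (fun x => f x * χ x) 2 μ := by
  refine hf.of_le_mul (c := M) (hf.1.mul hχ) ?_
  filter_upwards [hM] with x hx
  rw [norm_mul, mul_comm]
  exact mul_le_mul_of_nonneg_right hx (norm_nonneg _)

theorem eLpNorm_mul_bdd_le {f χ : X → ℝ} {M : ℝ} (hM : ∀ᵐ x ∂μ, |χ x| ≤ M) :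
    eLpNorm (fun x => f x * χ x) 2 μ ≤ ENNReal.ofReal M * eLpNorm f 2 μ := by
  refine eLpNorm_le_mul_eLpNorm_of_ae_le_mul ?_ 2
  filter_upwards [hM] with x hx
  rw [norm_mul, mul_comm]
  exact mul_le_mul_of_nonneg_right hx (norm_nonneg _)

/-- Strong convergence in `L²`. -/
structure StrongL2 (μ : Measure X) (l : Filter ι) (a : ι → X → ℝ) (a0 : X → ℝ) : Prop where
  mem : ∀ n, MemLp (a n) 2 μ
  mem0 : MemLp a0 2 μ
  tendsto : Tendsto (fun n => eLpNorm (fun x => a n x - a0 x) 2 μ) l (𝓝 0)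

/-- Weak convergence in `L²` of an eventually bounded family. -/
structure WeakL2 (μ : Measure X) (l : Filter ι) (a : ι → X → ℝ) (a0 : X → ℝ) : Prop where
  mem : ∀ n, MemLp (a n) 2 μ
  mem0 : MemLp a0 2 μ
  bdd : ∃ C : ℝ≥0, ∀ᶠ n in l, eLpNorm (a n) 2 μ ≤ C
  tendsto : ∀ b : X → ℝ, MemLp b 2 μ →
    Tendsto (fun n => ∫ x, a n x * b x ∂μ) l (𝓝 (∫ x, a0 x * b x ∂μ))

theorem StrongL2.bdd {a : ι → X → ℝ} {a0 : X → ℝ} (h : StrongL2 μ l a a0) :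
    ∃ C : ℝ≥0, ∀ᶠ n in l, eLpNorm (a n) 2 μ ≤ C := by
  refine ⟨1 + (eLpNorm a0 2 μ).toNNReal, ?_⟩
  have h1 : ∀ᶠ n in l, eLpNorm (fun x => a n x - a0 x) 2 μ < 1 :=
    h.tendsto.eventually (gt_mem_nhds one_pos)
  filter_upwards [h1] with n hn
  have h2 : eLpNorm (a n) 2 μ ≤ eLpNorm (fun x => a n x - a0 x) 2 μ + eLpNorm a0 2 μ := by
    have := eLpNorm_add_le (f := fun x => a n x - a0 x) (g := a0) (μ := μ) (p := 2)
      (memLp_sub (h.mem n) h.mem0).1 h.mem0.1 (by norm_num)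
    refine le_trans (le_of_eq ?_) this
    congr 1; ext x; simp
  refine h2.trans ?_
  push_cast
  rw [ENNReal.coe_toNNReal h.mem0.2.ne]
  gcongr

/-- The comparison family may depend on η. This serves to replace a rough limit object by a test
function at a cost that is uniform in the sequence. -/
theorem tendsto_of_approx {x : ι → ℝ} {x0 : ℝ}
    (h : ∀ η > 0, ∃ (y : ι → ℝ) (y0 : ℝ), Tendsto y l (𝓝 y0) ∧ (∀ᶠ n in l, |x n - y n| ≤ η) ∧
      |x0 - y0| ≤ η) : Tendsto x l (𝓝 x0) := by
  rw [Metric.tendsto_nhds]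
  intro η hη
  obtain ⟨y, y0, hy, h1, h2⟩ := h (η / 4) (by positivity)
  have h3 := (Metric.tendsto_nhds.1 hy) (η / 4) (by positivity)
  filter_upwards [h1, h3] with n hn1 hn3
  rw [Real.dist_eq] at *
  have := abs_sub_le (x n) (y n) x0
  have h4 := abs_sub_le (y n) y0 x0
  rw [abs_sub_comm y0 x0] at h4
  linarith

theorem tendsto_of_abs_le {x : ι → ℝ} {x0 : ℝ} {B : ι → ℝ≥0∞} (hB : Tendsto B l (𝓝 0))
    (h : ∀ᶠ n in l, |x n - x0| ≤ (B n).toReal) : Tendsto x l (𝓝 x0) := by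
  rw [tendsto_iff_dist_tendsto_zero]
  refine squeeze_zero' (Eventually.of_forall fun _ => dist_nonneg) h ?_
  have := (ENNReal.continuousAt_toReal (by simp : (0 : ℝ≥0∞) ≠ ⊤)).tendsto.comp hB
  simpa [Function.comp_def] using this

theorem StrongL2.weak {a : ι → X → ℝ} {a0 : X → ℝ} (h : StrongL2 μ l a a0) :
    WeakL2 μ l a a0 := by
  refine ⟨h.mem, h.mem0, h.bdd, fun b hb => ?_⟩
  have hB : Tendsto (fun n => eLpNorm (fun x => a n x - a0 x) 2 μ * eLpNorm b 2 μ) l (𝓝 0) := by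
    have := ENNReal.Tendsto.mul_const (b := eLpNorm b 2 μ) h.tendsto (Or.inr hb.2.ne)
    simpa using this
  refine tendsto_of_abs_le hB (Eventually.of_forall fun n => ?_)
  rw [← integral_sub (integrable_mul_of_memLp (h.mem n) hb) (integrable_mul_of_memLp h.mem0 hb)]
  simp_rw [← sub_mul]
  rw [ENNReal.toReal_mul]
  exact abs_integral_mul_le (memLp_sub (h.mem n) h.mem0) hb

/-- The boundedness of the weak family absorbs the error b n − b0; what remains is a pairing with a
fixed function. -/
theorem WeakL2.integral_mul {a b : ι → X → ℝ} {a0 b0 : X → ℝ} (ha : WeakL2 μ l a a0)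
    (hb : StrongL2 μ l b b0) :
    Tendsto (fun n => ∫ x, a n x * b n x ∂μ) l (𝓝 (∫ x, a0 x * b0 x ∂μ)) := by
  obtain ⟨C, hC⟩ := ha.bdd
  have h1 := ha.tendsto b0 hb.mem0
  have h2 : Tendsto (fun n => ∫ x, a n x * (b n x - b0 x) ∂μ) l (𝓝 0) := by
    have hB : Tendsto (fun n => C * eLpNorm (fun x => b n x - b0 x) 2 μ) l (𝓝 0) := by
      have := ENNReal.Tendsto.const_mul (a := C) hb.tendsto (Or.inr (by simp))
      simpa using this
    refine tendsto_of_abs_le hB ?_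
    filter_upwards [hC] with n hn
    rw [sub_zero, ENNReal.toReal_mul]
    refine (abs_integral_mul_le (ha.mem n) (memLp_sub (hb.mem n) hb.mem0)).trans ?_
    gcongr
    simp
  have h3 := h1.add h2
  rw [add_zero] at h3
  refine h3.congr fun n => ?_
  rw [← integral_add (integrable_mul_of_memLp (ha.mem n) hb.mem0)
    (integrable_mul_of_memLp (ha.mem n) (memLp_sub (hb.mem n) hb.mem0))]
  congr 1; ext x; ring

theorem StrongL2.integral_mul {a b : ι → X → ℝ} {a0 b0 : X → ℝ} (ha : StrongL2 μ l a a0)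
    (hb : StrongL2 μ l b b0) :
    Tendsto (fun n => ∫ x, a n x * b n x ∂μ) l (𝓝 (∫ x, a0 x * b0 x ∂μ)) :=
  ha.weak.integral_mul hb

theorem StrongL2.integral_mul_weak {a b : ι → X → ℝ} {a0 b0 : X → ℝ} (ha : StrongL2 μ l a a0)
    (hb : WeakL2 μ l b b0) :
    Tendsto (fun n => ∫ x, a n x * b n x ∂μ) l (𝓝 (∫ x, a0 x * b0 x ∂μ)) := by
  have := hb.integral_mul ha
  simpa only [mul_comm] using this

theorem StrongL2.const {a : X → ℝ} (h : MemLp a 2 μ) : StrongL2 μ l (fun _ => a) a :=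
  ⟨fun _ => h, h, by simpa using tendsto_const_nhds⟩

theorem StrongL2.add {a b : ι → X → ℝ} {a0 b0 : X → ℝ} (ha : StrongL2 μ l a a0)
    (hb : StrongL2 μ l b b0) :
    StrongL2 μ l (fun n x => a n x + b n x) (fun x => a0 x + b0 x) := by
  refine ⟨fun n => (ha.mem n).add (hb.mem n), ha.mem0.add hb.mem0, ?_⟩
  have h := ha.tendsto.add hb.tendsto
  rw [add_zero] at h
  refine tendsto_of_tendsto_of_tendsto_of_le_of_le tendsto_const_nhds h (fun _ => zero_le) ?_
  intro n
  have e : (fun x => a n x + b n x - (a0 x + b0 x)) =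
      (fun x => a n x - a0 x) + (fun x => b n x - b0 x) := by
    ext x; simp only [Pi.add_apply]; ring
  simp only [e]
  exact eLpNorm_add_le (memLp_sub (ha.mem n) ha.mem0).1 (memLp_sub (hb.mem n) hb.mem0).1
    (by norm_num)

theorem StrongL2.mul_bdd {a : ι → X → ℝ} {a0 χ : X → ℝ} {M : ℝ} (ha : StrongL2 μ l a a0)
    (hχ : AEStronglyMeasurable χ μ) (hM : ∀ᵐ x ∂μ, |χ x| ≤ M) :
    StrongL2 μ l (fun n x => a n x * χ x) (fun x => a0 x * χ x) := by
  refine ⟨fun n => memLp_mul_bdd (ha.mem n) hχ hM, memLp_mul_bdd ha.mem0 hχ hM, ?_⟩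
  have h : Tendsto (fun n => ENNReal.ofReal M * eLpNorm (fun x => a n x - a0 x) 2 μ) l (𝓝 0) := by
    have := ENNReal.Tendsto.const_mul (a := ENNReal.ofReal M) ha.tendsto (Or.inr (by simp))
    simpa using this
  refine tendsto_of_tendsto_of_tendsto_of_le_of_le tendsto_const_nhds h (fun _ => zero_le) ?_
  intro n
  simp_rw [← sub_mul]
  exact eLpNorm_mul_bdd_le hM

theorem StrongL2.sum {κ : Type*} (s : Finset κ) {a : κ → ι → X → ℝ} {a0 : κ → X → ℝ}
    (ha : ∀ k, StrongL2 μ l (a k) (a0 k)) :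
    StrongL2 μ l (fun n x => ∑ k ∈ s, a k n x) (fun x => ∑ k ∈ s, a0 k x) := by
  classical
  induction s using Finset.induction_on with
  | empty => simpa using StrongL2.const (l := l) (μ := μ) (a := fun _ => (0 : ℝ)) MemLp.zero
  | insert k s hk ih =>
    simp_rw [Finset.sum_insert hk]
    exact (ha k).add ih

theorem WeakL2.add {a b : ι → X → ℝ} {a0 b0 : X → ℝ} (ha : WeakL2 μ l a a0)
    (hb : WeakL2 μ l b b0) :
    WeakL2 μ l (fun n x => a n x + b n x) (fun x => a0 x + b0 x) := by
  obtain ⟨C, hC⟩ := ha.bdd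
  obtain ⟨C', hC'⟩ := hb.bdd
  refine ⟨fun n => (ha.mem n).add (hb.mem n), ha.mem0.add hb.mem0, ⟨C + C', ?_⟩, fun c hc => ?_⟩
  · filter_upwards [hC, hC'] with n h1 h2
    refine (eLpNorm_add_le (ha.mem n).1 (hb.mem n).1 (by norm_num)).trans ?_
    push_cast
    gcongr
  · have h := (ha.tendsto c hc).add (hb.tendsto c hc)
    rw [← integral_add (integrable_mul_of_memLp ha.mem0 hc) (integrable_mul_of_memLp hb.mem0 hc)]
      at h
    simp_rw [add_mul]
    refine h.congr fun n => ?_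
    rw [← integral_add (integrable_mul_of_memLp (ha.mem n) hc)
      (integrable_mul_of_memLp (hb.mem n) hc)]

theorem WeakL2.mul_bdd {a : ι → X → ℝ} {a0 χ : X → ℝ} {M : ℝ} (ha : WeakL2 μ l a a0)
    (hχ : AEStronglyMeasurable χ μ) (hM : ∀ᵐ x ∂μ, |χ x| ≤ M) :
    WeakL2 μ l (fun n x => a n x * χ x) (fun x => a0 x * χ x) := by
  obtain ⟨C, hC⟩ := ha.bdd
  refine ⟨fun n => memLp_mul_bdd (ha.mem n) hχ hM, memLp_mul_bdd ha.mem0 hχ hM,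
    ⟨M.toNNReal * C, ?_⟩, fun b hb => ?_⟩
  · filter_upwards [hC] with n hn
    refine (eLpNorm_mul_bdd_le hM).trans ?_
    push_cast
    gcongr
    exact le_rfl
  · have := ha.tendsto (fun x => b x * χ x) (memLp_mul_bdd hb hχ hM)
    simpa only [mul_assoc, mul_comm (χ _)] using this

theorem WeakL2.const_mul {a : ι → X → ℝ} {a0 : X → ℝ} (c : ℝ) (ha : WeakL2 μ l a a0) :
    WeakL2 μ l (fun n x => c * a n x) (fun x => c * a0 x) := by
  simp_rw [mul_comm c]
  exact ha.mul_bdd (M := |c|) aestronglyMeasurable_const (by simp)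

theorem WeakL2.sub {a b : ι → X → ℝ} {a0 b0 : X → ℝ} (ha : WeakL2 μ l a a0)
    (hb : WeakL2 μ l b b0) :
    WeakL2 μ l (fun n x => a n x - b n x) (fun x => a0 x - b0 x) := by
  have := ha.add (hb.const_mul (-1))
  simpa only [neg_mul, one_mul, ← sub_eq_add_neg] using this

theorem exists_bdd_approx {b : X → ℝ} (hb : MemLp b 2 μ) {η : ℝ≥0∞} (hη : η ≠ 0) :
    ∃ (b' : X → ℝ) (M : ℝ), AEStronglyMeasurable b' μ ∧ (∀ x, |b' x| ≤ M) ∧ MemLp b' 2 μ ∧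
      eLpNorm (fun x => b x - b' x) 2 μ ≤ η := by
  obtain ⟨g, hg, hg2⟩ := hb.exists_simpleFunc_eLpNorm_sub_lt (by norm_num) hη
  obtain ⟨M, hM⟩ := g.exists_forall_norm_le
  exact ⟨g, M, g.aestronglyMeasurable, hM, hg2, hg.le⟩

/-- Against a general b in L² the product a n · b need not be in L², so the weak convergence of h n
cannot be applied directly. Replacing b by a bounded b' repairs this, and the uniform bound on h n
controls the error. -/
theorem StrongL2.mul_weak_bdd {a h : ι → X → ℝ} {a0 h0 : X → ℝ} {M : ℝ} (ha : StrongL2 μ l a a0)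
    (hh : WeakL2 μ l h h0) (hM : ∀ n, ∀ᵐ x ∂μ, |h n x| ≤ M) (hM0 : ∀ᵐ x ∂μ, |h0 x| ≤ M) :
    WeakL2 μ l (fun n x => a n x * h n x) (fun x => a0 x * h0 x) := by
  obtain ⟨C, hC⟩ := ha.bdd
  refine ⟨fun n => memLp_mul_bdd (ha.mem n) (hh.mem n).1 (hM n), memLp_mul_bdd ha.mem0 hh.mem0.1 hM0,
    ⟨M.toNNReal * C, ?_⟩, fun b hb => ?_⟩
  · filter_upwards [hC] with n hn
    refine (eLpNorm_mul_bdd_le (hM n)).trans ?_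
    push_cast
    gcongr
    exact le_rfl
  · refine tendsto_of_approx fun η hη => ?_
    -- N bounds the norm of a0 and, eventually, those of the a n. The tolerance below is chosen so
    -- that |M| · N times it is at most η; the two added ones keep the denominator positive.
    set N : ℝ≥0 := C + (eLpNorm a0 2 μ).toNNReal + 1 with hN
    have hη' : ENNReal.ofReal (η / ((|M| + 1) * N)) ≠ 0 := by
      simp only [ne_eq, ENNReal.ofReal_eq_zero, not_le]
      have : (0 : ℝ) < N := by rw [hN]; positivity
      positivity
    obtain ⟨b', K, hb'm, hb'K, hb'2, hbb⟩ := exists_bdd_approx hb hη'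
    have key : ∀ (a h : X → ℝ), MemLp a 2 μ → AEStronglyMeasurable h μ → (∀ᵐ x ∂μ, |h x| ≤ M) →
        eLpNorm a 2 μ ≤ N →
        |∫ x, a x * h x * b x ∂μ - ∫ x, h x * (a x * b' x) ∂μ| ≤ η := by
      intro a h ha hh hM haN
      have hah := memLp_mul_bdd ha hh hM
      have h1 : ∫ x, h x * (a x * b' x) ∂μ = ∫ x, (a x * h x) * b' x ∂μ := by
        congr 1; ext x; ring
      rw [h1, ← integral_sub (integrable_mul_of_memLp hah hb) (integrable_mul_of_memLp hah hb'2)]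
      simp_rw [← mul_sub]
      refine (abs_integral_mul_le hah (memLp_sub hb hb'2)).trans ?_
      have hNpos : (0 : ℝ) < N := by rw [hN]; positivity
      have e1 : (eLpNorm (fun x => a x * h x) 2 μ).toReal ≤ |M| * N := by
        have := ENNReal.toReal_mono (by finiteness) ((eLpNorm_mul_bdd_le (f := a) hM).trans
          (mul_le_mul_right haN (ENNReal.ofReal M)))
        refine this.trans ?_
        rw [ENNReal.toReal_mul]
        simp only [ENNReal.coe_toReal]
        gcongr
        rw [ENNReal.toReal_ofReal']
        exact max_le (le_abs_self M) (abs_nonneg _)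
      have e2 : (eLpNorm (fun x => b x - b' x) 2 μ).toReal ≤ η / ((|M| + 1) * N) := by
        have := ENNReal.toReal_mono (by finiteness) hbb
        rwa [ENNReal.toReal_ofReal (by positivity)] at this
      calc _ ≤ (|M| * N) * (η / ((|M| + 1) * N)) := by gcongr
        _ = (|M| / (|M| + 1)) * η := by field_simp
        _ ≤ 1 * η := by
          gcongr
          rw [div_le_one (by positivity)]; linarith
        _ = η := one_mul η
    refine ⟨fun n => ∫ x, h n x * (a n x * b' x) ∂μ, ∫ x, h0 x * (a0 x * b' x) ∂μ,
      hh.integral_mul (ha.mul_bdd hb'm (Eventually.of_forall hb'K)), ?_, ?_⟩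
    · filter_upwards [hC] with n hn
      refine key _ _ (ha.mem n) (hh.mem n).1 (hM n) (hn.trans ?_)
      rw [hN]; exact_mod_cast (by rw [add_assoc]; exact le_self_add)
    · refine key _ _ ha.mem0 hh.mem0.1 hM0 ?_
      rw [hN]; push_cast
      rw [ENNReal.coe_toNNReal ha.mem0.2.ne, add_right_comm]
      exact le_add_self

/-- The quadratic form of a nonnegative bounded weight lies above its tangents. -/
theorem two_mul_integral_sub_le {a a0 χ : X → ℝ} {M : ℝ} (ha : MemLp a 2 μ) (ha0 : MemLp a0 2 μ)
    (hχ : AEStronglyMeasurable χ μ) (hM : ∀ x, |χ x| ≤ M) (h0 : ∀ x, 0 ≤ χ x) :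
    2 * ∫ x, a x * (a0 x * χ x) ∂μ - ∫ x, a0 x * (a0 x * χ x) ∂μ ≤ ∫ x, a x * (a x * χ x) ∂μ := by
  have hM' := Eventually.of_forall (f := ae μ) hM
  have i1 := integrable_mul_of_memLp ha (memLp_mul_bdd ha0 hχ hM')
  have i2 := integrable_mul_of_memLp ha0 (memLp_mul_bdd ha0 hχ hM')
  have i3 := integrable_mul_of_memLp ha (memLp_mul_bdd ha hχ hM')
  rw [← integral_const_mul, ← integral_sub (i1.const_mul 2) i2]
  refine integral_mono ((i1.const_mul 2).sub i2) i3 fun x => ?_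
  have := mul_nonneg (h0 x) (sq_nonneg (a x - a0 x))
  simp only
  nlinarith

end L2

theorem sq_lintegral_mul_le {X : Type*} [MeasurableSpace X] {μ : Measure X} {f g : X → ℝ≥0∞}
    (hf : AEMeasurable f μ) (hg : AEMeasurable g μ) :
    (∫⁻ x, f x * g x ∂μ) ^ 2 ≤ (∫⁻ x, f x ^ 2 ∂μ) * ∫⁻ x, g x ^ 2 ∂μ := by
  have h := ENNReal.lintegral_mul_le_Lp_mul_Lq μ (p := 2) (q := 2)
    (by rw [Real.holderConjugate_iff]; norm_num) hf hg
  calc (∫⁻ x, f x * g x ∂μ) ^ 2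
      ≤ ((∫⁻ a, f a ^ (2 : ℝ) ∂μ) ^ (1 / (2 : ℝ)) * (∫⁻ a, g a ^ (2 : ℝ) ∂μ) ^ (1 / (2 : ℝ))) ^ 2 := by
        gcongr; exact h
    _ = _ := by
      rw [mul_pow, ← ENNReal.rpow_natCast, ← ENNReal.rpow_natCast, ← ENNReal.rpow_mul,
        ← ENNReal.rpow_mul]
      norm_num

/-- Cauchy–Schwarz for the measure with density f, obtained by splitting f into two square roots. -/
theorem sq_lintegral_weight_le {X : Type*} [MeasurableSpace X] {μ : Measure X} {f g : X → ℝ≥0∞}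
    (hf : AEMeasurable f μ) (hg : AEMeasurable g μ) :
    (∫⁻ x, f x * g x ∂μ) ^ 2 ≤ (∫⁻ x, f x ∂μ) * ∫⁻ x, f x * g x ^ 2 ∂μ := by
  have e : ∀ a : ℝ≥0∞, a ^ (1 / 2 : ℝ) * a ^ (1 / 2 : ℝ) = a := fun a => by
    rw [← ENNReal.rpow_add_of_nonneg _ _ (by norm_num) (by norm_num)]; norm_num
  have h := sq_lintegral_mul_le (μ := μ) (hf.pow_const (1 / 2 : ℝ))
    ((hf.pow_const (1 / 2 : ℝ)).mul hg)
  have e1 : ∀ x, f x ^ (1 / 2 : ℝ) * (f x ^ (1 / 2 : ℝ) * g x) = f x * g x := fun x => by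
    rw [← mul_assoc, e]
  have e2 : ∀ x, (f x ^ (1 / 2 : ℝ)) ^ 2 = f x := fun x => by rw [pow_two, e]
  simpa only [Pi.mul_apply, e1, e2, mul_pow] using h

/-! ### Averages of translates in space-time -/

instance : (volume : Measure SpaceTime).IsAddHaarMeasure := by
  rw [Measure.volume_eq_prod]; infer_instance

/-- Each slice is a translation, so the shear preserves the product measure. It transports
measurability, integrability and almost everywhere statements from F to its translates. -/
theorem measurePreserving_shear {A : Type*} [MeasurableSpace A] (ν : Measure A) [SFinite ν]
    {τ : A → SpaceTime} (hτ : Measurable τ) :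
    MeasurePreserving (fun p : SpaceTime × A => (p.1 - τ p.2, p.2))
      (volume.prod ν) (volume.prod ν) := by
  have h1 : MeasurePreserving (fun p : A × SpaceTime => (p.1, p.2 - τ p.1))
      (ν.prod volume) (ν.prod volume) := by
    refine (MeasurePreserving.id ν).skew_product (g := fun a z => z - τ a) ?_ ?_
    · exact measurable_snd.sub (hτ.comp measurable_fst)
    · exact Eventually.of_forall fun a => (measurePreserving_sub_right volume (τ a)).map_eq
  exact (Measure.measurePreserving_swap (μ := ν) (ν := (volume : Measure SpaceTime))).comp
    (h1.comp (Measure.measurePreserving_swap (μ := (volume : Measure SpaceTime)) (ν := ν)))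

/-- A finite signed family of translations of space-time. -/
structure TransKernel where
  A : Type
  [ms : MeasurableSpace A]
  ν : Measure A
  [sf : SFinite ν]
  m : A → ℝ
  τ : A → SpaceTime
  hm : Integrable m ν
  hτ : Measurable τ

attribute [instance] TransKernel.ms TransKernel.sf

namespace TransKernel

variable (k : TransKernel)

section
variable {E : Type*} [NormedAddCommGroup E] [NormedSpace ℝ E]

/-- The average of the translates of `F` along a translation kernel. -/
def avg (F : SpaceTime → E) (z : SpaceTime) : E := ∫ α, k.m α • F (z - k.τ α) ∂k.ν

end

/-- The kernel with the opposite translations. -/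
def adj : TransKernel := { k with τ := fun α => -k.τ α, hτ := k.hτ.neg }

/-- The total variation of the kernel. -/
def mass : ℝ≥0∞ := ∫⁻ α, ‖k.m α‖ₑ ∂k.ν

/-- The translations of the kernel have length at most `r`. -/
def InBall (r : ℝ) : Prop := ∀ α, k.m α ≠ 0 → ‖k.τ α‖ ≤ r

theorem adj_mass : k.adj.mass = k.mass := rfl

theorem InBall.adj {k : TransKernel} {r : ℝ} (h : k.InBall r) : k.adj.InBall r :=
  fun α hα => by simpa [TransKernel.adj] using h α hα

theorem mass_ne_top : k.mass ≠ ⊤ := k.hm.2.ne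

theorem measurePreserving_shear :
    MeasurePreserving (fun p : SpaceTime × k.A => (p.1 - k.τ p.2, p.2))
      (volume.prod k.ν) (volume.prod k.ν) :=
  NavierStokes.measurePreserving_shear k.ν k.hτ

theorem measurePreserving_shear' :
    MeasurePreserving (fun p : SpaceTime × k.A => (p.1 + k.τ p.2, p.2))
      (volume.prod k.ν) (volume.prod k.ν) := by
  simpa only [Pi.neg_apply, sub_neg_eq_add] using
    NavierStokes.measurePreserving_shear k.ν k.hτ.neg

section
variable {E : Type*} [NormedAddCommGroup E] [NormedSpace ℝ E] {F : SpaceTime → E}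

theorem aestronglyMeasurable_comp (hF : AEStronglyMeasurable F volume) :
    AEStronglyMeasurable (fun p : SpaceTime × k.A => F (p.1 - k.τ p.2)) (volume.prod k.ν) :=
  (hF.comp_fst (ν := k.ν)).comp_measurePreserving k.measurePreserving_shear

theorem aestronglyMeasurable_smul_comp (hF : AEStronglyMeasurable F volume) :
    AEStronglyMeasurable (fun p : SpaceTime × k.A => k.m p.2 • F (p.1 - k.τ p.2))
      (volume.prod k.ν) :=
  (k.hm.1.comp_snd).smul (k.aestronglyMeasurable_comp hF)

theorem aestronglyMeasurable_avg (hF : AEStronglyMeasurable F volume) :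
    AEStronglyMeasurable (k.avg F) volume :=
  (k.aestronglyMeasurable_smul_comp hF).integral_prod_right'

theorem enorm_avg_le (z : SpaceTime) :
    ‖k.avg F z‖ₑ ≤ ∫⁻ α, ‖k.m α‖ₑ * ‖F (z - k.τ α)‖ₑ ∂k.ν := by
  refine (enorm_integral_le_lintegral_enorm _).trans (le_of_eq ?_)
  simp_rw [enorm_smul]

theorem ae_aemeasurable_slice (hF : AEStronglyMeasurable F volume) :
    ∀ᵐ z : SpaceTime, AEStronglyMeasurable (fun α => F (z - k.τ α)) k.ν := by
  have h := k.aestronglyMeasurable_comp hF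
  exact h.prodMk_left

theorem lintegral_lintegral_shift {V : SpaceTime → SpaceTime → ℝ≥0∞}
    (hV : AEMeasurable (fun p : SpaceTime × k.A => V p.1 (p.1 - k.τ p.2)) (volume.prod k.ν)) :
    ∫⁻ z, ∫⁻ α, ‖k.m α‖ₑ * V z (z - k.τ α) ∂k.ν =
      ∫⁻ α, ‖k.m α‖ₑ * (∫⁻ z, V z (z - k.τ α)) ∂k.ν := by
  have h1 : AEMeasurable (fun p : SpaceTime × k.A => ‖k.m p.2‖ₑ * V p.1 (p.1 - k.τ p.2))
      (volume.prod k.ν) := (k.hm.1.comp_snd.enorm).mul hV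
  rw [lintegral_lintegral_swap h1]
  refine lintegral_congr fun α => ?_
  rw [lintegral_const_mul' _ _ (by simp)]

end

section L2
variable {F H : SpaceTime → ℝ}

theorem lintegral_weight_sq (hF : AEStronglyMeasurable F volume) :
    ∫⁻ z, ∫⁻ α, ‖k.m α‖ₑ * ‖F (z - k.τ α)‖ₑ ^ 2 ∂k.ν = k.mass * ∫⁻ z, ‖F z‖ₑ ^ 2 := by
  rw [k.lintegral_lintegral_shift (V := fun _ w => ‖F w‖ₑ ^ 2)
    ((k.aestronglyMeasurable_comp hF).enorm.pow_const 2)]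
  have e : ∀ α, ∫⁻ z, ‖F (z - k.τ α)‖ₑ ^ 2 = ∫⁻ z, ‖F z‖ₑ ^ 2 := fun α =>
    lintegral_sub_right_eq_self (fun w : SpaceTime => ‖F w‖ₑ ^ 2) (k.τ α)
  simp only [e]
  rw [lintegral_mul_const'' _ k.hm.1.enorm, mass]

theorem ae_sq_avg_le (hF : AEStronglyMeasurable F volume) :
    ∀ᵐ z : SpaceTime, (∫⁻ α, ‖k.m α‖ₑ * ‖F (z - k.τ α)‖ₑ ∂k.ν) ^ 2 ≤
      k.mass * ∫⁻ α, ‖k.m α‖ₑ * ‖F (z - k.τ α)‖ₑ ^ 2 ∂k.ν := by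
  filter_upwards [k.ae_aemeasurable_slice hF] with z hz
  exact sq_lintegral_weight_le k.hm.1.enorm hz.enorm

/-- Young's inequality for convolution of L¹ with L²: Cauchy–Schwarz against |m|, then Fubini and
translation invariance. -/
theorem lintegral_sq_avg_le (hF : AEStronglyMeasurable F volume) :
    ∫⁻ z, ‖k.avg F z‖ₑ ^ 2 ≤ k.mass ^ 2 * ∫⁻ z, ‖F z‖ₑ ^ 2 := by
  calc ∫⁻ z, ‖k.avg F z‖ₑ ^ 2
      ≤ ∫⁻ z, k.mass * ∫⁻ α, ‖k.m α‖ₑ * ‖F (z - k.τ α)‖ₑ ^ 2 ∂k.ν := by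
        refine lintegral_mono_ae ?_
        filter_upwards [k.ae_sq_avg_le hF] with z hz
        refine le_trans ?_ hz
        gcongr
        exact k.enorm_avg_le z
    _ = _ := by
        rw [lintegral_const_mul' _ _ k.mass_ne_top, k.lintegral_weight_sq hF, ← mul_assoc, pow_two]

theorem memLp_avg (hF : MemLp F 2) : MemLp (k.avg F) 2 := by
  refine memLp_two_of_lintegral (k.aestronglyMeasurable_avg hF.1) ?_
  refine ne_top_of_le_ne_top ?_ (k.lintegral_sq_avg_le hF.1)
  rw [← eLpNorm_two_sq]
  exact ENNReal.mul_ne_top (ENNReal.pow_ne_top k.mass_ne_top) (ENNReal.pow_ne_top hF.2.ne)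

theorem eLpNorm_avg_le (hF : AEStronglyMeasurable F volume) :
    eLpNorm (k.avg F) 2 volume ≤ k.mass * eLpNorm F 2 volume := by
  have h := k.lintegral_sq_avg_le hF
  rw [← eLpNorm_two_sq, ← eLpNorm_two_sq, ← mul_pow] at h
  exact (ENNReal.pow_le_pow_left_iff two_ne_zero).1 h

theorem ae_integrable (hF : MemLp F 2) :
    ∀ᵐ z : SpaceTime, Integrable (fun α => k.m α • F (z - k.τ α)) k.ν := by
  have h1 : ∫⁻ z, ∫⁻ α, ‖k.m α‖ₑ * ‖F (z - k.τ α)‖ₑ ^ 2 ∂k.ν ≠ ⊤ := by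
    rw [k.lintegral_weight_sq hF.1, ← eLpNorm_two_sq]
    exact ENNReal.mul_ne_top k.mass_ne_top (ENNReal.pow_ne_top hF.2.ne)
  have hm : AEMeasurable (fun z : SpaceTime => ∫⁻ α, ‖k.m α‖ₑ * ‖F (z - k.τ α)‖ₑ ^ 2 ∂k.ν) :=
    ((k.hm.1.comp_snd.enorm).mul
      ((k.aestronglyMeasurable_comp hF.1).enorm.pow_const 2)).lintegral_prod_right'
  filter_upwards [ae_lt_top' hm h1, k.ae_sq_avg_le hF.1, k.ae_aemeasurable_slice hF.1]
    with z h2 h3 h4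
  refine ⟨k.hm.1.smul h4, ?_⟩
  rw [hasFiniteIntegral_iff_enorm]
  simp_rw [enorm_smul]
  have : (∫⁻ α, ‖k.m α‖ₑ * ‖F (z - k.τ α)‖ₑ ∂k.ν) ^ 2 < ⊤ :=
    h3.trans_lt (ENNReal.mul_lt_top k.mass_ne_top.lt_top h2)
  by_contra h
  rw [not_lt, top_le_iff] at h
  simp [h] at this

theorem ae_integrable_of_integrable (hF : Integrable F volume) :
    ∀ᵐ z : SpaceTime, Integrable (fun α => k.m α • F (z - k.τ α)) k.ν := by
  have h : Integrable (fun p : SpaceTime × k.A => F p.1 * k.m p.2) (volume.prod k.ν) :=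
    hF.mul_prod k.hm
  have h2 := (k.measurePreserving_shear.integrable_comp h.1).2 h
  filter_upwards [h2.prod_right_ae] with z hz
  simpa [Function.comp_def, mul_comm] using hz

theorem ae_avg_sub (hF : MemLp F 2) (hH : MemLp H 2) :
    ∀ᵐ z : SpaceTime, k.avg (fun w => F w - H w) z = k.avg F z - k.avg H z := by
  filter_upwards [k.ae_integrable hF, k.ae_integrable hH] with z h1 h2
  simp only [avg, smul_sub]
  exact integral_sub h1 h2

theorem strongL2_avg {ι : Type*} {l : Filter ι} {a : ι → SpaceTime → ℝ} {a0 : SpaceTime → ℝ}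
    (h : StrongL2 volume l a a0) : StrongL2 volume l (fun n => k.avg (a n)) (k.avg a0) := by
  refine ⟨fun n => k.memLp_avg (h.mem n), k.memLp_avg h.mem0, ?_⟩
  have h1 : Tendsto (fun n => k.mass * eLpNorm (fun x => a n x - a0 x) 2 volume) l (𝓝 0) := by
    have := ENNReal.Tendsto.const_mul (a := k.mass) h.tendsto (Or.inr k.mass_ne_top)
    simpa using this
  refine tendsto_of_tendsto_of_tendsto_of_le_of_le tendsto_const_nhds h1 (fun _ => zero_le) ?_
  intro n
  refine le_trans (le_of_eq ?_) (k.eLpNorm_avg_le (memLp_sub (h.mem n) h.mem0).1)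
  refine eLpNorm_congr_ae ?_
  filter_upwards [k.ae_avg_sub (h.mem n) h.mem0] with z hz using hz.symm

/-- Fubini and the change of variables z ↦ z + τ. Joint integrability is left as a hypothesis
because it holds for two different reasons: both functions in L², or one integrable and the other
bounded. -/
theorem integral_avg_mul (h : Integrable
    (fun p : SpaceTime × k.A => k.m p.2 * F (p.1 - k.τ p.2) * H p.1) (volume.prod k.ν)) :
    ∫ z, k.avg F z * H z = ∫ z, F z * k.adj.avg H z := by
  have h' : Integrable (fun p : SpaceTime × k.A => k.m p.2 * F p.1 * H (p.1 + k.τ p.2))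
      (volume.prod k.ν) := by
    have := (k.measurePreserving_shear'.integrable_comp h.1).2 h
    simpa [Function.comp_def] using this
  have e1 : ∀ z, k.avg F z * H z = ∫ α, k.m α * F (z - k.τ α) * H z ∂k.ν := fun z => by
    rw [avg, ← integral_mul_const]; rfl
  have e2 : ∀ z, F z * k.adj.avg H z = ∫ α, k.m α * F z * H (z + k.τ α) ∂k.ν := fun z => by
    rw [avg, ← integral_const_mul]
    refine integral_congr_ae (Eventually.of_forall fun α => ?_)
    simp [adj]; ring
  simp_rw [e1, e2]
  rw [integral_integral_swap (f := fun z α => k.m α * F (z - k.τ α) * H z) h,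
    integral_integral_swap (f := fun z α => k.m α * F z * H (z + k.τ α)) h']
  refine integral_congr_ae (Eventually.of_forall fun α => ?_)
  have := integral_sub_right_eq_self (μ := (volume : Measure SpaceTime))
    (fun z : SpaceTime => k.m α * F z * H (z + k.τ α)) (k.τ α)
  simpa using this

theorem integral_avg_mul_of_memLp (hF : MemLp F 2) (hH : MemLp H 2) :
    ∫ z, k.avg F z * H z = ∫ z, F z * k.adj.avg H z := by
  refine k.integral_avg_mul ⟨((k.hm.1.comp_snd).mul (k.aestronglyMeasurable_comp hF.1)).mul
    hH.1.comp_fst, ?_⟩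
  rw [hasFiniteIntegral_iff_enorm, lintegral_prod]
  swap
  · exact (((k.hm.1.comp_snd).mul (k.aestronglyMeasurable_comp hF.1)).mul hH.1.comp_fst).enorm
  simp_rw [enorm_mul, mul_assoc]
  rw [k.lintegral_lintegral_shift (V := fun z w => ‖F w‖ₑ * ‖H z‖ₑ)
    ((k.aestronglyMeasurable_comp hF.1).enorm.mul hH.1.comp_fst.enorm)]
  have h1 : ∀ α, ∫⁻ z, ‖F (z - k.τ α)‖ₑ * ‖H z‖ₑ ≤ eLpNorm F 2 volume * eLpNorm H 2 volume := by
    intro α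
    have hFα : AEStronglyMeasurable (fun z => F (z - k.τ α)) volume :=
      hF.1.comp_measurePreserving (measurePreserving_sub_right volume (k.τ α))
    have h := sq_lintegral_mul_le hFα.enorm hH.1.enorm
    rw [lintegral_sub_right_eq_self (fun w : SpaceTime => ‖F w‖ₑ ^ 2), ← eLpNorm_two_sq,
      ← eLpNorm_two_sq, ← mul_pow] at h
    exact (ENNReal.pow_le_pow_left_iff two_ne_zero).1 h
  calc _ ≤ ∫⁻ α, ‖k.m α‖ₑ * (eLpNorm F 2 volume * eLpNorm H 2 volume) ∂k.ν := by
        gcongr with α; exact h1 α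
    _ = k.mass * (eLpNorm F 2 volume * eLpNorm H 2 volume) := by
        rw [lintegral_mul_const'' _ k.hm.1.enorm, mass]
    _ < ⊤ := ENNReal.mul_lt_top k.mass_ne_top.lt_top (ENNReal.mul_lt_top hF.2 hH.2)

theorem integral_avg_mul_of_bdd {M : ℝ} (hF : Integrable F volume)
    (hH : AEStronglyMeasurable H volume) (hM : ∀ z, |H z| ≤ M) :
    ∫ z, k.avg F z * H z = ∫ z, F z * k.adj.avg H z := by
  refine k.integral_avg_mul ?_
  have h : Integrable (fun p : SpaceTime × k.A => F p.1 * k.m p.2) (volume.prod k.ν) :=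
    hF.mul_prod k.hm
  have h2 := (k.measurePreserving_shear.integrable_comp h.1).2 h
  have h3 := h2.mul_bdd (c := M) (f := _) (g := fun p : SpaceTime × k.A => H p.1) hH.comp_fst
    (Eventually.of_forall fun p => hM p.1)
  simpa [Function.comp_def, mul_comm] using h3

theorem weakL2_avg {ι : Type*} {l : Filter ι} {a : ι → SpaceTime → ℝ} {a0 : SpaceTime → ℝ}
    (h : WeakL2 volume l a a0) : WeakL2 volume l (fun n => k.avg (a n)) (k.avg a0) := by
  obtain ⟨C, hC⟩ := h.bdd
  refine ⟨fun n => k.memLp_avg (h.mem n), k.memLp_avg h.mem0, ⟨k.mass.toNNReal * C, ?_⟩,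
    fun b hb => ?_⟩
  · filter_upwards [hC] with n hn
    refine (k.eLpNorm_avg_le (h.mem n).1).trans ?_
    push_cast
    rw [ENNReal.coe_toNNReal k.mass_ne_top]
    gcongr
  · simp_rw [k.integral_avg_mul_of_memLp (h.mem _) hb, k.integral_avg_mul_of_memLp h.mem0 hb]
    exact h.tendsto _ (k.adj.memLp_avg hb)

/-- An average with total weight one is as close to `F` in `L²(V)` as the translates of `F`. -/
theorem lintegral_sq_avg_sub_le {V : Set SpaceTime} {B : ℝ≥0∞} (hF : MemLp F 2)
    (h1 : ∫ α, k.m α ∂k.ν = 1)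
    (hB : ∀ α, k.m α ≠ 0 → ∫⁻ z in V, ‖F (z - k.τ α) - F z‖ₑ ^ 2 ≤ B) :
    ∫⁻ z in V, ‖k.avg F z - F z‖ₑ ^ 2 ≤ k.mass ^ 2 * B := by
  have hmeas : AEMeasurable (fun p : SpaceTime × k.A => ‖F (p.1 - k.τ p.2) - F p.1‖ₑ)
      (volume.prod k.ν) :=
    ((k.aestronglyMeasurable_comp hF.1).sub hF.1.comp_fst).enorm
  have hle : (volume.restrict V).prod k.ν ≤ (volume : Measure SpaceTime).prod k.ν :=
    Measure.prod_mono Measure.restrict_le_self le_rfl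
  calc ∫⁻ z in V, ‖k.avg F z - F z‖ₑ ^ 2
      ≤ ∫⁻ z in V, k.mass * ∫⁻ α, ‖k.m α‖ₑ * ‖F (z - k.τ α) - F z‖ₑ ^ 2 ∂k.ν := by
        refine lintegral_mono_ae (ae_restrict_of_ae ?_)
        filter_upwards [k.ae_integrable hF, k.ae_aemeasurable_slice hF.1] with z hz1 hz2
        have e : k.avg F z - F z = ∫ α, k.m α • (F (z - k.τ α) - F z) ∂k.ν := by
          simp_rw [smul_sub]
          rw [integral_sub hz1 (k.hm.smul_const _), integral_smul_const, h1, one_smul]; rfl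
        refine le_trans ?_ (sq_lintegral_weight_le (g := fun α => ‖F (z - k.τ α) - F z‖ₑ)
          k.hm.1.enorm (hz2.sub aestronglyMeasurable_const).enorm)
        gcongr
        rw [e]
        refine (enorm_integral_le_lintegral_enorm _).trans (le_of_eq ?_)
        simp_rw [enorm_smul]
    _ = k.mass * ∫⁻ α, ‖k.m α‖ₑ * (∫⁻ z in V, ‖F (z - k.τ α) - F z‖ₑ ^ 2) ∂k.ν := by
        rw [lintegral_const_mul' _ _ k.mass_ne_top]
        congr 1
        rw [lintegral_lintegral_swap]
        · refine lintegral_congr fun α => ?_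
          rw [lintegral_const_mul' _ _ (by simp)]
        · exact ((k.hm.1.comp_snd.enorm).mul (hmeas.pow_const 2)).mono_measure hle
    _ ≤ k.mass * ∫⁻ α, ‖k.m α‖ₑ * B ∂k.ν := by
        refine mul_le_mul_right (lintegral_mono fun α => ?_) _
        by_cases h : k.m α = 0
        · simp [h]
        · exact mul_le_mul_right (hB α h) _
    _ = k.mass ^ 2 * B := by
        rw [lintegral_mul_const'' _ k.hm.1.enorm, pow_two, mul_assoc, mass]

end L2

section Smooth

theorem integrable_smul_comp {E : Type*} [NormedAddCommGroup E] [NormedSpace ℝ E]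
    {F : SpaceTime → E} (hF : Continuous F) (hc : HasCompactSupport F) (z : SpaceTime) :
    Integrable (fun α => k.m α • F (z - k.τ α)) k.ν := by
  obtain ⟨C, hC⟩ := hF.bounded_above_of_compact_support hc
  refine k.hm.smul_bdd C ?_ (Eventually.of_forall fun α => hC _)
  refine AEStronglyMeasurable.comp_measurable (g := F) ?_ (measurable_const.sub k.hτ)
  exact (hF.stronglyMeasurable_of_hasCompactSupport hc).aestronglyMeasurable

theorem hasFDerivAt_avg {E : Type} [NormedAddCommGroup E] [NormedSpace ℝ E]
    {F : SpaceTime → E} (hF : ContDiff ℝ ∞ F) (hc : HasCompactSupport F) (z : SpaceTime) :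
    HasFDerivAt (k.avg F) (k.avg (fderiv ℝ F) z) z := by
  have hF' : Continuous (fderiv ℝ F) := hF.continuous_fderiv (by simp)
  have hc' : HasCompactSupport (fderiv ℝ F) := hc.fderiv ℝ
  obtain ⟨C, hC⟩ := hF'.bounded_above_of_compact_support hc'
  refine hasFDerivAt_integral_of_dominated_of_fderiv_le (s := univ) (bound := fun α => ‖k.m α‖ * C)
    (F := fun z α => k.m α • F (z - k.τ α)) (F' := fun z α => k.m α • fderiv ℝ F (z - k.τ α))
    univ_mem ?_ ?_ ?_ ?_ ?_ ?_
  · exact Eventually.of_forall fun w => (k.integrable_smul_comp hF.continuous hc w).1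
  · exact k.integrable_smul_comp hF.continuous hc z
  · exact (k.integrable_smul_comp hF' hc' z).1
  · refine Eventually.of_forall fun α w _ => ?_
    rw [norm_smul]
    gcongr
    exact hC _
  · exact k.hm.norm.mul_const C
  · refine Eventually.of_forall fun α w _ => ?_
    have h1 : HasFDerivAt F (fderiv ℝ F (w - k.τ α)) (w - k.τ α) :=
      (hF.differentiable (by simp) _).hasFDerivAt
    have h2 := (h1.comp w ((hasFDerivAt_id w).sub_const (k.τ α))).const_smul (k.m α)
    rw [ContinuousLinearMap.comp_id] at h2
    exact h2

theorem contDiff_avg {E : Type} [NormedAddCommGroup E] [NormedSpace ℝ E]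
    {F : SpaceTime → E} (hF : ContDiff ℝ ∞ F) (hc : HasCompactSupport F) :
    ContDiff ℝ ∞ (k.avg F) := by
  -- The induction must range over all target spaces, since the derivative of F takes values in a
  -- space of linear maps.
  have key : ∀ (n : ℕ) (E : Type) [NormedAddCommGroup E] [NormedSpace ℝ E]
      (F : SpaceTime → E), ContDiff ℝ ∞ F → HasCompactSupport F → ContDiff ℝ n (k.avg F) := by
    intro n
    induction n with
    | zero =>
      intro E _ _ F hF hc
      refine contDiff_zero.2 ?_
      exact continuous_iff_continuousAt.2 fun z => (k.hasFDerivAt_avg hF hc z).continuousAt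
    | succ n ih =>
      intro E _ _ F hF hc
      push_cast
      rw [contDiff_succ_iff_fderiv]
      refine ⟨fun z => (k.hasFDerivAt_avg hF hc z).differentiableAt, by simp, ?_⟩
      have e : fderiv ℝ (k.avg F) = k.avg (fderiv ℝ F) :=
        funext fun z => (k.hasFDerivAt_avg hF hc z).fderiv
      rw [e]
      exact ih _ _ (hF.fderiv_right (by simp)) (hc.fderiv ℝ)
  exact contDiff_infty.2 fun n => key n E F hF hc

theorem fderiv_avg_apply {F : SpaceTime → ℝ} (hF : ContDiff ℝ ∞ F) (hc : HasCompactSupport F)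
    (z e : SpaceTime) : fderiv ℝ (k.avg F) z e = k.avg (fun w => fderiv ℝ F w e) z := by
  rw [(k.hasFDerivAt_avg hF hc z).fderiv, avg,
    ContinuousLinearMap.integral_apply (k.integrable_smul_comp
      (hF.continuous_fderiv (by simp)) (hc.fderiv ℝ) z)]
  rfl

theorem avg_eq_zero_of_forall {E : Type*} [NormedAddCommGroup E] [NormedSpace ℝ E] {r : ℝ}
    (hk : k.InBall r) {F : SpaceTime → E} {z : SpaceTime}
    (h : ∀ w, ‖z - w‖ ≤ r → F w = 0) : k.avg F z = 0 := by
  rw [avg]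
  refine integral_eq_zero_of_ae (Eventually.of_forall fun α => ?_)
  by_cases hα : k.m α = 0
  · simp [hα]
  · simp [h (z - k.τ α) (by simpa using hk α hα)]

theorem avg_congr_of_forall {E : Type*} [NormedAddCommGroup E] [NormedSpace ℝ E] {r : ℝ}
    (hk : k.InBall r) {F H : SpaceTime → E} {z : SpaceTime}
    (h : ∀ w, ‖z - w‖ ≤ r → F w = H w) : k.avg F z = k.avg H z := by
  rw [avg, avg]
  refine integral_congr_ae (Eventually.of_forall fun α => ?_)
  by_cases hα : k.m α = 0
  · simp [hα]
  · simp [h (z - k.τ α) (by simpa using hk α hα)]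

theorem tsupport_avg_subset {r : ℝ} (hk : k.InBall r) {F : SpaceTime → ℝ}
    : tsupport (k.avg F) ⊆ Metric.cthickening r (tsupport F) := by
  refine closure_minimal (fun z hz => ?_) Metric.isClosed_cthickening
  by_contra hz'
  refine hz (k.avg_eq_zero_of_forall hk fun w hw => ?_)
  by_contra hw'
  refine hz' (Metric.mem_cthickening_of_dist_le z w r _ (subset_tsupport _ hw') ?_)
  rwa [dist_eq_norm]

theorem hasCompactSupport_avg {r : ℝ} (hk : k.InBall r) {F : SpaceTime → ℝ}
    (hc : HasCompactSupport F) : HasCompactSupport (k.avg F) :=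
  hc.isCompact.cthickening.of_isClosed_subset (isClosed_tsupport _) (k.tsupport_avg_subset hk)
end Smooth

end TransKernel

/-! ### Test functions and their directional derivatives -/

/-- The derivative of `ψ` in the direction `e`. -/
def dd (e : SpaceTime) (ψ : SpaceTime → ℝ) (z : SpaceTime) : ℝ := fderiv ℝ ψ z e

/-- The `j`-th space direction. -/
def ej (j : Fin 3) : SpaceTime := (0, EuclideanSpace.single j 1)

/-- The time direction. -/
def et : SpaceTime := (1, 0)

/-- Smooth functions with compact support in `U`. -/
structure IsTest (U : Set SpaceTime) (ψ : SpaceTime → ℝ) : Prop where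
  smooth : ContDiff ℝ ∞ ψ
  compact : HasCompactSupport ψ
  supp : tsupport ψ ⊆ U

/-- The closed `r`-neighbourhood of `V` is contained in `U`. -/
def Near (r : ℝ) (V U : Set SpaceTime) : Prop := ∀ z ∈ V, ∀ w, ‖z - w‖ ≤ r → w ∈ U

section IsTest
variable {U V : Set SpaceTime} {ψ χ : SpaceTime → ℝ} {e : SpaceTime} {k : TransKernel} {r : ℝ}

theorem IsTest.mono (h : IsTest U ψ) (hUV : U ⊆ V) : IsTest V ψ := ⟨h.1, h.2, h.3.trans hUV⟩

theorem IsTest.differentiable (h : IsTest U ψ) : Differentiable ℝ ψ :=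
  h.smooth.differentiable (by simp)

theorem IsTest.memLp (h : IsTest U ψ) : MemLp ψ 2 :=
  h.smooth.continuous.memLp_of_hasCompactSupport h.compact

theorem IsTest.integrable (h : IsTest U ψ) : Integrable ψ :=
  h.smooth.continuous.integrable_of_hasCompactSupport h.compact

theorem IsTest.bdd (h : IsTest U ψ) : ∃ M, ∀ z, |ψ z| ≤ M :=
  h.smooth.continuous.bounded_above_of_compact_support h.compact

theorem IsTest.aesm (h : IsTest U ψ) : AEStronglyMeasurable ψ volume := h.memLp.1

theorem IsTest.eq_zero (h : IsTest U ψ) {z : SpaceTime} (hz : z ∉ U) : ψ z = 0 :=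
  image_eq_zero_of_notMem_tsupport fun h' => hz (h.supp h')

theorem IsTest.zero : IsTest U (fun _ => 0) :=
  ⟨contDiff_const, HasCompactSupport.zero, by simp [tsupport, Function.support]⟩

theorem IsTest.add (h : IsTest U ψ) (h' : IsTest U χ) : IsTest U (fun z => ψ z + χ z) :=
  ⟨h.1.add h'.1, h.2.add h'.2, (tsupport_add ψ χ).trans (union_subset h.3 h'.3)⟩

theorem IsTest.mul_smooth (h : IsTest U ψ) (h' : ContDiff ℝ ∞ χ) :
    IsTest U (fun z => ψ z * χ z) :=
  ⟨h.1.mul h', h.2.mul_right, (tsupport_mul_subset_left (f := ψ) (g := χ)).trans h.3⟩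

theorem IsTest.const_mul (h : IsTest U ψ) (c : ℝ) : IsTest U (fun z => c * ψ z) := by
  simp_rw [mul_comm c]
  exact h.mul_smooth contDiff_const

theorem IsTest.neg (h : IsTest U ψ) : IsTest U (fun z => - ψ z) := by
  simpa using h.const_mul (-1)

theorem IsTest.sub (h : IsTest U ψ) (h' : IsTest U χ) : IsTest U (fun z => ψ z - χ z) := by
  simpa [sub_eq_add_neg] using h.add h'.neg

theorem IsTest.sum {κ : Type*} (s : Finset κ) {ψ : κ → SpaceTime → ℝ}
    (h : ∀ i, IsTest U (ψ i)) : IsTest U (fun z => ∑ i ∈ s, ψ i z) := by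
  classical
  induction s using Finset.induction_on with
  | empty => simpa using IsTest.zero
  | insert i s hi ih =>
    simp_rw [Finset.sum_insert hi]
    exact (h i).add ih

theorem contDiff_dd (h : ContDiff ℝ ∞ ψ) (e : SpaceTime) : ContDiff ℝ ∞ (dd e ψ) :=
  (h.fderiv_right (m := ∞) (by simp)).clm_apply contDiff_const

theorem IsTest.dd (h : IsTest U ψ) (e : SpaceTime) : IsTest U (dd e ψ) :=
  ⟨contDiff_dd h.1 e, h.2.fderiv_apply ℝ e, (tsupport_fderiv_apply_subset ℝ e).trans h.3⟩

theorem IsTest.avg (h : IsTest V ψ) (hk : k.InBall r) (hV : Near r V U) (hr : 0 ≤ r) :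
    IsTest U (k.avg ψ) := by
  refine ⟨k.contDiff_avg h.1 h.2, k.hasCompactSupport_avg hk h.2,
    (k.tsupport_avg_subset hk).trans ?_⟩
  rw [h.compact.isCompact.cthickening_eq_biUnion_closedBall hr]
  refine iUnion₂_subset fun w hw z hz => ?_
  refine hV w (h.supp hw) z ?_
  rw [← dist_eq_norm, dist_comm]; exact hz

theorem IsTest.dd_avg (h : IsTest V ψ) (z : SpaceTime) :
    NavierStokes.dd e (k.avg ψ) z = k.avg (NavierStokes.dd e ψ) z :=
  k.fderiv_avg_apply h.1 h.2 z e

theorem dd_sub {ψ χ : SpaceTime → ℝ} (h : Differentiable ℝ ψ) (h' : Differentiable ℝ χ)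
    (z : SpaceTime) : dd e (fun z => ψ z - χ z) z = dd e ψ z - dd e χ z := by
  simp [dd, fderiv_fun_sub (h z) (h' z)]

theorem dd_mul {ψ χ : SpaceTime → ℝ} (h : Differentiable ℝ ψ) (h' : Differentiable ℝ χ)
    (z : SpaceTime) : dd e (fun z => ψ z * χ z) z = ψ z * dd e χ z + χ z * dd e ψ z := by
  simp [dd, fderiv_fun_mul (h z) (h' z)]

theorem dd_sum {κ : Type*} {s : Finset κ} {ψ : κ → SpaceTime → ℝ}
    (h : ∀ i, Differentiable ℝ (ψ i)) (z : SpaceTime) :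
    dd e (fun z => ∑ i ∈ s, ψ i z) z = ∑ i ∈ s, dd e (ψ i) z := by
  rw [dd, fderiv_fun_sum (fun i _ => h i z), _root_.sum_apply]
  rfl

theorem dd_comm {ψ : SpaceTime → ℝ} (h : ContDiff ℝ ∞ ψ) (e e' : SpaceTime) (z : SpaceTime) :
    dd e (dd e' ψ) z = dd e' (dd e ψ) z := by
  have hd : DifferentiableAt ℝ (fderiv ℝ ψ) z :=
    (h.fderiv_right (m := ∞) (by simp)).differentiable (by simp) z
  have key : ∀ a b : SpaceTime, dd a (dd b ψ) z = fderiv ℝ (fderiv ℝ ψ) z a b := by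
    intro a b
    have : dd b ψ = fun w => fderiv ℝ ψ w b := rfl
    rw [dd, this, fderiv_clm_apply hd (differentiableAt_const b)]
    simp
  rw [key, key]
  have hs : IsSymmSndFDerivAt ℝ ψ z :=
    h.contDiffAt.isSymmSndFDerivAt
      (by simp only [minSmoothness_of_isRCLikeNormedField]; exact WithTop.coe_le_coe.2 le_top)
  exact hs e e'

theorem integral_mul_dd {a : SpaceTime → ℝ} (ha : ContDiff ℝ ∞ a) (h : IsTest U ψ) :
    ∫ z, a z * dd e ψ z = - ∫ z, dd e a z * ψ z := by
  refine integral_mul_fderiv_eq_neg_fderiv_mul_of_integrable ?_ ?_ ?_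
    (fun x _ => ha.differentiable (by simp) x) (fun x _ => h.differentiable x)
  · have := (h.mul_smooth (contDiff_dd ha e)).integrable
    simpa [mul_comm, dd] using this
  · have := ((h.dd e).mul_smooth ha).integrable
    simpa [mul_comm, dd] using this
  · have := (h.mul_smooth ha).integrable
    simpa [mul_comm] using this

end IsTest

theorem Near.mono {r r' : ℝ} {V U : Set SpaceTime} (h : Near r V U) (hr : r' ≤ r) : Near r' V U :=
  fun z hz w hw => h z hz w (hw.trans hr)

theorem Near.subset {r : ℝ} {V U : Set SpaceTime} (h : Near r V U) (hr : 0 ≤ r) : V ⊆ U :=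
  fun z hz => h z hz z (by simpa using hr)

/-! ### Continuity of translations and approximation of the identity -/

section Translation

/-- Translations act continuously on L²: the integral is the squared norm of a difference of
elements of `Lp`, continuous in a and zero at a = 0. -/
theorem exists_translate_le {F : SpaceTime → ℝ} (hF : MemLp F 2) {η : ℝ≥0∞} (hη : η ≠ 0) :
    ∃ r > 0, ∀ a : SpaceTime, ‖a‖ ≤ r → ∫⁻ z, ‖F (z - a) - F z‖ₑ ^ 2 ≤ η := by
  set L : Lp ℝ 2 (volume : Measure SpaceTime) := hF.toLp F
  let g : C(SpaceTime, C(SpaceTime, SpaceTime)) :=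
    (ContinuousMap.mk (fun a : SpaceTime × SpaceTime => a.2 - a.1) (by fun_prop)).curry
  have hg : ∀ a, MeasurePreserving (g a) (volume : Measure SpaceTime) volume :=
    fun a => measurePreserving_sub_right volume a
  have hcont : Continuous fun a : SpaceTime => Lp.compMeasurePreserving (g a) (hg a) L :=
    Continuous.compMeasurePreservingLp (f := fun _ => L) continuous_const g.continuous hg
      (by norm_num)
  have hae : ∀ a, ∫⁻ z, ‖F (z - a) - F z‖ₑ ^ 2 =
      ‖Lp.compMeasurePreserving (g a) (hg a) L - L‖ₑ ^ 2 := by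
    intro a
    rw [Lp.enorm_def, eLpNorm_two_sq]
    refine lintegral_congr_ae ?_
    have h1 := Lp.coeFn_sub (Lp.compMeasurePreserving (g a) (hg a) L) L
    have h2 := Lp.coeFn_compMeasurePreserving L (hg a)
    have h3 : (L : SpaceTime → ℝ) =ᵐ[volume] F := hF.coeFn_toLp
    have h4 := (hg a).quasiMeasurePreserving.ae_eq_comp h3
    filter_upwards [h1, h2, h3, h4] with z e1 e2 e3 e4
    rw [e1, Pi.sub_apply, e2, e3, e4]
    rfl
  have ht : Tendsto (fun a : SpaceTime => ∫⁻ z, ‖F (z - a) - F z‖ₑ ^ 2) (𝓝 0) (𝓝 0) := by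
    have : Continuous fun a : SpaceTime => ∫⁻ z, ‖F (z - a) - F z‖ₑ ^ 2 := by
      simp_rw [hae]
      exact (ENNReal.continuous_pow 2).comp (hcont.sub continuous_const).enorm
    have h := this.tendsto 0
    simpa using h
  have hev := (ENNReal.tendsto_nhds_zero.1 ht) η (pos_iff_ne_zero.2 hη)
  obtain ⟨r, hr, hball⟩ := Metric.eventually_nhds_iff_ball.1 hev
  refine ⟨r / 2, by positivity, fun a ha => hball a ?_⟩
  rw [Metric.mem_ball, dist_zero_right]; linarith

/-- A sequence of averages of total weight one and bounded mass along shrinking translations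
approximates the identity in `L²`. -/
theorem strongL2_avg_seq {ι : Type*} {l : Filter ι} {k : ι → TransKernel} {r : ι → ℝ} {C : ℝ≥0}
    (hk : ∀ n, (k n).InBall (r n)) (hr : Tendsto r l (𝓝 0)) (hC : ∀ n, (k n).mass ≤ C)
    (h1 : ∀ n, ∫ α, (k n).m α ∂(k n).ν = 1) {F : SpaceTime → ℝ} (hF : MemLp F 2) :
    StrongL2 volume l (fun n => (k n).avg F) F := by
  refine ⟨fun n => (k n).memLp_avg hF, hF, ?_⟩
  rw [ENNReal.tendsto_nhds_zero]
  intro η hη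
  by_cases hηt : η = ⊤
  · simp [hηt]
  obtain ⟨ρ, hρ, hB⟩ := exists_translate_le hF (η := η ^ 2 / ((C : ℝ≥0∞) ^ 2 + 1))
    (ENNReal.div_pos (by positivity) (by finiteness)).ne'
  filter_upwards [hr.eventually (gt_mem_nhds hρ)] with n hn
  have h := (k n).lintegral_sq_avg_sub_le (V := univ) hF (h1 n)
    (B := η ^ 2 / ((C : ℝ≥0∞) ^ 2 + 1)) (fun α hα => by
      simpa using hB _ ((hk n α hα).trans hn.le))
  rw [Measure.restrict_univ, ← eLpNorm_two_sq (fun z => (k n).avg F z - F z)] at h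
  have h2 : eLpNorm (fun z => (k n).avg F z - F z) 2 volume ^ 2 ≤ η ^ 2 := by
    refine h.trans ?_
    calc _ ≤ ((C : ℝ≥0∞) ^ 2 + 1) * (η ^ 2 / ((C : ℝ≥0∞) ^ 2 + 1)) := by
          gcongr
          exact (pow_le_pow_left₀ zero_le (hC n) 2).trans le_self_add
      _ = η ^ 2 := ENNReal.mul_div_cancel (by simp) (by finiteness)
  exact (ENNReal.pow_le_pow_left_iff two_ne_zero).1 h2

/-- Uniformly bounded masses make the averages equicontinuous on L², so the averaged function may
vary along the sequence. -/
theorem StrongL2.avg_seq {ι : Type*} {l : Filter ι} {k : ι → TransKernel} {r : ι → ℝ} {C : ℝ≥0}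
    (hk : ∀ n, (k n).InBall (r n)) (hr : Tendsto r l (𝓝 0)) (hC : ∀ n, (k n).mass ≤ C)
    (h1 : ∀ n, ∫ α, (k n).m α ∂(k n).ν = 1) {a : ι → SpaceTime → ℝ} {a0 : SpaceTime → ℝ}
    (ha : StrongL2 volume l a a0) :
    StrongL2 volume l (fun n => (k n).avg (a n)) a0 := by
  refine ⟨fun n => (k n).memLp_avg (ha.mem n), ha.mem0, ?_⟩
  have hF := strongL2_avg_seq hk hr hC h1 ha.mem0
  have h2 : Tendsto (fun n => (C : ℝ≥0∞) * eLpNorm (fun x => a n x - a0 x) 2 volume +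
      eLpNorm (fun x => (k n).avg a0 x - a0 x) 2 volume) l (𝓝 0) := by
    have := (ENNReal.Tendsto.const_mul (a := (C : ℝ≥0∞)) ha.tendsto (Or.inr (by simp))).add
      hF.tendsto
    simpa using this
  refine tendsto_of_tendsto_of_tendsto_of_le_of_le tendsto_const_nhds h2 (fun _ => zero_le) ?_
  intro n
  have e : (fun x => (k n).avg (a n) x - a0 x) =ᵐ[volume]
      (k n).avg (fun x => a n x - a0 x) + fun x => (k n).avg a0 x - a0 x := by
    filter_upwards [(k n).ae_avg_sub (ha.mem n) ha.mem0] with z hz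
    rw [Pi.add_apply, hz]; ring
  simp only
  rw [eLpNorm_congr_ae e]
  have m1 := memLp_sub (ha.mem n) ha.mem0
  refine (eLpNorm_add_le ((k n).memLp_avg m1).1 (memLp_sub (hF.mem n) hF.mem0).1
    (by norm_num)).trans ?_
  gcongr
  exact ((k n).eLpNorm_avg_le m1.1).trans (by gcongr; exact hC n)

end Translation

/-! ### Weak directional derivatives -/

section WD

/-- `∂_e a = b` in the sense of distributions on `U`. -/
def WD (U : Set SpaceTime) (e : SpaceTime) (a b : SpaceTime → ℝ) : Prop :=
  ∀ ψ, IsTest U ψ → ∫ z, a z * dd e ψ z = - ∫ z, b z * ψ z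

variable {U V : Set SpaceTime} {e : SpaceTime} {a b a' b' χ : SpaceTime → ℝ} {k : TransKernel}
  {r : ℝ}

theorem WD.mono (h : WD U e a b) (hV : V ⊆ U) : WD V e a b := fun ψ hψ => h ψ (hψ.mono hV)

/-- By duality the average is moved onto the test function, where it commutes with the derivative;
it spreads the support by r, whence the smaller set V. -/
theorem WD.avg (h : WD U e a b) (ha : MemLp a 2) (hb : MemLp b 2) (hk : k.InBall r) (hr : 0 ≤ r)
    (hV : Near r V U) : WD V e (k.avg a) (k.avg b) := by
  intro ψ hψ
  rw [k.integral_avg_mul_of_memLp ha (hψ.dd e).memLp, k.integral_avg_mul_of_memLp hb hψ.memLp,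
    ← h _ (hψ.avg hk.adj hV hr)]
  simp_rw [hψ.dd_avg]

theorem WD.add (h : WD U e a b) (h' : WD U e a' b') (ha : MemLp a 2) (hb : MemLp b 2)
    (ha' : MemLp a' 2) (hb' : MemLp b' 2) :
    WD U e (fun z => a z + a' z) (fun z => b z + b' z) := by
  intro ψ hψ
  simp_rw [add_mul]
  rw [integral_add (integrable_mul_of_memLp ha (hψ.dd e).memLp)
    (integrable_mul_of_memLp ha' (hψ.dd e).memLp), integral_add (integrable_mul_of_memLp hb hψ.memLp)
    (integrable_mul_of_memLp hb' hψ.memLp), h ψ hψ, h' ψ hψ]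
  ring

theorem WD.const_mul (h : WD U e a b) (c : ℝ) : WD U e (fun z => c * a z) (fun z => c * b z) := by
  intro ψ hψ
  simp_rw [mul_assoc]
  rw [integral_const_mul, integral_const_mul, h ψ hψ]; ring

theorem WD.sub (h : WD U e a b) (h' : WD U e a' b') (ha : MemLp a 2) (hb : MemLp b 2)
    (ha' : MemLp a' 2) (hb' : MemLp b' 2) :
    WD U e (fun z => a z - a' z) (fun z => b z - b' z) := by
  have := h.add (h'.const_mul (-1)) ha hb (ha'.const_mul (-1)) (hb'.const_mul (-1))
  simpa only [neg_mul, one_mul, ← sub_eq_add_neg] using this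

/-- For any ψ the product χψ is an admissible test function on U. A cut-off therefore turns a weak
derivative on U into one on the whole space, with the Leibniz correction. -/
theorem WD.mul_test (h : WD U e a b) (ha : MemLp a 2) (hb : MemLp b 2) (hχ : IsTest U χ) :
    WD univ e (fun z => a z * χ z) (fun z => b z * χ z + a z * dd e χ z) := by
  intro ψ hψ
  have h1 := h _ (hχ.mul_smooth hψ.smooth)
  obtain ⟨M, hM⟩ := hχ.bdd
  obtain ⟨M', hM'⟩ := (hχ.dd e).bdd
  have i1 := integrable_mul_of_memLp (memLp_mul_bdd ha hχ.aesm (Eventually.of_forall hM))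
    (hψ.dd e).memLp
  have i2 := integrable_mul_of_memLp (memLp_mul_bdd ha (hχ.dd e).aesm (Eventually.of_forall hM'))
    hψ.memLp
  have i3 := integrable_mul_of_memLp (memLp_mul_bdd hb hχ.aesm (Eventually.of_forall hM)) hψ.memLp
  have e1 : ∫ z, a z * dd e (fun z => χ z * ψ z) z =
      (∫ z, a z * χ z * dd e ψ z) + ∫ z, a z * dd e χ z * ψ z := by
    rw [← integral_add i1 i2]
    congr 1; ext z
    rw [dd_mul hχ.differentiable hψ.differentiable]; ring
  rw [e1] at h1
  have e2 : ∫ z, (b z * χ z + a z * dd e χ z) * ψ z =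
      (∫ z, b z * (χ z * ψ z)) + ∫ z, a z * dd e χ z * ψ z := by
    simp_rw [add_mul, ← mul_assoc]
    exact integral_add i3 i2
  rw [e2]; simp only; linarith

end WD

/-- The `j`-th partial derivative on `ℝ³`. -/
def d3 (j : Fin 3) (κ : R3 → ℝ) (y : R3) : ℝ := fderiv ℝ κ y (EuclideanSpace.single j 1)

theorem contDiff_d3 {κ : R3 → ℝ} (h : ContDiff ℝ ∞ κ) (j : Fin 3) : ContDiff ℝ ∞ (d3 j κ) :=
  (h.fderiv_right (m := ∞) (by simp)).clm_apply contDiff_const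

theorem hasCompactSupport_d3 {κ : R3 → ℝ} (h : HasCompactSupport κ) (j : Fin 3) :
    HasCompactSupport (d3 j κ) := h.fderiv_apply ℝ _

/-! ### Convolutions in space, in time and in space-time -/

section Kernels

/-- Convolution in space-time as an average of translates. -/
def convKer (ρ : SpaceTime → ℝ) (h : ContDiff ℝ ∞ ρ) (hc : HasCompactSupport ρ) : TransKernel where
  A := SpaceTime
  ν := volume
  m := ρ
  τ := fun y => y
  hm := h.continuous.integrable_of_hasCompactSupport hc
  hτ := measurable_id

/-- Convolution in the space variable. -/
def spaceKer (κ : R3 → ℝ) (h : ContDiff ℝ ∞ κ) (hc : HasCompactSupport κ) : TransKernel where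
  A := R3
  ν := volume
  m := κ
  τ := fun y => (0, y)
  hm := h.continuous.integrable_of_hasCompactSupport hc
  hτ := by fun_prop

/-- Convolution in the time variable. -/
def timeKer (κ : ℝ → ℝ) (h : ContDiff ℝ ∞ κ) (hc : HasCompactSupport κ) : TransKernel where
  A := ℝ
  ν := volume
  m := κ
  τ := fun s => (s, 0)
  hm := h.continuous.integrable_of_hasCompactSupport hc
  hτ := by fun_prop

variable {ρ : SpaceTime → ℝ} {h : ContDiff ℝ ∞ ρ} {hc : HasCompactSupport ρ}

theorem convKer_avg_eq (F : SpaceTime → ℝ) (z : SpaceTime) :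
    (convKer ρ h hc).avg F z = ∫ y, ρ y * F (z - y) := rfl

theorem spaceKer_avg_eq {κ : R3 → ℝ} {h : ContDiff ℝ ∞ κ} {hc : HasCompactSupport κ}
    (F : SpaceTime → ℝ) (z : SpaceTime) :
    (spaceKer κ h hc).avg F z = ∫ y, κ y * F (z - (0, y)) := rfl

theorem spaceKer_adj_avg_eq {κ : R3 → ℝ} {h : ContDiff ℝ ∞ κ} {hc : HasCompactSupport κ}
    (F : SpaceTime → ℝ) (z : SpaceTime) :
    (spaceKer κ h hc).adj.avg F z = ∫ y, κ y * F (z - -(0, y)) := rfl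

theorem timeKer_avg_eq {κ : ℝ → ℝ} {h : ContDiff ℝ ∞ κ} {hc : HasCompactSupport κ}
    (F : SpaceTime → ℝ) (z : SpaceTime) :
    (timeKer κ h hc).avg F z = ∫ s, κ s * F (z - (s, 0)) := rfl

theorem convKer_avg_apply (F : SpaceTime → ℝ) (z : SpaceTime) :
    (convKer ρ h hc).avg F z = ∫ w, ρ (z - w) * F w := by
  have := integral_sub_left_eq_self (μ := (volume : Measure SpaceTime))
    (fun y : SpaceTime => ρ y * F (z - y)) z
  rw [convKer_avg_eq, ← this]
  simp

theorem contDiff_convKer {F : SpaceTime → ℝ} (hF : LocallyIntegrable F) :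
    ContDiff ℝ ∞ ((convKer ρ h hc).avg F) :=
  hc.contDiff_convolution_left (ContinuousLinearMap.lsmul ℝ ℝ) (μ := volume) h hF

theorem dd_convKer {F : SpaceTime → ℝ} (hF : LocallyIntegrable F) (e z : SpaceTime) :
    dd e ((convKer ρ h hc).avg F) z = ∫ w, dd e ρ (z - w) * F w := by
  have h1 := hc.hasFDerivAt_convolution_left (ContinuousLinearMap.lsmul ℝ ℝ)
    (μ := (volume : Measure SpaceTime)) (h.of_le (by simp)) hF z
  have h2 : dd e ((convKer ρ h hc).avg F) z =
      (convolution (fderiv ℝ ρ) F ((ContinuousLinearMap.lsmul ℝ ℝ).precompL SpaceTime) volume z) e :=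
    congrArg (fun L => L e) h1.fderiv
  have h3 : ConvolutionExistsAt (fderiv ℝ ρ) F z
      ((ContinuousLinearMap.lsmul ℝ ℝ).precompL SpaceTime) volume :=
    (hc.fderiv ℝ).convolutionExists_left _ (h.continuous_fderiv (by simp)) hF z
  rw [h2, convolution_def, ContinuousLinearMap.integral_apply h3]
  have := integral_sub_left_eq_self (μ := (volume : Measure SpaceTime))
    (fun y : SpaceTime => dd e ρ y * F (z - y)) z
  simp only [sub_sub_cancel] at this
  rw [this]
  rfl

theorem isTest_reflect {U : Set SpaceTime} {r : ℝ} (hr : (convKer ρ h hc).InBall r) {z : SpaceTime}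
    (hz : ∀ w, ‖z - w‖ ≤ r → w ∈ U) : IsTest U (fun w => ρ (z - w)) := by
  refine ⟨h.comp (contDiff_const.sub contDiff_id), ?_, ?_⟩
  · exact hc.comp_homeomorph (Homeomorph.subLeft z)
  · have hsub : Function.support (fun w => ρ (z - w)) ⊆ Metric.closedBall z r := by
      intro w hw
      rw [Metric.mem_closedBall, dist_comm, dist_eq_norm]
      exact hr (z - w) hw
    refine (closure_minimal hsub Metric.isClosed_closedBall).trans fun w hw => hz w ?_
    rw [← dist_eq_norm, dist_comm]; exact hw

theorem dd_reflect {ρ : SpaceTime → ℝ} (h : ContDiff ℝ ∞ ρ) (e z w : SpaceTime) :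
    dd e (fun w => ρ (z - w)) w = - dd e ρ (z - w) := by
  have h1 : HasFDerivAt ρ (fderiv ℝ ρ (z - w)) (z - w) :=
    (h.differentiable (by simp) _).hasFDerivAt
  have h2 := h1.comp w ((hasFDerivAt_id w).const_sub z)
  have h3 : fderiv ℝ (fun w => ρ (z - w)) w = _ := h2.fderiv
  rw [dd, h3]; simp [dd]

/-- The weak derivative is tested with the reflected kernel w ↦ ρ(z − w), which is supported in U
when the r-ball around z is. -/
theorem WD.dd_convKer {U : Set SpaceTime} {e : SpaceTime} {a b : SpaceTime → ℝ} {r : ℝ}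
    (hab : WD U e a b) (ha : MemLp a 2) (hr : (convKer ρ h hc).InBall r) {z : SpaceTime}
    (hz : ∀ w, ‖z - w‖ ≤ r → w ∈ U) :
    dd e ((convKer ρ h hc).avg a) z = (convKer ρ h hc).avg b z := by
  have := hab _ (isTest_reflect hr hz)
  simp_rw [dd_reflect h] at this
  rw [NavierStokes.dd_convKer (ha.locallyIntegrable (by norm_num)), convKer_avg_apply]
  simp_rw [mul_comm _ (a _), mul_comm _ (b _)]
  simp only [mul_neg, integral_neg] at this
  linarith

theorem spaceKer_inBall {κ : R3 → ℝ} {h : ContDiff ℝ ∞ κ} {hc : HasCompactSupport κ} {r : ℝ}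
    (hr : ∀ y, r < ‖y‖ → κ y = 0) : (spaceKer κ h hc).InBall r := by
  intro (y : R3) (hy : κ y ≠ 0)
  have : ‖((0, y) : SpaceTime)‖ = ‖y‖ := by simp [Prod.norm_def]
  change ‖((0, y) : SpaceTime)‖ ≤ r
  rw [this]
  by_contra h'
  exact hy (hr y (not_le.1 h'))

/-- The integrand on the left is, up to sign, κ times a y-derivative of ψ(z − s y), so one
integrates by parts in y. The free parameter covers the convolution (s = 1), its adjoint (s = −1)
and the potentials (0 < s ≤ 1). -/
theorem integral_mul_dd_scale {U : Set SpaceTime} {κ : R3 → ℝ} {ψ : SpaceTime → ℝ}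
    (hκ : ContDiff ℝ ∞ κ) (hc : HasCompactSupport κ) (hψ : IsTest U ψ) (j : Fin 3) (s : ℝ)
    (z : SpaceTime) :
    ∫ y, κ y * (s * dd (ej j) ψ (z - (0, s • y))) = ∫ y, d3 j κ y * ψ (z - (0, s • y)) := by
  set F : R3 → ℝ := fun y => ψ (z - (0, s • y)) with hF
  have hFs : ContDiff ℝ ∞ F := hψ.smooth.comp (by fun_prop)
  have hd : ∀ y, fderiv ℝ F y (EuclideanSpace.single j 1) = -(s * dd (ej j) ψ (z - (0, s • y))) := by
    intro y
    have h1 : HasFDerivAt ψ (fderiv ℝ ψ (z - (0, s • y))) (z - (0, s • y)) :=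
      (hψ.differentiable _).hasFDerivAt
    let L : R3 →L[ℝ] SpaceTime := s • ContinuousLinearMap.inr ℝ ℝ R3
    have h2 : HasFDerivAt (fun y : R3 => z - ((0, s • y) : SpaceTime)) (-L) y := by
      have e : (fun y : R3 => z - ((0, s • y) : SpaceTime)) = fun y => z - L y := by
        ext y <;> simp [L]
      rw [e]
      exact L.hasFDerivAt.const_sub z
    have h3 := (h1.comp y h2).fderiv
    have e2 : F = ψ ∘ fun y : R3 => z - ((0, s • y) : SpaceTime) := rfl
    rw [e2, h3]
    simp [L, dd, ej]
  have key := integral_mul_fderiv_eq_neg_fderiv_mul_of_integrable (μ := (volume : Measure R3))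
    (f := κ) (g := F) (v := EuclideanSpace.single j 1) ?_ ?_ ?_
    (fun x _ => hκ.differentiable (by simp) x) (fun x _ => hFs.differentiable (by simp) x)
  · simp_rw [hd] at key
    simp only [mul_neg, integral_neg, neg_inj] at key
    exact key
  · exact ((contDiff_d3 hκ j).continuous.mul hFs.continuous).integrable_of_hasCompactSupport
      ((hasCompactSupport_d3 hc j).mul_right)
  · exact (hκ.continuous.mul ((hFs.continuous_fderiv (by simp)).clm_apply
      continuous_const)).integrable_of_hasCompactSupport hc.mul_right
  · exact (hκ.continuous.mul hFs.continuous).integrable_of_hasCompactSupport hc.mul_right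

variable {κ : R3 → ℝ} {hκ : ContDiff ℝ ∞ κ} {hcκ : HasCompactSupport κ}

theorem spaceKer_avg_dd {U : Set SpaceTime} {ψ : SpaceTime → ℝ} (hψ : IsTest U ψ) (j : Fin 3)
    (z : SpaceTime) : (spaceKer κ hκ hcκ).avg (dd (ej j) ψ) z =
      (spaceKer (d3 j κ) (contDiff_d3 hκ j) (hasCompactSupport_d3 hcκ j)).avg ψ z := by
  have := integral_mul_dd_scale hκ hcκ hψ j 1 z
  rw [spaceKer_avg_eq, spaceKer_avg_eq]
  simpa using this

theorem spaceKer_adj_avg_dd {U : Set SpaceTime} {ψ : SpaceTime → ℝ} (hψ : IsTest U ψ) (j : Fin 3)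
    (z : SpaceTime) : (spaceKer κ hκ hcκ).adj.avg (dd (ej j) ψ) z =
      -(spaceKer (d3 j κ) (contDiff_d3 hκ j) (hasCompactSupport_d3 hcκ j)).adj.avg ψ z := by
  have := integral_mul_dd_scale hκ hcκ hψ j (-1) z
  rw [spaceKer_adj_avg_eq, spaceKer_adj_avg_eq]
  simp only [neg_smul, one_smul, neg_mul, one_mul, mul_neg, integral_neg] at this
  have e : ∀ y : R3, ((0, -y) : SpaceTime) = -(0, y) := fun y => by simp
  simp only [e] at this
  linarith

/-- All derivatives fall on the kernel, so nothing is needed on the derivatives of a; this is how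
the regularized velocity gets its gradient. -/
theorem wd_spaceKer {a : SpaceTime → ℝ} (ha : MemLp a 2) (j : Fin 3) :
    WD univ (ej j) ((spaceKer κ hκ hcκ).avg a)
      ((spaceKer (d3 j κ) (contDiff_d3 hκ j) (hasCompactSupport_d3 hcκ j)).avg a) := by
  intro ψ hψ
  rw [TransKernel.integral_avg_mul_of_memLp _ ha (hψ.dd _).memLp,
    TransKernel.integral_avg_mul_of_memLp _ ha hψ.memLp, ← integral_neg]
  congr 1; ext z
  rw [spaceKer_adj_avg_dd hψ]; ring

/-- The product of a time and a space kernel acts as the composition. -/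
theorem convKer_prod_ae {ζ : ℝ → ℝ} {hζ : ContDiff ℝ ∞ ζ} {hcζ : HasCompactSupport ζ}
    {h : ContDiff ℝ ∞ (fun z : SpaceTime => ζ z.1 * κ z.2)}
    {hc : HasCompactSupport (fun z : SpaceTime => ζ z.1 * κ z.2)} {F : SpaceTime → ℝ}
    (hz : ∀ᵐ z, Integrable (fun α => (convKer _ h hc).m α • F (z - (convKer _ h hc).τ α))
      (convKer _ h hc).ν) :
    (convKer _ h hc).avg F =ᵐ[volume] (timeKer ζ hζ hcζ).avg ((spaceKer κ hκ hcκ).avg F) := by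
  filter_upwards [hz] with z hz
  change Integrable (fun y : ℝ × R3 => ζ y.1 * κ y.2 * F (z - y)) volume at hz
  rw [convKer_avg_eq, timeKer_avg_eq]
  simp only [spaceKer_avg_eq]
  rw [Measure.volume_eq_prod] at hz ⊢
  rw [integral_prod _ hz]
  refine integral_congr_ae (Eventually.of_forall fun s => ?_)
  simp only
  rw [← integral_const_mul]
  refine integral_congr_ae (Eventually.of_forall fun y => ?_)
  simp only [mul_assoc]
  congr 3
  ext <;> simp

end Kernels

/-! ### The radial kernel R, the parametrix of the Laplacian and the solenoidal projection -/

/-- A radial mollifier of radius `r` together with the potential `S` of `y ↦ R(y) y`. -/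
structure RadialBump (r : ℝ) where
  R : R3 → ℝ
  S : R3 → ℝ
  smooth : ContDiff ℝ ∞ R
  smooth_S : ContDiff ℝ ∞ S
  supp : ∀ y, r < ‖y‖ → R y = 0
  supp_S : ∀ y, r < ‖y‖ → S y = 0
  even : ∀ y, R (-y) = R y
  integral_eq_one : ∫ y, R y = 1
  grad_S : ∀ j y, d3 j S y = y j * R y

theorem hasCompactSupport_of_norm {κ : R3 → ℝ} {r : ℝ} (h : ∀ y, r < ‖y‖ → κ y = 0) :
    HasCompactSupport κ := by
  refine HasCompactSupport.intro (isCompact_closedBall (0 : R3) r) fun y hy => h y ?_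
  simpa using hy

theorem exists_radialBump {r : ℝ} (hr : 0 < r) : Nonempty (RadialBump r) := by
  -- The profile is a function of |y|² rather than of |y|, so that the kernel is smooth at the
  -- origin; it vanishes from r² on.
  let β : ContDiffBump (0 : ℝ) := ⟨r ^ 2 / 2, r ^ 2, by positivity, by
    have : 0 < r ^ 2 := by positivity
    linarith⟩
  set R0 : R3 → ℝ := fun y => β (‖y‖ ^ 2) with hR0
  have hsm : ContDiff ℝ ∞ fun y : R3 => ‖y‖ ^ 2 := contDiff_norm_sq ℝ
  have hβ0 : ∀ q, r ^ 2 ≤ q → β q = 0 := fun q hq => β.zero_of_le_dist (by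
    simpa [abs_of_nonneg ((sq_nonneg r).trans hq)] using hq)
  have h0 : ∀ y : R3, r < ‖y‖ → R0 y = 0 := fun y hy =>
    hβ0 _ (by gcongr)
  have hR0s : ContDiff ℝ ∞ R0 := β.contDiff.comp hsm
  have hR0c := hasCompactSupport_of_norm h0
  have hpos : 0 < ∫ y, R0 y := by
    refine hR0s.continuous.integral_pos_of_hasCompactSupport_nonneg_nonzero hR0c
      (fun y => β.nonneg) (x := 0) ?_
    have : (β : ℝ → ℝ) 0 = 1 := β.one_of_mem_closedBall (by simp [β]; positivity)
    simp [hR0, this]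
  set c := ∫ y, R0 y with hc
  -- Integration starts at r², so σ vanishes beyond r² and S has compact support. The factor 2⁻¹ in
  -- S compensates the gradient 2y of |y|².
  set σ : ℝ → ℝ := fun q => ∫ t in (r ^ 2)..q, β t with hσ
  have hσd : ∀ q, HasDerivAt σ (β q) q := fun q =>
    intervalIntegral.integral_hasDerivAt_right (β.continuous.intervalIntegrable _ _)
      (β.continuous.stronglyMeasurableAtFilter _ _) β.continuous.continuousAt
  have hσs : ContDiff ℝ ∞ σ := by
    rw [contDiff_infty_iff_deriv]
    refine ⟨fun q => (hσd q).differentiableAt, ?_⟩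
    rw [funext fun q => (hσd q).deriv]
    exact β.contDiff
  refine ⟨⟨fun y => c⁻¹ * R0 y, fun y => c⁻¹ * (2⁻¹ * σ (‖y‖ ^ 2)), contDiff_const.mul hR0s,
    contDiff_const.mul (contDiff_const.mul (hσs.comp hsm)), fun y hy => by simp [h0 y hy],
    fun y hy => ?_, fun y => by simp [hR0], ?_, fun j y => ?_⟩⟩
  · have : σ (‖y‖ ^ 2) = 0 := by
      rw [hσ]
      refine intervalIntegral.integral_zero_ae (Eventually.of_forall fun t ht => hβ0 t ?_)
      rw [uIoc_of_le (by gcongr)] at ht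
      exact ht.1.le
    simp [this]
  · rw [integral_const_mul]; exact inv_mul_cancel₀ hpos.ne'
  · have h1 : HasFDerivAt (fun y : R3 => ‖y‖ ^ 2) (2 • innerSL ℝ y) y :=
      (hasStrictFDerivAt_norm_sq y).hasFDerivAt
    have h2 := (((hσd (‖y‖ ^ 2)).comp_hasFDerivAt y h1).const_mul 2⁻¹).const_mul c⁻¹
    have h3 : fderiv ℝ (fun y : R3 => c⁻¹ * (2⁻¹ * σ (‖y‖ ^ 2))) y = _ := h2.fderiv
    rw [d3, h3]
    simp [EuclideanSpace.inner_single_right]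
    ring

namespace RadialBump
variable {r : ℝ} (B : RadialBump r)

theorem compact : HasCompactSupport B.R := hasCompactSupport_of_norm B.supp
theorem compact_S : HasCompactSupport B.S := hasCompactSupport_of_norm B.supp_S

/-- Convolution with the radial mollifier. -/
def TR : TransKernel := spaceKer B.R B.smooth B.compact

/-- Convolution with a partial derivative of the radial mollifier. -/
def TD (j : Fin 3) : TransKernel :=
  spaceKer (d3 j B.R) (contDiff_d3 B.smooth j) (hasCompactSupport_d3 B.compact j)

/-- The measure on the parameters of the potentials. -/
def potMeasure : Measure (ℝ × R3) := (volume.restrict (Ioc 0 1)).prod volume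

instance : SFinite potMeasure := by unfold potMeasure; infer_instance

/-- The convolution with a compactly supported parametrix of the Laplacian. -/
def E : TransKernel where
  A := ℝ × R3
  ν := potMeasure
  -- The weight s is the factor produced when ψ(z − s y) is differentiated in y. Integrating by
  -- parts with ∂ᵢS = yᵢR turns this kernel, applied to ∂ᵢψ, into `K i` applied to ψ.
  m := fun p => (Ioc 0 1).indicator (fun s : ℝ => s) p.1 * B.S p.2
  τ := fun p => (0, p.1 • p.2)
  hm := by
    refine Integrable.mul_prod ?_
      (B.smooth_S.continuous.integrable_of_hasCompactSupport B.compact_S)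
    refine IntegrableOn.integrable_indicator ?_ measurableSet_Ioc
    rw [IntegrableOn, Measure.restrict_restrict measurableSet_Ioc, inter_self]
    exact (continuous_id.integrableOn_Icc (a := (0 : ℝ)) (b := 1)).mono_set Ioc_subset_Icc_self
  hτ := by fun_prop

/-- The convolution with the `i`-th derivative of the parametrix. -/
def K (i : Fin 3) : TransKernel where
  A := ℝ × R3
  ν := potMeasure
  -- As a convolution kernel this is ∂ᵢE: near the origin it behaves like xᵢ/(4π|x|³), the gradient
  -- of the Newtonian potential, and it is supported in the ball of radius r.
  m := fun p => (Ioc 0 1).indicator (fun _ : ℝ => (1 : ℝ)) p.1 * (p.2 i * B.R p.2)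
  τ := fun p => (0, p.1 • p.2)
  hm := by
    have h1 : Integrable (fun y : R3 => y i * B.R y) := by
      refine Continuous.integrable_of_hasCompactSupport ?_ B.compact.mul_left
      have := B.smooth.continuous
      fun_prop
    refine Integrable.mul_prod ?_ h1
    exact (integrable_const (1 : ℝ)).indicator measurableSet_Ioc
  hτ := by fun_prop

theorem inBall_TR : B.TR.InBall r := spaceKer_inBall B.supp

theorem norm_pot_le {s : ℝ} {y : R3} (hs : s ∈ Ioc (0 : ℝ) 1) (hy : ‖y‖ ≤ r) :
    ‖((0, s • y) : SpaceTime)‖ ≤ r := by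
  have : ‖((0, s • y) : SpaceTime)‖ = |s| * ‖y‖ := by simp [Prod.norm_def, norm_smul, mul_nonneg]
  rw [this, abs_of_pos hs.1]
  calc s * ‖y‖ ≤ 1 * ‖y‖ := by gcongr; exact hs.2
    _ ≤ r := by simpa using hy

theorem inBall_E : B.E.InBall r := by
  rintro ⟨s, y⟩ (h : (Ioc 0 1).indicator (fun s : ℝ => s) s * B.S y ≠ 0)
  refine norm_pot_le ?_ ?_
  · by_contra hs
    simp [indicator_of_notMem hs] at h
  · by_contra hy
    simp [B.supp_S y (not_le.1 hy)] at h

theorem inBall_K (i : Fin 3) : (B.K i).InBall r := by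
  rintro ⟨s, y⟩ (h : (Ioc 0 1).indicator (fun _ : ℝ => (1 : ℝ)) s * (y i * B.R y) ≠ 0)
  refine norm_pot_le ?_ ?_
  · by_contra hs
    simp [indicator_of_notMem hs] at h
  · by_contra hy
    simp [B.supp y (not_le.1 hy)] at h

theorem TR_adj_avg (F : SpaceTime → ℝ) (z : SpaceTime) : B.TR.adj.avg F z = B.TR.avg F z := by
  rw [TR, spaceKer_adj_avg_eq, spaceKer_avg_eq,
    ← integral_neg_eq_self (fun y => B.R y * F (z - (0, y)))]
  congr 1; ext y
  rw [B.even]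
  congr 2
  ext <;> simp

section Smooth
variable {U : Set SpaceTime} {ψ : SpaceTime → ℝ}

theorem E_avg_eq (hψ : IsTest U ψ) (z : SpaceTime) :
    B.E.avg ψ z = ∫ s in (0 : ℝ)..1, ∫ y, B.S y * (s * ψ (z - (0, s • y))) := by
  have hi : Integrable (fun p : ℝ × R3 => ((Ioc 0 1).indicator (fun s : ℝ => s) p.1 * B.S p.2) *
      ψ (z - (0, p.1 • p.2))) ((volume.restrict (Ioc 0 1)).prod volume) :=
    B.E.integrable_smul_comp hψ.smooth.continuous hψ.compact z
  have h1 : B.E.avg ψ z = ∫ p, ((Ioc 0 1).indicator (fun s : ℝ => s) p.1 * B.S p.2) *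
      ψ (z - (0, p.1 • p.2)) ∂((volume.restrict (Ioc 0 1)).prod (volume : Measure R3)) := rfl
  rw [h1, integral_prod _ hi, intervalIntegral.integral_of_le zero_le_one]
  refine setIntegral_congr_fun measurableSet_Ioc fun s hs => ?_
  simp only [indicator_of_mem hs]
  congr 1; ext y; ring

theorem K_avg_eq (i : Fin 3) (hψ : IsTest U ψ) (z : SpaceTime) :
    (B.K i).avg ψ z = ∫ s in (0 : ℝ)..1, ∫ y : R3, (y i * B.R y) * ψ (z - (0, s • y)) := by
  have hi : Integrable (fun p : ℝ × R3 =>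
      ((Ioc 0 1).indicator (fun _ : ℝ => (1 : ℝ)) p.1 * (p.2 i * B.R p.2)) *
      ψ (z - (0, p.1 • p.2))) ((volume.restrict (Ioc 0 1)).prod volume) :=
    (B.K i).integrable_smul_comp hψ.smooth.continuous hψ.compact z
  have h1 : (B.K i).avg ψ z = ∫ p : ℝ × R3,
      ((Ioc 0 1).indicator (fun _ : ℝ => (1 : ℝ)) p.1 * (p.2 i * B.R p.2)) *
      ψ (z - (0, p.1 • p.2)) ∂((volume.restrict (Ioc 0 1)).prod (volume : Measure R3)) := rfl
  rw [h1, integral_prod _ hi, intervalIntegral.integral_of_le zero_le_one]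
  refine setIntegral_congr_fun measurableSet_Ioc fun s hs => ?_
  simp only [indicator_of_mem hs]
  congr 1; ext y; ring

/-- `E` applied to a space derivative is `K`. -/
theorem E_avg_dd (i : Fin 3) (hψ : IsTest U ψ) (z : SpaceTime) :
    B.E.avg (dd (ej i) ψ) z = (B.K i).avg ψ z := by
  rw [B.E_avg_eq (hψ.dd _), B.K_avg_eq i hψ]
  refine intervalIntegral.integral_congr fun s _ => ?_
  simp only
  rw [integral_mul_dd_scale B.smooth_S B.compact_S hψ]
  simp_rw [B.grad_S]

/-- The parametrix identity. -/
theorem sum_K_avg_dd (hψ : IsTest U ψ) (z : SpaceTime) :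
    ∑ i, (B.K i).avg (dd (ej i) ψ) z = ψ z - B.TR.avg ψ z := by
  have hI : ∀ i, Integrable (fun p : ℝ × R3 => (p.2 i * B.R p.2) *
      dd (ej i) ψ (z - (0, p.1 • p.2))) ((volume.restrict (Ioc 0 1)).prod volume) := by
    intro i
    have hi : Integrable (fun p : ℝ × R3 =>
      ((Ioc 0 1).indicator (fun _ : ℝ => (1 : ℝ)) p.1 * (p.2 i * B.R p.2)) *
      dd (ej i) ψ (z - (0, p.1 • p.2))) ((volume.restrict (Ioc 0 1)).prod volume) :=
      (B.K i).integrable_smul_comp (hψ.dd _).smooth.continuous (hψ.dd _).compact z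
    refine hi.congr ?_
    have : ∀ᵐ p ∂((volume.restrict (Ioc (0 : ℝ) 1)).prod (volume : Measure R3)),
        p.1 ∈ Ioc (0 : ℝ) 1 :=
      Measure.quasiMeasurePreserving_fst.ae (ae_restrict_mem measurableSet_Ioc)
    filter_upwards [this] with p hp
    simp [indicator_of_mem hp]
  have hsum : ∀ (s : ℝ) (y : R3), ∑ i, (y i * B.R y) * dd (ej i) ψ (z - (0, s • y)) =
      B.R y * dd (0, y) ψ (z - (0, s • y)) := by
    intro s y
    have hy : ((0, y) : SpaceTime) = ∑ i, y i • ej i := by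
      refine Prod.ext ?_ ?_
      · simp [ej, Prod.fst_sum]
      · ext j
        simp [ej, Fin.sum_univ_three]
        fin_cases j <;> simp
    rw [hy]
    simp only [dd, map_sum, map_smul, smul_eq_mul, Finset.mul_sum]
    refine Finset.sum_congr rfl fun i _ => ?_
    ring
  -- For fixed y, the directional derivative along y at z − s y is minus the s-derivative of ψ(z − s
  -- y), so the integral over s telescopes. Averaging against R, of total mass one, leaves ψ − R *
  -- ψ.
  have hftc : ∀ y : R3, ∫ s in (0 : ℝ)..1, dd (0, y) ψ (z - (0, s • y)) =
      ψ z - ψ (z - (0, y)) := by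
    intro y
    have hd : ∀ s : ℝ, HasDerivAt (fun s : ℝ => -ψ (z - (0, s • y)))
        (dd (0, y) ψ (z - (0, s • y))) s := by
      intro s
      have h1 : HasFDerivAt ψ (fderiv ℝ ψ (z - (0, s • y))) (z - (0, s • y)) :=
        (hψ.differentiable _).hasFDerivAt
      have h2 : HasDerivAt (fun s : ℝ => z - ((0, s • y) : SpaceTime)) (-(0, y)) s := by
        have := ((hasDerivAt_id s).smul_const ((0, y) : SpaceTime)).const_sub z
        simpa using this
      have h3 := (h1.comp_hasDerivAt s h2).neg
      rw [map_neg, neg_neg] at h3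
      exact h3
    have := intervalIntegral.integral_eq_sub_of_hasDerivAt (a := (0 : ℝ)) (b := 1)
      (fun s _ => hd s) (Continuous.intervalIntegrable ?_ _ _)
    · rw [this, zero_smul, one_smul, Prod.mk_zero_zero, sub_zero]; ring
    · have := (hψ.dd (0, y)).smooth.continuous
      fun_prop
  have hs : ∀ i, (B.K i).avg (dd (ej i) ψ) z = ∫ y : R3, ∫ s in Ioc (0 : ℝ) 1,
      (y i * B.R y) * dd (ej i) ψ (z - (0, s • y)) := by
    intro i
    rw [B.K_avg_eq i (hψ.dd _), intervalIntegral.integral_of_le zero_le_one]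
    exact integral_integral_swap (hI i)
  simp_rw [hs]
  rw [← integral_finsetSum _ fun i _ => (hI i).integral_prod_right]
  have hin : ∀ y : R3, ∑ i, ∫ s in Ioc (0 : ℝ) 1, (y i * B.R y) * dd (ej i) ψ (z - (0, s • y)) =
      B.R y * (ψ z - ψ (z - (0, y))) := by
    intro y
    rw [← integral_finsetSum]
    · simp_rw [hsum]
      rw [integral_const_mul, ← intervalIntegral.integral_of_le zero_le_one, hftc]
    · intro i _
      have := (hψ.dd (ej i)).smooth.continuous
      refine (Continuous.integrableOn_Icc (a := (0 : ℝ)) (b := 1) ?_).mono_set Ioc_subset_Icc_self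
      fun_prop
  simp_rw [hin, mul_sub]
  rw [integral_sub, integral_mul_const, B.integral_eq_one, one_mul, TR, spaceKer_avg_eq]
  · exact (B.smooth.continuous.integrable_of_hasCompactSupport B.compact).mul_const _
  · exact B.TR.integrable_smul_comp hψ.smooth.continuous hψ.compact z

variable {V : Set SpaceTime}

/-- The solenoidal part `Ψ - R * Ψ - ∇ E div Ψ` of a test field. -/
def sol (Ψ : Fin 3 → SpaceTime → ℝ) (i : Fin 3) (z : SpaceTime) : ℝ :=
  Ψ i z - B.TR.avg (Ψ i) z - (B.K i).avg (fun w => ∑ j, dd (ej j) (Ψ j) w) z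

theorem isTest_div {Ψ : Fin 3 → SpaceTime → ℝ} (hΨ : ∀ i, IsTest V (Ψ i)) :
    IsTest V (fun w => ∑ j, dd (ej j) (Ψ j) w) := IsTest.sum _ fun j => (hΨ j).dd _

theorem isTest_sol {Ψ : Fin 3 → SpaceTime → ℝ} (hΨ : ∀ i, IsTest V (Ψ i)) (hr : 0 ≤ r)
    (hV : Near r V U) (i : Fin 3) : IsTest U (B.sol Ψ i) :=
  (((hΨ i).mono (hV.subset hr)).sub ((hΨ i).avg B.inBall_TR hV hr)).sub
    ((isTest_div hΨ).avg (B.inBall_K i) hV hr)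

/-- The parametrix identity applied to div Ψ says that the divergence of the K-term is div Ψ − R *
div Ψ, which is the divergence of Ψ − R * Ψ. -/
theorem div_sol {Ψ : Fin 3 → SpaceTime → ℝ} (hΨ : ∀ i, IsTest V (Ψ i)) (hr : 0 ≤ r)
    (z : SpaceTime) : ∑ i, dd (ej i) (B.sol Ψ i) z = 0 := by
  have hV : Near r univ univ := fun _ _ _ _ => trivial
  have hΨ' : ∀ i, IsTest univ (Ψ i) := fun i => (hΨ i).mono (subset_univ _)
  have hdiv := isTest_div hΨ'
  have e : ∀ i, dd (ej i) (B.sol Ψ i) z = dd (ej i) (Ψ i) z - B.TR.avg (dd (ej i) (Ψ i)) z -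
      (B.K i).avg (dd (ej i) (fun w => ∑ j, dd (ej j) (Ψ j) w)) z := by
    intro i
    have a1 := (hΨ' i).avg B.inBall_TR hV hr
    have a2 := hdiv.avg (B.inBall_K i) hV hr
    unfold sol
    rw [dd_sub ((hΨ' i).sub a1).differentiable a2.differentiable,
      dd_sub (hΨ' i).differentiable a1.differentiable, (hΨ' i).dd_avg, hdiv.dd_avg]
  simp_rw [e]
  rw [Finset.sum_sub_distrib, B.sum_K_avg_dd hdiv, Finset.sum_sub_distrib]
  have : B.TR.avg (fun w => ∑ j, dd (ej j) (Ψ j) w) z = ∑ j, B.TR.avg (dd (ej j) (Ψ j)) z := by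
    simp only [TransKernel.avg, Finset.smul_sum]
    exact integral_finsetSum _ fun j _ => B.TR.integrable_smul_comp
      ((hΨ j).dd _).smooth.continuous ((hΨ j).dd _).compact z
  rw [this]; ring

/-- The gradient part of the solenoidal projection is the gradient of a test function. -/
theorem K_avg_eq_dd {ψ : SpaceTime → ℝ} (hψ : IsTest V ψ) (i : Fin 3) (z : SpaceTime) :
    (B.K i).avg ψ z = dd (ej i) (B.E.avg ψ) z := by
  rw [hψ.dd_avg, B.E_avg_dd i hψ]

end Smooth

end RadialBump

/-! ### Mollifiers in space and time at a given scale -/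

section Mollifiers

/-- The rescaled space kernel `ε⁻³ φ(y / ε)`. -/
def phiE (φ : R3 → ℝ) (ε : ℝ) (y : R3) : ℝ := (ε ^ 3)⁻¹ * φ (ε⁻¹ • y)

/-- A fixed bump function on the real line. -/
def timeBump : ContDiffBump (0 : ℝ) := ⟨1 / 2, 1, by norm_num, by norm_num⟩

/-- The rescaled time kernel. -/
def zet (δ : ℝ) (s : ℝ) : ℝ := δ⁻¹ * timeBump.normed volume (δ⁻¹ • s)

variable {φ : R3 → ℝ}

theorem contDiff_phiE (hφ : IsMollifier φ) (ε : ℝ) : ContDiff ℝ ∞ (phiE φ ε) :=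
  contDiff_const.mul (hφ.contDiff.comp (contDiff_const_smul _))

theorem hasCompactSupport_phiE (hφ : IsMollifier φ) (ε : ℝ) : HasCompactSupport (phiE φ ε) := by
  by_cases h : ε = 0
  · have : phiE φ ε = fun _ => 0 := by ext y; simp [phiE, h]
    rw [this]; exact HasCompactSupport.zero
  · exact (hφ.hasCompactSupport.comp_homeomorph (Homeomorph.smulOfNeZero _ (inv_ne_zero h))).mul_left

theorem contDiff_zet (δ : ℝ) : ContDiff ℝ ∞ (zet δ) :=
  contDiff_const.mul (timeBump.contDiff_normed.comp (contDiff_const_smul _))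

theorem hasCompactSupport_zet (δ : ℝ) : HasCompactSupport (zet δ) := by
  by_cases h : δ = 0
  · have : zet δ = fun _ => 0 := by ext y; simp [zet, h]
    rw [this]; exact HasCompactSupport.zero
  · exact (timeBump.hasCompactSupport_normed.comp_homeomorph
      (Homeomorph.smulOfNeZero _ (inv_ne_zero h))).mul_left

theorem integral_phiE (hφ : IsMollifier φ) {ε : ℝ} (hε : 0 < ε) : ∫ y, phiE φ ε y = 1 := by
  have := Measure.integral_comp_inv_smul (volume : Measure R3) φ ε
  simp only [phiE]
  rw [integral_const_mul, this, hφ.integral_eq_one, finrank_euclideanSpace, Fintype.card_fin,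
    abs_of_pos (by positivity), smul_eq_mul, mul_one, inv_mul_cancel₀ (by positivity)]

/-- The kernel φ may change sign, so its total variation is tracked separately from its integral;
scaling leaves it unchanged. -/
theorem lintegral_phiE (hφ : IsMollifier φ) {ε : ℝ} (hε : 0 < ε) :
    ∫⁻ y, ‖phiE φ ε y‖ₑ = ∫⁻ y, ‖φ y‖ₑ := by
  have hi : Integrable φ := hφ.contDiff.continuous.integrable_of_hasCompactSupport
    hφ.hasCompactSupport
  have hi' : Integrable (phiE φ ε) :=
    (contDiff_phiE hφ ε).continuous.integrable_of_hasCompactSupport (hasCompactSupport_phiE hφ ε)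
  have := Measure.integral_comp_inv_smul (volume : Measure R3) (fun y => ‖φ y‖) ε
  rw [← ofReal_integral_norm_eq_lintegral_enorm hi, ← ofReal_integral_norm_eq_lintegral_enorm hi']
  congr 1
  simp only [phiE, norm_mul]
  rw [integral_const_mul, this, finrank_euclideanSpace, Fintype.card_fin, Real.norm_eq_abs, abs_inv,
    smul_eq_mul, ← mul_assoc, inv_mul_cancel₀ (by positivity), one_mul]

theorem zet_nonneg {δ : ℝ} (hδ : 0 < δ) (s : ℝ) : 0 ≤ zet δ s :=
  mul_nonneg (by positivity) (timeBump.nonneg_normed _)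

theorem integral_zet {δ : ℝ} (hδ : 0 < δ) : ∫ s, zet δ s = 1 := by
  have := Measure.integral_comp_inv_smul (volume : Measure ℝ) (timeBump.normed volume) δ
  simp only [zet]
  rw [integral_const_mul, this, timeBump.integral_normed, Module.finrank_self, pow_one,
    abs_of_pos hδ, smul_eq_mul, mul_one, inv_mul_cancel₀ hδ.ne']

theorem lintegral_zet {δ : ℝ} (hδ : 0 < δ) : ∫⁻ s, ‖zet δ s‖ₑ = 1 := by
  have hi' : Integrable (zet δ) :=
    (contDiff_zet δ).continuous.integrable_of_hasCompactSupport (hasCompactSupport_zet δ)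
  rw [← ofReal_integral_norm_eq_lintegral_enorm hi']
  simp_rw [Real.norm_eq_abs, abs_of_nonneg (zet_nonneg hδ _)]
  rw [integral_zet hδ, ENNReal.ofReal_one]

theorem zet_eq_zero {δ : ℝ} (hδ : 0 < δ) {s : ℝ} (hs : δ < |s|) : zet δ s = 0 := by
  have : timeBump.normed volume (δ⁻¹ • s) = 0 := by
    rw [← Function.notMem_support, timeBump.support_normed_eq, Metric.mem_ball, dist_zero_right,
      norm_smul, not_lt]
    change (1 : ℝ) ≤ _
    rw [Real.norm_eq_abs, Real.norm_eq_abs, abs_inv, abs_of_pos hδ, inv_mul_eq_div,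
      le_div_iff₀ hδ, one_mul]
    exact hs.le
  rw [zet, this, mul_zero]

theorem phiE_eq_zero {ρ0 ε : ℝ} (h0 : ∀ y, ρ0 < ‖y‖ → φ y = 0) (hε : 0 < ε) {y : R3}
    (hy : ε * ρ0 < ‖y‖) : phiE φ ε y = 0 := by
  rw [phiE, h0, mul_zero]
  rw [norm_smul, norm_inv, Real.norm_eq_abs, abs_of_pos hε, inv_mul_eq_div, lt_div_iff₀ hε,
    mul_comm]
  exact hy

theorem exists_radius (hφ : IsMollifier φ) : ∃ ρ0 > 0, ∀ y, ρ0 < ‖y‖ → φ y = 0 := by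
  obtain ⟨ρ, hρ⟩ := hφ.hasCompactSupport.isCompact.isBounded.subset_closedBall 0
  refine ⟨max ρ 1, by positivity, fun y hy => image_eq_zero_of_notMem_tsupport fun h => ?_⟩
  have := hρ h
  rw [Metric.mem_closedBall, dist_zero_right] at this
  exact absurd (this.trans (le_max_left ρ 1)) (not_le.2 hy)

/-- Space mollification as an average of translates. -/
def spaceMol (hφ : IsMollifier φ) (ε : ℝ) : TransKernel :=
  spaceKer (phiE φ ε) (contDiff_phiE hφ ε) (hasCompactSupport_phiE hφ ε)

/-- Time mollification as an average of translates. -/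
def timeMol (δ : ℝ) : TransKernel := timeKer (zet δ) (contDiff_zet δ) (hasCompactSupport_zet δ)

theorem contDiff_rho (hφ : IsMollifier φ) (δ ε : ℝ) :
    ContDiff ℝ ∞ (fun z : SpaceTime => zet δ z.1 * phiE φ ε z.2) :=
  ((contDiff_zet δ).comp contDiff_fst).mul ((contDiff_phiE hφ ε).comp contDiff_snd)

theorem hasCompactSupport_rho (hφ : IsMollifier φ) (δ ε : ℝ) :
    HasCompactSupport (fun z : SpaceTime => zet δ z.1 * phiE φ ε z.2) := by
  refine HasCompactSupport.intro
    ((hasCompactSupport_zet δ).isCompact.prod (hasCompactSupport_phiE hφ ε).isCompact) ?_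
  intro z hz
  rw [mem_prod, not_and_or] at hz
  rcases hz with hz | hz
  · rw [image_eq_zero_of_notMem_tsupport hz, zero_mul]
  · rw [image_eq_zero_of_notMem_tsupport hz, mul_zero]

/-- Space-time mollification as an average of translates. -/
def mol (hφ : IsMollifier φ) (δ ε : ℝ) : TransKernel :=
  convKer _ (contDiff_rho hφ δ ε) (hasCompactSupport_rho hφ δ ε)

/-- The common bound for the masses of the mollifiers. -/
def molMass (φ : R3 → ℝ) : ℝ≥0 := (∫⁻ y, ‖φ y‖ₑ).toNNReal

theorem coe_molMass (hφ : IsMollifier φ) : (molMass φ : ℝ≥0∞) = ∫⁻ y, ‖φ y‖ₑ :=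
  ENNReal.coe_toNNReal (hφ.contDiff.continuous.integrable_of_hasCompactSupport
    hφ.hasCompactSupport).2.ne

theorem spaceMol_mass (hφ : IsMollifier φ) {ε : ℝ} (hε : 0 < ε) :
    (spaceMol hφ ε).mass = molMass φ := by
  rw [coe_molMass hφ]; exact lintegral_phiE hφ hε

theorem spaceMol_integral (hφ : IsMollifier φ) {ε : ℝ} (hε : 0 < ε) :
    ∫ α, (spaceMol hφ ε).m α ∂(spaceMol hφ ε).ν = 1 := integral_phiE hφ hε

theorem timeMol_mass {δ : ℝ} (hδ : 0 < δ) : (timeMol δ).mass = 1 := lintegral_zet hδ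

theorem timeMol_integral {δ : ℝ} (hδ : 0 < δ) : ∫ α, (timeMol δ).m α ∂(timeMol δ).ν = 1 :=
  integral_zet hδ

theorem mol_mass (hφ : IsMollifier φ) {δ ε : ℝ} (hδ : 0 < δ) (hε : 0 < ε) :
    (mol hφ δ ε).mass = molMass φ := by
  change ∫⁻ z : SpaceTime, ‖zet δ z.1 * phiE φ ε z.2‖ₑ = _
  simp_rw [enorm_mul]
  rw [Measure.volume_eq_prod, lintegral_prod_mul (f := fun s => ‖zet δ s‖ₑ)
    (g := fun y => ‖phiE φ ε y‖ₑ) (contDiff_zet δ).continuous.enorm.aemeasurable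
    (contDiff_phiE hφ ε).continuous.enorm.aemeasurable, lintegral_zet hδ, one_mul,
    lintegral_phiE hφ hε, coe_molMass hφ]

theorem mol_integral (hφ : IsMollifier φ) {δ ε : ℝ} (hδ : 0 < δ) (hε : 0 < ε) :
    ∫ α, (mol hφ δ ε).m α ∂(mol hφ δ ε).ν = 1 := by
  change ∫ z : SpaceTime, zet δ z.1 * phiE φ ε z.2 = 1
  rw [Measure.volume_eq_prod, integral_prod_mul (zet δ) (phiE φ ε), integral_zet hδ,
    integral_phiE hφ hε, one_mul]

theorem spaceMol_inBall (hφ : IsMollifier φ) {ρ0 ε : ℝ} (h0 : ∀ y, ρ0 < ‖y‖ → φ y = 0)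
    (hε : 0 < ε) : (spaceMol hφ ε).InBall (ε * ρ0) :=
  spaceKer_inBall fun _ hy => phiE_eq_zero h0 hε hy

theorem timeMol_inBall {δ : ℝ} (hδ : 0 < δ) : (timeMol δ).InBall δ := by
  intro (s : ℝ) (hs : zet δ s ≠ 0)
  change ‖((s, 0) : SpaceTime)‖ ≤ δ
  have : ‖((s, 0) : SpaceTime)‖ = |s| := by simp [Prod.norm_def]
  rw [this]
  by_contra h
  exact hs (zet_eq_zero hδ (not_le.1 h))

theorem mol_inBall (hφ : IsMollifier φ) {ρ0 δ ε : ℝ} (h0 : ∀ y, ρ0 < ‖y‖ → φ y = 0)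
    (hδ : 0 < δ) (hε : 0 < ε) : (mol hφ δ ε).InBall (max δ (ε * ρ0)) := by
  intro (z : SpaceTime) (hz : zet δ z.1 * phiE φ ε z.2 ≠ 0)
  change ‖z‖ ≤ _
  rw [Prod.norm_def]
  refine max_le_max ?_ ?_
  · by_contra h
    rw [zet_eq_zero hδ (not_le.1 h), zero_mul] at hz
    exact hz rfl
  · by_contra h
    rw [phiE_eq_zero h0 hε (not_le.1 h), mul_zero] at hz
    exact hz rfl

theorem mol_ae_eq (hφ : IsMollifier φ) {δ ε : ℝ} {F : SpaceTime → ℝ} (hF : MemLp F 2) :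
    (mol hφ δ ε).avg F =ᵐ[volume] (timeMol δ).avg ((spaceMol hφ ε).avg F) :=
  convKer_prod_ae ((mol hφ δ ε).ae_integrable hF)

theorem mol_ae_eq_of_integrable (hφ : IsMollifier φ) {δ ε : ℝ} {F : SpaceTime → ℝ}
    (hF : Integrable F) :
    (mol hφ δ ε).avg F =ᵐ[volume] (timeMol δ).avg ((spaceMol hφ ε).avg F) :=
  convKer_prod_ae ((mol hφ δ ε).ae_integrable_of_integrable hF)

theorem contDiff_mol (hφ : IsMollifier φ) {δ ε : ℝ} {F : SpaceTime → ℝ} (hF : MemLp F 2) :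
    ContDiff ℝ ∞ ((mol hφ δ ε).avg F) := contDiff_convKer (hF.locallyIntegrable (by norm_num))

theorem mollify_eq (hφ : IsMollifier φ) (ε : ℝ) (v : SpaceTime → R3) (z : SpaceTime) :
    mollify φ ε v z = (spaceMol hφ ε).avg v z := by
  change _ = ∫ y, phiE φ ε y • v (z - (0, y))
  have e : ∀ y : R3, z - (0, y) = (z.1, z.2 - y) := fun y => Prod.ext (by simp) (by simp)
  simp only [e]
  rfl

/-- Auxiliary approximations may use any mollifier, unrelated to the one that defines the energy
defect. -/
theorem exists_isMollifier : ∃ φ : R3 → ℝ, IsMollifier φ := by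
  obtain ⟨B⟩ := exists_radialBump (r := 1) one_pos
  exact ⟨B.R, B.smooth, B.compact, B.integral_eq_one⟩

end Mollifiers

/-! ### Mixed norms in time and space -/

section Mixed

theorem aemeasurable_slice_lintegral {g : SpaceTime → ℝ≥0∞} (hg : AEMeasurable g) :
    AEMeasurable (fun t : ℝ => ∫⁻ x : R3, g (t, x)) := by
  rw [Measure.volume_eq_prod] at hg
  exact hg.lintegral_prod_right'

theorem lintegral_slice {g : SpaceTime → ℝ≥0∞} (hg : AEMeasurable g) :
    ∫⁻ z, g z = ∫⁻ t : ℝ, ∫⁻ x : R3, g (t, x) := by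
  rw [Measure.volume_eq_prod] at hg ⊢
  exact lintegral_prod _ hg

theorem ae_slice {p : SpaceTime → Prop} (h : ∀ᵐ z, p z) : ∀ᵐ t : ℝ, ∀ᵐ x : R3, p (t, x) := by
  rw [Measure.volume_eq_prod] at h
  exact Measure.ae_ae_of_ae_prod h

theorem ae_fst {p : ℝ → Prop} (h : ∀ᵐ t, p t) : ∀ᵐ z : SpaceTime, p z.1 := by
  rw [Measure.volume_eq_prod]
  exact Measure.quasiMeasurePreserving_fst.ae h

/-- The square of the norm in `L²ₜ L¹ₓ`. -/
def nL21 (g : SpaceTime → ℝ) : ℝ≥0∞ := ∫⁻ t : ℝ, (∫⁻ x : R3, ‖g (t, x)‖ₑ) ^ 2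

/-- Duality between L²ₜL¹ₓ and L²ₜL^∞ₓ: N(t) bounds F on almost every slice, and Cauchy–Schwarz is
applied in time. -/
theorem sq_lintegral_pair_le {g F : SpaceTime → ℝ} {N : ℝ → ℝ≥0∞}
    (hg : AEStronglyMeasurable g volume) (hN : AEMeasurable N)
    (hF : ∀ᵐ z : SpaceTime, ‖F z‖ₑ ≤ N z.1) :
    (∫⁻ z, ‖g z * F z‖ₑ) ^ 2 ≤ nL21 g * ∫⁻ t, N t ^ 2 := by
  have hN' : AEMeasurable (fun z : SpaceTime => N z.1) := by
    rw [Measure.volume_eq_prod]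
    exact hN.comp_fst
  have h1 : ∫⁻ z, ‖g z * F z‖ₑ ≤ ∫⁻ t : ℝ, (∫⁻ x : R3, ‖g (t, x)‖ₑ) * N t := by
    calc ∫⁻ z, ‖g z * F z‖ₑ ≤ ∫⁻ z, ‖g z‖ₑ * N z.1 := by
          refine lintegral_mono_ae ?_
          filter_upwards [hF] with z hz
          rw [enorm_mul]; gcongr
      _ = ∫⁻ t : ℝ, ∫⁻ x : R3, ‖g (t, x)‖ₑ * N t := lintegral_slice (hg.enorm.mul hN')
      _ = _ := by
          have hg' := hg
          rw [Measure.volume_eq_prod] at hg'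
          refine lintegral_congr_ae ?_
          filter_upwards [hg'.prodMk_left] with t ht
          exact lintegral_mul_const'' _ ht.enorm
  calc (∫⁻ z, ‖g z * F z‖ₑ) ^ 2 ≤ (∫⁻ t : ℝ, (∫⁻ x : R3, ‖g (t, x)‖ₑ) * N t) ^ 2 := by gcongr
    _ ≤ _ := sq_lintegral_mul_le (aemeasurable_slice_lintegral hg.enorm) hN

/-- The time integral of the square of the space `L⁴` norm. -/
def nL24 (θ : SpaceTime → ℝ) : ℝ≥0∞ := ∫⁻ t : ℝ, (∫⁻ x : R3, ‖θ (t, x)‖ₑ ^ 4) ^ (1 / 2 : ℝ)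

end Mixed

/-! ### Sobolev inequality and interpolation into L²ₜL⁴ₓ -/

section Sobolev

/-- The constant of the Sobolev inequality on `ℝ³`. -/
def sobConst : ℝ≥0 := eLpNormLESNormFDerivOfEqInnerConst (volume : Measure R3) 2

theorem enorm_clm_sq_le (L : R3 →L[ℝ] ℝ) :
    ‖L‖ₑ ^ 2 ≤ 3 * ∑ j, ‖L (EuclideanSpace.single j 1)‖ₑ ^ 2 := by
  have h1 : ‖L‖ ≤ ∑ j, ‖L (EuclideanSpace.single j 1)‖ := by
    refine L.opNorm_le_bound (Finset.sum_nonneg fun _ _ => norm_nonneg _) fun y => ?_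
    have hy : y = ∑ j, y j • EuclideanSpace.single j (1 : ℝ) := by
      ext j
      simp [Fin.sum_univ_three]
      fin_cases j <;> simp
    conv_lhs => rw [hy]
    rw [map_sum, Finset.sum_mul]
    refine (norm_sum_le _ _).trans (Finset.sum_le_sum fun j _ => ?_)
    rw [map_smul, norm_smul, mul_comm]
    gcongr
    exact PiLp.norm_apply_le y j
  have h2 : ‖L‖ ^ 2 ≤ 3 * ∑ j, ‖L (EuclideanSpace.single j 1)‖ ^ 2 := by
    refine (pow_le_pow_left₀ (norm_nonneg _) h1 2).trans ?_
    have h3 := sq_sum_le_card_mul_sum_sq (s := (Finset.univ : Finset (Fin 3)))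
      (f := fun j => ‖L (EuclideanSpace.single j 1)‖)
    simpa using h3
  have := ENNReal.ofReal_le_ofReal h2
  rw [ENNReal.ofReal_mul (by norm_num), ENNReal.ofReal_sum_of_nonneg (fun _ _ => by positivity)] at this
  simp_rw [ENNReal.ofReal_pow (norm_nonneg _), ofReal_norm] at this
  simpa using this

/-- Cauchy–Schwarz on |u| · |u|³ bounds (∫ u⁴)² by ∫ u² ∫ u⁶, and the Sobolev embedding of the
gradient norm into L⁶ handles the last factor. The 3 passes from the operator norm of the derivative
to its components. -/
theorem sobolev_slice {u : R3 → ℝ} (hu : ContDiff ℝ ∞ u) (hc : HasCompactSupport u) :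
    (∫⁻ x, ‖u x‖ₑ ^ 4) ^ 2 ≤ (∫⁻ x, ‖u x‖ₑ ^ 2) *
      ((sobConst : ℝ≥0∞) ^ 6 * (3 * ∫⁻ x, ∑ j, ‖d3 j u x‖ₑ ^ 2) ^ 3) := by
  have hm : AEMeasurable (fun x => ‖u x‖ₑ) := hu.continuous.enorm.aemeasurable
  have h1 := sq_lintegral_mul_le (μ := (volume : Measure R3)) hm (hm.pow_const 3)
  have e4 : ∀ x, ‖u x‖ₑ * ‖u x‖ₑ ^ 3 = ‖u x‖ₑ ^ 4 := fun x => by ring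
  have e6 : ∀ x, (‖u x‖ₑ ^ 3) ^ 2 = ‖u x‖ₑ ^ 6 := fun x => by ring
  simp_rw [e4, e6] at h1
  refine h1.trans (mul_le_mul_right ?_ _)
  have h2 := eLpNorm_le_eLpNorm_fderiv_of_eq_inner (volume : Measure R3) (u := u) (p := 2) (p' := 6)
    (hu.of_le (by simp)) hc (by norm_num) (by simp)
    (by rw [finrank_euclideanSpace, Fintype.card_fin]; norm_num)
  have h6 := eLpNorm_nnreal_pow_eq_lintegral (f := u) (μ := (volume : Measure R3)) (p := 6)
    (by norm_num)
  have h22 := eLpNorm_nnreal_pow_eq_lintegral (f := fderiv ℝ u) (μ := (volume : Measure R3)) (p := 2)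
    (by norm_num)
  have h6' : ∫⁻ x, ‖u x‖ₑ ^ 6 = eLpNorm u (6 : ℝ≥0) volume ^ 6 := by
    have := h6.symm
    norm_cast at this ⊢
    simpa using this
  have h22' : eLpNorm (fderiv ℝ u) (2 : ℝ≥0) volume ^ 2 = ∫⁻ x, ‖fderiv ℝ u x‖ₑ ^ 2 := by
    norm_cast at h22 ⊢
    simpa using h22
  rw [h6']
  calc eLpNorm u (6 : ℝ≥0) volume ^ 6
      ≤ (sobConst * eLpNorm (fderiv ℝ u) (2 : ℝ≥0) volume) ^ 6 := by gcongr; exact h2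
    _ = (sobConst : ℝ≥0∞) ^ 6 * (eLpNorm (fderiv ℝ u) (2 : ℝ≥0) volume ^ 2) ^ 3 := by
        rw [mul_pow, ← pow_mul]
    _ ≤ _ := by
        rw [h22', ← lintegral_const_mul' _ _ (by norm_num)]
        gcongr with x
        exact enorm_clm_sq_le _

theorem rpow_quarter {a b c : ℝ≥0∞} (h : a ^ 2 ≤ b * c ^ 3) :
    a ^ (1 / 2 : ℝ) ≤ b ^ (1 / 4 : ℝ) * c ^ (3 / 4 : ℝ) := by
  have h1 : (a ^ 2) ^ (1 / 4 : ℝ) ≤ (b * c ^ 3) ^ (1 / 4 : ℝ) := by gcongr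
  rw [ENNReal.mul_rpow_of_nonneg _ _ (by norm_num), ← ENNReal.rpow_natCast, ← ENNReal.rpow_natCast,
    ← ENNReal.rpow_mul, ← ENNReal.rpow_mul] at h1
  norm_num at h1 ⊢
  exact h1

theorem lintegral_quarter_le {X : Type*} [MeasurableSpace X] {μ : Measure X} {f g : X → ℝ≥0∞}
    (hf : AEMeasurable f μ) (hg : AEMeasurable g μ) :
    (∫⁻ x, f x ^ (1 / 4 : ℝ) * g x ^ (3 / 4 : ℝ) ∂μ) ^ 4 ≤
      (∫⁻ x, f x ∂μ) * (∫⁻ x, g x ∂μ) ^ 3 := by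
  have h := ENNReal.lintegral_mul_le_Lp_mul_Lq μ (p := 4) (q := 4 / 3)
    (by rw [Real.holderConjugate_iff]; norm_num) (hf.pow_const (1 / 4 : ℝ))
    (hg.pow_const (3 / 4 : ℝ))
  simp only [← ENNReal.rpow_mul, Pi.mul_apply] at h
  norm_num at h
  calc _ ≤ ((∫⁻ x, f x ∂μ) ^ (1 / 4 : ℝ) * (∫⁻ x, g x ∂μ) ^ (3 / 4 : ℝ)) ^ 4 := by
        gcongr
    _ = _ := by
        rw [mul_pow, ← ENNReal.rpow_natCast, ← ENNReal.rpow_natCast, ← ENNReal.rpow_mul,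
          ← ENNReal.rpow_mul, ← ENNReal.rpow_natCast]
        norm_num

/-- The constant in the parabolic interpolation inequality. -/
def nL24Const : ℝ≥0∞ := (sobConst : ℝ≥0∞) ^ 6 * 3 ^ 3

theorem nL24Const_ne_top : nL24Const ≠ ⊤ := by unfold nL24Const; finiteness

/-- On each slice the squared L⁴ norm is a quarter power of the L² integral times a three-quarter
power of the gradient integral; Hölder in time with exponents 4 and 4/3 concludes. -/
theorem nL24_le_of_smooth {U : Set SpaceTime} {θ : SpaceTime → ℝ} (hθ : IsTest U θ) :
    nL24 θ ^ 4 ≤ nL24Const * ((∫⁻ z, ‖θ z‖ₑ ^ 2) * (∫⁻ z, ∑ j, ‖dd (ej j) θ z‖ₑ ^ 2) ^ 3) := by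
  have hm1 : AEMeasurable (fun z => ‖θ z‖ₑ ^ 2) := hθ.aesm.enorm.pow_const 2
  have hm2 : AEMeasurable (fun z => ∑ j, ‖dd (ej j) θ z‖ₑ ^ 2) :=
    Finset.aemeasurable_fun_sum _ fun j _ => (hθ.dd _).aesm.enorm.pow_const 2
  have hsl : ∀ t : ℝ, (∫⁻ x : R3, ‖θ (t, x)‖ₑ ^ 4) ^ 2 ≤ (nL24Const * ∫⁻ x : R3, ‖θ (t, x)‖ₑ ^ 2) *
      (∫⁻ x : R3, ∑ j, ‖dd (ej j) θ (t, x)‖ₑ ^ 2) ^ 3 := by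
    intro t
    have hd : ∀ j (x : R3), d3 j (fun x => θ (t, x)) x = dd (ej j) θ (t, x) := by
      intro j x
      have h1 : HasFDerivAt θ (fderiv ℝ θ (t, x)) (t, x) := (hθ.differentiable _).hasFDerivAt
      have h2 := (h1.comp x (hasFDerivAt_prodMk_right t x)).fderiv
      have h3 : fderiv ℝ (fun x => θ (t, x)) x = _ := h2
      rw [d3, h3]
      simp [dd, ej]
    have hs := sobolev_slice (u := fun x => θ (t, x))
      (hθ.smooth.comp (contDiff_const.prodMk contDiff_id)) ?_
    · simp_rw [hd] at hs
      refine hs.trans (le_of_eq ?_)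
      rw [nL24Const]; ring
    · refine HasCompactSupport.intro (hθ.compact.isCompact.image continuous_snd) fun x hx => ?_
      refine image_eq_zero_of_notMem_tsupport fun h => hx ⟨(t, x), h, rfl⟩
  have h1 : nL24 θ ≤ ∫⁻ t : ℝ, (nL24Const * ∫⁻ x : R3, ‖θ (t, x)‖ₑ ^ 2) ^ (1 / 4 : ℝ) *
      (∫⁻ x : R3, ∑ j, ‖dd (ej j) θ (t, x)‖ₑ ^ 2) ^ (3 / 4 : ℝ) :=
    lintegral_mono fun t => rpow_quarter (hsl t)
  calc nL24 θ ^ 4 ≤ _ := by gcongr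
    _ ≤ (∫⁻ t : ℝ, nL24Const * ∫⁻ x : R3, ‖θ (t, x)‖ₑ ^ 2) *
        (∫⁻ t : ℝ, ∫⁻ x : R3, ∑ j, ‖dd (ej j) θ (t, x)‖ₑ ^ 2) ^ 3 :=
      lintegral_quarter_le ((aemeasurable_slice_lintegral hm1).const_mul _)
        (aemeasurable_slice_lintegral hm2)
    _ = _ := by
      rw [lintegral_const_mul' _ _ nL24Const_ne_top, ← lintegral_slice hm1, ← lintegral_slice hm2,
        mul_assoc]

/-- Fatou's lemma in x and then in t; the square root, an order isomorphism, commutes with the lower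
limit. -/
theorem nL24_liminf_le {θ : ℕ → SpaceTime → ℝ} {θ0 : SpaceTime → ℝ}
    (hm : ∀ n, AEStronglyMeasurable (θ n) volume)
    (h : ∀ᵐ z, Tendsto (fun n => θ n z) atTop (𝓝 (θ0 z))) :
    nL24 θ0 ≤ liminf (fun n => nL24 (θ n)) atTop := by
  have hm' : ∀ n, AEMeasurable (fun z => ‖θ n z‖ₑ ^ 4) := fun n => (hm n).enorm.pow_const 4
  have h1 : ∀ᵐ t : ℝ, ∫⁻ x : R3, ‖θ0 (t, x)‖ₑ ^ 4 ≤
      liminf (fun n => ∫⁻ x : R3, ‖θ n (t, x)‖ₑ ^ 4) atTop := by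
    have hms : ∀ᵐ t : ℝ, ∀ n, AEMeasurable (fun x : R3 => ‖θ n (t, x)‖ₑ ^ 4) := by
      rw [ae_all_iff]
      intro n
      have := hm n
      rw [Measure.volume_eq_prod] at this
      filter_upwards [this.prodMk_left] with t ht
      exact ht.enorm.pow_const 4
    filter_upwards [ae_slice h, hms] with t ht hmt
    calc ∫⁻ x : R3, ‖θ0 (t, x)‖ₑ ^ 4 = ∫⁻ x : R3, liminf (fun n => ‖θ n (t, x)‖ₑ ^ 4) atTop := by
          refine lintegral_congr_ae ?_
          filter_upwards [ht] with x hx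
          have hc : Continuous fun y : ℝ => ‖y‖ₑ ^ 4 :=
            (ENNReal.continuous_pow 4).comp continuous_enorm
          exact ((hc.tendsto _).comp hx).liminf_eq.symm
      _ ≤ _ := lintegral_liminf_le' hmt
  calc nL24 θ0 ≤ ∫⁻ t : ℝ, liminf (fun n => (∫⁻ x : R3, ‖θ n (t, x)‖ₑ ^ 4) ^ (1 / 2 : ℝ)) atTop := by
        refine lintegral_mono_ae ?_
        filter_upwards [h1] with t ht
        refine (ENNReal.rpow_le_rpow ht (by norm_num)).trans (le_of_eq ?_)
        exact (ENNReal.orderIsoRpow (1 / 2) (by norm_num)).liminf_apply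
    _ ≤ _ := lintegral_liminf_le' fun n => (aemeasurable_slice_lintegral (hm' n)).pow_const _

theorem StrongL2.exists_subseq_ae {X : Type*} [MeasurableSpace X] {μ : Measure X}
    {a : ℕ → X → ℝ} {a0 : X → ℝ} (h : StrongL2 μ atTop a a0) :
    ∃ ns : ℕ → ℕ, StrictMono ns ∧
      ∀ᵐ x ∂μ, Tendsto (fun n => a (ns n) x) atTop (𝓝 (a0 x)) := by
  refine (tendstoInMeasure_of_tendsto_eLpNorm (p := 2) (by norm_num) (fun n => (h.mem n).1)
    h.mem0.1 h.tendsto).exists_seq_tendsto_ae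

/-- The interpolation inequality for functions with weak space gradient in `L²`. -/
theorem nL24_le {θ : SpaceTime → ℝ} {D : Fin 3 → SpaceTime → ℝ} (hθ : MemLp θ 2)
    (hD : ∀ j, MemLp (D j) 2) (hwd : ∀ j, WD univ (ej j) θ (D j)) (hc : HasCompactSupport θ) :
    nL24 θ ^ 4 ≤ nL24Const * (∫⁻ z, ‖θ z‖ₑ ^ 2) * (∫⁻ z, ∑ j, ‖D j z‖ₑ ^ 2) ^ 3 := by
  obtain ⟨φ, hφ⟩ := exists_isMollifier
  obtain ⟨ρ0, hρ0, h0⟩ := exists_radius hφ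
  set c : ℕ → ℝ := fun n => 1 / ((n : ℝ) + 1) with hcdef
  have hcpos : ∀ n, 0 < c n := fun n => by positivity
  have hclim : Tendsto c atTop (𝓝 0) := tendsto_one_div_add_atTop_nhds_zero_nat
  set k : ℕ → TransKernel := fun n => mol hφ (c n) (c n) with hk
  have hball : ∀ n, (k n).InBall (max (c n) (c n * ρ0)) :=
    fun n => mol_inBall hφ h0 (hcpos n) (hcpos n)
  have hrlim : Tendsto (fun n => max (c n) (c n * ρ0)) atTop (𝓝 0) := by
    have := hclim.max (hclim.mul_const ρ0)
    simpa using this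
  have hmass : ∀ n, (k n).mass ≤ molMass φ := fun n => (mol_mass hφ (hcpos n) (hcpos n)).le
  have hS : ∀ {F : SpaceTime → ℝ}, MemLp F 2 → StrongL2 volume atTop (fun n => (k n).avg F) F :=
    fun hF => strongL2_avg_seq hball hrlim hmass (fun n => mol_integral hφ (hcpos n) (hcpos n)) hF
  have htest : ∀ n, IsTest univ ((k n).avg θ) := fun n =>
    ⟨contDiff_mol hφ hθ, (k n).hasCompactSupport_avg (hball n) hc, subset_univ _⟩
  have hdd : ∀ n j z, dd (ej j) ((k n).avg θ) z = (k n).avg (D j) z := fun n j z =>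
    (hwd j).dd_convKer hθ (hball n) fun _ _ => trivial
  have hsq : ∀ {F : SpaceTime → ℝ}, MemLp F 2 →
      Tendsto (fun n => ∫⁻ z, ‖(k n).avg F z‖ₑ ^ 2) atTop (𝓝 (∫⁻ z, ‖F z‖ₑ ^ 2)) := by
    intro F hF
    have h1 := (hS hF).integral_mul (hS hF)
    have e : ∀ {H : SpaceTime → ℝ}, MemLp H 2 → ∫⁻ z, ‖H z‖ₑ ^ 2 = ENNReal.ofReal (∫ z, H z * H z) := by
      intro H hH
      rw [ofReal_integral_eq_lintegral_ofReal (integrable_mul_of_memLp hH hH)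
        (Eventually.of_forall fun z => mul_self_nonneg _)]
      refine lintegral_congr fun z => ?_
      rw [← ofReal_norm, ← ENNReal.ofReal_pow (norm_nonneg _), Real.norm_eq_abs, sq_abs, sq]
    simp_rw [e ((hS hF).mem _), e hF]
    exact (ENNReal.continuous_ofReal.tendsto _).comp h1
  obtain ⟨ns, hns, hae⟩ := (hS hθ).exists_subseq_ae
  have h1 := nL24_liminf_le (fun n => ((hS hθ).mem (ns n)).1) hae
  have h2 : ∀ n, nL24 ((k n).avg θ) ^ 4 ≤ nL24Const * (∫⁻ z, ‖(k n).avg θ z‖ₑ ^ 2) *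
      (∫⁻ z, ∑ j, ‖(k n).avg (D j) z‖ₑ ^ 2) ^ 3 := by
    intro n
    have := nL24_le_of_smooth (htest n)
    simp_rw [hdd] at this
    rwa [← mul_assoc] at this
  have hlimD : Tendsto (fun n => ∫⁻ z, ∑ j, ‖(k n).avg (D j) z‖ₑ ^ 2) atTop
      (𝓝 (∫⁻ z, ∑ j, ‖D j z‖ₑ ^ 2)) := by
    have e : ∀ H : Fin 3 → SpaceTime → ℝ, (∀ j, MemLp (H j) 2) →
        ∫⁻ z, ∑ j, ‖H j z‖ₑ ^ 2 = ∑ j, ∫⁻ z, ‖H j z‖ₑ ^ 2 := fun H hH =>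
      lintegral_finsetSum' _ fun j _ => (hH j).1.enorm.pow_const 2
    simp_rw [e _ fun j => (hS (hD j)).mem _, e _ hD]
    exact tendsto_finsetSum _ fun j _ => hsq (hD j)
  have hDfin : ∫⁻ z, ∑ j, ‖D j z‖ₑ ^ 2 ≠ ⊤ := by
    rw [lintegral_finsetSum' _ fun j _ => (hD j).1.enorm.pow_const 2]
    refine ENNReal.sum_ne_top.2 fun j _ => ?_
    rw [← eLpNorm_two_sq]; exact ENNReal.pow_ne_top (hD j).2.ne
  have hθfin : ∫⁻ z, ‖θ z‖ₑ ^ 2 ≠ ⊤ := by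
    rw [← eLpNorm_two_sq]; exact ENNReal.pow_ne_top hθ.2.ne
  have hlim : Tendsto (fun n => nL24Const * (∫⁻ z, ‖(k n).avg θ z‖ₑ ^ 2) *
      (∫⁻ z, ∑ j, ‖(k n).avg (D j) z‖ₑ ^ 2) ^ 3) atTop
      (𝓝 (nL24Const * (∫⁻ z, ‖θ z‖ₑ ^ 2) * (∫⁻ z, ∑ j, ‖D j z‖ₑ ^ 2) ^ 3)) := by
    refine ENNReal.Tendsto.mul (ENNReal.Tendsto.const_mul (hsq hθ) (Or.inr nL24Const_ne_top))
      (Or.inr (ENNReal.pow_ne_top hDfin)) (((ENNReal.continuous_pow 3).tendsto _).comp hlimD)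
      (Or.inr (ENNReal.mul_ne_top nL24Const_ne_top hθfin))
  have hrt : ∀ x : ℝ≥0∞, (x ^ (1 / 4 : ℝ)) ^ 4 = x := fun x => by
    rw [← ENNReal.rpow_natCast, ← ENNReal.rpow_mul]; norm_num
  have hfin : nL24 θ ≤ (nL24Const * (∫⁻ z, ‖θ z‖ₑ ^ 2) *
      (∫⁻ z, ∑ j, ‖D j z‖ₑ ^ 2) ^ 3) ^ (1 / 4 : ℝ) := by
    refine h1.trans ?_
    have hl4 := ((ENNReal.continuous_rpow_const (y := (1 / 4 : ℝ))).tendsto _).comp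
      (hlim.comp hns.tendsto_atTop)
    refine (liminf_le_liminf (Eventually.of_forall fun n => ?_)).trans (le_of_eq hl4.liminf_eq)
    refine (ENNReal.pow_le_pow_left_iff (n := 4) (by norm_num)).1 ?_
    simp only [Function.comp_apply]
    rw [hrt]
    exact h2 (ns n)
  calc nL24 θ ^ 4 ≤ _ := by gcongr
    _ = _ := hrt _

end Sobolev

/-! ### Pointwise bounds for averages; space kernels from L¹ₓ and L²ₓ into L^∞ₓ -/

namespace TransKernel
variable (k : TransKernel) {F H : SpaceTime → ℝ}

theorem ae_ae_comp {p : SpaceTime → Prop} (h : ∀ᵐ z, p z) :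
    ∀ᵐ z : SpaceTime, ∀ᵐ α ∂k.ν, p (z - k.τ α) := by
  have h1 : ∀ᵐ q ∂((volume : Measure SpaceTime).prod k.ν), p q.1 :=
    Measure.quasiMeasurePreserving_fst.ae h
  exact Measure.ae_ae_of_ae_prod (k.measurePreserving_shear.quasiMeasurePreserving.ae h1)

theorem avg_congr_ae (h : F =ᵐ[volume] H) : k.avg F =ᵐ[volume] k.avg H := by
  filter_upwards [k.ae_ae_comp h] with z hz
  refine integral_congr_ae ?_
  filter_upwards [hz] with α hα
  rw [hα]

/-- The translations are purely spatial, so a bound depending on time alone is not displaced by the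
average. -/
theorem ae_enorm_avg_le (hk : ∀ α, (k.τ α).1 = 0) {N : ℝ → ℝ≥0∞}
    (h : ∀ᵐ z : SpaceTime, ‖F z‖ₑ ≤ N z.1) :
    ∀ᵐ z : SpaceTime, ‖k.avg F z‖ₑ ≤ k.mass * N z.1 := by
  filter_upwards [k.ae_ae_comp h] with z hz
  refine (k.enorm_avg_le z).trans ?_
  rw [mass, ← lintegral_mul_const'' _ k.hm.1.enorm]
  refine lintegral_mono_ae ?_
  filter_upwards [hz] with α hα
  have e : (z - k.τ α).1 = z.1 := by simp [hk]
  rw [e] at hα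
  gcongr

theorem ae_abs_avg_le {M : ℝ} (h : ∀ᵐ z, |F z| ≤ M) :
    ∀ᵐ z, |k.avg F z| ≤ k.mass.toReal * M := by
  have hM : 0 ≤ M := by
    obtain ⟨z, hz⟩ := h.exists
    exact (abs_nonneg _).trans hz
  filter_upwards [k.ae_ae_comp h] with z hz
  have h1 : ‖k.avg F z‖ₑ ≤ k.mass * ENNReal.ofReal M := by
    refine (k.enorm_avg_le z).trans ?_
    rw [mass, ← lintegral_mul_const'' _ k.hm.1.enorm]
    refine lintegral_mono_ae ?_
    filter_upwards [hz] with α hα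
    gcongr
    rw [← ofReal_norm]
    exact ENNReal.ofReal_le_ofReal hα
  have := ENNReal.toReal_mono (ENNReal.mul_ne_top k.mass_ne_top ENNReal.ofReal_ne_top) h1
  rwa [toReal_enorm, ENNReal.toReal_mul, ENNReal.toReal_ofReal hM] at this

theorem integral_avg_mul_of_ae_bdd {M : ℝ} (hF : Integrable F volume)
    (hH : AEStronglyMeasurable H volume) (hM : ∀ᵐ z, |H z| ≤ M) :
    ∫ z, k.avg F z * H z = ∫ z, F z * k.adj.avg H z := by
  -- Truncation at level M changes H on a null set only and makes the bound hold everywhere.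
  set H' : SpaceTime → ℝ := fun z => max (-M) (min M (H z)) with hH'
  have hM0 : 0 ≤ M := by
    obtain ⟨z, hz⟩ := hM.exists
    exact (abs_nonneg _).trans hz
  have e : H =ᵐ[volume] H' := by
    filter_upwards [hM] with z hz
    rw [abs_le] at hz
    simp only [hH']
    rw [min_eq_right hz.2, max_eq_right hz.1]
  have hb : ∀ z, |H' z| ≤ M := fun z => abs_le.2
    ⟨le_max_left _ _, max_le (by linarith) (min_le_left _ _)⟩
  have h := k.integral_avg_mul_of_bdd hF (hH.congr e) hb
  calc _ = ∫ z, k.avg F z * H' z := integral_congr_ae (by filter_upwards [e] with z hz; rw [hz])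
    _ = _ := h
    _ = _ := integral_congr_ae (by filter_upwards [k.adj.avg_congr_ae e] with z hz; rw [hz])

end TransKernel

section SpaceKernel
variable {κ : R3 → ℝ} {h : ContDiff ℝ ∞ κ} {hc : HasCompactSupport κ} {F : SpaceTime → ℝ}

theorem lintegral_slice_sub (z : SpaceTime) (f : SpaceTime → ℝ≥0∞) :
    ∫⁻ y : R3, f (z - (0, y)) = ∫⁻ x : R3, f (z.1, x) := by
  have e : ∀ y : R3, z - (0, y) = (z.1, z.2 - y) := fun y => Prod.ext (by simp) (by simp)
  simp only [e]
  exact lintegral_sub_left_eq_self (μ := (volume : Measure R3)) (fun x => f (z.1, x)) z.2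

theorem enorm_spaceKer_le_one {M : ℝ≥0} (hM : ∀ y, ‖κ y‖ₑ ≤ M) (z : SpaceTime) :
    ‖(spaceKer κ h hc).avg F z‖ₑ ≤ M * ∫⁻ x : R3, ‖F (z.1, x)‖ₑ := by
  refine ((spaceKer κ h hc).enorm_avg_le z).trans ?_
  calc _ ≤ ∫⁻ y : R3, M * ‖F (z - (0, y))‖ₑ := lintegral_mono fun y => by
        change ‖κ y‖ₑ * ‖F (z - (0, y))‖ₑ ≤ _
        gcongr; exact hM y
    _ = M * ∫⁻ y : R3, ‖F (z - (0, y))‖ₑ := lintegral_const_mul' _ _ ENNReal.coe_ne_top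
    _ = _ := by rw [lintegral_slice_sub z fun w => ‖F w‖ₑ]

/-- The square of the `L²` norm of a space kernel. -/
def kerSq (κ : R3 → ℝ) : ℝ≥0∞ := ∫⁻ y, ‖κ y‖ₑ ^ 2

theorem kerSq_ne_top (h : ContDiff ℝ ∞ κ) (hc : HasCompactSupport κ) : kerSq κ ≠ ⊤ := by
  have : MemLp κ 2 volume := h.continuous.memLp_of_hasCompactSupport hc
  rw [kerSq, ← eLpNorm_two_sq]
  exact ENNReal.pow_ne_top this.2.ne

/-- Cauchy–Schwarz in y on each time slice. Applied to a velocity bounded in L^∞ₜL²ₓ, it makes R * u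
and its gradient bounded functions. -/
theorem ae_enorm_spaceKer_le (hF : AEStronglyMeasurable F volume) :
    ∀ᵐ z : SpaceTime, ‖(spaceKer κ h hc).avg F z‖ₑ ≤
      (kerSq κ * ∫⁻ x : R3, ‖F (z.1, x)‖ₑ ^ 2) ^ (1 / 2 : ℝ) := by
  filter_upwards [(spaceKer κ h hc).ae_aemeasurable_slice hF] with z hz
  change AEStronglyMeasurable (fun y : R3 => F (z - (0, y))) volume at hz
  rw [one_div, ENNReal.le_rpow_inv_iff (by norm_num)]
  norm_num
  refine (pow_le_pow_left' ((spaceKer κ h hc).enorm_avg_le z) 2).trans ?_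
  refine (sq_lintegral_mul_le (spaceKer κ h hc).hm.1.enorm hz.enorm).trans (le_of_eq ?_)
  rw [← lintegral_slice_sub z fun w => ‖F w‖ₑ ^ 2]
  rfl

theorem hasCompactSupport_neg (hc : HasCompactSupport κ) :
    HasCompactSupport (fun y => κ (-y)) := hc.comp_homeomorph (Homeomorph.neg R3)

theorem spaceKer_adj_avg (F : SpaceTime → ℝ) :
    (spaceKer κ h hc).adj.avg F = (spaceKer (fun y => κ (-y)) (h.comp contDiff_neg)
      (hasCompactSupport_neg hc)).avg F := by
  ext z
  rw [spaceKer_adj_avg_eq, spaceKer_avg_eq]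
  have := integral_neg_eq_self (fun y : R3 => κ (-y) * F (z - (0, y))) volume
  rw [← this]
  refine integral_congr_ae (Eventually.of_forall fun y => ?_)
  simp only [neg_neg]
  congr 2
  ext <;> simp

theorem sq_lintegral_spaceKer_le {g : SpaceTime → ℝ} (hg : AEStronglyMeasurable g volume)
    (hF : AEStronglyMeasurable F volume) :
    (∫⁻ z, ‖g z * (spaceKer κ h hc).avg F z‖ₑ) ^ 2 ≤
      nL21 g * (kerSq κ * ∫⁻ z, ‖F z‖ₑ ^ 2) := by
  have hm : AEMeasurable (fun t : ℝ => ∫⁻ x : R3, ‖F (t, x)‖ₑ ^ 2) :=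
    aemeasurable_slice_lintegral (hF.enorm.pow_const 2)
  refine (sq_lintegral_pair_le hg
    (N := fun t => (kerSq κ * ∫⁻ x : R3, ‖F (t, x)‖ₑ ^ 2) ^ (1 / 2 : ℝ))
    ((hm.const_mul _).pow_const _) (ae_enorm_spaceKer_le hF)).trans (le_of_eq ?_)
  congr 1
  rw [lintegral_slice (hF.enorm.pow_const 2), ← lintegral_const_mul'' _ hm]
  refine lintegral_congr fun t => ?_
  rw [← ENNReal.rpow_natCast, ← ENNReal.rpow_mul]
  norm_num

/-- The kernels of the composed convolution act boundedly from `L²ₓ` to `L^∞ₓ`. -/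
theorem sq_lintegral_avg_spaceKer_le (k : TransKernel) (hk : ∀ α, (k.τ α).1 = 0)
    {g : SpaceTime → ℝ} (hg : AEStronglyMeasurable g volume)
    (hF : AEStronglyMeasurable F volume) :
    (∫⁻ z, ‖g z * k.avg ((spaceKer κ h hc).avg F) z‖ₑ) ^ 2 ≤
      nL21 g * (k.mass ^ 2 * (kerSq κ * ∫⁻ z, ‖F z‖ₑ ^ 2)) := by
  have hm : AEMeasurable (fun t : ℝ => ∫⁻ x : R3, ‖F (t, x)‖ₑ ^ 2) :=
    aemeasurable_slice_lintegral (hF.enorm.pow_const 2)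
  refine (sq_lintegral_pair_le hg
    (N := fun t => k.mass * (kerSq κ * ∫⁻ x : R3, ‖F (t, x)‖ₑ ^ 2) ^ (1 / 2 : ℝ))
    (((hm.const_mul _).pow_const _).const_mul _)
    (k.ae_enorm_avg_le hk (N := fun t => (kerSq κ * ∫⁻ x : R3, ‖F (t, x)‖ₑ ^ 2) ^ (1 / 2 : ℝ))
      (ae_enorm_spaceKer_le hF))).trans (le_of_eq ?_)
  congr 1
  rw [lintegral_slice (hF.enorm.pow_const 2), ← lintegral_const_mul'' _ hm,
    ← lintegral_const_mul'' _ (hm.const_mul _)]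
  refine lintegral_congr fun t => ?_
  rw [mul_pow, ← ENNReal.rpow_natCast (_ ^ (1 / 2 : ℝ)), ← ENNReal.rpow_mul]
  norm_num

end SpaceKernel

/-! ### The derivatives of the parametrix act from L⁴ₓ into L^∞ₓ -/

section PotentialKernel
variable {r : ℝ} (B : RadialBump r)

/-- The constant in the bound of the kernels `K i` from `L⁴ₓ` to `L^∞ₓ`. -/
def potConst (i : Fin 3) : ℝ≥0∞ :=
  (∫⁻ s in Ioc (0 : ℝ) 1, ENNReal.ofReal (s ^ (-(3 / 4) : ℝ))) *
    (∫⁻ y : R3, ‖y i * B.R y‖ₑ ^ (4 / 3 : ℝ)) ^ (3 / 4 : ℝ)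

/-- The power s^(−3/4) is integrable at zero. This is where an exponent larger than the dimension 3
is needed: for L^p the power would be s^(−3/p). -/
theorem potConst_ne_top (i : Fin 3) : potConst B i ≠ ⊤ := by
  refine ENNReal.mul_ne_top ?_ (ENNReal.rpow_ne_top_of_nonneg (by norm_num) ?_)
  · have h1 : IntegrableOn (fun s : ℝ => s ^ (-(3 / 4) : ℝ)) (Ioc 0 1) := by
      have := intervalIntegral.intervalIntegrable_rpow' (r := (-(3 / 4) : ℝ)) (a := 0) (b := 1)
        (by norm_num)
      rwa [intervalIntegrable_iff_integrableOn_Ioc_of_le zero_le_one] at this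
    exact h1.lintegral_lt_top.ne
  · have hcont : Continuous (fun y : R3 => y i * B.R y) := by
      have := B.smooth.continuous
      fun_prop
    have hc : HasCompactSupport (fun y : R3 => y i * B.R y) := B.compact.mul_left
    have : MemLp (fun y : R3 => y i * B.R y) (4 / 3 : ℝ≥0∞) volume :=
      hcont.memLp_of_hasCompactSupport hc
    have := this.2
    rw [eLpNorm_lt_top_iff_lintegral_rpow_enorm_lt_top (by norm_num) (by finiteness)] at this
    convert this.ne using 4
    simp

theorem lintegral_slice_smul {s : ℝ} (hs : 0 < s) (z : SpaceTime) (f : SpaceTime → ℝ≥0∞)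
    (hf : AEMeasurable (fun x : R3 => f (z.1, x))) :
    ∫⁻ y : R3, f (z - (0, s • y)) = ENNReal.ofReal (s ^ (-3 : ℝ)) * ∫⁻ x : R3, f (z.1, x) := by
  have e : ∀ y : R3, z - (0, s • y) = (z.1, z.2 - s • y) := fun y => Prod.ext (by simp) (by simp)
  simp only [e]
  have hf' : AEMeasurable (fun x : R3 => f (z.1, z.2 - x)) :=
    hf.comp_quasiMeasurePreserving (quasiMeasurePreserving_sub_left volume z.2)
  have hmap := Measure.map_addHaar_smul (volume : Measure R3) hs.ne'
  have h1 : AEMeasurable (fun x : R3 => f (z.1, z.2 - x)) (Measure.map (s • ·) volume) := by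
    rw [hmap]; exact hf'.smul_measure _
  have h2 := lintegral_map' h1 (measurable_const_smul s).aemeasurable
  rw [← h2, hmap, lintegral_smul_measure,
    lintegral_sub_left_eq_self (μ := (volume : Measure R3)) (fun x => f (z.1, x)) z.2, smul_eq_mul]
  congr 2
  rw [finrank_euclideanSpace, Fintype.card_fin, abs_of_pos (by positivity), Real.rpow_neg hs.le]
  norm_num

/-- For each s, Hölder with exponents 4/3 and 4 in y; undoing the dilation by s costs the factor
s^(−3/4), which is then integrated over (0, 1]. -/
theorem ae_enorm_K_le (i : Fin 3) {θ : SpaceTime → ℝ} (hθ : AEStronglyMeasurable θ volume) :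
    ∀ᵐ z : SpaceTime, ‖(B.K i).avg θ z‖ₑ ≤
      potConst B i * (∫⁻ x : R3, ‖θ (z.1, x)‖ₑ ^ 4) ^ (1 / 4 : ℝ) := by
  have hθ' := hθ
  rw [Measure.volume_eq_prod] at hθ'
  filter_upwards [ae_fst hθ'.prodMk_left] with z hz
  refine ((B.K i).enorm_avg_le z).trans ?_
  change ∫⁻ p : ℝ × R3, ‖(Ioc 0 1).indicator (fun _ : ℝ => (1 : ℝ)) p.1 * (p.2 i * B.R p.2)‖ₑ *
    ‖θ (z - (0, p.1 • p.2))‖ₑ ∂((volume.restrict (Ioc 0 1)).prod volume) ≤ _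
  refine (lintegral_prod_le _).trans ?_
  set X := ∫⁻ x : R3, ‖θ (z.1, x)‖ₑ ^ 4 with hX
  set Y := ∫⁻ y : R3, ‖y i * B.R y‖ₑ ^ (4 / 3 : ℝ) with hY
  have key : ∀ s ∈ Ioc (0 : ℝ) 1, ∫⁻ y : R3,
      ‖(Ioc 0 1).indicator (fun _ : ℝ => (1 : ℝ)) s * (y i * B.R y)‖ₑ *
        ‖θ (z - (0, s • y))‖ₑ ≤
      ENNReal.ofReal (s ^ (-(3 / 4) : ℝ)) * (Y ^ (3 / 4 : ℝ) * X ^ (1 / 4 : ℝ)) := by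
    intro s hs
    simp only [indicator_of_mem hs, one_mul]
    have e : ∀ y : R3, z - (0, s • y) = (z.1, z.2 - s • y) := fun y =>
      Prod.ext (by simp) (by simp)
    have m1 : AEMeasurable (fun y : R3 => ‖y i * B.R y‖ₑ) := by
      have := B.smooth.continuous
      exact (by fun_prop : Continuous (fun y : R3 => y i * B.R y)).enorm.aemeasurable
    have m2 : AEMeasurable (fun y : R3 => ‖θ (z - (0, s • y))‖ₑ) := by
      simp only [e]
      exact (hz.enorm.comp_quasiMeasurePreserving
        (quasiMeasurePreserving_sub_left volume z.2)).comp_quasiMeasurePreserving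
        (Measure.quasiMeasurePreserving_smul volume hs.1.ne')
    have hH := ENNReal.lintegral_mul_le_Lp_mul_Lq volume (p := 4 / 3) (q := 4)
      (by rw [Real.holderConjugate_iff]; norm_num) m1 m2
    refine hH.trans (le_of_eq ?_)
    have e4 : ∫⁻ y : R3, ‖θ (z - (0, s • y))‖ₑ ^ (4 : ℝ) = ENNReal.ofReal (s ^ (-3 : ℝ)) * X := by
      have := lintegral_slice_smul hs.1 z (fun w => ‖θ w‖ₑ ^ 4) (hz.enorm.pow_const 4)
      rw [hX, ← this]
      refine lintegral_congr fun y => ?_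
      norm_cast
    rw [e4, ENNReal.mul_rpow_of_nonneg _ _ (by norm_num),
      ENNReal.ofReal_rpow_of_nonneg (by have := hs.1; positivity) (by norm_num),
      ← Real.rpow_mul hs.1.le, ← hY]
    norm_num
    ring
  calc _ ≤ ∫⁻ s in Ioc (0 : ℝ) 1, ENNReal.ofReal (s ^ (-(3 / 4) : ℝ)) *
        (Y ^ (3 / 4 : ℝ) * X ^ (1 / 4 : ℝ)) := setLIntegral_mono' measurableSet_Ioc key
    _ = _ := by
        rw [lintegral_mul_const _ (by fun_prop), potConst]
        ring

theorem sq_lintegral_K_le (i : Fin 3) {g θ : SpaceTime → ℝ} (hg : AEStronglyMeasurable g volume)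
    (hθ : AEStronglyMeasurable θ volume) :
    (∫⁻ z, ‖g z * (B.K i).avg θ z‖ₑ) ^ 2 ≤ nL21 g * (potConst B i ^ 2 * nL24 θ) := by
  have hm : AEMeasurable (fun t : ℝ => ∫⁻ x : R3, ‖θ (t, x)‖ₑ ^ 4) :=
    aemeasurable_slice_lintegral (hθ.enorm.pow_const 4)
  refine (sq_lintegral_pair_le hg
    (N := fun t => potConst B i * (∫⁻ x : R3, ‖θ (t, x)‖ₑ ^ 4) ^ (1 / 4 : ℝ))
    ((hm.pow_const _).const_mul _) (ae_enorm_K_le B i hθ)).trans (le_of_eq ?_)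
  congr 1
  rw [nL24, ← lintegral_const_mul'' _ (hm.pow_const _)]
  refine lintegral_congr fun t => ?_
  rw [mul_pow, ← ENNReal.rpow_natCast (_ ^ (1 / 4 : ℝ)), ← ENNReal.rpow_mul]
  norm_num

end PotentialKernel

/-! ### Products of velocities and gradients in mixed norms -/

section Products

/-- Cauchy–Schwarz on each slice. With a a component of the velocity and b one of its gradient, it
places the convection term in L²ₜL¹ₓ. -/
theorem nL21_mul_le {a b : SpaceTime → ℝ} {C : ℝ≥0} (ha : AEStronglyMeasurable a volume)
    (hb : AEStronglyMeasurable b volume)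
    (hC : ∀ᵐ t : ℝ, ∫⁻ x : R3, ‖a (t, x)‖ₑ ^ 2 ≤ C) :
    nL21 (fun z => a z * b z) ≤ C * ∫⁻ z, ‖b z‖ₑ ^ 2 := by
  have ha' := ha
  have hb' := hb
  rw [Measure.volume_eq_prod] at ha' hb'
  rw [lintegral_slice (hb.enorm.pow_const 2),
    ← lintegral_const_mul'' _ (aemeasurable_slice_lintegral (hb.enorm.pow_const 2)), nL21]
  refine lintegral_mono_ae ?_
  filter_upwards [hC, ha'.prodMk_left, hb'.prodMk_left] with t ht h1 h2
  simp only [enorm_mul]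
  refine (sq_lintegral_mul_le h1.enorm h2.enorm).trans ?_
  gcongr

theorem nL21_sum_le {g : Fin 3 → SpaceTime → ℝ} (hg : ∀ i, AEStronglyMeasurable (g i) volume) :
    nL21 (fun z => ∑ i, g i z) ≤ 3 * ∑ i, nL21 (g i) := by
  have hg' : ∀ i, ∀ᵐ t : ℝ, AEStronglyMeasurable (fun x : R3 => g i (t, x)) volume := fun i => by
    have := hg i
    rw [Measure.volume_eq_prod] at this
    exact this.prodMk_left
  have hm := fun i => aemeasurable_slice_lintegral (hg i).enorm
  simp only [nL21]
  rw [← lintegral_finsetSum' _ (fun i _ => (hm i).pow_const 2),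
    ← lintegral_const_mul' _ _ (by norm_num)]
  refine lintegral_mono_ae ?_
  filter_upwards [ae_all_iff.2 hg'] with t ht
  have h1 : ∫⁻ x : R3, ‖∑ i, g i (t, x)‖ₑ ≤ ∑ i, ∫⁻ x : R3, ‖g i (t, x)‖ₑ := by
    rw [← lintegral_finsetSum' _ (fun i _ => (ht i).enorm)]
    exact lintegral_mono fun x => enorm_sum_le _ _
  refine (pow_le_pow_left' h1 2).trans ?_
  have := ENNReal.inner_le_Lp_mul_Lq Finset.univ (fun _ : Fin 3 => (1 : ℝ≥0∞))
    (fun i => ∫⁻ x : R3, ‖g i (t, x)‖ₑ) (p := 2) (q := 2)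
    (by rw [Real.holderConjugate_iff]; norm_num)
  refine (pow_le_pow_left' (by simpa only [one_mul] using this) 2).trans (le_of_eq ?_)
  rw [mul_pow, ← ENNReal.rpow_natCast, ← ENNReal.rpow_natCast, ← ENNReal.rpow_mul,
    ← ENNReal.rpow_mul]
  norm_num

/-- Hölder with L^∞ₜL²ₓ for a and L²ₜL⁴ₓ for b and c. It gives a meaning to the cubic energy flux.
-/
theorem sq_lintegral_three_le {a b c : SpaceTime → ℝ} {C : ℝ≥0}
    (ha : AEStronglyMeasurable a volume) (hb : AEStronglyMeasurable b volume)
    (hc : AEStronglyMeasurable c volume)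
    (hC : ∀ᵐ t : ℝ, ∫⁻ x : R3, ‖a (t, x)‖ₑ ^ 2 ≤ C) :
    (∫⁻ z, ‖a z * (b z * c z)‖ₑ) ^ 2 ≤ C * (nL24 b * nL24 c) := by
  have hs : ∀ {f : SpaceTime → ℝ}, AEStronglyMeasurable f volume →
      ∀ᵐ t : ℝ, AEStronglyMeasurable (fun x : R3 => f (t, x)) volume := fun h => by
    rw [Measure.volume_eq_prod] at h
    exact h.prodMk_left
  have hmb : AEMeasurable (fun t : ℝ => (∫⁻ x : R3, ‖b (t, x)‖ₑ ^ 4) ^ (1 / 4 : ℝ)) :=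
    (aemeasurable_slice_lintegral (hb.enorm.pow_const 4)).pow_const _
  have hmc : AEMeasurable (fun t : ℝ => (∫⁻ x : R3, ‖c (t, x)‖ₑ ^ 4) ^ (1 / 4 : ℝ)) :=
    (aemeasurable_slice_lintegral (hc.enorm.pow_const 4)).pow_const _
  have h1 : ∫⁻ z, ‖a z * (b z * c z)‖ₑ ≤ ∫⁻ t : ℝ, (C : ℝ≥0∞) ^ (1 / 2 : ℝ) *
      ((∫⁻ x : R3, ‖b (t, x)‖ₑ ^ 4) ^ (1 / 4 : ℝ) * (∫⁻ x : R3, ‖c (t, x)‖ₑ ^ 4) ^ (1 / 4 : ℝ)) := by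
    rw [lintegral_slice (g := fun z => ‖a z * (b z * c z)‖ₑ) (ha.mul (hb.mul hc)).enorm]
    refine lintegral_mono_ae ?_
    filter_upwards [hC, hs ha, hs hb, hs hc] with t ht h1 h2 h3
    simp only [enorm_mul]
    have e1 := sq_lintegral_mul_le h1.enorm (h2.enorm.mul h3.enorm)
    have e2 := sq_lintegral_mul_le (h2.enorm.pow_const 2) (h3.enorm.pow_const 2)
    simp only [Pi.mul_apply, mul_pow, ← pow_mul] at e1 e2
    norm_num at e1 e2
    set b4 := ∫⁻ x : R3, ‖b (t, x)‖ₑ ^ 4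
    set c4 := ∫⁻ x : R3, ‖c (t, x)‖ₑ ^ 4
    have e3 : (∫⁻ x : R3, ‖a (t, x)‖ₑ * (‖b (t, x)‖ₑ * ‖c (t, x)‖ₑ)) ^ 4 ≤ C ^ 2 * (b4 * c4) := by
      calc _ = ((∫⁻ x : R3, ‖a (t, x)‖ₑ * (‖b (t, x)‖ₑ * ‖c (t, x)‖ₑ)) ^ 2) ^ 2 := by
            rw [← pow_mul]
        _ ≤ (C * ∫⁻ x : R3, ‖b (t, x)‖ₑ ^ 2 * ‖c (t, x)‖ₑ ^ 2) ^ 2 := by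
            refine pow_le_pow_left' (e1.trans ?_) 2
            gcongr
        _ ≤ _ := by rw [mul_pow]; gcongr
    have e4 := ENNReal.rpow_le_rpow e3 (by norm_num : (0 : ℝ) ≤ 1 / 4)
    rw [ENNReal.mul_rpow_of_nonneg _ _ (by norm_num), ENNReal.mul_rpow_of_nonneg _ _ (by norm_num),
      ← ENNReal.rpow_natCast, ← ENNReal.rpow_natCast, ← ENNReal.rpow_mul, ← ENNReal.rpow_mul] at e4
    norm_num at e4 ⊢
    exact e4
  refine (pow_le_pow_left' h1 2).trans ?_
  rw [lintegral_const_mul'' (f := fun t => (∫⁻ x : R3, ‖b (t, x)‖ₑ ^ 4) ^ (1 / 4 : ℝ) *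
    (∫⁻ x : R3, ‖c (t, x)‖ₑ ^ 4) ^ (1 / 4 : ℝ)) _ (hmb.mul hmc), mul_pow, ← ENNReal.rpow_natCast, ← ENNReal.rpow_mul]
  norm_num
  gcongr
  refine (sq_lintegral_mul_le hmb hmc).trans (le_of_eq ?_)
  simp only [nL24, ← ENNReal.rpow_natCast, ← ENNReal.rpow_mul]
  norm_num

end Products

/-! ### Neighbourhoods, approximation by test functions and L² bounds by duality -/

section Duality
variable {φ : R3 → ℝ}

theorem Near.cthickening_subset {r r' : ℝ} {V U : Set SpaceTime} (h : Near r V U) (hr : r' < r)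
    (hr0 : 0 ≤ r') : Metric.cthickening r' V ⊆ U := by
  intro w hw
  have := Metric.cthickening_subset_thickening' (hr0.trans_lt hr) hr V hw
  rw [Metric.mem_thickening_iff] at this
  obtain ⟨z, hz, hd⟩ := this
  refine h z hz w ?_
  rw [← dist_eq_norm, dist_comm]
  exact hd.le

/-- The closed `r`-neighbourhood of a set. -/
def nbhd (r : ℝ) (V : Set SpaceTime) : Set SpaceTime := {w | ∃ z ∈ V, ‖z - w‖ ≤ r}

theorem near_nbhd (r : ℝ) (V : Set SpaceTime) : Near r V (nbhd r V) :=
  fun z hz _ hw => ⟨z, hz, hw⟩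

theorem Near.nbhd {r r' r'' : ℝ} {V U : Set SpaceTime} (h : Near r V U) (hr : r' + r'' ≤ r) :
    Near r'' (nbhd r' V) U := by
  rintro w ⟨z, hz, hzw⟩ y hy
  refine h z hz y ?_
  calc ‖z - y‖ = ‖(z - w) + (w - y)‖ := by congr 1; abel
    _ ≤ _ := (norm_add_le _ _).trans (by linarith)

theorem isBounded_nbhd {r : ℝ} {V : Set SpaceTime} (hV : Bornology.IsBounded V) :
    Bornology.IsBounded (nbhd r V) := by
  refine (hV.cthickening (δ := r)).subset ?_
  rintro w ⟨z, hz, hzw⟩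
  refine Metric.mem_cthickening_of_dist_le w z r V hz ?_
  rwa [dist_comm, dist_eq_norm]

theorem isTest_mol (hφ : IsMollifier φ) {δ ε r r' : ℝ} {F : SpaceTime → ℝ} (hF : MemLp F 2)
    {V U : Set SpaceTime} (hV : Bornology.IsBounded V) (h0 : ∀ z, z ∉ V → F z = 0)
    (hVU : Near r V U) (hk : (mol hφ δ ε).InBall r') (hr : r' < r) (hr0 : 0 ≤ r') :
    IsTest U ((mol hφ δ ε).avg F) := by
  have hs : tsupport F ⊆ closure V := closure_mono fun z hz => by
    by_contra h
    exact hz (h0 z h)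
  have hc : HasCompactSupport F := IsCompact.of_isClosed_subset hV.isCompact_closure
    (isClosed_tsupport F) hs
  refine ⟨contDiff_mol hφ hF, (mol hφ δ ε).hasCompactSupport_avg hk hc, ?_⟩
  refine ((mol hφ δ ε).tsupport_avg_subset hk).trans ?_
  refine (Metric.cthickening_subset_of_subset r' hs).trans ?_
  rw [Metric.cthickening_closure]
  exact hVU.cthickening_subset hr hr0

/-- A sequence of scales tending to zero. -/
def scale (n : ℕ) : ℝ := 1 / ((n : ℝ) + 1)

theorem scale_pos (n : ℕ) : 0 < scale n := by unfold scale; positivity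

theorem tendsto_scale : Tendsto scale atTop (𝓝 0) := tendsto_one_div_add_atTop_nhds_zero_nat

/-- A mollified cut-off function approximates in `L²`, by test functions. -/
theorem exists_test_approx {F : SpaceTime → ℝ} (hF : MemLp F 2) {V U : Set SpaceTime} {r : ℝ}
    (hV : Bornology.IsBounded V) (h0 : ∀ z, z ∉ V → F z = 0) (hr : 0 < r) (hVU : Near r V U) :
    ∃ θ : ℕ → SpaceTime → ℝ, (∀ n, IsTest U (θ n)) ∧ StrongL2 volume atTop θ F := by
  obtain ⟨φ, hφ⟩ := exists_isMollifier
  obtain ⟨ρ0, hρ0, h1⟩ := exists_radius hφ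
  have hb : ∀ n, (mol hφ (scale n) (scale n)).InBall (max (scale n) (scale n * ρ0)) := fun n =>
    mol_inBall hφ h1 (scale_pos n) (scale_pos n)
  have ht : Tendsto (fun n => max (scale n) (scale n * ρ0)) atTop (𝓝 0) := by
    have := tendsto_scale.max (tendsto_scale.mul_const ρ0)
    simpa using this
  have hS : StrongL2 volume atTop (fun n => (mol hφ (scale n) (scale n)).avg F) F :=
    strongL2_avg_seq hb ht (C := molMass φ)
      (fun n => (mol_mass hφ (scale_pos n) (scale_pos n)).le)
      (fun n => mol_integral hφ (scale_pos n) (scale_pos n)) hF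
  obtain ⟨N, hN⟩ := eventually_atTop.1 (ht.eventually (gt_mem_nhds hr))
  refine ⟨fun n => (mol hφ (scale (n + N)) (scale (n + N))).avg F, fun n => ?_, ?_⟩
  · exact isTest_mol hφ hF hV h0 hVU (hb _) (hN _ (by omega))
      (le_max_of_le_left (scale_pos _).le)
  · exact ⟨fun n => hS.1 _, hS.2, (tendsto_add_atTop_iff_nat
      (f := fun n => eLpNorm (fun x => (mol hφ (scale n) (scale n)).avg F x - F x) 2 volume) N).2
      hS.3⟩

theorem StrongL2.tendsto_eLpNorm {X ι : Type*} [MeasurableSpace X] {μ : Measure X} {l : Filter ι}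
    {a : ι → X → ℝ} {a0 : X → ℝ} (h : StrongL2 μ l a a0) :
    Tendsto (fun n => (eLpNorm (a n) 2 μ).toReal) l (𝓝 (eLpNorm a0 2 μ).toReal) := by
  refine tendsto_of_abs_le h.3 (Eventually.of_forall fun n => ?_)
  have h1 := memLp_sub (h.1 n) h.2
  have e1 : eLpNorm (a n) 2 μ ≤ eLpNorm a0 2 μ + eLpNorm (fun x => a n x - a0 x) 2 μ := by
    have := eLpNorm_add_le h.2.1 h1.1 (p := 2) one_le_two
    convert this using 2
    ext x; simp
  have e2 : eLpNorm a0 2 μ ≤ eLpNorm (a n) 2 μ + eLpNorm (fun x => a n x - a0 x) 2 μ := by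
    have := eLpNorm_sub_le (h.1 n).1 h1.1 (p := 2) one_le_two
    convert this using 2
    ext x; simp
  have f1 := ENNReal.toReal_mono (by have := h.2.2.ne; have := h1.2.ne; finiteness) e1
  have f2 := ENNReal.toReal_mono (by have := (h.1 n).2.ne; have := h1.2.ne; finiteness) e2
  rw [ENNReal.toReal_add (by first | exact h.2.2.ne | exact (h.1 n).2.ne) h1.2.ne] at f1 f2
  rw [abs_le]
  constructor <;> linarith

/-- The test functions are mollifications of F cut off to V, so the pairing tends to the square of
the norm. Mollification enlarges the support, hence the margin between V and U. -/
theorem lintegral_sq_le_of_dual {F : SpaceTime → ℝ} (hF : MemLp F 2) {V U : Set SpaceTime} {r : ℝ}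
    {C : ℝ≥0} (hV : Bornology.IsBounded V) (hVm : MeasurableSet V) (hr : 0 < r)
    (hVU : Near r V U)
    (h : ∀ θ, IsTest U θ → |∫ z, F z * θ z| ≤ C * (eLpNorm θ 2 volume).toReal) :
    ∫⁻ z in V, ‖F z‖ₑ ^ 2 ≤ (C : ℝ≥0∞) ^ 2 := by
  have hI : MemLp (V.indicator F) 2 := hF.indicator hVm
  obtain ⟨θ, hθ, hS⟩ := exists_test_approx hI hV (fun z hz => indicator_of_notMem hz F) hr hVU
  have h1 := (StrongL2.const (l := atTop) hF).integral_mul hS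
  have h2 := le_of_tendsto_of_tendsto' h1.abs (hS.tendsto_eLpNorm.const_mul (C : ℝ))
    (fun n => h _ (hθ n))
  have e0 : ∫⁻ z in V, ‖F z‖ₑ ^ 2 = eLpNorm (V.indicator F) 2 volume ^ 2 := by
    rw [eLpNorm_two_sq, ← lintegral_indicator hVm]
    refine lintegral_congr fun z => ?_
    by_cases hz : z ∈ V <;> simp [hz]
  have e1 : ∫ z, F z * V.indicator F z = (eLpNorm (V.indicator F) 2 volume).toReal ^ 2 := by
    rw [← ENNReal.toReal_pow, eLpNorm_two_sq, ← integral_toReal (hI.1.enorm.pow_const 2)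
      (by filter_upwards with z; finiteness)]
    refine integral_congr_ae (Eventually.of_forall fun z => ?_)
    by_cases hz : z ∈ V
    · simp [hz, ← sq]
    · simp [hz]
  rw [e1, abs_of_nonneg (by positivity), sq] at h2
  rw [e0]
  gcongr
  rw [← ENNReal.ofReal_toReal hI.2.ne, ← ENNReal.ofReal_coe_nnreal]
  refine ENNReal.ofReal_le_ofReal ?_
  by_cases hz : (eLpNorm (V.indicator F) 2 volume).toReal = 0
  · rw [hz]; positivity
  · have : 0 < (eLpNorm (V.indicator F) 2 volume).toReal := lt_of_le_of_ne (by positivity)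
      (Ne.symm hz)
    exact le_of_mul_le_mul_right h2 this

end Duality

/-! ### Translation estimates from bounded derivatives -/

section Translates

/-- The derivative of `a` in the direction `e` is bounded by `C` in `L²(U)`, by duality. -/
def DB (U : Set SpaceTime) (e : SpaceTime) (a : SpaceTime → ℝ) (C : ℝ≥0) : Prop :=
  ∀ θ, IsTest U θ → |∫ z, a z * dd e θ z| ≤ C * (eLpNorm θ 2 volume).toReal

variable {U V : Set SpaceTime} {e : SpaceTime} {a b : SpaceTime → ℝ} {C : ℝ≥0}

theorem WD.db (h : WD U e a b) (hb : MemLp b 2) (hC : eLpNorm b 2 volume ≤ C) : DB U e a C := by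
  intro θ hθ
  rw [h θ hθ, abs_neg]
  refine (abs_integral_mul_le hb hθ.memLp).trans ?_
  gcongr
  exact ENNReal.toReal_mono ENNReal.coe_ne_top hC

theorem DB.smul (h : DB U e a C) (s : ℝ) : DB U (s • e) a (‖s‖₊ * C) := by
  intro θ hθ
  have e1 : ∀ z, a z * dd (s • e) θ z = s * (a z * dd e θ z) := fun z => by
    simp only [dd, map_smul, smul_eq_mul]; ring
  simp only [e1]
  rw [integral_const_mul, abs_mul, NNReal.coe_mul, mul_assoc]
  exact mul_le_mul_of_nonneg_left (h θ hθ) (abs_nonneg s)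

theorem DB.space (ha : MemLp a 2) (h : ∀ j, DB U (ej j) a C) (y : R3) :
    DB U (0, y) a (3 * ‖y‖₊ * C) := by
  intro θ hθ
  have e1 : ((0, y) : SpaceTime) = ∑ j, y j • ej j := by
    have : y = ∑ j, y j • EuclideanSpace.single j (1 : ℝ) := by
      ext i; simp [Finset.sum_apply, Pi.single_apply]
    ext1
    · simp [ej, Prod.fst_sum]
    · rw [Prod.snd_sum]; simpa [ej] using this
  have e2 : ∀ z, a z * dd (0, y) θ z = ∑ j, a z * dd (y j • ej j) θ z := fun z => by
    rw [← Finset.mul_sum, e1]; simp only [dd, map_sum]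
  simp only [e2]
  rw [integral_finsetSum _ fun j _ => integrable_mul_of_memLp ha (hθ.dd _).memLp]
  refine (Finset.abs_sum_le_sum_abs _ _).trans ?_
  calc _ ≤ ∑ _j : Fin 3, ((‖y‖₊ * C : ℝ≥0) : ℝ) * (eLpNorm θ 2 volume).toReal := by
        refine Finset.sum_le_sum fun j _ => ((h j).smul (y j) θ hθ).trans ?_
        gcongr
        exact PiLp.nnnorm_apply_le y j
    _ = _ := by simp; ring

/-- The average along the segment from `0` to `-e`. -/
def segKer (e : SpaceTime) : TransKernel where
  A := ℝ
  ν := volume.restrict (Ioc 0 1)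
  m := (Ioc 0 1).indicator fun _ => 1
  τ := fun s => -(s • e)
  hm := (integrable_const _).indicator measurableSet_Ioc
  hτ := by fun_prop

theorem segKer_mass (e : SpaceTime) : (segKer e).mass = 1 := by
  change ∫⁻ s : ℝ in Ioc 0 1, ‖(Ioc (0 : ℝ) 1).indicator (fun _ => (1 : ℝ)) s‖ₑ = 1
  rw [setLIntegral_congr_fun (g := fun _ => 1) measurableSet_Ioc
    fun s hs => by simp only [indicator_of_mem hs, enorm_one]]
  simp

theorem segKer_avg_dd {θ : SpaceTime → ℝ} (hθ : ContDiff ℝ ∞ θ) (z : SpaceTime) :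
    (segKer e).avg (dd e θ) z = θ (z + e) - θ z := by
  change ∫ s : ℝ in Ioc 0 1, (Ioc (0 : ℝ) 1).indicator (fun _ => (1 : ℝ)) s •
    dd e θ (z - -(s • e)) = _
  rw [setIntegral_congr_fun (g := fun s : ℝ => dd e θ (z + s • e)) measurableSet_Ioc
    fun s hs => by simp only [indicator_of_mem hs, one_smul, sub_neg_eq_add], ← intervalIntegral.integral_of_le zero_le_one]
  have hd : ∀ s ∈ uIcc (0 : ℝ) 1, HasDerivAt (fun s : ℝ => θ (z + s • e)) (dd e θ (z + s • e)) s :=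
    fun s _ => by
      have h1 : HasDerivAt (fun s : ℝ => z + s • e) e s := by
        simpa using ((hasDerivAt_id s).smul_const e).const_add z
      exact ((hθ.differentiable (by simp)).differentiableAt.hasFDerivAt).comp_hasDerivAt s h1
  have hc : Continuous (fun s : ℝ => dd e θ (z + s • e)) :=
    (contDiff_dd hθ e).continuous.comp (by fun_prop)
  rw [intervalIntegral.integral_eq_sub_of_hasDerivAt hd (hc.intervalIntegrable _ _)]
  simp

theorem segKer_isTest {θ : SpaceTime → ℝ} (hθ : IsTest V θ) (hV : Near ‖e‖ V U) :
    IsTest U ((segKer e).avg θ) := by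
  refine hθ.avg (r := ‖e‖) ?_ hV (norm_nonneg _)
  intro (s : ℝ) hs
  have hs' : s ∈ Ioc (0 : ℝ) 1 := by
    by_contra h
    exact hs (indicator_of_notMem h (fun _ => (1 : ℝ)))
  change ‖-(s • e)‖ ≤ _
  rw [norm_neg, norm_smul, Real.norm_eq_abs, abs_of_pos hs'.1]
  exact mul_le_of_le_one_left (norm_nonneg _) hs'.2

/-- Transferred to the test function, the difference becomes θ(z + e) − θ(z), the derivative along e
of the average of θ over a segment. That average has mass one, so its L² norm does not exceed that
of θ. -/
theorem DB.translate {V' : Set SpaceTime} {r : ℝ} (h : DB U e a C) (ha : MemLp a 2)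
    (hV : Near ‖e‖ V U) (hV' : Bornology.IsBounded V') (hm : MeasurableSet V') (hr : 0 < r)
    (hn : Near r V' V) : ∫⁻ z in V', ‖a (z - e) - a z‖ₑ ^ 2 ≤ (C : ℝ≥0∞) ^ 2 := by
  have ha' : MemLp (fun z => a (z - e)) 2 :=
    ha.comp_measurePreserving (measurePreserving_sub_right volume e)
  refine lintegral_sq_le_of_dual (memLp_sub ha' ha) hV' hm hr hn fun θ hθ => ?_
  have ht := segKer_isTest (e := e) hθ hV
  have e1 : ∫ z, a (z - e) * θ z = ∫ z, a z * θ (z + e) := by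
    have := integral_sub_right_eq_self (μ := (volume : Measure SpaceTime))
      (fun z => a z * θ (z + e)) e
    simpa using this
  have hθe : MemLp (fun z => θ (z + e)) 2 :=
    hθ.memLp.comp_measurePreserving (measurePreserving_add_right volume e)
  have e2 : ∫ z, (a (z - e) - a z) * θ z = ∫ z, a z * dd e ((segKer e).avg θ) z := by
    simp only [sub_mul]
    rw [integral_sub (integrable_mul_of_memLp ha' hθ.memLp) (integrable_mul_of_memLp ha hθ.memLp),
      e1, ← integral_sub (integrable_mul_of_memLp ha hθe) (integrable_mul_of_memLp ha hθ.memLp)]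
    refine integral_congr_ae (Eventually.of_forall fun z => ?_)
    simp only
    rw [hθ.dd_avg, segKer_avg_dd hθ.smooth]
    ring
  rw [e2]
  refine (h _ ht).trans ?_
  gcongr
  · exact hθ.memLp.2.ne
  · refine ((segKer e).eLpNorm_avg_le hθ.aesm).trans ?_
    rw [segKer_mass, one_mul]

end Translates
-- A compactness criterion in L²
section Compactness
variable {φ : R3 → ℝ}

/-- A smooth kernel turns weak into strong convergence on bounded sets: the convolutions converge
pointwise, by testing with ρ(z − ·), and are uniformly bounded, so dominated convergence applies. -/
theorem tendsto_convKer_of_weak {ρ : SpaceTime → ℝ} {h1 : ContDiff ℝ ∞ ρ}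
    {hc : HasCompactSupport ρ} {a : ℕ → SpaceTime → ℝ}
    {a0 : SpaceTime → ℝ} (h : WeakL2 volume atTop a a0) {V : Set SpaceTime}
    (hV : Bornology.IsBounded V) :
    Tendsto (fun n => eLpNorm (fun z => (convKer ρ h1 hc).avg (a n) z -
      (convKer ρ h1 hc).avg a0 z) 2 (volume.restrict V)) atTop (𝓝 0) := by
  have hρm : ∀ z, MemLp (fun w => ρ (z - w)) 2 volume := fun z =>
    (h1.continuous.memLp_of_hasCompactSupport hc
      (p := 2)).comp_measurePreserving (Measure.measurePreserving_sub_left volume z)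
  have hρn : ∀ z, eLpNorm (fun w => ρ (z - w)) 2 volume = eLpNorm ρ 2 volume := fun z =>
    eLpNorm_comp_measurePreserving h1.continuous.aestronglyMeasurable
      (Measure.measurePreserving_sub_left volume z)
  have hfin : eLpNorm ρ 2 volume ≠ ⊤ := by rw [← hρn 0]; exact (hρm 0).2.ne
  have e : ∀ F z, (convKer ρ h1 hc).avg F z = ∫ w, F w * ρ (z - w) := fun F z => by
    rw [convKer_avg_apply]
    simp only [mul_comm]
  have hp : ∀ z, Tendsto (fun n => (convKer ρ h1 hc).avg (a n) z) atTop (𝓝 ((convKer ρ h1 hc).avg a0 z)) :=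
    fun z => by
      simp only [e]
      exact h.tendsto _ (hρm z)
  obtain ⟨C, hC⟩ := h.bdd
  set M : ℝ≥0∞ := ENNReal.ofReal ((C : ℝ) * (eLpNorm ρ 2 volume).toReal +
    (eLpNorm a0 2 volume).toReal * (eLpNorm ρ 2 volume).toReal) with hM
  have hbd : ∀ᶠ n in atTop, ∀ z,
      ‖(convKer ρ h1 hc).avg (a n) z - (convKer ρ h1 hc).avg a0 z‖ₑ ≤ M := by
    filter_upwards [hC] with n hn z
    rw [← ofReal_norm]
    refine ENNReal.ofReal_le_ofReal ((norm_sub_le _ _).trans ?_)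
    rw [e, e]
    have g1 := abs_integral_mul_le (h.mem n) (hρm z)
    have g2 := abs_integral_mul_le h.mem0 (hρm z)
    rw [hρn] at g1 g2
    refine add_le_add (g1.trans ?_) g2
    gcongr
    exact ENNReal.toReal_mono ENNReal.coe_ne_top hn
  have hcont : ∀ F, MemLp F 2 volume → Continuous ((convKer ρ h1 hc).avg F) := fun F hF =>
    (contDiff_convKer (hF.locallyIntegrable (by norm_num))).continuous
  have hl : Tendsto (fun n => ∫⁻ z in V,
      ‖(convKer ρ h1 hc).avg (a n) z - (convKer ρ h1 hc).avg a0 z‖ₑ ^ 2) atTop (𝓝 (∫⁻ _ in V, 0)) := by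
    refine tendsto_lintegral_filter_of_dominated_convergence (fun _ => M ^ 2)
      (Eventually.of_forall fun n => ?_) ?_ ?_ ?_
    · exact (((hcont _ (h.mem n)).sub (hcont _ h.mem0)).measurable.enorm.pow_const 2)
    · filter_upwards [hbd] with n hn
      filter_upwards with z
      gcongr
      exact hn z
    · rw [lintegral_const, Measure.restrict_apply_univ]
      exact ENNReal.mul_ne_top (by finiteness) hV.measure_lt_top.ne
    · filter_upwards with z
      have g1 := ((hp z).sub_const ((convKer ρ h1 hc).avg a0 z)).enorm
      have h2 := ENNReal.Tendsto.pow (n := 2) g1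
      simpa using h2
  rw [lintegral_zero] at hl
  have h3 := (ENNReal.continuous_rpow_const (y := (1 / 2 : ℝ))).tendsto 0 |>.comp hl
  rw [ENNReal.zero_rpow_of_pos (by norm_num)] at h3
  refine h3.congr fun n => ?_
  simp only [Function.comp_apply]
  rw [← eLpNorm_two_sq, ← ENNReal.rpow_natCast, ← ENNReal.rpow_mul]
  norm_num

/-- Compactness in `L²` from bounds on space derivatives, and on time derivatives of space
mollifications. -/
theorem WeakL2.strongL2_of_db (hφ : IsMollifier φ) {a : ℕ → SpaceTime → ℝ} {a0 : SpaceTime → ℝ}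
    (h : WeakL2 volume atTop a a0) {V U : Set SpaceTime} {r ε0 : ℝ} {C : ℝ≥0}
    (hV : Bornology.IsBounded V) (hVm : MeasurableSet V) (hr : 0 < r) (hε0 : 0 < ε0)
    (hVU : Near r V U) (hs : ∀ n j, DB U (ej j) (a n) C)
    (ht : ∀ ε, 0 < ε → ε < ε0 → ∃ C' : ℝ≥0, ∀ n, DB U et ((spaceMol hφ ε).avg (a n)) C') :
    StrongL2 volume atTop (fun n => V.indicator (a n)) (V.indicator a0) := by
  refine ⟨fun n => (h.mem n).indicator hVm, h.mem0.indicator hVm, ?_⟩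
  have e0 : ∀ n, eLpNorm (fun z => V.indicator (a n) z - V.indicator a0 z) 2 volume =
      eLpNorm (fun z => a n z - a0 z) 2 (volume.restrict V) := fun n => by
    rw [← eLpNorm_indicator_eq_eLpNorm_restrict hVm]
    congr 1
    ext z
    by_cases hz : z ∈ V <;> simp [hz]
  simp only [e0]
  obtain ⟨ρ0, hρ0, h0⟩ := exists_radius hφ
  -- Half of the margin serves the duality argument, whose test functions leave V; the other half
  -- serves the translations.
  have hV1 : Near (r / 2) V (nbhd (r / 2) V) := near_nbhd _ _
  have hV2 : Near (r / 2) (nbhd (r / 2) V) U := hVU.nbhd (by linarith)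
  have sqle : ∀ {f : SpaceTime → ℝ} {X : ℝ≥0∞}, ∫⁻ z in V, ‖f z‖ₑ ^ 2 ≤ X ^ 2 →
      eLpNorm f 2 (volume.restrict V) ≤ X := fun {f X} hf => by
    rw [← eLpNorm_two_sq] at hf
    exact (ENNReal.pow_le_pow_left_iff two_ne_zero).1 hf
  rw [ENNReal.tendsto_nhds_zero]
  intro η hη
  -- Five errors are summed: a n to its space mollification, then to its space-time mollification,
  -- then to that of a0, and back to a0 through the same two stages.
  have hη5 : 0 < η / 5 := ENNReal.div_pos hη.ne' (by norm_num)
  -- the space scale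
  have S1 : ∀ᶠ ε in 𝓝[>] (0 : ℝ), 0 < ε ∧ ε < ε0 ∧ (∀ n, eLpNorm (fun z =>
      (spaceMol hφ ε).avg (a n) z - a n z) 2 (volume.restrict V) ≤ η / 5) ∧
      eLpNorm (fun z => (spaceMol hφ ε).avg a0 z - a0 z) 2 (volume.restrict V) ≤ η / 5 := by
    have t1 : Tendsto (fun ε : ℝ => ε * ρ0) (𝓝[>] 0) (𝓝 0) := by
      have : Tendsto (fun ε : ℝ => ε * ρ0) (𝓝 0) (𝓝 (0 * ρ0)) := by
        exact (continuous_id.mul continuous_const).tendsto 0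
      rw [zero_mul] at this
      exact this.mono_left nhdsWithin_le_nhds
    have t2 : Tendsto (fun ε : ℝ => (molMass φ : ℝ≥0∞) * ENNReal.ofReal (3 * (ε * ρ0) * C))
        (𝓝[>] 0) (𝓝 0) := by
      have := ENNReal.Tendsto.const_mul (a := (molMass φ : ℝ≥0∞))
        (ENNReal.tendsto_ofReal ((t1.const_mul 3).mul_const (C : ℝ))) (Or.inr ENNReal.coe_ne_top)
      simpa using this
    have hpos : ∀ᶠ ε : ℝ in 𝓝[>] 0, 0 < ε := self_mem_nhdsWithin
    obtain ⟨r1, hr1, hr1'⟩ := exists_translate_le h.mem0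
      (η := (η / 5 / (molMass φ + 1)) ^ 2) (by
        have : η / 5 / (molMass φ + 1) ≠ 0 := ENNReal.div_ne_zero.2 ⟨hη5.ne', by finiteness⟩
        exact pow_ne_zero 2 this)
    filter_upwards [hpos, t1.eventually (gt_mem_nhds (half_pos hr)),
      t1.eventually (gt_mem_nhds hr1), t2.eventually (gt_mem_nhds hη5),
      nhdsWithin_le_nhds (gt_mem_nhds hε0)] with ε hε g1 g2 g3 g4
    refine ⟨hε, g4, fun n => ?_, ?_⟩
    · refine (sqle (X := (molMass φ : ℝ≥0∞) * ENNReal.ofReal (3 * (ε * ρ0) * C)) ?_).trans g3.le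
      rw [mul_pow, ← spaceMol_mass hφ hε]
      refine (spaceMol hφ ε).lintegral_sq_avg_sub_le (h.mem n) (spaceMol_integral hφ hε) ?_
      intro (y : R3) hy
      have hy' := spaceMol_inBall hφ h0 hε y hy
      have hDB := DB.space (h.mem n) (hs n) y
      have := hDB.translate (V := nbhd (r / 2) V) (h.mem n) (hV2.mono (hy'.trans g1.le)) hV hVm
        (half_pos hr) hV1
      refine this.trans ?_
      gcongr
      rw [← ENNReal.ofReal_coe_nnreal]
      refine ENNReal.ofReal_le_ofReal ?_
      have hyn : ‖(y : R3)‖ ≤ ε * ρ0 := by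
        refine le_trans ?_ hy'
        change ‖(y : R3)‖ ≤ ‖((0, y) : SpaceTime)‖
        rw [Prod.norm_def]; exact le_max_right _ _
      push_cast
      gcongr
    · refine sqle (X := η / 5) ?_
      refine ((spaceMol hφ ε).lintegral_sq_avg_sub_le h.mem0 (spaceMol_integral hφ hε)
        (B := (η / 5 / (molMass φ + 1)) ^ 2) ?_).trans ?_
      · intro y hy
        exact (setLIntegral_le_lintegral _ _).trans
          (hr1' _ ((spaceMol_inBall hφ h0 hε y hy).trans g2.le))
      · rw [spaceMol_mass hφ hε, ← mul_pow]
        gcongr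
        calc (molMass φ : ℝ≥0∞) * (η / 5 / (molMass φ + 1))
            ≤ (molMass φ + 1) * (η / 5 / (molMass φ + 1)) := by gcongr; exact le_self_add
          _ ≤ η / 5 := ENNReal.mul_div_le
  -- The space scale is fixed before the time scale, because the bound on the time derivative of the
  -- mollified sequence depends on ε.
  obtain ⟨ε, hε, hεε0, A1, A2⟩ := S1.exists
  obtain ⟨C', hC'⟩ := ht ε hε hεε0
  have mS : ∀ {F : SpaceTime → ℝ}, MemLp F 2 volume → MemLp ((spaceMol hφ ε).avg F) 2 volume :=
    fun hF => (spaceMol hφ ε).memLp_avg hF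
  -- the time scale
  have S2 : ∀ᶠ δ in 𝓝[>] (0 : ℝ), (∀ n, eLpNorm (fun z => (mol hφ δ ε).avg (a n) z -
      (spaceMol hφ ε).avg (a n) z) 2 (volume.restrict V) ≤ η / 5) ∧
      eLpNorm (fun z => (mol hφ δ ε).avg a0 z - (spaceMol hφ ε).avg a0 z) 2
        (volume.restrict V) ≤ η / 5 := by
    have hpos : ∀ᶠ ε : ℝ in 𝓝[>] 0, 0 < ε := self_mem_nhdsWithin
    have t2 : Tendsto (fun δ : ℝ => ENNReal.ofReal (δ * C')) (𝓝[>] 0) (𝓝 0) := by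
      have : Tendsto (fun δ : ℝ => δ * (C' : ℝ)) (𝓝[>] 0) (𝓝 (0 * C')) :=
        ((continuous_id.mul continuous_const).tendsto 0).mono_left nhdsWithin_le_nhds
      simpa using ENNReal.tendsto_ofReal this
    obtain ⟨r1, hr1, hr1'⟩ := exists_translate_le (mS h.mem0) (η := (η / 5) ^ 2)
      (pow_ne_zero 2 hη5.ne')
    filter_upwards [hpos, nhdsWithin_le_nhds (gt_mem_nhds (half_pos hr)),
      nhdsWithin_le_nhds (gt_mem_nhds hr1), t2.eventually (gt_mem_nhds hη5)] with δ hδ g1 g2 g3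
    have ec : ∀ {F : SpaceTime → ℝ}, MemLp F 2 volume → eLpNorm (fun z => (mol hφ δ ε).avg F z -
        (spaceMol hφ ε).avg F z) 2 (volume.restrict V) = eLpNorm (fun z =>
        (timeMol δ).avg ((spaceMol hφ ε).avg F) z - (spaceMol hφ ε).avg F z) 2
          (volume.restrict V) := fun hF => by
      refine eLpNorm_congr_ae (ae_restrict_of_ae ?_)
      filter_upwards [mol_ae_eq hφ (δ := δ) (ε := ε) hF] with z hz
      rw [hz]
    refine ⟨fun n => ?_, ?_⟩
    · rw [ec (h.mem n)]
      refine (sqle (X := ENNReal.ofReal (δ * C')) ?_).trans g3.le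
      refine ((timeMol δ).lintegral_sq_avg_sub_le (mS (h.mem n)) (timeMol_integral hδ)
        (B := ENNReal.ofReal (δ * C') ^ 2) ?_).trans (by rw [timeMol_mass hδ]; simp)
      intro (s : ℝ) hs'
      have hs2 := timeMol_inBall hδ s hs'
      have hτ : (timeMol δ).τ s = s • et := by
        change ((s, 0) : SpaceTime) = s • et
        simp [et]
      rw [hτ] at hs2 ⊢
      refine (((hC' n).smul s).translate (V := nbhd (r / 2) V) (mS (h.mem n))
        (hV2.mono (hs2.trans g1.le)) hV hVm (half_pos hr) hV1).trans ?_
      gcongr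
      rw [← ENNReal.ofReal_coe_nnreal]
      refine ENNReal.ofReal_le_ofReal ?_
      push_cast
      gcongr
      refine le_trans (le_of_eq ?_) hs2
      simp [et, Prod.norm_def]
    · rw [ec h.mem0]
      refine sqle ?_
      refine ((timeMol δ).lintegral_sq_avg_sub_le (mS h.mem0) (timeMol_integral hδ)
        (B := (η / 5) ^ 2) ?_).trans (by rw [timeMol_mass hδ]; simp)
      intro s hs'
      exact (setLIntegral_le_lintegral _ _).trans
          (hr1' _ ((timeMol_inBall hδ s hs').trans g2.le))
  obtain ⟨δ, B1, B2⟩ := S2.exists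
  have S3 := ENNReal.tendsto_nhds_zero.1 (tendsto_convKer_of_weak
    (h1 := contDiff_rho hφ δ ε) (hc := hasCompactSupport_rho hφ δ ε) h hV) (η / 5) hη5
  filter_upwards [S3] with n hn
  have mM : ∀ {F : SpaceTime → ℝ}, MemLp F 2 volume → MemLp ((mol hφ δ ε).avg F) 2 volume :=
    fun hF => (mol hφ δ ε).memLp_avg hF
  have tri : ∀ {f g k : SpaceTime → ℝ}, MemLp f 2 volume → MemLp g 2 volume → MemLp k 2 volume →
      eLpNorm (fun z => f z - k z) 2 (volume.restrict V) ≤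
      eLpNorm (fun z => f z - g z) 2 (volume.restrict V) +
        eLpNorm (fun z => g z - k z) 2 (volume.restrict V) := fun {f g k} hf hg hk => by
    have := eLpNorm_add_le (μ := volume.restrict V) (memLp_sub hf hg).1.restrict
      (memLp_sub hg hk).1.restrict (p := 2) one_le_two
    refine le_trans (le_of_eq ?_) this
    congr 1
    ext z; simp
  have sym : ∀ f g : SpaceTime → ℝ, eLpNorm (fun z => f z - g z) 2 (volume.restrict V) =
      eLpNorm (fun z => g z - f z) 2 (volume.restrict V) := fun f g =>
    eLpNorm_sub_comm f g 2 _
  calc eLpNorm (fun z => a n z - a0 z) 2 (volume.restrict V)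
      ≤ η / 5 + (η / 5 + (η / 5 + (η / 5 + η / 5))) := by
        refine (tri (h.mem n) (mS (h.mem n)) h.mem0).trans (add_le_add ?_ ?_)
        · rw [sym]; exact A1 n
        refine (tri (mS (h.mem n)) (mM (h.mem n)) h.mem0).trans (add_le_add ?_ ?_)
        · rw [sym]; exact B1 n
        refine (tri (mM (h.mem n)) (mM h.mem0) h.mem0).trans (add_le_add hn ?_)
        exact (tri (mM h.mem0) (mS h.mem0) h.mem0).trans (add_le_add B2 A2)
    _ = 5 * (η / 5) := by ring
    _ ≤ η := ENNReal.mul_div_le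

end Compactness

/-! ### Integration by parts and product rules for weak derivatives -/

section Parts
variable {U V : Set SpaceTime} {e : SpaceTime}

theorem IsTest.exists_near {ψ : SpaceTime → ℝ} (hψ : IsTest U ψ) (hU : IsOpen U) :
    ∃ r > 0, Near r (tsupport ψ) U := by
  obtain ⟨r, hr, h⟩ := hψ.compact.isCompact.exists_cthickening_subset_open hU hψ.supp
  refine ⟨r, hr, fun z hz w hw => h (Metric.mem_cthickening_of_dist_le w z r _ hz ?_)⟩
  rwa [dist_comm, dist_eq_norm]

theorem IsTest.tsupport {ψ : SpaceTime → ℝ} (hψ : IsTest U ψ) : IsTest (tsupport ψ) ψ :=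
  ⟨hψ.1, hψ.2, subset_rfl⟩

/-- Approximation by smooth functions, together with the weak derivatives. -/
theorem exists_smooth_approx {ι : Type*} {e : ι → SpaceTime} {q : SpaceTime → ℝ}
    {D : ι → SpaceTime → ℝ} {r : ℝ} (hq : MemLp q 2) (hD : ∀ j, MemLp (D j) 2)
    (hwd : ∀ j, WD U (e j) q (D j)) (hr : 0 < r) (hV : Near r V U) :
    ∃ (qs : ℕ → SpaceTime → ℝ) (Ds : ι → ℕ → SpaceTime → ℝ), (∀ n, ContDiff ℝ ∞ (qs n)) ∧
      StrongL2 volume atTop qs q ∧ (∀ j, StrongL2 volume atTop (Ds j) (D j)) ∧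
      ∀ n j, ∀ z ∈ V, dd (e j) (qs n) z = Ds j n z := by
  obtain ⟨φ, hφ⟩ := exists_isMollifier
  obtain ⟨ρ0, hρ0, h1⟩ := exists_radius hφ
  have hb : ∀ n, (mol hφ (scale n) (scale n)).InBall (max (scale n) (scale n * ρ0)) := fun n =>
    mol_inBall hφ h1 (scale_pos n) (scale_pos n)
  have ht : Tendsto (fun n => max (scale n) (scale n * ρ0)) atTop (𝓝 0) := by
    have := tendsto_scale.max (tendsto_scale.mul_const ρ0)
    simpa using this
  obtain ⟨N, hN⟩ := eventually_atTop.1 (ht.eventually (gt_mem_nhds hr))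
  have hS : ∀ {F : SpaceTime → ℝ}, MemLp F 2 volume → StrongL2 volume atTop
      (fun n => (mol hφ (scale (n + N)) (scale (n + N))).avg F) F := fun hF =>
    strongL2_avg_seq (fun n => hb (n + N)) ((tendsto_add_atTop_iff_nat N).2 ht) (C := molMass φ)
      (fun n => (mol_mass hφ (scale_pos _) (scale_pos _)).le)
      (fun n => mol_integral hφ (scale_pos _) (scale_pos _)) hF
  refine ⟨fun n => (mol hφ (scale (n + N)) (scale (n + N))).avg q,
    fun j n => (mol hφ (scale (n + N)) (scale (n + N))).avg (D j), fun n => contDiff_mol hφ hq,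
    hS hq, fun j => hS (hD j), fun n j z hz => ?_⟩
  exact (hwd j).dd_convKer hq (hb _) fun w hw => hV z hz w (hw.trans (hN _ (by omega)).le)

/-- `div c = 0` in the sense of distributions on `U`. -/
def DivFree (U : Set SpaceTime) (c : Fin 3 → SpaceTime → ℝ) : Prop :=
  ∀ ψ, IsTest U ψ → ∑ j, ∫ z, c j z * dd (ej j) ψ z = 0

theorem DivFree.mono {c : Fin 3 → SpaceTime → ℝ} (h : DivFree U c) (hV : V ⊆ U) : DivFree V c :=
  fun ψ hψ => h ψ (hψ.mono hV)

theorem IsTest.ae_bdd {ψ : SpaceTime → ℝ} (hψ : IsTest U ψ) : ∃ M, ∀ᵐ z, |ψ z| ≤ M :=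
  let ⟨M, hM⟩ := hψ.bdd; ⟨M, Eventually.of_forall hM⟩

theorem IsTest.eq_zero' {ψ : SpaceTime → ℝ} {z : SpaceTime} (hz : z ∉ _root_.tsupport ψ) :
    ψ z = 0 := image_eq_zero_of_notMem_tsupport hz

theorem DivFree.sum_dd_convKer {c : Fin 3 → SpaceTime → ℝ} {ρ : SpaceTime → ℝ}
    {h : ContDiff ℝ ∞ ρ} {hρ : HasCompactSupport ρ} {r : ℝ} (hc : DivFree U c)
    (mc : ∀ j, MemLp (c j) 2) (hr : (convKer ρ h hρ).InBall r) {z : SpaceTime}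
    (hz : ∀ w, ‖z - w‖ ≤ r → w ∈ U) :
    ∑ j, dd (ej j) ((convKer ρ h hρ).avg (c j)) z = 0 := by
  have := hc _ (isTest_reflect hr hz)
  simp_rw [dd_reflect h] at this
  simp only [mul_neg, integral_neg, Finset.sum_neg_distrib, neg_eq_zero] at this
  rw [← this]
  refine Finset.sum_congr rfl fun j _ => ?_
  rw [dd_convKer ((mc j).locallyIntegrable (by norm_num))]
  simp only [mul_comm]

theorem IsTest.smooth_mul {ψ χ : SpaceTime → ℝ} (h : IsTest U ψ) (h' : ContDiff ℝ ∞ χ) :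
    IsTest U (fun z => χ z * ψ z) := by
  simpa only [mul_comm] using h.mul_smooth h'

/-- If q were smooth, qψ would be a test function for div c = 0 and the Leibniz rule would finish.
The general case follows by mollifying q, whose derivative is the mollified D on the support of ψ.
-/
theorem DivFree.parts {c : Fin 3 → SpaceTime → ℝ} {q ψ : SpaceTime → ℝ}
    {D : Fin 3 → SpaceTime → ℝ} (hU : IsOpen U) (hc : DivFree U c) (mc : ∀ j, MemLp (c j) 2)
    (hq : MemLp q 2) (hD : ∀ j, MemLp (D j) 2) (hwd : ∀ j, WD U (ej j) q (D j))
    (hψ : IsTest U ψ) :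
    ∑ j, ∫ z, c j z * (q z * dd (ej j) ψ z) = - ∑ j, ∫ z, c j z * (D j z * ψ z) := by
  obtain ⟨r, hr, hn⟩ := hψ.exists_near hU
  obtain ⟨qs, Ds, hs, h1, h2, h3⟩ := exists_smooth_approx hq hD hwd hr hn
  obtain ⟨M, hM⟩ := hψ.ae_bdd
  choose M' hM' using fun j => (hψ.dd (ej j)).ae_bdd
  have L1 : Tendsto (fun n => ∑ j, ∫ z, c j z * (qs n z * dd (ej j) ψ z)) atTop
      (𝓝 (∑ j, ∫ z, c j z * (q z * dd (ej j) ψ z))) := tendsto_finsetSum _ fun j _ =>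
    (StrongL2.const (mc j)).integral_mul (h1.mul_bdd (hψ.dd (ej j)).aesm (hM' j))
  have L2 : Tendsto (fun n => ∑ j, ∫ z, c j z * (Ds j n z * ψ z)) atTop
      (𝓝 (∑ j, ∫ z, c j z * (D j z * ψ z))) := tendsto_finsetSum _ fun j _ =>
    (StrongL2.const (mc j)).integral_mul ((h2 j).mul_bdd hψ.aesm hM)
  have e1 : ∀ n, (∑ j, ∫ z, c j z * (qs n z * dd (ej j) ψ z)) =
      - ∑ j, ∫ z, c j z * (Ds j n z * ψ z) := fun n => by
    have := hc _ (hψ.mul_smooth (hs n))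
    rw [eq_neg_iff_add_eq_zero, ← this, ← Finset.sum_add_distrib]
    refine Finset.sum_congr rfl fun j _ => ?_
    rw [← integral_add (integrable_mul_of_memLp (mc j)
      (memLp_mul_bdd (h1.mem n) (hψ.dd (ej j)).aesm (hM' j))) (integrable_mul_of_memLp (mc j)
      (memLp_mul_bdd ((h2 j).mem n) hψ.aesm hM))]
    refine integral_congr_ae (Eventually.of_forall fun z => ?_)
    simp only
    rw [dd_mul hψ.differentiable ((hs n).differentiable (by simp))]
    by_cases hz : z ∈ _root_.tsupport ψ
    · rw [h3 n j z hz]; ring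
    · rw [IsTest.eq_zero' hz]; ring
  simp only [e1] at L1
  exact tendsto_nhds_unique L1 L2.neg

/-- Only a is regularized: for smooth a the rule comes from testing k with aψ, and the bounds on k
and Dk keep the products convergent in L². -/
theorem WD.mul_bdd {a b k Dk : SpaceTime → ℝ} {M : ℝ} (hU : IsOpen U) (h : WD U e a b)
    (h' : WD U e k Dk) (ha : MemLp a 2) (hb : MemLp b 2) (hk : MemLp k 2) (hDk : MemLp Dk 2)
    (hM : ∀ᵐ z, |k z| ≤ M) (hM' : ∀ᵐ z, |Dk z| ≤ M) :
    WD U e (fun z => a z * k z) (fun z => b z * k z + a z * Dk z) := by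
  intro ψ hψ
  obtain ⟨r, hr, hn⟩ := hψ.exists_near hU
  obtain ⟨qs, Ds, hs, h1, h2, h3⟩ := exists_smooth_approx (ι := Unit) (e := fun _ => e)
    (D := fun _ => b) ha (fun _ => hb) (fun _ => h) hr hn
  obtain ⟨N, hN⟩ := hψ.ae_bdd
  obtain ⟨N', hN'⟩ := (hψ.dd e).ae_bdd
  have L1 := (h1.mul_bdd hk.1 hM).integral_mul (StrongL2.const (l := atTop) (hψ.dd e).memLp)
  have L2 := (((h2 ()).mul_bdd hk.1 hM).add (h1.mul_bdd hDk.1 hM')).integral_mul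
    (StrongL2.const (l := atTop) hψ.memLp)
  have e1 : ∀ n, ∫ z, qs n z * k z * dd e ψ z =
      - ∫ z, (Ds () n z * k z + qs n z * Dk z) * ψ z := fun n => by
    have m1 := memLp_mul_bdd (h1.mem n) (hψ.dd e).aesm hN'
    have m2 := memLp_mul_bdd ((h2 ()).mem n) hψ.aesm hN
    have m3 := memLp_mul_bdd (h1.mem n) hψ.aesm hN
    have := h' _ (hψ.mul_smooth (hs n))
    have e2 : ∫ z, k z * dd e (fun z => ψ z * qs n z) z = (∫ z, k z * (qs n z * dd e ψ z)) +
        ∫ z, k z * (Ds () n z * ψ z) := by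
      rw [← integral_add (integrable_mul_of_memLp hk m1) (integrable_mul_of_memLp hk m2)]
      refine integral_congr_ae (Eventually.of_forall fun z => ?_)
      simp only
      rw [dd_mul hψ.differentiable ((hs n).differentiable (by simp))]
      by_cases hz : z ∈ _root_.tsupport ψ
      · rw [h3 n () z hz]; ring
      · rw [IsTest.eq_zero' hz]; ring
    have e3 : ∫ z, (Ds () n z * k z + qs n z * Dk z) * ψ z = (∫ z, k z * (Ds () n z * ψ z)) +
        ∫ z, Dk z * (ψ z * qs n z) := by
      rw [← integral_add (integrable_mul_of_memLp hk m2)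
        (by simpa only [mul_comm (ψ _)] using integrable_mul_of_memLp hDk m3)]
      refine integral_congr_ae (Eventually.of_forall fun z => ?_)
      simp only; ring
    have e4 : ∫ z, qs n z * k z * dd e ψ z = ∫ z, k z * (qs n z * dd e ψ z) :=
      integral_congr_ae (Eventually.of_forall fun z => by simp only; ring)
    rw [e4, e3]
    linarith
  simp only [e1] at L1
  exact tendsto_nhds_unique L1 L2.neg

end Parts

/-! ### Compactly supported functions with weak space gradient in L² -/

section H1

/-- Compactly supported functions of `L²`, with weak space derivatives in `L²`. -/
structure IsH1 (θ : SpaceTime → ℝ) (D : Fin 3 → SpaceTime → ℝ) : Prop where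
  mem : MemLp θ 2
  memD : ∀ j, MemLp (D j) 2
  wd : ∀ j, WD univ (ej j) θ (D j)
  compact : HasCompactSupport θ

theorem IsH1.sub {θ θ' : SpaceTime → ℝ} {D D' : Fin 3 → SpaceTime → ℝ} (h : IsH1 θ D)
    (h' : IsH1 θ' D') : IsH1 (fun z => θ z - θ' z) (fun j z => D j z - D' j z) :=
  ⟨memLp_sub h.mem h'.mem, fun j => memLp_sub (h.memD j) (h'.memD j),
    fun j => (h.wd j).sub (h'.wd j) h.mem (h.memD j) h'.mem (h'.memD j),
    h.compact.sub h'.compact⟩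

theorem IsH1.add {θ θ' : SpaceTime → ℝ} {D D' : Fin 3 → SpaceTime → ℝ} (h : IsH1 θ D)
    (h' : IsH1 θ' D') : IsH1 (fun z => θ z + θ' z) (fun j z => D j z + D' j z) :=
  ⟨memLp_add h.mem h'.mem, fun j => memLp_add (h.memD j) (h'.memD j),
    fun j => (h.wd j).add (h'.wd j) h.mem (h.memD j) h'.mem (h'.memD j),
    h.compact.add h'.compact⟩

theorem IsH1.zero : IsH1 (fun _ => 0) (fun _ _ => 0) :=
  ⟨MemLp.zero, fun _ => MemLp.zero, fun j ψ _ => by simp, HasCompactSupport.zero⟩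

theorem IsH1.sum {κ : Type*} (s : Finset κ) {θ : κ → SpaceTime → ℝ}
    {D : κ → Fin 3 → SpaceTime → ℝ} (h : ∀ k, IsH1 (θ k) (D k)) :
    IsH1 (fun z => ∑ k ∈ s, θ k z) (fun j z => ∑ k ∈ s, D k j z) := by
  classical
  induction s using Finset.induction_on with
  | empty => simpa using IsH1.zero
  | insert k s hk ih => simp only [Finset.sum_insert hk]; exact (h k).add ih

theorem IsTest.isH1 {U : Set SpaceTime} {θ : SpaceTime → ℝ} (h : IsTest U θ) :
    IsH1 θ (fun j => NavierStokes.dd (ej j) θ) :=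
  ⟨h.memLp, fun _ => (h.dd _).memLp, fun _ _ hψ => integral_mul_dd h.smooth hψ, h.compact⟩

theorem WD.isH1 {U : Set SpaceTime} {a χ : SpaceTime → ℝ} {D : Fin 3 → SpaceTime → ℝ}
    (h : ∀ j, WD U (ej j) a (D j)) (ha : MemLp a 2) (hD : ∀ j, MemLp (D j) 2) (hχ : IsTest U χ) :
    IsH1 (fun z => a z * χ z) (fun j z => D j z * χ z + a z * dd (ej j) χ z) := by
  obtain ⟨M, hM⟩ := hχ.ae_bdd
  refine ⟨memLp_mul_bdd ha hχ.aesm hM, fun j => ?_, fun j => (h j).mul_test ha (hD j) hχ,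
    hχ.compact.mul_left⟩
  obtain ⟨M', hM'⟩ := (hχ.dd (ej j)).ae_bdd
  exact memLp_add (memLp_mul_bdd (hD j) hχ.aesm hM) (memLp_mul_bdd ha (hχ.dd (ej j)).aesm hM')

theorem IsH1.avg {θ : SpaceTime → ℝ} {D : Fin 3 → SpaceTime → ℝ} (h : IsH1 θ D)
    {k : TransKernel} {r : ℝ} (hk : k.InBall r) (hr : 0 ≤ r) :
    IsH1 (k.avg θ) (fun j => k.avg (D j)) :=
  ⟨k.memLp_avg h.mem, fun j => k.memLp_avg (h.memD j),
    fun j => (h.wd j).avg h.mem (h.memD j) hk hr (fun _ _ _ _ => mem_univ _),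
    k.hasCompactSupport_avg hk h.compact⟩

theorem lintegral_sum_sq {D : Fin 3 → SpaceTime → ℝ} (hD : ∀ j, MemLp (D j) 2) :
    ∫⁻ z, ∑ j, ‖D j z‖ₑ ^ 2 = ∑ j, eLpNorm (D j) 2 volume ^ 2 := by
  rw [lintegral_finsetSum' _ (fun j _ => (hD j).1.enorm.pow_const 2)]
  simp only [eLpNorm_two_sq]

theorem IsH1.nL24_pow_le {θ : SpaceTime → ℝ} {D : Fin 3 → SpaceTime → ℝ} (h : IsH1 θ D) :
    nL24 θ ^ 4 ≤ nL24Const * eLpNorm θ 2 volume ^ 2 * (∑ j, eLpNorm (D j) 2 volume ^ 2) ^ 3 := by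
  rw [eLpNorm_two_sq, ← lintegral_sum_sq h.memD]
  exact nL24_le h.mem h.memD h.wd h.compact

theorem IsH1.nL24_ne_top {θ : SpaceTime → ℝ} {D : Fin 3 → SpaceTime → ℝ} (h : IsH1 θ D) :
    nL24 θ ≠ ⊤ := by
  intro h1
  have h2 := h.nL24_pow_le
  rw [h1, ENNReal.top_pow (by norm_num), top_le_iff] at h2
  refine ENNReal.mul_ne_top (ENNReal.mul_ne_top nL24Const_ne_top
    (ENNReal.pow_ne_top h.mem.2.ne)) (ENNReal.pow_ne_top ?_) h2
  exact ENNReal.sum_ne_top.2 fun j _ => ENNReal.pow_ne_top (h.memD j).2.ne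

/-- Strong convergence in `L²`, with bounded weak space derivatives. -/
structure H1Conv {ι : Type*} (l : Filter ι) (θ : ι → SpaceTime → ℝ)
    (D : ι → Fin 3 → SpaceTime → ℝ) (θ0 : SpaceTime → ℝ) (D0 : Fin 3 → SpaceTime → ℝ) : Prop where
  isH1 : ∀ n, IsH1 (θ n) (D n)
  isH1_lim : IsH1 θ0 D0
  strong : StrongL2 volume l θ θ0
  bdd : ∃ C : ℝ≥0, ∀ᶠ n in l, ∀ j, eLpNorm (D n j) 2 volume ≤ C

/-- The interpolation inequality carries a positive power of the L² norm, which tends to zero while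
the gradients stay bounded. No convergence of gradients is needed. -/
theorem H1Conv.tendsto_nL24 {ι : Type*} {l : Filter ι} {θ : ι → SpaceTime → ℝ}
    {D : ι → Fin 3 → SpaceTime → ℝ} {θ0 : SpaceTime → ℝ} {D0 : Fin 3 → SpaceTime → ℝ}
    (h : H1Conv l θ D θ0 D0) : Tendsto (fun n => nL24 (fun z => θ n z - θ0 z)) l (𝓝 0) := by
  obtain ⟨C, hC⟩ := h.bdd
  set B : ℝ≥0∞ := (∑ j, (C + eLpNorm (D0 j) 2 volume) ^ 2) ^ 3 with hB
  have hBt : B ≠ ⊤ := by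
    refine ENNReal.pow_ne_top (ENNReal.sum_ne_top.2 fun j _ => ENNReal.pow_ne_top ?_)
    have := (h.isH1_lim.memD j).2.ne
    finiteness
  have h1 : Tendsto (fun n => nL24 (fun z => θ n z - θ0 z) ^ 4) l (𝓝 0) := by
    have t : Tendsto (fun n => nL24Const * eLpNorm (fun z => θ n z - θ0 z) 2 volume ^ 2 * B) l
        (𝓝 0) := by
      have t1 := ENNReal.Tendsto.pow (n := 2) h.strong.tendsto
      have t2 := ENNReal.Tendsto.const_mul (a := nL24Const) t1 (Or.inr nL24Const_ne_top)
      have t3 := ENNReal.Tendsto.mul_const t2 (b := B) (Or.inr hBt)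
      simpa using t3
    refine tendsto_of_tendsto_of_tendsto_of_le_of_le' tendsto_const_nhds t
      (Eventually.of_forall fun _ => zero_le) ?_
    filter_upwards [hC] with n hn
    refine ((h.isH1 n).sub h.isH1_lim).nL24_pow_le.trans ?_
    rw [hB]
    gcongr with j
    exact (eLpNorm_sub_le ((h.isH1 n).memD j).1 (h.isH1_lim.memD j).1 one_le_two).trans
      (by gcongr; exact hn j)
  have h2 := (ENNReal.continuous_rpow_const (y := (1 / 4 : ℝ))).tendsto 0 |>.comp h1
  rw [ENNReal.zero_rpow_of_pos (by norm_num)] at h2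
  refine h2.congr fun n => ?_
  simp only [Function.comp_apply]
  rw [← ENNReal.rpow_natCast, ← ENNReal.rpow_mul]
  norm_num

end H1

/-! ### Pairings of L²ₜL¹ₓ with smoothing kernels -/

section Pairing
variable {g : SpaceTime → ℝ}

theorem integrable_of_sq_lintegral_le {X : Type*} [MeasurableSpace X] {μ : Measure X} {f : X → ℝ}
    {B : ℝ≥0∞} (hf : AEStronglyMeasurable f μ) (h : (∫⁻ x, ‖f x‖ₑ ∂μ) ^ 2 ≤ B) (hB : B ≠ ⊤) :
    Integrable f μ := by
  refine ⟨hf, lt_top_iff_ne_top.2 fun h1 => ?_⟩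
  rw [h1, ENNReal.top_pow (by norm_num), top_le_iff] at h
  exact hB h

theorem abs_integral_le_of_sq_lintegral_le {X : Type*} [MeasurableSpace X] {μ : Measure X}
    {f : X → ℝ} {B : ℝ≥0∞} (h : (∫⁻ x, ‖f x‖ₑ ∂μ) ^ 2 ≤ B) (hB : B ≠ ⊤) :
    |∫ x, f x ∂μ| ≤ (B ^ (1 / 2 : ℝ)).toReal := by
  have h1 : ‖∫ x, f x ∂μ‖ₑ ≤ B ^ (1 / 2 : ℝ) := by
    refine (enorm_integral_le_lintegral_enorm _).trans ?_
    rw [one_div, ENNReal.le_rpow_inv_iff (by norm_num)]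
    exact_mod_cast h
  have := ENNReal.toReal_mono (ENNReal.rpow_ne_top_of_nonneg (by norm_num) hB) h1
  rwa [toReal_enorm] at this

theorem eventually_abs_integral_sub_le {ι X : Type*} [MeasurableSpace X] {μ : Measure X}
    {l : Filter ι} {B : ι → ℝ≥0∞} (hB : Tendsto B l (𝓝 0)) {η : ℝ} (hη : 0 < η) :
    ∀ᶠ n in l, ∀ f f0 : X → ℝ, Integrable f μ → Integrable f0 μ →
      (∫⁻ x, ‖f x - f0 x‖ₑ ∂μ) ^ 2 ≤ B n → |(∫ x, f x ∂μ) - ∫ x, f0 x ∂μ| ≤ η := by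
  filter_upwards [hB.eventually (gt_mem_nhds (ENNReal.ofReal_pos.2 (pow_pos hη 2)))]
    with n hn f f0 hf hf0 h
  rw [← integral_sub hf hf0]
  refine (abs_integral_le_of_sq_lintegral_le (h.trans hn.le) ENNReal.ofReal_ne_top).trans ?_
  rw [ENNReal.ofReal_rpow_of_nonneg (by positivity) (by norm_num), ← Real.sqrt_eq_rpow,
    Real.sqrt_sq hη.le, ENNReal.toReal_ofReal hη.le]

theorem integrable_mul_spaceKer {κ : R3 → ℝ} {h : ContDiff ℝ ∞ κ} {hc : HasCompactSupport κ}
    {F : SpaceTime → ℝ} (hg : AEStronglyMeasurable g volume) (hg' : nL21 g ≠ ⊤) (hF : MemLp F 2) :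
    Integrable (fun z => g z * (spaceKer κ h hc).avg F z) := by
  refine integrable_of_sq_lintegral_le
    (hg.mul ((spaceKer κ h hc).aestronglyMeasurable_avg hF.1))
    (sq_lintegral_spaceKer_le hg hF.1) ?_
  rw [← eLpNorm_two_sq]
  have := kerSq_ne_top h hc
  have := hF.2.ne
  finiteness

/-- The threshold is uniform over all g with the same bound; this is needed because g will be the
convection term of a varying solution. -/
theorem eventually_integral_mul_spaceKer {ι : Type*} {l : Filter ι} {κ : R3 → ℝ}
    {h : ContDiff ℝ ∞ κ} {hc : HasCompactSupport κ} {F : ι → SpaceTime → ℝ} {F0 : SpaceTime → ℝ}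
    (hF : StrongL2 volume l F F0) {N : ℝ≥0∞} (hN : N ≠ ⊤) {η : ℝ} (hη : 0 < η) :
    ∀ᶠ n in l, ∀ g : SpaceTime → ℝ, AEStronglyMeasurable g volume → nL21 g ≤ N →
      |(∫ z, g z * (spaceKer κ h hc).avg (F n) z) - ∫ z, g z * (spaceKer κ h hc).avg F0 z| ≤ η := by
  have hκ := kerSq_ne_top h hc
  have t1 := ENNReal.Tendsto.pow (n := 2) hF.tendsto
  have t2 := ENNReal.Tendsto.const_mul (a := kerSq κ) t1 (Or.inr hκ)
  have t3 := ENNReal.Tendsto.const_mul (a := N) t2 (Or.inr hN)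
  filter_upwards [eventually_abs_integral_sub_le (X := SpaceTime) (μ := volume)
    (by simpa using t3) hη] with n hn g hg hgN
  have hg' : nL21 g ≠ ⊤ := ne_top_of_le_ne_top hN hgN
  refine hn _ _ (integrable_mul_spaceKer hg hg' (hF.mem n)) (integrable_mul_spaceKer hg hg' hF.mem0) ?_
  have := sq_lintegral_spaceKer_le (κ := κ) (h := h) (hc := hc) hg
    (memLp_sub (hF.mem n) hF.mem0).1
  rw [← eLpNorm_two_sq] at this
  refine le_trans (le_of_eq ?_) (this.trans (by gcongr))
  congr 1
  refine lintegral_congr_ae ?_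
  filter_upwards [(spaceKer κ h hc).ae_avg_sub (hF.mem n) hF.mem0] with z hz
  rw [hz, mul_sub]

theorem tendsto_of_forall_abs_le {ι : Type*} {l : Filter ι} {x : ι → ℝ} {x0 : ℝ}
    (h : ∀ η > 0, ∀ᶠ n in l, |x n - x0| ≤ η) : Tendsto x l (𝓝 x0) :=
  tendsto_of_approx fun η hη => ⟨fun _ => x0, x0, tendsto_const_nhds, h η hη, by simpa using hη.le⟩

theorem tendsto_integral_mul_spaceKer {ι : Type*} {l : Filter ι} {κ : R3 → ℝ}
    {h : ContDiff ℝ ∞ κ} {hc : HasCompactSupport κ} {F : ι → SpaceTime → ℝ} {F0 : SpaceTime → ℝ}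
    (hg : AEStronglyMeasurable g volume) (hg' : nL21 g ≠ ⊤) (hF : StrongL2 volume l F F0) :
    Tendsto (fun n => ∫ z, g z * (spaceKer κ h hc).avg (F n) z) l
      (𝓝 (∫ z, g z * (spaceKer κ h hc).avg F0 z)) :=
  tendsto_of_forall_abs_le fun _ hη =>
    (eventually_integral_mul_spaceKer hF hg' hη).mono fun _ hn => hn g hg le_rfl

variable {r : ℝ} (B : RadialBump r)

theorem integrable_mul_K (i : Fin 3) {θ : SpaceTime → ℝ} {D : Fin 3 → SpaceTime → ℝ}
    (hg : AEStronglyMeasurable g volume) (hg' : nL21 g ≠ ⊤) (hθ : IsH1 θ D) :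
    Integrable (fun z => g z * (B.K i).avg θ z) := by
  refine integrable_of_sq_lintegral_le
    (hg.mul ((B.K i).aestronglyMeasurable_avg hθ.mem.1)) (sq_lintegral_K_le B i hg hθ.mem.1) ?_
  have := potConst_ne_top B i
  have := hθ.nL24_ne_top
  finiteness

theorem eventually_integral_mul_K {ι : Type*} {l : Filter ι} (i : Fin 3) {θ : ι → SpaceTime → ℝ}
    {D : ι → Fin 3 → SpaceTime → ℝ} {θ0 : SpaceTime → ℝ} {D0 : Fin 3 → SpaceTime → ℝ}
    (hθ : H1Conv l θ D θ0 D0) {N : ℝ≥0∞} (hN : N ≠ ⊤) {η : ℝ} (hη : 0 < η) :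
    ∀ᶠ n in l, ∀ g : SpaceTime → ℝ, AEStronglyMeasurable g volume → nL21 g ≤ N →
      |(∫ z, g z * (B.K i).avg (θ n) z) - ∫ z, g z * (B.K i).avg θ0 z| ≤ η := by
  have hκ := potConst_ne_top B i
  have t2 := ENNReal.Tendsto.const_mul (a := potConst B i ^ 2) hθ.tendsto_nL24
    (Or.inr (ENNReal.pow_ne_top hκ))
  have t3 := ENNReal.Tendsto.const_mul (a := N) t2 (Or.inr hN)
  filter_upwards [eventually_abs_integral_sub_le (X := SpaceTime) (μ := volume)
    (by simpa using t3) hη] with n hn g hg hgN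
  have hg' : nL21 g ≠ ⊤ := ne_top_of_le_ne_top hN hgN
  refine hn _ _ (integrable_mul_K B i hg hg' (hθ.isH1 n))
    (integrable_mul_K B i hg hg' hθ.isH1_lim) ?_
  refine le_trans (le_of_eq ?_)
    ((sq_lintegral_K_le B i hg ((hθ.isH1 n).sub hθ.isH1_lim).mem.1).trans (by gcongr))
  congr 1
  refine lintegral_congr_ae ?_
  filter_upwards [(B.K i).ae_avg_sub (hθ.isH1 n).mem hθ.isH1_lim.mem] with z hz
  rw [hz, mul_sub]

theorem tendsto_integral_mul_K {ι : Type*} {l : Filter ι} (i : Fin 3) {θ : ι → SpaceTime → ℝ}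
    {D : ι → Fin 3 → SpaceTime → ℝ} {θ0 : SpaceTime → ℝ} {D0 : Fin 3 → SpaceTime → ℝ}
    (hg : AEStronglyMeasurable g volume) (hg' : nL21 g ≠ ⊤) (hθ : H1Conv l θ D θ0 D0) :
    Tendsto (fun n => ∫ z, g z * (B.K i).avg (θ n) z) l
      (𝓝 (∫ z, g z * (B.K i).avg θ0 z)) :=
  tendsto_of_forall_abs_le fun _ hη =>
    (eventually_integral_mul_K B i hθ hg' hη).mono fun _ hn => hn g hg le_rfl

end Pairing

/-! ### Solutions in components -/

/-- The bounds, the weak derivatives and the divergence conditions for a velocity `u` with weak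
gradient `G` and a force `f`, extended by zero outside the bounded open set `W`. -/
structure FlowData (W : Set SpaceTime) (C : ℝ≥0) (u f : Fin 3 → SpaceTime → ℝ)
    (G : Fin 3 → Fin 3 → SpaceTime → ℝ) : Prop where
  isOpen : IsOpen W
  bounded : Bornology.IsBounded W
  memU : ∀ i, MemLp (u i) 2
  memF : ∀ i, MemLp (f i) 2
  memG : ∀ j i, MemLp (G j i) 2
  normU : ∀ i, eLpNorm (u i) 2 volume ≤ C
  normF : ∀ i, eLpNorm (f i) 2 volume ≤ C
  normG : ∀ j i, eLpNorm (G j i) 2 volume ≤ C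
  zeroU : ∀ i, ∀ z, z ∉ W → u i z = 0
  wd : ∀ j i, WD W (ej j) (u i) (G j i)
  divU : DivFree W u
  divF : DivFree W f
  slice : ∀ i, ∀ᵐ t : ℝ, ∫⁻ x : R3, ‖u i (t, x)‖ₑ ^ 2 ≤ C

/-- The weak form of the Navier-Stokes equations. -/
def WeakEq (W : Set SpaceTime) (u f : Fin 3 → SpaceTime → ℝ) : Prop :=
  ∀ φ : Fin 3 → SpaceTime → ℝ, (∀ i, IsTest W (φ i)) → (∀ z, ∑ i, dd (ej i) (φ i) z = 0) →
    (∑ i, ∫ z, u i z * dd et (φ i) z) + (∑ i, ∑ j, ∫ z, u i z * dd (ej j) (dd (ej j) (φ i)) z) +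
      (∑ i, ∑ j, ∫ z, u j z * (u i z * dd (ej j) (φ i) z)) + (∑ i, ∫ z, f i z * φ i z) = 0

/-- The convection term `u · ∇u`. -/
def conv (u : Fin 3 → SpaceTime → ℝ) (G : Fin 3 → Fin 3 → SpaceTime → ℝ) (i : Fin 3)
    (z : SpaceTime) : ℝ := ∑ j, u j z * G j i z

/-! ### Splitting the velocity into R * u and the remainder -/

namespace RadialBump
variable {r : ℝ} (B : RadialBump r)

/-- The regularized velocity. -/
def low (u : Fin 3 → SpaceTime → ℝ) (i : Fin 3) : SpaceTime → ℝ := B.TR.avg (u i)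

/-- The gradient of the regularized velocity. -/
def dlow (u : Fin 3 → SpaceTime → ℝ) (j i : Fin 3) : SpaceTime → ℝ := (B.TD j).avg (u i)

/-- The difference of the velocity and the regularized velocity. -/
def high (u : Fin 3 → SpaceTime → ℝ) (i : Fin 3) (z : SpaceTime) : ℝ := u i z - B.low u i z

/-- The gradient of `high`. -/
def dhigh (u : Fin 3 → SpaceTime → ℝ) (G : Fin 3 → Fin 3 → SpaceTime → ℝ) (j i : Fin 3)
    (z : SpaceTime) : ℝ := G j i z - B.dlow u j i z

/-- The antisymmetric gradient of the regularized velocity. -/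
def curl (u : Fin 3 → SpaceTime → ℝ) (j i : Fin 3) (z : SpaceTime) : ℝ :=
  B.dlow u j i z - B.dlow u i j z

theorem wd_low {u : Fin 3 → SpaceTime → ℝ} (hu : ∀ i, MemLp (u i) 2) (j i : Fin 3) :
    WD univ (ej j) (B.low u i) (B.dlow u j i) := wd_spaceKer (hu i) j

theorem memLp_low {u : Fin 3 → SpaceTime → ℝ} (hu : ∀ i, MemLp (u i) 2) (i : Fin 3) :
    MemLp (B.low u i) 2 := B.TR.memLp_avg (hu i)

theorem memLp_dlow {u : Fin 3 → SpaceTime → ℝ} (hu : ∀ i, MemLp (u i) 2) (j i : Fin 3) :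
    MemLp (B.dlow u j i) 2 := (B.TD j).memLp_avg (hu i)

theorem memLp_high {u : Fin 3 → SpaceTime → ℝ} (hu : ∀ i, MemLp (u i) 2) (i : Fin 3) :
    MemLp (B.high u i) 2 := memLp_sub (hu i) (B.memLp_low hu i)

theorem integral_low_mul {u : Fin 3 → SpaceTime → ℝ} (hu : ∀ i, MemLp (u i) 2) (i : Fin 3)
    {H : SpaceTime → ℝ} (hH : MemLp H 2) :
    ∫ z, B.low u i z * H z = ∫ z, u i z * B.TR.avg H z := by
  rw [low, B.TR.integral_avg_mul_of_memLp (hu i) hH]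
  simp only [B.TR_adj_avg]

theorem sol_dd {V : Set SpaceTime} {Ψ : Fin 3 → SpaceTime → ℝ} (hΨ : ∀ i, IsTest V (Ψ i))
    (hr : 0 ≤ r) (e : SpaceTime) (i : Fin 3) :
    dd e (B.sol Ψ i) = B.sol (fun i => dd e (Ψ i)) i := by
  ext z
  have hV : Near r univ univ := fun _ _ _ _ => trivial
  have hΨ' : ∀ i, IsTest univ (Ψ i) := fun i => (hΨ i).mono (subset_univ _)
  have hdiv := isTest_div hΨ'
  have a1 := (hΨ' i).avg B.inBall_TR hV hr
  have a2 := hdiv.avg (B.inBall_K i) hV hr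
  unfold sol
  rw [dd_sub ((hΨ' i).sub a1).differentiable a2.differentiable,
    dd_sub (hΨ' i).differentiable a1.differentiable, (hΨ' i).dd_avg, hdiv.dd_avg]
  congr 2
  ext w
  rw [dd_sum fun j => ((hΨ' j).dd _).differentiable]
  exact Finset.sum_congr rfl fun j _ => dd_comm (hΨ' j).smooth _ _ _

theorem divFree_low {u : Fin 3 → SpaceTime → ℝ} {V W : Set SpaceTime} (hu : ∀ i, MemLp (u i) 2)
    (hd : DivFree W u) (hr : 0 ≤ r) (hV : Near r V W) : DivFree V (B.low u) := by
  intro ψ hψ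
  rw [← hd _ (hψ.avg B.inBall_TR hV hr)]
  refine Finset.sum_congr rfl fun j _ => ?_
  rw [B.integral_low_mul hu j (hψ.dd _).memLp]
  simp only [hψ.dd_avg]

theorem divFree_high {u : Fin 3 → SpaceTime → ℝ} {V W : Set SpaceTime} (hu : ∀ i, MemLp (u i) 2)
    (hd : DivFree W u) (hr : 0 ≤ r) (hV : Near r V W) : DivFree V (B.high u) := by
  intro ψ hψ
  have h1 := B.divFree_low hu hd hr hV ψ hψ
  have h2 := hd.mono (hV.subset hr) ψ hψ
  simp only [high, sub_mul]
  have : ∀ j, ∫ z, (u j z * dd (ej j) ψ z - B.low u j z * dd (ej j) ψ z) =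
      (∫ z, u j z * dd (ej j) ψ z) - ∫ z, B.low u j z * dd (ej j) ψ z := fun j =>
    integral_sub (integrable_mul_of_memLp (hu j) (hψ.dd _).memLp)
      (integrable_mul_of_memLp (B.memLp_low hu j) (hψ.dd _).memLp)
  simp only [this, Finset.sum_sub_distrib, h1, h2, sub_zero]

/-- Pairing with the solenoidal part of a test field removes the regularized part. -/
theorem sum_integral_sol {c : Fin 3 → SpaceTime → ℝ} {V W : Set SpaceTime}
    (hc : ∀ i, MemLp (c i) 2) (hd : DivFree W c) {Ψ : Fin 3 → SpaceTime → ℝ}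
    (hΨ : ∀ i, IsTest V (Ψ i)) (hr : 0 ≤ r) (hV : Near r V W) :
    ∑ i, ∫ z, c i z * B.sol Ψ i z = ∑ i, ∫ z, B.high c i z * Ψ i z := by
  have hdiv := isTest_div hΨ
  -- The part ∇(E * div Ψ) is the gradient of a test function, hence orthogonal to c. The remaining
  -- Ψ − R * Ψ is transferred to c by the symmetry of R.
  have h1 := hd _ (hdiv.avg B.inBall_E hV hr)
  have e : ∀ i, ∫ z, c i z * B.sol Ψ i z = (∫ z, B.high c i z * Ψ i z) -
      ∫ z, c i z * dd (ej i) (B.E.avg fun w => ∑ j, dd (ej j) (Ψ j) w) z := fun i => by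
    have m1 := integrable_mul_of_memLp (hc i) (hΨ i).memLp
    have m2 := integrable_mul_of_memLp (hc i) (B.TR.memLp_avg (hΨ i).memLp)
    have m3 := integrable_mul_of_memLp (hc i) ((hdiv.avg B.inBall_E hV hr).dd (ej i)).memLp
    have m4 := integrable_mul_of_memLp (B.memLp_low hc i) (hΨ i).memLp
    simp only [sol, B.K_avg_eq_dd hdiv, high, mul_sub, sub_mul]
    rw [integral_sub (f := fun z => c i z * Ψ i z - c i z * B.TR.avg (Ψ i) z) (m1.sub m2) m3, integral_sub m1 m2, integral_sub m1 m4,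
      B.integral_low_mul hc i (hΨ i).memLp]
  simp only [e, Finset.sum_sub_distrib, h1, sub_zero]

end RadialBump

/-! ### The equation of the high part -/

namespace FlowData
variable {W : Set SpaceTime} {C : ℝ≥0} {u f : Fin 3 → SpaceTime → ℝ}
  {G : Fin 3 → Fin 3 → SpaceTime → ℝ}

theorem conv_aesm (S : FlowData W C u f G) (i : Fin 3) : AEStronglyMeasurable (conv u G i) volume :=
  Finset.aestronglyMeasurable_fun_sum _ fun j _ => (S.memU j).1.mul (S.memG j i).1

theorem integrable_conv (S : FlowData W C u f G) (i : Fin 3) : Integrable (conv u G i) :=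
  integrable_finsetSum _ fun j _ => integrable_mul_of_memLp (S.memU j) (S.memG j i)

theorem nL21_term_le (S : FlowData W C u f G) (k j i : Fin 3) : nL21 (fun z => u k z * G j i z) ≤ C * C ^ 2 := by
  refine (nL21_mul_le (S.memU k).1 (S.memG j i).1 (S.slice k)).trans ?_
  rw [← eLpNorm_two_sq]
  gcongr
  exact S.normG j i

theorem nL21_conv_le (S : FlowData W C u f G) (i : Fin 3) : nL21 (conv u G i) ≤ 9 * (C * C ^ 2) := by
  refine (nL21_sum_le fun j => (S.memU j).1.mul (S.memG j i).1).trans ?_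
  calc _ ≤ 3 * ∑ _j : Fin 3, (C * C ^ 2 : ℝ≥0∞) := by
        gcongr with j; exact S.nL21_term_le j j i
    _ = _ := by simp; ring

theorem nL21_conv_ne_top (S : FlowData W C u f G) (i : Fin 3) : nL21 (conv u G i) ≠ ⊤ :=
  ne_top_of_le_ne_top (by finiteness) (S.nL21_conv_le i)

theorem sum_integral_conv (S : FlowData W C u f G) {φ : Fin 3 → SpaceTime → ℝ} (hφ : ∀ i, IsTest W (φ i)) :
    ∑ i, ∑ j, ∫ z, u j z * (u i z * dd (ej j) (φ i) z) = - ∑ i, ∫ z, conv u G i z * φ i z := by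
  rw [← Finset.sum_neg_distrib]
  refine Finset.sum_congr rfl fun i _ => ?_
  rw [S.divU.parts S.isOpen S.memU (S.memU i) (fun j => S.memG j i) (fun j => S.wd j i) (hφ i)]
  congr 1
  obtain ⟨M, hM⟩ := (hφ i).ae_bdd
  rw [← integral_finsetSum _ fun j _ => integrable_mul_of_memLp (S.memU j)
    (memLp_mul_bdd (S.memG j i) (hφ i).aesm hM)]
  refine integral_congr_ae (Eventually.of_forall fun z => ?_)
  simp only [conv, Finset.sum_mul, mul_assoc]

theorem wd_high (S : FlowData W C u f G) {r : ℝ} (B : RadialBump r) (j i : Fin 3) :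
    WD W (ej j) (B.high u i) (B.dhigh u G j i) :=
  (S.wd j i).sub ((B.wd_low S.memU j i).mono (subset_univ _)) (S.memU i) (S.memG j i)
    (B.memLp_low S.memU i) (B.memLp_dlow S.memU j i)

theorem memLp_dhigh (S : FlowData W C u f G) {r : ℝ} (B : RadialBump r) (j i : Fin 3) : MemLp (B.dhigh u G j i) 2 :=
  memLp_sub (S.memG j i) (B.memLp_dlow S.memU j i)

theorem equation_conv (S : FlowData W C u f G) (hE : WeakEq W u f) {φ : Fin 3 → SpaceTime → ℝ} (hφ : ∀ i, IsTest W (φ i))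
    (hd : ∀ z, ∑ i, dd (ej i) (φ i) z = 0) :
    ∑ i, ∫ z, conv u G i z * φ i z = (∑ i, ∫ z, u i z * dd et (φ i) z) +
      (∑ i, ∑ j, ∫ z, u i z * dd (ej j) (dd (ej j) (φ i)) z) + ∑ i, ∫ z, f i z * φ i z := by
  have h1 := hE φ hφ hd
  rw [S.sum_integral_conv hφ] at h1
  linarith

/-- The equation for arbitrary test fields. -/
theorem equation_sol (S : FlowData W C u f G) (hE : WeakEq W u f) {r : ℝ} (B : RadialBump r) (hr : 0 ≤ r)
    {V : Set SpaceTime} (hV : Near r V W) {Ψ : Fin 3 → SpaceTime → ℝ}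
    (hΨ : ∀ i, IsTest V (Ψ i)) :
    ∑ i, ∫ z, conv u G i z * B.sol Ψ i z = (∑ i, ∫ z, B.high u i z * dd et (Ψ i) z) -
      (∑ i, ∑ j, ∫ z, B.dhigh u G j i z * dd (ej j) (Ψ i) z) +
      ∑ i, ∫ z, B.high f i z * Ψ i z := by
  -- The projection commutes with derivatives, so each linear term pairs a divergence-free field
  -- with a projected one and retains its high part only. The convection keeps the projection, which
  -- plays the role of the pressure.
  rw [S.equation_conv hE (B.isTest_sol hΨ hr hV) (B.div_sol hΨ hr),
    B.sum_integral_sol S.memF S.divF hΨ hr hV]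
  congr 1
  rw [sub_eq_add_neg]
  congr 1
  · simp only [B.sol_dd hΨ hr]
    exact B.sum_integral_sol S.memU S.divU (fun i => (hΨ i).dd _) hr hV
  · rw [Finset.sum_comm, Finset.sum_comm (f := fun i j => ∫ z, B.dhigh u G j i z *
      dd (ej j) (Ψ i) z), ← Finset.sum_neg_distrib]
    refine Finset.sum_congr rfl fun j _ => ?_
    simp only [B.sol_dd hΨ hr]
    simp only [B.sol_dd (fun i => (hΨ i).dd (ej j)) hr]
    rw [B.sum_integral_sol S.memU S.divU (fun i => ((hΨ i).dd _).dd _) hr hV,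
      ← Finset.sum_neg_distrib]
    refine Finset.sum_congr rfl fun i _ => ?_
    exact S.wd_high B j i _ (((hΨ i).dd _).mono (hV.subset hr))

end FlowData

theorem integrable_add_fun {X : Type*} [MeasurableSpace X] {μ : Measure X} {f g : X → ℝ}
    (hf : Integrable f μ) (hg : Integrable g μ) : Integrable (fun x => f x + g x) μ := hf.add hg

/-- Integration by parts turns a ∂a into half the derivative of a². For the high part this yields
the local kinetic energy. -/
theorem integral_mul_dd_mul {U : Set SpaceTime} {a ψ : SpaceTime → ℝ} (ha : ContDiff ℝ ∞ a)
    (hψ : IsTest U ψ) (e : SpaceTime) :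
    ∫ z, a z * dd e (fun w => a w * ψ w) z = 1 / 2 * ∫ z, a z * (a z * dd e ψ z) := by
  have h1 := integral_mul_dd (e := e) ha (hψ.smooth_mul ha)
  have i1 : Integrable (fun z => a z * (a z * dd e ψ z)) :=
    (((hψ.dd e).smooth_mul ha).smooth_mul ha).integrable
  have i2 : Integrable (fun z => dd e a z * (a z * ψ z)) :=
    ((hψ.smooth_mul ha).smooth_mul (contDiff_dd ha e)).integrable
  have h2 : ∫ z, a z * dd e (fun w => a w * ψ w) z =
      (∫ z, a z * (a z * dd e ψ z)) + ∫ z, dd e a z * (a z * ψ z) := by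
    rw [← integral_add i1 i2]
    refine integral_congr_ae (Eventually.of_forall fun z => ?_)
    simp only
    rw [dd_mul (ha.differentiable (by simp)) hψ.differentiable]
    ring
  linarith

/-! ### The local energy balance of the high part -/

namespace RadialBump
variable {r : ℝ} (B : RadialBump r)

/-- The pairing `v · ∇ψ` of the high part of the velocity. -/
def flux (u : Fin 3 → SpaceTime → ℝ) (ψ : SpaceTime → ℝ) (z : SpaceTime) : ℝ :=
  ∑ j, B.high u j z * dd (ej j) ψ z

/-- The nonlocal correction in the energy balance. -/
def corr (u : Fin 3 → SpaceTime → ℝ) (ψ : SpaceTime → ℝ) (i : Fin 3) (z : SpaceTime) : ℝ :=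
  B.TR.avg (fun w => B.high u i w * ψ w) z + (B.K i).avg (B.flux u ψ) z

theorem integrable_mul_corr {u : Fin 3 → SpaceTime → ℝ} {g ψ : SpaceTime → ℝ} {i : Fin 3}
    {D : Fin 3 → SpaceTime → ℝ} (ga : AEStronglyMeasurable g volume) (hg : nL21 g ≠ ⊤)
    (h : MemLp (fun w => B.high u i w * ψ w) 2) (hf : IsH1 (B.flux u ψ) D) :
    Integrable (fun z => g z * B.corr u ψ i z) := by
  have := integrable_add_fun (integrable_mul_spaceKer (κ := B.R) (h := B.smooth) (hc := B.compact)
    ga hg h) (integrable_mul_K B i ga hg hf)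
  simp only [corr, mul_add]
  exact this

theorem integral_mul_corr {u : Fin 3 → SpaceTime → ℝ} {g ψ : SpaceTime → ℝ} {i : Fin 3}
    {D : Fin 3 → SpaceTime → ℝ} (ga : AEStronglyMeasurable g volume) (hg : nL21 g ≠ ⊤)
    (h : MemLp (fun w => B.high u i w * ψ w) 2) (hf : IsH1 (B.flux u ψ) D) :
    ∫ z, g z * B.corr u ψ i z = (∫ z, g z * B.TR.avg (fun w => B.high u i w * ψ w) z) +
      ∫ z, g z * (B.K i).avg (B.flux u ψ) z := by
  have h1 : Integrable (fun z => g z * B.TR.avg (fun w => B.high u i w * ψ w) z) :=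
    integrable_mul_spaceKer ga hg h
  rw [← integral_add h1 (integrable_mul_K B i ga hg hf)]
  simp only [corr, mul_add]

/-- Half of the work of the convection term, as it follows from the equation. -/
def work (u f : Fin 3 → SpaceTime → ℝ) (G : Fin 3 → Fin 3 → SpaceTime → ℝ)
    (ψ : SpaceTime → ℝ) : ℝ :=
  (∑ i, 1 / 2 * ∫ z, B.high u i z * (B.high u i z * dd et ψ z)) -
    (∑ i, ∑ j, ((∫ z, B.dhigh u G j i z * (B.dhigh u G j i z * ψ z)) +
      ∫ z, B.dhigh u G j i z * (B.high u i z * dd (ej j) ψ z))) +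
    (∑ i, ∫ z, B.high f i z * (B.high u i z * ψ z)) + ∑ i, ∫ z, conv u G i z * B.corr u ψ i z

end RadialBump

namespace FlowData
variable {W : Set SpaceTime} {C : ℝ≥0} {u f : Fin 3 → SpaceTime → ℝ}
  {G : Fin 3 → Fin 3 → SpaceTime → ℝ} {φ : R3 → ℝ} {r : ℝ}

/-- The test field is m*(m(v)ψ), where m is the mollification and m* its adjoint: the two
mollifications then fall symmetrically on v and the time term becomes a derivative of a square.
Since m(v) is divergence-free near the support of ψ, the divergence of the test field is m*(m(v) ·
∇ψ), which contains no derivative of v; this makes the nonlocal term admissible for K. -/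
theorem work_identity (S : FlowData W C u f G) (hE : WeakEq W u f) (B : RadialBump r)
    (hr : 0 ≤ r) (hφ : IsMollifier φ) {δ ε r1 R : ℝ} {V0 V : Set SpaceTime} {ψ : SpaceTime → ℝ}
    (hV0 : Near r1 V0 V) (hV : Near r V W) (hψ : IsTest V0 ψ) (hm : (mol hφ δ ε).InBall R)
    (hR0 : 0 ≤ R) (hR : R ≤ r1) :
    ∑ i, ∫ z, conv u G i z *
        (mol hφ δ ε).adj.avg (fun w => (mol hφ δ ε).avg (B.high u i) w * ψ w) z =
      (∑ i, 1 / 2 * ∫ z, (mol hφ δ ε).avg (B.high u i) z *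
        ((mol hφ δ ε).avg (B.high u i) z * dd et ψ z)) -
      (∑ i, ∑ j, ((∫ z, (mol hφ δ ε).avg (B.dhigh u G j i) z *
          ((mol hφ δ ε).avg (B.dhigh u G j i) z * ψ z)) +
        ∫ z, (mol hφ δ ε).avg (B.dhigh u G j i) z *
          ((mol hφ δ ε).avg (B.high u i) z * dd (ej j) ψ z))) +
      (∑ i, ∫ z, B.high f i z *
        (mol hφ δ ε).adj.avg (fun w => (mol hφ δ ε).avg (B.high u i) w * ψ w) z) +
      ∑ i, ((∫ z, conv u G i z * B.TR.avg ((mol hφ δ ε).adj.avg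
          (fun w => (mol hφ δ ε).avg (B.high u i) w * ψ w)) z) +
        ∫ z, conv u G i z * (B.K i).avg ((mol hφ δ ε).adj.avg
          (fun w => ∑ j, (mol hφ δ ε).avg (B.high u j) w * dd (ej j) ψ w)) z) := by
  set m := mol hφ δ ε with hmdef
  have mv := B.memLp_high S.memU
  have sm : ∀ i, ContDiff ℝ ∞ (m.avg (B.high u i)) := fun i => contDiff_mol hφ (mv i)
  have hVW := hV.subset hr
  have hV0' : Near R V0 V := hV0.mono hR
  have tθ : ∀ i, IsTest V0 (fun w => m.avg (B.high u i) w * ψ w) := fun i => hψ.smooth_mul (sm i)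
  have tΨ : ∀ i, IsTest V (m.adj.avg fun w => m.avg (B.high u i) w * ψ w) := fun i =>
    (tθ i).avg hm.adj hV0' hR0
  have da : ∀ i j, ∀ z ∈ V0, dd (ej j) (m.avg (B.high u i)) z = m.avg (B.dhigh u G j i) z :=
    fun i j z hz => (S.wd_high B j i).dd_convKer (mv i) hm fun w hw => hVW (hV0' z hz w hw)
  have diva : ∀ z ∈ V0, ∑ j, dd (ej j) (m.avg (B.high u j)) z = 0 := fun z hz =>
    (B.divFree_high S.memU S.divU hr hV).sum_dd_convKer mv hm fun w hw => hV0' z hz w hw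
  have hdiv : (fun w => ∑ j, dd (ej j) (m.adj.avg fun w => m.avg (B.high u j) w * ψ w) w) =
      m.adj.avg (fun w => ∑ j, m.avg (B.high u j) w * dd (ej j) ψ w) := by
    ext w
    simp only [(tθ _).dd_avg]
    have e1 : (fun w => ∑ j, m.avg (B.high u j) w * dd (ej j) ψ w) =
        fun w => ∑ j, dd (ej j) (fun w => m.avg (B.high u j) w * ψ w) w := by
      ext w
      simp only [dd_mul ((sm _).differentiable (by simp)) hψ.differentiable]
      rw [Finset.sum_add_distrib, ← Finset.mul_sum]
      by_cases hw : w ∈ V0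
      · rw [diva w hw]; ring
      · rw [hψ.eq_zero hw]; ring
    rw [e1]
    simp only [TransKernel.avg, Finset.smul_sum]
    refine (integral_finsetSum _ fun j _ => ?_).symm
    exact m.adj.integrable_smul_comp ((tθ j).dd _).smooth.continuous ((tθ j).dd _).compact w
  have hg := S.nL21_conv_ne_top
  have ga := S.conv_aesm
  have key := S.equation_sol hE B hr hV tΨ
  have split : ∀ i, ∫ z, conv u G i z * B.sol (fun i => m.adj.avg fun w =>
      m.avg (B.high u i) w * ψ w) i z = (∫ z, conv u G i z * m.adj.avg (fun w =>
      m.avg (B.high u i) w * ψ w) z) - ((∫ z, conv u G i z * B.TR.avg (m.adj.avg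
          (fun w => m.avg (B.high u i) w * ψ w)) z) +
        ∫ z, conv u G i z * (B.K i).avg (m.adj.avg
          (fun w => ∑ j, m.avg (B.high u j) w * dd (ej j) ψ w)) z) := fun i => by
    obtain ⟨M, hM⟩ := (tΨ i).ae_bdd
    have j1 : Integrable (fun z => conv u G i z * m.adj.avg (fun w =>
      m.avg (B.high u i) w * ψ w) z) := (S.integrable_conv i).mul_bdd (tΨ i).aesm hM
    have j2 : Integrable (fun z => conv u G i z * B.TR.avg (m.adj.avg
          (fun w => m.avg (B.high u i) w * ψ w)) z) :=
      integrable_mul_spaceKer (ga i) (hg i) (tΨ i).memLp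
    have j3 : Integrable (fun z => conv u G i z * (B.K i).avg (m.adj.avg
          (fun w => ∑ j, m.avg (B.high u j) w * dd (ej j) ψ w)) z) := by
      rw [← hdiv]
      exact integrable_mul_K B i (ga i) (hg i) (RadialBump.isTest_div tΨ).isH1
    rw [← integral_add j2 j3, ← integral_sub j1 (integrable_add_fun j2 j3)]
    refine integral_congr_ae (Eventually.of_forall fun z => ?_)
    simp only [RadialBump.sol, hdiv]
    ring
  simp only [split, Finset.sum_sub_distrib] at key
  have T1 : ∀ i, ∫ z, B.high u i z * dd et (m.adj.avg fun w => m.avg (B.high u i) w * ψ w) z =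
      1 / 2 * ∫ z, m.avg (B.high u i) z * (m.avg (B.high u i) z * dd et ψ z) := fun i => by
    simp only [(tθ i).dd_avg]
    rw [← m.integral_avg_mul_of_memLp (mv i) ((tθ i).dd et).memLp]
    exact integral_mul_dd_mul (sm i) hψ et
  have T2 : ∀ i j, ∫ z, B.dhigh u G j i z *
      dd (ej j) (m.adj.avg fun w => m.avg (B.high u i) w * ψ w) z =
      (∫ z, m.avg (B.dhigh u G j i) z * (m.avg (B.dhigh u G j i) z * ψ z)) +
        ∫ z, m.avg (B.dhigh u G j i) z * (m.avg (B.high u i) z * dd (ej j) ψ z) := fun i j => by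
    simp only [(tθ i).dd_avg]
    rw [← m.integral_avg_mul_of_memLp (S.memLp_dhigh B j i) ((tθ i).dd (ej j)).memLp]
    have md := m.memLp_avg (S.memLp_dhigh B j i)
    obtain ⟨M, hM⟩ := hψ.ae_bdd
    rw [← integral_add (integrable_mul_of_memLp md (memLp_mul_bdd md hψ.aesm hM))
      (integrable_mul_of_memLp md ((hψ.dd (ej j)).smooth_mul (sm i)).memLp)]
    refine integral_congr_ae (Eventually.of_forall fun z => ?_)
    simp only
    rw [dd_mul ((sm i).differentiable (by simp)) hψ.differentiable]
    by_cases hz : z ∈ V0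
    · rw [da i j z hz]; ring
    · rw [hψ.eq_zero hz]; ring
  simp only [T1, T2] at key
  linarith

/-- The quadratic terms converge because every factor converges strongly in L². The convection is
only in L²ₜL¹ₓ and stays fixed, while its partners converge after convolution with R, or with ∇E by
means of bounds in H¹. The two scales may tend to zero in any manner. -/
theorem tendsto_work (S : FlowData W C u f G) (hE : WeakEq W u f) (B : RadialBump r)
    (hr : 0 ≤ r) (hφ : IsMollifier φ) {r1 : ℝ} {V0 V : Set SpaceTime} {ψ : SpaceTime → ℝ}
    (hr1 : 0 < r1) (hV0 : Near r1 V0 V) (hV : Near r V W) (hψ : IsTest V0 ψ) {δ ε : ℕ → ℝ}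
    (hδ : ∀ k, 0 < δ k) (hε : ∀ k, 0 < ε k) (tδ : Tendsto δ atTop (𝓝 0))
    (tε : Tendsto ε atTop (𝓝 0)) :
    Tendsto (fun k => ∑ i, ∫ z, conv u G i z * (mol hφ (δ k) (ε k)).adj.avg
      (fun w => (mol hφ (δ k) (ε k)).avg (B.high u i) w * ψ w) z) atTop
      (𝓝 (B.work u f G ψ)) := by
  obtain ⟨ρ0, hρ0, h0⟩ := exists_radius hφ
  set R : ℕ → ℝ := fun k => max (δ k) (ε k * ρ0) with hRdef
  have hm : ∀ k, (mol hφ (δ k) (ε k)).InBall (R k) := fun k => mol_inBall hφ h0 (hδ k) (hε k)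
  have hR0 : ∀ k, 0 ≤ R k := fun k => le_max_of_le_left (hδ k).le
  have tR : Tendsto R atTop (𝓝 0) := by simpa using tδ.max (tε.mul_const ρ0)
  set m : ℕ → TransKernel := fun k => mol hφ (δ k) (ε k) with hmdef
  have hmass : ∀ k, (m k).mass ≤ molMass φ := fun k => (mol_mass hφ (hδ k) (hε k)).le
  have hI : ∀ k, ∫ α, (m k).m α ∂(m k).ν = 1 := fun k => mol_integral hφ (hδ k) (hε k)
  have st : ∀ {F : SpaceTime → ℝ}, MemLp F 2 volume →
      StrongL2 volume atTop (fun k => (m k).avg F) F := fun hF =>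
    strongL2_avg_seq hm tR hmass hI hF
  have st' : ∀ {a : ℕ → SpaceTime → ℝ} {a0 : SpaceTime → ℝ}, StrongL2 volume atTop a a0 →
      StrongL2 volume atTop (fun k => (m k).adj.avg (a k)) a0 := fun ha =>
    StrongL2.avg_seq (k := fun k => (m k).adj) (fun k => (hm k).adj) tR (C := molMass φ)
      (fun k => by rw [TransKernel.adj_mass]; exact hmass k) hI ha
  have mv := B.memLp_high S.memU
  have bd : ∀ {χ : SpaceTime → ℝ} {a : ℕ → SpaceTime → ℝ} {a0 : SpaceTime → ℝ}, IsTest V0 χ →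
      StrongL2 volume atTop a a0 →
      StrongL2 volume atTop (fun k z => a k z * χ z) (fun z => a0 z * χ z) := fun hχ ha => by
    obtain ⟨M, hM⟩ := hχ.ae_bdd
    exact ha.mul_bdd hχ.aesm hM
  have sΨ : ∀ i, StrongL2 volume atTop
      (fun k => (m k).adj.avg fun w => (m k).avg (B.high u i) w * ψ w)
      (fun w => B.high u i w * ψ w) := fun i => st' (bd hψ (st (mv i)))
  have hVW := hV.subset hr
  have hV0W : V0 ⊆ W := (hV0.subset hr1.le).trans hVW
  have h1 : ∀ j, IsH1 (fun z => B.high u j z * dd (ej j) ψ z) (fun l z =>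
      B.dhigh u G l j z * dd (ej j) ψ z + B.high u j z * dd (ej l) (dd (ej j) ψ) z) := fun j =>
    WD.isH1 (fun l => S.wd_high B l j) (mv j) (fun l => S.memLp_dhigh B l j)
      ((hψ.dd (ej j)).mono hV0W)
  have sβ : StrongL2 volume atTop
      (fun k => (m k).adj.avg fun w => ∑ j, (m k).avg (B.high u j) w * dd (ej j) ψ w)
      (B.flux u ψ) := st' (StrongL2.sum Finset.univ fun j => bd (hψ.dd (ej j)) (st (mv j)))
  have tst : ∀ k j, IsTest V0 (fun w => (m k).avg (B.high u j) w * dd (ej j) ψ w) := fun k j =>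
    (hψ.dd (ej j)).smooth_mul (contDiff_mol hφ (mv j))
  have hK : H1Conv atTop
      (fun k => (m k).adj.avg fun w => ∑ j, (m k).avg (B.high u j) w * dd (ej j) ψ w)
      (fun k l => (m k).adj.avg fun z => ∑ j, dd (ej l)
        (fun w => (m k).avg (B.high u j) w * dd (ej j) ψ w) z)
      (B.flux u ψ) (fun l z => ∑ j, (B.dhigh u G l j z * dd (ej j) ψ z +
        B.high u j z * dd (ej l) (dd (ej j) ψ) z)) := by
    refine ⟨fun k => ?_, IsH1.sum _ h1, sβ, ?_⟩
    · exact (IsH1.sum _ fun j => (tst k j).isH1).avg (hm k).adj (hR0 k)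
    · have hs : ∀ l, StrongL2 volume atTop (fun k z => ∑ j,
          ((m k).avg (B.dhigh u G l j) z * dd (ej j) ψ z +
            (m k).avg (B.high u j) z * dd (ej l) (dd (ej j) ψ) z))
          (fun z => ∑ j, (B.dhigh u G l j z * dd (ej j) ψ z +
            B.high u j z * dd (ej l) (dd (ej j) ψ) z)) := fun l =>
        StrongL2.sum Finset.univ fun j => (bd (hψ.dd (ej j)) (st (S.memLp_dhigh B l j))).add
          (bd ((hψ.dd (ej j)).dd (ej l)) (st (mv j)))
      choose Cb hCb using fun l => (st' (hs l)).bdd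
      refine ⟨Finset.univ.sup Cb, ?_⟩
      -- Derivative and mollification commute on V0 only once the mollification radius is below r1,
      -- so the gradient bound is merely eventual.
      filter_upwards [eventually_all.2 hCb, tR.eventually (gt_mem_nhds hr1)] with k hk hkR l
      refine le_trans (le_of_eq ?_) ((hk l).trans
        (by exact_mod_cast Finset.le_sup (Finset.mem_univ l)))
      congr 2
      ext z
      refine Finset.sum_congr rfl fun j _ => ?_
      rw [dd_mul ((contDiff_mol hφ (mv j)).differentiable (by simp)) (hψ.dd (ej j)).differentiable]
      by_cases hz : z ∈ V0
      · rw [show dd (ej l) ((m k).avg (B.high u j)) z = (m k).avg (B.dhigh u G l j) z from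
          (S.wd_high B l j).dd_convKer (mv j) (hm k)
            fun w hw => hVW (hV0 z hz w (hw.trans hkR.le))]
        ring
      · rw [(hψ.dd (ej j)).eq_zero hz]; ring
  have ev : ∀ᶠ k in atTop, R k ≤ r1 := (tR.eventually (gt_mem_nhds hr1)).mono fun k h => h.le
  refine Tendsto.congr' (ev.mono fun k hk =>
    (S.work_identity hE B hr hφ hV0 hV hψ (hm k) (hR0 k) hk).symm) ?_
  have ga := S.conv_aesm
  have hg := S.nL21_conv_ne_top
  have ecorr := fun i => B.integral_mul_corr (ga i) (hg i) (sΨ i).mem0 hK.isH1_lim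
  unfold RadialBump.work
  simp only [ecorr]
  refine ((Tendsto.sub ?_ ?_).add ?_).add ?_
  · exact tendsto_finsetSum _ fun i _ => ((st (mv i)).integral_mul
      (bd (hψ.dd et) (st (mv i)))).const_mul _
  · refine tendsto_finsetSum _ fun i _ => tendsto_finsetSum _ fun j _ => ?_
    exact ((st (S.memLp_dhigh B j i)).integral_mul (bd hψ (st (S.memLp_dhigh B j i)))).add
      ((st (S.memLp_dhigh B j i)).integral_mul (bd (hψ.dd (ej j)) (st (mv i))))
  · exact tendsto_finsetSum _ fun i _ =>
      (StrongL2.const (B.memLp_high S.memF i)).integral_mul (sΨ i)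
  · exact tendsto_finsetSum _ fun i _ =>
      (tendsto_integral_mul_spaceKer (ga i) (hg i) (sΨ i)).add
        (tendsto_integral_mul_K B i (ga i) (hg i) hK)

end FlowData

/-! ### From space-time to space mollification -/

/-- Here g is merely integrable. Every subsequence has a further one along which F n converges
almost everywhere, and the uniform bound allows dominated convergence. -/
theorem tendsto_integral_mul_of_ae_bdd {X : Type*} [MeasurableSpace X] {μ : Measure X}
    {g : X → ℝ} {F : ℕ → X → ℝ} {F0 : X → ℝ} {M : ℝ} (hg : Integrable g μ)
    (hF : StrongL2 μ atTop F F0) (hM : ∀ n, ∀ᵐ x ∂μ, |F n x| ≤ M) :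
    Tendsto (fun n => ∫ x, g x * F n x ∂μ) atTop (𝓝 (∫ x, g x * F0 x ∂μ)) := by
  refine tendsto_of_subseq_tendsto fun ns hns => ?_
  have hF' : StrongL2 μ atTop (fun n => F (ns n)) F0 :=
    ⟨fun n => hF.mem _, hF.mem0, hF.tendsto.comp hns⟩
  obtain ⟨ms, _, h⟩ := hF'.exists_subseq_ae
  refine ⟨ms, tendsto_integral_of_dominated_convergence (fun x => M * |g x|) (fun n => ?_)
    (hg.abs.const_mul M) (fun n => ?_) ?_⟩
  · exact hg.1.mul (hF.mem _).1
  · filter_upwards [hM (ns (ms n))] with x hx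
    rw [norm_mul, Real.norm_eq_abs, Real.norm_eq_abs, mul_comm]
    gcongr
  · filter_upwards [h] with x hx
    exact hx.const_mul (g x)

/-- On each slice the convolution is bounded by the L¹ norm and lives in a fixed ball, so its L²
norm is controlled by the L¹ norm. -/
theorem memLp_spaceKer_of_nL21 {κ : R3 → ℝ} {h : ContDiff ℝ ∞ κ} {hc : HasCompactSupport κ}
    {g : SpaceTime → ℝ} {W : Set SpaceTime} {R : ℝ} (hg : AEStronglyMeasurable g volume)
    (hg' : nL21 g ≠ ⊤) (hW : Bornology.IsBounded W) (h0 : ∀ z, z ∉ W → g z = 0)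
    (hR : (spaceKer κ h hc).InBall R) : MemLp ((spaceKer κ h hc).avg g) 2 := by
  obtain ⟨M, hM⟩ := hc.exists_bound_of_continuous h.continuous
  have hM' : ∀ y, ‖κ y‖ₑ ≤ (M.toNNReal : ℝ≥0∞) := fun y => by
    rw [← ofReal_norm]; exact ENNReal.ofReal_le_ofReal (hM y)
  obtain ⟨ρ, hρ⟩ := (isBounded_nbhd (r := R) hW).subset_closedBall 0
  have hz : ∀ z : SpaceTime, z.2 ∉ Metric.closedBall (0 : R3) ρ → (spaceKer κ h hc).avg g z = 0 :=
    fun z hz => (spaceKer κ h hc).avg_eq_zero_of_forall hR fun w hw => h0 w fun hwW => by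
      have h1 : z ∈ Metric.closedBall (0 : SpaceTime) ρ := hρ ⟨w, hwW, by rwa [norm_sub_rev]⟩
      rw [Metric.mem_closedBall, dist_zero_right] at h1 hz
      exact hz (le_trans (by rw [Prod.norm_def]; exact le_max_right _ _) h1)
  have hm := (spaceKer κ h hc).aestronglyMeasurable_avg hg
  refine memLp_two_of_lintegral hm (ne_top_of_le_ne_top
    (b := ∫⁻ t : ℝ, (M.toNNReal : ℝ≥0∞) ^ 2 * volume (Metric.closedBall (0 : R3) ρ) *
      (∫⁻ x : R3, ‖g (t, x)‖ₑ) ^ 2) ?_ ?_)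
  · have hb : volume (Metric.closedBall (0 : R3) ρ) ≠ ⊤ := measure_closedBall_lt_top.ne
    rw [lintegral_const_mul' _ _ (by finiteness)]
    exact ENNReal.mul_ne_top (by finiteness) hg'
  · rw [lintegral_slice (hm.enorm.pow_const 2)]
    refine lintegral_mono fun t => ?_
    calc ∫⁻ x : R3, ‖(spaceKer κ h hc).avg g (t, x)‖ₑ ^ 2
        ≤ ∫⁻ x : R3, (Metric.closedBall (0 : R3) ρ).indicator
          (fun _ => ((M.toNNReal : ℝ≥0∞) * ∫⁻ x : R3, ‖g (t, x)‖ₑ) ^ 2) x := by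
          refine lintegral_mono fun x => ?_
          by_cases hx : x ∈ Metric.closedBall (0 : R3) ρ
          · rw [indicator_of_mem hx]
            gcongr
            exact enorm_spaceKer_le_one hM' (t, x)
          · rw [hz (t, x) hx]; simp
      _ = _ := by
          rw [lintegral_indicator measurableSet_closedBall, setLIntegral_const, mul_pow]
          ring

/-- The bound for the convolutions of a space kernel with a field bounded in `L^∞ₜ L²ₓ`. -/
def kerBound (κ : R3 → ℝ) (C : ℝ≥0) : ℝ := ((kerSq κ * C) ^ (1 / 2 : ℝ)).toReal

namespace FlowData
variable {W : Set SpaceTime} {C : ℝ≥0} {u f : Fin 3 → SpaceTime → ℝ}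
  {G : Fin 3 → Fin 3 → SpaceTime → ℝ} {φ : R3 → ℝ} {r : ℝ}

theorem ae_abs_spaceKer_le (S : FlowData W C u f G) {κ : R3 → ℝ} {h : ContDiff ℝ ∞ κ}
    {hc : HasCompactSupport κ} (i : Fin 3) :
    ∀ᵐ z, |(spaceKer κ h hc).avg (u i) z| ≤ kerBound κ C := by
  filter_upwards [ae_enorm_spaceKer_le (κ := κ) (h := h) (hc := hc) (S.memU i).1,
    ae_fst (S.slice i)] with z h1 h2
  have h3 : ‖(spaceKer κ h hc).avg (u i) z‖ₑ ≤ (kerSq κ * C) ^ (1 / 2 : ℝ) :=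
    h1.trans (by gcongr)
  have := ENNReal.toReal_mono (ENNReal.rpow_ne_top_of_nonneg (by norm_num)
    (ENNReal.mul_ne_top (kerSq_ne_top h hc) ENNReal.coe_ne_top)) h3
  rwa [toReal_enorm] at this

theorem abs_low_le (S : FlowData W C u f G) (B : RadialBump r) (i : Fin 3) :
    ∀ᵐ z, |B.low u i z| ≤ kerBound B.R C := S.ae_abs_spaceKer_le i

theorem abs_dlow_le (S : FlowData W C u f G) (B : RadialBump r) (j i : Fin 3) :
    ∀ᵐ z, |B.dlow u j i z| ≤ kerBound (d3 j B.R) C := S.ae_abs_spaceKer_le i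

theorem conv_eq_zero (S : FlowData W C u f G) (i : Fin 3) {z : SpaceTime} (hz : z ∉ W) :
    conv u G i z = 0 := by
  simp only [conv, S.zeroU _ z hz, zero_mul, Finset.sum_const_zero]

theorem memLp_spaceMol_conv (S : FlowData W C u f G) (hφ : IsMollifier φ) {ε : ℝ} (hε : 0 < ε)
    (i : Fin 3) : MemLp ((spaceMol hφ ε).avg (conv u G i)) 2 := by
  obtain ⟨ρ0, _, h0⟩ := exists_radius hφ
  exact memLp_spaceKer_of_nL21 (S.conv_aesm i) (S.nL21_conv_ne_top i) S.bounded
    (fun z hz => S.conv_eq_zero i hz) (spaceMol_inBall hφ h0 hε)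

theorem strongL2_timeMol {F : SpaceTime → ℝ} (hF : MemLp F 2) :
    StrongL2 volume atTop (fun k : ℕ => (timeMol (scale k)).avg F) F :=
  strongL2_avg_seq (fun k => timeMol_inBall (scale_pos k)) tendsto_scale (C := 1)
    (fun k => by rw [timeMol_mass (scale_pos k)]; simp)
    (fun k => timeMol_integral (scale_pos k)) hF

/-- The limit of vanishing time mollification. -/
theorem tendsto_time (S : FlowData W C u f G) (B : RadialBump r) (hφ : IsMollifier φ)
    {V : Set SpaceTime} {ψ : SpaceTime → ℝ} (hψ : IsTest V ψ) {ε : ℝ} (hε : 0 < ε) :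
    Tendsto (fun k : ℕ => ∑ i, ∫ z, conv u G i z * (mol hφ (scale k) ε).adj.avg
      (fun w => (mol hφ (scale k) ε).avg (B.high u i) w * ψ w) z) atTop
      (𝓝 (∑ i, ∫ z, (spaceMol hφ ε).avg (conv u G i) z *
        ((spaceMol hφ ε).avg (B.high u i) z * ψ z))) := by
  refine tendsto_finsetSum _ fun i _ => ?_
  have mv := B.memLp_high S.memU i
  obtain ⟨M, hM⟩ := hψ.ae_bdd
  have h1 := (strongL2_timeMol (S.memLp_spaceMol_conv hφ hε i)).integral_mul
    ((strongL2_timeMol ((spaceMol hφ ε).memLp_avg mv)).mul_bdd hψ.aesm hM)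
  refine h1.congr fun k => ?_
  have t : IsTest V (fun w => (mol hφ (scale k) ε).avg (B.high u i) w * ψ w) :=
    hψ.smooth_mul (contDiff_mol hφ mv)
  obtain ⟨N, hN⟩ := t.bdd
  rw [← (mol hφ (scale k) ε).integral_avg_mul_of_bdd (S.integrable_conv i) t.aesm hN]
  refine integral_congr_ae ?_
  filter_upwards [mol_ae_eq hφ (δ := scale k) (ε := ε) mv,
    mol_ae_eq_of_integrable hφ (δ := scale k) (ε := ε) (S.integrable_conv i)] with z e1 e2
  rw [e1, e2]

/-- The energy defect is mollified in space only. For each ε k a time scale is chosen so small that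
suppressing the time mollification costs less than `scale k`; along the resulting pairs the previous
limit applies. -/
theorem tendsto_space_high (S : FlowData W C u f G) (hE : WeakEq W u f) (B : RadialBump r)
    (hr : 0 ≤ r) (hφ : IsMollifier φ) {r1 : ℝ} {V0 V : Set SpaceTime} {ψ : SpaceTime → ℝ}
    (hr1 : 0 < r1) (hV0 : Near r1 V0 V) (hV : Near r V W) (hψ : IsTest V0 ψ) {ε : ℕ → ℝ}
    (hε : ∀ k, 0 < ε k) (tε : Tendsto ε atTop (𝓝 0)) :
    Tendsto (fun k => ∑ i, ∫ z, (spaceMol hφ (ε k)).avg (conv u G i) z *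
        ((spaceMol hφ (ε k)).avg (B.high u i) z * ψ z)) atTop (𝓝 (B.work u f G ψ)) := by
  have h1 : ∀ k, ∃ n, k ≤ n ∧ dist (∑ i, ∫ z, conv u G i z * (mol hφ (scale n) (ε k)).adj.avg
      (fun w => (mol hφ (scale n) (ε k)).avg (B.high u i) w * ψ w) z)
      (∑ i, ∫ z, (spaceMol hφ (ε k)).avg (conv u G i) z *
        ((spaceMol hφ (ε k)).avg (B.high u i) z * ψ z)) < scale k := fun k => by
    have := (Metric.tendsto_nhds.1 (S.tendsto_time B hφ hψ (hε k)) (scale k) (scale_pos k)).and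
      (eventually_ge_atTop k)
    obtain ⟨n, h1, h2⟩ := this.exists
    exact ⟨n, h2, h1⟩
  choose n hn hd using h1
  have t := S.tendsto_work hE B hr hφ hr1 hV0 hV hψ (δ := fun k => scale (n k))
    (fun k => scale_pos _) hε (tendsto_scale.comp (tendsto_atTop_mono hn tendsto_id)) tε
  refine tendsto_of_tendsto_of_dist t (squeeze_zero (fun _ => dist_nonneg) (fun k => ?_)
    tendsto_scale)
  exact (hd k).le

/-- No equation is needed: R * u is bounded, so pairing it with the merely integrable convection is
stable under mollification. -/
theorem tendsto_space_low (S : FlowData W C u f G) (B : RadialBump r)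
    (hφ : IsMollifier φ) {V : Set SpaceTime} {ψ : SpaceTime → ℝ} (hψ : IsTest V ψ) {ε : ℕ → ℝ}
    (hε : ∀ k, 0 < ε k) (tε : Tendsto ε atTop (𝓝 0)) :
    Tendsto (fun k => ∑ i, ∫ z, (spaceMol hφ (ε k)).avg (conv u G i) z *
        ((spaceMol hφ (ε k)).avg (B.low u i) z * ψ z)) atTop
      (𝓝 (∑ i, ∫ z, conv u G i z * (B.low u i z * ψ z))) := by
  refine tendsto_finsetSum _ fun i _ => ?_
  obtain ⟨ρ0, _, h0⟩ := exists_radius hφ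
  have hm := fun k => spaceMol_inBall hφ h0 (hε k)
  have tR : Tendsto (fun k => ε k * ρ0) atTop (𝓝 0) := by simpa using tε.mul_const ρ0
  obtain ⟨N, hN⟩ := hψ.bdd
  have hN0 : 0 ≤ N := (abs_nonneg _).trans (hN 0)
  have s1 : StrongL2 volume atTop (fun k => (spaceMol hφ (ε k)).avg (B.low u i)) (B.low u i) :=
    strongL2_avg_seq hm tR (C := molMass φ) (fun k => (spaceMol_mass hφ (hε k)).le)
      (fun k => spaceMol_integral hφ (hε k)) (B.memLp_low S.memU i)
  have s2 : StrongL2 volume atTop (fun k => (spaceMol hφ (ε k)).adj.avg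
      fun z => (spaceMol hφ (ε k)).avg (B.low u i) z * ψ z) (fun z => B.low u i z * ψ z) :=
    StrongL2.avg_seq (k := fun k => (spaceMol hφ (ε k)).adj) (fun k => (hm k).adj) tR
      (C := molMass φ)
      (fun k => by rw [TransKernel.adj_mass]; exact (spaceMol_mass hφ (hε k)).le)
      (fun k => spaceMol_integral hφ (hε k))
      (s1.mul_bdd hψ.aesm (Eventually.of_forall hN))
  have b1 : ∀ k, ∀ᵐ z, |(spaceMol hφ (ε k)).avg (B.low u i) z * ψ z| ≤
      (molMass φ : ℝ) * kerBound B.R C * N := fun k => by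
    filter_upwards [(spaceMol hφ (ε k)).ae_abs_avg_le (S.abs_low_le B i)] with z hz
    rw [spaceMol_mass hφ (hε k), ENNReal.coe_toReal] at hz
    rw [abs_mul]
    gcongr
    · exact (abs_nonneg _).trans hz
    · exact hN z
  have b2 : ∀ k, ∀ᵐ z, |(spaceMol hφ (ε k)).adj.avg
      (fun z => (spaceMol hφ (ε k)).avg (B.low u i) z * ψ z) z| ≤
      (molMass φ : ℝ) * ((molMass φ : ℝ) * kerBound B.R C * N) := fun k => by
    filter_upwards [(spaceMol hφ (ε k)).adj.ae_abs_avg_le (b1 k)] with z hz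
    rwa [TransKernel.adj_mass, spaceMol_mass hφ (hε k), ENNReal.coe_toReal] at hz
  refine (tendsto_integral_mul_of_ae_bdd (S.integrable_conv i) s2 b2).congr fun k => ?_
  exact ((spaceMol hφ (ε k)).integral_avg_mul_of_ae_bdd (S.integrable_conv i)
    ((s1.mem k).1.mul hψ.aesm) (b1 k)).symm

theorem tendsto_space (S : FlowData W C u f G) (hE : WeakEq W u f) (B : RadialBump r)
    (hr : 0 ≤ r) (hφ : IsMollifier φ) {r1 : ℝ} {V0 V : Set SpaceTime} {ψ : SpaceTime → ℝ}
    (hr1 : 0 < r1) (hV0 : Near r1 V0 V) (hV : Near r V W) (hψ : IsTest V0 ψ) {ε : ℕ → ℝ}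
    (hε : ∀ k, 0 < ε k) (tε : Tendsto ε atTop (𝓝 0)) :
    Tendsto (fun k => ∑ i, ∫ z, (spaceMol hφ (ε k)).avg (conv u G i) z *
        ((spaceMol hφ (ε k)).avg (u i) z * ψ z)) atTop
      (𝓝 (B.work u f G ψ + ∑ i, ∫ z, conv u G i z * (B.low u i z * ψ z))) := by
  refine ((S.tendsto_space_high hE B hr hφ hr1 hV0 hV hψ hε tε).add
    (S.tendsto_space_low B hφ hψ hε tε)).congr fun k => ?_
  rw [← Finset.sum_add_distrib]
  refine Finset.sum_congr rfl fun i _ => ?_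
  obtain ⟨N, hN⟩ := hψ.ae_bdd
  have mg := S.memLp_spaceMol_conv hφ (hε k) i
  have m1 := memLp_mul_bdd ((spaceMol hφ (ε k)).memLp_avg (B.memLp_high S.memU i)) hψ.aesm hN
  have m2 := memLp_mul_bdd ((spaceMol hφ (ε k)).memLp_avg (B.memLp_low S.memU i)) hψ.aesm hN
  rw [← integral_add (integrable_mul_of_memLp mg m1) (integrable_mul_of_memLp mg m2)]
  refine integral_congr_ae ?_
  filter_upwards [(spaceMol hφ (ε k)).ae_avg_sub (S.memU i) (B.memLp_low S.memU i)] with z hz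
  have : (spaceMol hφ (ε k)).avg (B.high u i) z = (spaceMol hφ (ε k)).avg (u i) z -
    (spaceMol hφ (ε k)).avg (B.low u i) z := hz
  rw [this]; ring

end FlowData

/-! ### The limit of the energy defects and its rearrangement -/

theorem exists_cutoff {K U : Set SpaceTime} (hK : IsCompact K) (hU : IsOpen U) (hKU : K ⊆ U) :
    ∃ χ : SpaceTime → ℝ, IsTest U χ ∧ (∀ z, 0 ≤ χ z) ∧ (∀ z, |χ z| ≤ 1) ∧ ∀ z ∈ K, χ z = 1 := by
  obtain ⟨L, hL, hKL, hLU⟩ := exists_compact_between hK hU hKU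
  obtain ⟨f, hf0, hf1, hf⟩ := exists_contMDiffMap_zero_one_of_isClosed
    (modelWithCornersSelf ℝ SpaceTime) (n := ⊤) (s := (interior L)ᶜ) (t := K)
    isOpen_interior.isClosed_compl hK.isClosed (disjoint_compl_left_iff_subset.2 hKL)
  have hs : tsupport f ⊆ L := closure_minimal (fun z hz => by
    by_contra h
    exact hz (hf0 fun h' => h (interior_subset h'))) hL.isClosed
  refine ⟨f, ⟨contMDiff_iff_contDiff.1 f.contMDiff, hL.of_isClosed_subset (isClosed_tsupport f) hs,
    hs.trans hLU⟩, fun z => (hf z).1, fun z => ?_, fun z hz => hf1 hz⟩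
  rw [abs_of_nonneg (hf z).1]
  exact (hf z).2

namespace RadialBump
variable {r : ℝ} (B : RadialBump r)

/-- The gradient of half of the square of the regularized velocity. -/
def lowGrad (u : Fin 3 → SpaceTime → ℝ) (i : Fin 3) (z : SpaceTime) : ℝ :=
  ∑ j, B.low u j z * B.dlow u i j z

/-- The limit of the energy defects. -/
def defect (u f : Fin 3 → SpaceTime → ℝ) (G : Fin 3 → Fin 3 → SpaceTime → ℝ)
    (ψ : SpaceTime → ℝ) : ℝ :=
  (∑ i, ∫ z, B.high u i z * (B.high u i z * dd et ψ z)) -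
    2 * (∑ i, ∑ j, ((∫ z, B.dhigh u G j i z * (B.dhigh u G j i z * ψ z)) +
      ∫ z, B.dhigh u G j i z * (B.high u i z * dd (ej j) ψ z))) +
    2 * (∑ i, ∫ z, B.high f i z * (B.high u i z * ψ z)) +
    2 * (∑ i, ∫ z, (conv u G i z - B.lowGrad u i z) * B.corr u ψ i z) +
    (∑ i, ∑ j, ∫ z, u j z * (B.high u i z * (B.high u i z * dd (ej j) ψ z))) -
    2 * (∑ i, ∑ j, ∫ z, (B.low u j z * B.curl u j i z + B.high u j z * B.dlow u j i z) *
      (B.high u i z * ψ z))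

end RadialBump

namespace FlowData
variable {W : Set SpaceTime} {C : ℝ≥0} {u f : Fin 3 → SpaceTime → ℝ}
  {G : Fin 3 → Fin 3 → SpaceTime → ℝ} {r : ℝ} {ψ : SpaceTime → ℝ}

theorem isH1_high (S : FlowData W C u f G) (B : RadialBump r) (i : Fin 3) {χ : SpaceTime → ℝ}
    (hχ : IsTest W χ) : IsH1 (fun z => B.high u i z * χ z)
      (fun j z => B.dhigh u G j i z * χ z + B.high u i z * dd (ej j) χ z) :=
  WD.isH1 (fun l => S.wd_high B l i) (B.memLp_high S.memU i) (fun l => S.memLp_dhigh B l i) hχ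

theorem isH1_flux (S : FlowData W C u f G) (B : RadialBump r) (hψ : IsTest W ψ) :
    IsH1 (B.flux u ψ) (fun l z => ∑ j, (B.dhigh u G l j z * dd (ej j) ψ z +
      B.high u j z * dd (ej l) (dd (ej j) ψ) z)) :=
  IsH1.sum _ fun j => S.isH1_high B j (hψ.dd (ej j))

theorem memLp_low_mul (S : FlowData W C u f G) (B : RadialBump r) (i : Fin 3) {a : SpaceTime → ℝ}
    (ha : MemLp a 2) : MemLp (fun z => a z * B.low u i z) 2 :=
  memLp_mul_bdd ha (B.memLp_low S.memU i).1 (S.abs_low_le B i)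

theorem memLp_dlow_mul (S : FlowData W C u f G) (B : RadialBump r) (j i : Fin 3)
    {a : SpaceTime → ℝ} (ha : MemLp a 2) : MemLp (fun z => a z * B.dlow u j i z) 2 :=
  memLp_mul_bdd ha (B.memLp_dlow S.memU j i).1 (S.abs_dlow_le B j i)

theorem memLp_lowGrad (S : FlowData W C u f G) (B : RadialBump r) (i : Fin 3) :
    MemLp (B.lowGrad u i) 2 :=
  memLp_finsetSum _ fun j _ => S.memLp_dlow_mul B i j (B.memLp_low S.memU j)

theorem memLp_corr (S : FlowData W C u f G) (B : RadialBump r) (hψ : IsTest W ψ) (i : Fin 3) :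
    MemLp (B.corr u ψ i) 2 :=
  memLp_add (B.TR.memLp_avg (S.isH1_high B i hψ).mem)
    ((B.K i).memLp_avg (S.isH1_flux B hψ).mem)

theorem integrable_three (S : FlowData W C u f G) {a b : SpaceTime → ℝ}
    {Da Db : Fin 3 → SpaceTime → ℝ} (ha : IsH1 a Da) (hb : IsH1 b Db) (j : Fin 3) :
    Integrable (fun z => u j z * (a z * b z)) := by
  refine integrable_of_sq_lintegral_le ((S.memU j).1.mul (ha.mem.1.mul hb.mem.1))
    (sq_lintegral_three_le (S.memU j).1 ha.mem.1 hb.mem.1 (S.slice j)) ?_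
  have := ha.nL24_ne_top
  have := hb.nL24_ne_top
  finiteness

/-- The factor ψ localizes only one copy of the high part. A cut-off equal to one on its support
localizes the other, so that both are globally in H¹. -/
theorem integrable_high_high (S : FlowData W C u f G) (B : RadialBump r) (hψ : IsTest W ψ)
    (i j : Fin 3) : Integrable (fun z => u j z * (B.high u i z * (B.high u i z * ψ z))) := by
  obtain ⟨χ, hχ, _, _, h1⟩ := exists_cutoff hψ.compact.isCompact S.isOpen hψ.supp
  refine (S.integrable_three (S.isH1_high B i hχ) (S.isH1_high B i hψ) j).congr
    (Eventually.of_forall fun z => ?_)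
  by_cases hz : z ∈ tsupport ψ
  · simp only [h1 z hz, mul_one]
  · simp only [IsTest.eq_zero' hz, mul_zero]

/-- The low part of the convection is, up to its rotational, a gradient. -/
theorem sum_integral_lowGrad_eq_zero (S : FlowData W C u f G) (B : RadialBump r) {U : Set SpaceTime}
    {Φ : Fin 3 → SpaceTime → ℝ} (hΦ : ∀ i, IsTest U (Φ i)) (hd : ∀ z, ∑ i, dd (ej i) (Φ i) z = 0) :
    ∑ i, ∫ z, B.lowGrad u i z * Φ i z = 0 := by
  have ml := B.memLp_low S.memU
  have wdP : ∀ i, WD univ (ej i) (fun z => ∑ j, B.low u j z * B.low u j z)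
      (fun z => 2 * B.lowGrad u i z) := fun i => by
    have h1 : ∀ j, WD univ (ej i) (fun z => B.low u j z * B.low u j z)
        (fun z => B.dlow u i j z * B.low u j z + B.low u j z * B.dlow u i j z) := fun j =>
      WD.mul_bdd isOpen_univ (B.wd_low S.memU i j) (B.wd_low S.memU i j) (ml j)
        (B.memLp_dlow S.memU i j) (ml j) (B.memLp_dlow S.memU i j)
        (M := max (kerBound B.R C) (kerBound (d3 i B.R) C))
        ((S.abs_low_le B j).mono fun z hz => hz.trans (le_max_left _ _))
        ((S.abs_dlow_le B i j).mono fun z hz => hz.trans (le_max_right _ _))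
    intro θ hθ
    simp only [Finset.sum_mul, RadialBump.lowGrad, Finset.mul_sum]
    rw [integral_finsetSum _ fun j _ => integrable_mul_of_memLp (S.memLp_low_mul B j (ml j))
      (hθ.dd _).memLp, integral_finsetSum _ fun j _ => integrable_mul_of_memLp
      ((S.memLp_dlow_mul B i j (ml j)).const_mul 2) hθ.memLp, ← Finset.sum_neg_distrib]
    refine Finset.sum_congr rfl fun j _ => ?_
    rw [h1 j θ hθ]
    congr 1
    refine integral_congr_ae (Eventually.of_forall fun z => ?_)
    simp only; ring
  have mP : MemLp (fun z => ∑ j, B.low u j z * B.low u j z) 2 :=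
    memLp_finsetSum _ fun j _ => S.memLp_low_mul B j (ml j)
  have h1 : ∑ i, ∫ z, (2 * B.lowGrad u i z) * Φ i z = 0 := by
    have h2 : ∀ i, ∫ z, (2 * B.lowGrad u i z) * Φ i z =
        - ∫ z, (∑ j, B.low u j z * B.low u j z) * dd (ej i) (Φ i) z := fun i => by
      rw [wdP i _ ((hΦ i).mono (subset_univ _)), neg_neg]
    simp only [h2, Finset.sum_neg_distrib]
    rw [← integral_finsetSum _ fun i _ => integrable_mul_of_memLp mP ((hΦ i).dd (ej i)).memLp]
    simp only [← Finset.mul_sum, hd, mul_zero, integral_zero, neg_zero]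
  simp only [mul_assoc, integral_const_mul, ← Finset.mul_sum] at h1
  linarith

/-- The pairing of the gradient of half of the square of the regularized velocity with the
correction. -/
theorem sum_integral_lowGrad_corr (S : FlowData W C u f G) (B : RadialBump r) (hr : 0 ≤ r)
    {r1 : ℝ} {V0 V : Set SpaceTime} (hr1 : 0 < r1) (hV0 : Near r1 V0 V) (hV : Near r V W)
    (hψ : IsTest V0 ψ) :
    ∑ i, ∫ z, B.lowGrad u i z * B.corr u ψ i z =
      ∑ i, ∫ z, B.lowGrad u i z * (B.high u i z * ψ z) := by
  obtain ⟨φ, hφ⟩ := exists_isMollifier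
  obtain ⟨ρ0, hρ0, h0⟩ := exists_radius hφ
  have hVW := hV.subset hr
  have hψW : IsTest W ψ := hψ.mono ((hV0.subset hr1.le).trans hVW)
  have mv := B.memLp_high S.memU
  have ml := B.memLp_low S.memU
  have mlg := S.memLp_lowGrad B
  have tR : Tendsto (fun n => max (scale n) (scale n * ρ0)) atTop (𝓝 0) := by
    simpa using tendsto_scale.max (tendsto_scale.mul_const ρ0)
  have hm : ∀ n, (mol hφ (scale n) (scale n)).InBall (max (scale n) (scale n * ρ0)) := fun n =>
    mol_inBall hφ h0 (scale_pos n) (scale_pos n)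
  set m : ℕ → TransKernel := fun n => mol hφ (scale n) (scale n) with hmdef
  have st : ∀ {F : SpaceTime → ℝ}, MemLp F 2 volume →
      StrongL2 volume atTop (fun k => (m k).avg F) F := fun hF =>
    strongL2_avg_seq hm tR (C := molMass φ) (fun n => (mol_mass hφ (scale_pos n) (scale_pos n)).le)
      (fun n => mol_integral hφ (scale_pos n) (scale_pos n)) hF
  have bd : ∀ {χ : SpaceTime → ℝ} {a : ℕ → SpaceTime → ℝ} {a0 : SpaceTime → ℝ}, IsTest V0 χ →
      StrongL2 volume atTop a a0 →
      StrongL2 volume atTop (fun k z => a k z * χ z) (fun z => a0 z * χ z) := fun hχ ha => by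
    obtain ⟨M, hM⟩ := hχ.ae_bdd
    exact ha.mul_bdd hχ.aesm hM
  have tΨ : ∀ k i, IsTest V (fun w => (m k).avg (B.high u i) w * ψ w) := fun k i =>
    (hψ.smooth_mul (contDiff_mol hφ (mv i))).mono (hV0.subset hr1.le)
  have sΨ : ∀ i, StrongL2 volume atTop (fun k w => (m k).avg (B.high u i) w * ψ w)
    (fun w => B.high u i w * ψ w) := fun i => bd hψ (st (mv i))
  have sβ : StrongL2 volume atTop (fun k w => ∑ j, (m k).avg (B.high u j) w * dd (ej j) ψ w)
      (B.flux u ψ) := StrongL2.sum Finset.univ fun j => bd (hψ.dd (ej j)) (st (mv j))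
  -- A gradient annihilates the solenoidal part of the mollified field vψ. Expanding the projection
  -- and letting the mollification vanish gives the identity.
  have zero : ∀ k, ∑ i, ∫ z, B.lowGrad u i z *
      B.sol (fun i w => (m k).avg (B.high u i) w * ψ w) i z = 0 := fun k =>
    S.sum_integral_lowGrad_eq_zero B (B.isTest_sol (tΨ k) hr hV) (B.div_sol (tΨ k) hr)
  have ev : ∀ᶠ k in atTop, ∀ i, ∫ z, B.lowGrad u i z *
      B.sol (fun i w => (m k).avg (B.high u i) w * ψ w) i z =
      (∫ z, B.lowGrad u i z * ((m k).avg (B.high u i) z * ψ z)) -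
      ((∫ z, B.lowGrad u i z * B.TR.avg (fun w => (m k).avg (B.high u i) w * ψ w) z) +
      ∫ z, B.lowGrad u i z * (B.K i).avg
        (fun w => ∑ j, (m k).avg (B.high u j) w * dd (ej j) ψ w) z) := by
    filter_upwards [tR.eventually (gt_mem_nhds hr1)] with k hk i
    have hdiv : (fun w => ∑ j, dd (ej j) (fun w => (m k).avg (B.high u j) w * ψ w) w) =
        fun w => ∑ j, (m k).avg (B.high u j) w * dd (ej j) ψ w := by
      ext w
      have e1 : ∀ j, dd (ej j) (fun w => (m k).avg (B.high u j) w * ψ w) w =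
          (m k).avg (B.high u j) w * dd (ej j) ψ w +
            ψ w * dd (ej j) ((m k).avg (B.high u j)) w := fun j =>
        dd_mul ((contDiff_mol hφ (mv j)).differentiable (by simp)) hψ.differentiable w
      simp only [e1]
      rw [Finset.sum_add_distrib, ← Finset.mul_sum]
      by_cases hw : w ∈ V0
      · have : ∑ j, dd (ej j) ((m k).avg (B.high u j)) w = 0 :=
          (B.divFree_high S.memU S.divU hr hV).sum_dd_convKer mv (hm k)
            fun y hy => hV0 w hw y (hy.trans hk.le)
        rw [this]; ring
      · rw [hψ.eq_zero hw]; ring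
    have j1 := integrable_mul_of_memLp (mlg i) ((sΨ i).mem k)
    have j2 := integrable_mul_of_memLp (mlg i) (B.TR.memLp_avg ((sΨ i).mem k))
    have j3 := integrable_mul_of_memLp (mlg i) ((B.K i).memLp_avg (sβ.mem k))
    rw [← integral_add j2 j3, ← integral_sub j1 (integrable_add_fun j2 j3)]
    refine integral_congr_ae (Eventually.of_forall fun z => ?_)
    simp only [RadialBump.sol, hdiv]
    ring
  have lim : Tendsto (fun k => ∑ i, ∫ z, B.lowGrad u i z *
      B.sol (fun i w => (m k).avg (B.high u i) w * ψ w) i z) atTop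
      (𝓝 (∑ i, ((∫ z, B.lowGrad u i z * (B.high u i z * ψ z)) -
        ((∫ z, B.lowGrad u i z * B.TR.avg (fun w => B.high u i w * ψ w) z) +
        ∫ z, B.lowGrad u i z * (B.K i).avg (B.flux u ψ) z)))) := by
    refine Tendsto.congr' (f₁ := fun k => ∑ i, ((∫ z, B.lowGrad u i z *
      ((m k).avg (B.high u i) z * ψ z)) -
      ((∫ z, B.lowGrad u i z * B.TR.avg (fun w => (m k).avg (B.high u i) w * ψ w) z) +
      ∫ z, B.lowGrad u i z * (B.K i).avg
        (fun w => ∑ j, (m k).avg (B.high u j) w * dd (ej j) ψ w) z)))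
      (ev.mono fun k hk => Finset.sum_congr rfl fun i _ => (hk i).symm) ?_
    refine tendsto_finsetSum _ fun i _ => ?_
    have c := StrongL2.const (l := (atTop : Filter ℕ)) (mlg i)
    exact (c.integral_mul (sΨ i)).sub ((c.integral_mul (B.TR.strongL2_avg (sΨ i))).add
      (c.integral_mul ((B.K i).strongL2_avg sβ)))
  simp only [zero] at lim
  have h2 := tendsto_nhds_unique tendsto_const_nhds lim
  rw [Finset.sum_sub_distrib] at h2
  have h3 : ∀ i, ∫ z, B.lowGrad u i z * B.corr u ψ i z =
      (∫ z, B.lowGrad u i z * B.TR.avg (fun w => B.high u i w * ψ w) z) +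
        ∫ z, B.lowGrad u i z * (B.K i).avg (B.flux u ψ) z := fun i => by
    rw [← integral_add (integrable_mul_of_memLp (mlg i) (B.TR.memLp_avg (sΨ i).mem0))
      (integrable_mul_of_memLp (mlg i) ((B.K i).memLp_avg sβ.mem0))]
    simp only [RadialBump.corr, mul_add]
  simp only [h3]
  linarith

/-- The flux of the energy in terms of the low and high parts. -/
theorem sum_integral_cubic (S : FlowData W C u f G) (B : RadialBump r) (hψ : IsTest W ψ)
    (i : Fin 3) :
    ∑ j, ∫ z, u j z * (u i z * (u i z * dd (ej j) ψ z)) =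
      (∑ j, ∫ z, u j z * (B.high u i z * (B.high u i z * dd (ej j) ψ z))) -
      2 * (∫ z, conv u G i z * (B.low u i z * ψ z)) -
      2 * ∑ j, ∫ z, u j z * (B.high u i z * B.dlow u j i z * ψ z) := by
  have mu := S.memU
  have mv := B.memLp_high mu
  -- Componentwise u² − v² = (u + v)(u − v), and u − v is the bounded regularized velocity. This
  -- part of the flux can therefore be integrated by parts using div u = 0; its gradient simplifies
  -- to 2(∂u) low + 2v ∂low.
  have wdq : ∀ j, WD W (ej j) (fun z => (u i z + B.high u i z) * B.low u i z)
      (fun z => (G j i z + B.dhigh u G j i z) * B.low u i z +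
        (u i z + B.high u i z) * B.dlow u j i z) := fun j =>
    WD.mul_bdd S.isOpen ((S.wd j i).add (S.wd_high B j i) (mu i) (S.memG j i) (mv i)
        (S.memLp_dhigh B j i)) ((B.wd_low mu j i).mono (subset_univ _))
      (memLp_add (mu i) (mv i)) (memLp_add (S.memG j i) (S.memLp_dhigh B j i))
      (B.memLp_low mu i) (B.memLp_dlow mu j i)
      (M := max (kerBound B.R C) (kerBound (d3 j B.R) C))
      ((S.abs_low_le B i).mono fun z hz => hz.trans (le_max_left _ _))
      ((S.abs_dlow_le B j i).mono fun z hz => hz.trans (le_max_right _ _))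
  have mq := S.memLp_low_mul B i (memLp_add (mu i) (mv i))
  have mDq : ∀ j, MemLp (fun z => (G j i z + B.dhigh u G j i z) * B.low u i z +
        (u i z + B.high u i z) * B.dlow u j i z) 2 := fun j =>
    memLp_add (S.memLp_low_mul B i (memLp_add (S.memG j i) (S.memLp_dhigh B j i)))
      (S.memLp_dlow_mul B j i (memLp_add (mu i) (mv i)))
  have hp := S.divU.parts S.isOpen mu mq mDq wdq hψ
  obtain ⟨M, hM⟩ := hψ.ae_bdd
  have e1 : ∀ j, ∫ z, u j z * (u i z * (u i z * dd (ej j) ψ z)) =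
      (∫ z, u j z * (B.high u i z * (B.high u i z * dd (ej j) ψ z))) +
      ∫ z, u j z * ((u i z + B.high u i z) * B.low u i z * dd (ej j) ψ z) := fun j => by
    obtain ⟨M', hM'⟩ := (hψ.dd (ej j)).ae_bdd
    rw [← integral_add (S.integrable_high_high B (hψ.dd (ej j)) i j)
      (integrable_mul_of_memLp (mu j) (memLp_mul_bdd mq (hψ.dd (ej j)).aesm hM'))]
    refine integral_congr_ae (Eventually.of_forall fun z => ?_)
    simp only [RadialBump.high]; ring
  have k1 : ∀ j, Integrable (fun z => u j z * (G j i z * B.low u i z * ψ z)) := fun j =>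
    integrable_mul_of_memLp (mu j) (memLp_mul_bdd (S.memLp_low_mul B i (S.memG j i)) hψ.aesm hM)
  have k2 : ∀ j, Integrable (fun z => u j z * (B.high u i z * B.dlow u j i z * ψ z)) := fun j =>
    integrable_mul_of_memLp (mu j) (memLp_mul_bdd (S.memLp_dlow_mul B j i (mv i)) hψ.aesm hM)
  have e2 : ∀ j, ∫ z, u j z * (((G j i z + B.dhigh u G j i z) * B.low u i z +
        (u i z + B.high u i z) * B.dlow u j i z) * ψ z) =
      2 * (∫ z, u j z * (G j i z * B.low u i z * ψ z)) +
      2 * ∫ z, u j z * (B.high u i z * B.dlow u j i z * ψ z) := fun j => by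
    rw [← integral_const_mul, ← integral_const_mul,
      ← integral_add ((k1 j).const_mul 2) ((k2 j).const_mul 2)]
    refine integral_congr_ae (Eventually.of_forall fun z => ?_)
    simp only [RadialBump.high, RadialBump.dhigh]; ring
  have e3 : ∫ z, conv u G i z * (B.low u i z * ψ z) =
      ∑ j, ∫ z, u j z * (G j i z * B.low u i z * ψ z) := by
    rw [← integral_finsetSum _ fun j _ => k1 j]
    refine integral_congr_ae (Eventually.of_forall fun z => ?_)
    simp only [conv, Finset.sum_mul]
    exact Finset.sum_congr rfl fun j _ => by ring
  simp only [e2, Finset.sum_add_distrib, ← Finset.mul_sum] at hp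
  simp only [e1, Finset.sum_add_distrib, e3]
  linarith

/-- The term with u · ∇u paired with the regularized velocity cancels against the one produced by
the cubic flux. The gradient of half the squared low part is then subtracted from the convection in
the correction term and compensated locally; the compensation turns the gradient of the low part
into its curl. What remains contains only combinations that are stable under weak convergence. -/
theorem defect_eq (S : FlowData W C u f G) (B : RadialBump r) (hr : 0 ≤ r)
    {r1 : ℝ} {V0 V : Set SpaceTime} (hr1 : 0 < r1) (hV0 : Near r1 V0 V) (hV : Near r V W)
    (hψ : IsTest V0 ψ) :
    (∑ i, ∑ j, ∫ z, u j z * (u i z * (u i z * dd (ej j) ψ z))) +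
      2 * (B.work u f G ψ + ∑ i, ∫ z, conv u G i z * (B.low u i z * ψ z)) =
      B.defect u f G ψ := by
  have hψW : IsTest W ψ := hψ.mono ((hV0.subset hr1.le).trans (hV.subset hr))
  have mu := S.memU
  have mv := B.memLp_high mu
  have ml := B.memLp_low mu
  obtain ⟨M, hM⟩ := hψ.ae_bdd
  have mvψ : ∀ i, MemLp (fun z => B.high u i z * ψ z) 2 := fun i =>
    memLp_mul_bdd (mv i) hψ.aesm hM
  have h1 := S.sum_integral_lowGrad_corr B hr hr1 hV0 hV hψ
  have h2 : ∀ i, ∫ z, (conv u G i z - B.lowGrad u i z) * B.corr u ψ i z =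
      (∫ z, conv u G i z * B.corr u ψ i z) - ∫ z, B.lowGrad u i z * B.corr u ψ i z := fun i => by
    rw [← integral_sub (B.integrable_mul_corr (S.conv_aesm i) (S.nL21_conv_ne_top i)
      (mvψ i) (S.isH1_flux B hψW))
      (integrable_mul_of_memLp (S.memLp_lowGrad B i) (S.memLp_corr B hψW i))]
    simp only [sub_mul]
  have k1 : ∀ i j, Integrable (fun z => B.low u j z * B.dlow u i j z * (B.high u i z * ψ z)) :=
    fun i j => integrable_mul_of_memLp (S.memLp_dlow_mul B i j (ml j)) (mvψ i)
  have k2 : ∀ i j, Integrable (fun z => u j z * (B.high u i z * B.dlow u j i z * ψ z)) :=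
    fun i j => integrable_mul_of_memLp (mu j)
      (memLp_mul_bdd (S.memLp_dlow_mul B j i (mv i)) hψ.aesm hM)
  have h3 : ∀ i, ∫ z, B.lowGrad u i z * (B.high u i z * ψ z) =
      ∑ j, ∫ z, B.low u j z * B.dlow u i j z * (B.high u i z * ψ z) := fun i => by
    rw [← integral_finsetSum _ fun j _ => k1 i j]
    simp only [RadialBump.lowGrad, Finset.sum_mul]
  have h4 : ∀ i j, ∫ z, (B.low u j z * B.curl u j i z + B.high u j z * B.dlow u j i z) *
      (B.high u i z * ψ z) = (∫ z, u j z * (B.high u i z * B.dlow u j i z * ψ z)) -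
      ∫ z, B.low u j z * B.dlow u i j z * (B.high u i z * ψ z) := fun i j => by
    rw [← integral_sub (k2 i j) (k1 i j)]
    refine integral_congr_ae (Eventually.of_forall fun z => ?_)
    simp only [RadialBump.curl, RadialBump.high]; ring
  unfold RadialBump.defect RadialBump.work
  simp only [S.sum_integral_cubic B hψW, h2, h4, Finset.sum_sub_distrib, ← Finset.mul_sum, h1, h3]
  ring

end FlowData

/-! ### Bounds on time derivatives, drawn from the equation -/

section Bounds

theorem abs_integral_le_eLpNorm {g θ : SpaceTime → ℝ} {N k : ℝ≥0∞} (hN : N ≠ ⊤) (hk : k ≠ ⊤)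
    (hθ : MemLp θ 2) (h : (∫⁻ z, ‖g z‖ₑ) ^ 2 ≤ N * (k * ∫⁻ z, ‖θ z‖ₑ ^ 2)) :
    |∫ z, g z| ≤ (((N * k) ^ (1 / 2 : ℝ)).toNNReal : ℝ) * (eLpNorm θ 2 volume).toReal := by
  rw [← eLpNorm_two_sq, ← mul_assoc] at h
  refine (abs_integral_le_of_sq_lintegral_le h (by have := hθ.2.ne; finiteness)).trans
    (le_of_eq ?_)
  rw [ENNReal.mul_rpow_of_nonneg _ _ (by norm_num), ENNReal.toReal_mul,
    ← ENNReal.rpow_natCast (eLpNorm θ 2 volume), ← ENNReal.rpow_mul,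
    show ((2 : ℕ) : ℝ) * (1 / 2) = 1 by norm_num, ENNReal.rpow_one]
  rfl

theorem eLpNorm_avg_toReal_le (k : TransKernel) {θ : SpaceTime → ℝ} (hθ : MemLp θ 2) :
    (eLpNorm (k.avg θ) 2 volume).toReal ≤ k.mass.toReal * (eLpNorm θ 2 volume).toReal := by
  rw [← ENNReal.toReal_mul]
  exact ENNReal.toReal_mono (by have := k.mass_ne_top; have := hθ.2.ne; finiteness)
    (k.eLpNorm_avg_le hθ.1)

theorem abs_integral_mul_avg_le {a θ : SpaceTime → ℝ} {C : ℝ≥0} (ha : MemLp a 2)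
    (hC : eLpNorm a 2 volume ≤ C) (hθ : MemLp θ 2) (k : TransKernel) :
    |∫ z, a z * k.avg θ z| ≤ (C * k.mass.toNNReal : ℝ≥0) * (eLpNorm θ 2 volume).toReal := by
  refine (abs_integral_mul_le ha (k.memLp_avg hθ)).trans ?_
  rw [NNReal.coe_mul, mul_assoc]
  refine mul_le_mul (ENNReal.toReal_mono ENNReal.coe_ne_top hC) (eLpNorm_avg_toReal_le k hθ)
    (by positivity) (by positivity)

end Bounds

namespace FlowData
variable {W : Set SpaceTime} {C : ℝ≥0} {r : ℝ} {φ : R3 → ℝ}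

/-- The constant in the bound of the convection term against smooth kernels. -/
def convConst (C : ℝ≥0) (k : ℝ≥0∞) : ℝ≥0 := ((9 * (C * C ^ 2) * k) ^ (1 / 2 : ℝ)).toNNReal

theorem abs_integral_conv_spaceKer_le {u f : Fin 3 → SpaceTime → ℝ}
    {G : Fin 3 → Fin 3 → SpaceTime → ℝ} (S : FlowData W C u f G) {κ : R3 → ℝ}
    {h : ContDiff ℝ ∞ κ} {hc : HasCompactSupport κ} {θ : SpaceTime → ℝ} (hθ : MemLp θ 2)
    (i : Fin 3) : |∫ z, conv u G i z * (spaceKer κ h hc).avg θ z| ≤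
      convConst C (kerSq κ) * (eLpNorm θ 2 volume).toReal :=
  abs_integral_le_eLpNorm (by finiteness) (kerSq_ne_top h hc) hθ
    ((sq_lintegral_spaceKer_le (S.conv_aesm i) hθ.1).trans (by
      gcongr; exact S.nL21_conv_le i))

theorem abs_integral_conv_avg_le {u f : Fin 3 → SpaceTime → ℝ}
    {G : Fin 3 → Fin 3 → SpaceTime → ℝ} (S : FlowData W C u f G) {κ : R3 → ℝ}
    {h : ContDiff ℝ ∞ κ} {hc : HasCompactSupport κ} {θ : SpaceTime → ℝ} (hθ : MemLp θ 2)
    (k : TransKernel) (hk : ∀ α, (k.τ α).1 = 0) (i : Fin 3) :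
    |∫ z, conv u G i z * k.avg ((spaceKer κ h hc).avg θ) z| ≤
      convConst C (k.mass ^ 2 * kerSq κ) * (eLpNorm θ 2 volume).toReal := by
  have := k.mass_ne_top
  have := kerSq_ne_top h hc
  refine abs_integral_le_eLpNorm (by finiteness) (by finiteness) hθ
    ((sq_lintegral_avg_spaceKer_le k hk (S.conv_aesm i) hθ.1).trans ?_)
  rw [← mul_assoc (k.mass ^ 2)]
  gcongr
  exact S.nL21_conv_le i

/-- A bound for the gradient of the high part. -/
def dhighConst (B : RadialBump r) (C : ℝ≥0) (j : Fin 3) : ℝ≥0 := C + (B.TD j).mass.toNNReal * C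

theorem eLpNorm_avg_le_coe {a : SpaceTime → ℝ} (ha : MemLp a 2) (hC : eLpNorm a 2 volume ≤ C)
    (k : TransKernel) : eLpNorm (k.avg a) 2 volume ≤ (k.mass.toNNReal * C : ℝ≥0) := by
  refine (k.eLpNorm_avg_le ha.1).trans ?_
  rw [ENNReal.coe_mul, ENNReal.coe_toNNReal k.mass_ne_top]
  gcongr

theorem eLpNorm_dhigh_le {u f : Fin 3 → SpaceTime → ℝ} {G : Fin 3 → Fin 3 → SpaceTime → ℝ}
    (S : FlowData W C u f G) (B : RadialBump r) (j i : Fin 3) :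
    eLpNorm (B.dhigh u G j i) 2 volume ≤ dhighConst B C j := by
  refine (eLpNorm_sub_le (S.memG j i).1 (B.memLp_dlow S.memU j i).1 one_le_two).trans ?_
  rw [dhighConst, ENNReal.coe_add]
  exact add_le_add (S.normG j i) (eLpNorm_avg_le_coe (S.memU i) (S.normU i) _)

theorem eLpNorm_high_force_le {u f : Fin 3 → SpaceTime → ℝ} {G : Fin 3 → Fin 3 → SpaceTime → ℝ}
    (S : FlowData W C u f G) (B : RadialBump r) (i : Fin 3) :
    eLpNorm (B.high f i) 2 volume ≤ (C + B.TR.mass.toNNReal * C : ℝ≥0) := by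
  refine (eLpNorm_sub_le (S.memF i).1 (B.memLp_low S.memF i).1 one_le_two).trans ?_
  rw [ENNReal.coe_add]
  exact add_le_add (S.normF i) (eLpNorm_avg_le_coe (S.memF i) (S.normF i) _)

/-- Bound for the time derivative of the space mollifications of the high part, uniform over flows
with the same bounds. -/
theorem exists_db_high (B : RadialBump r) (hr : 0 ≤ r) (hφ : IsMollifier φ) {ε R : ℝ}
    (hR : (spaceMol hφ ε).InBall R) (hR0 : 0 ≤ R) {U U' : Set SpaceTime}
    (hU : Near R U U') (hU' : Near r U' W) (i : Fin 3) :
    ∃ C' : ℝ≥0, ∀ (u f : Fin 3 → SpaceTime → ℝ) (G : Fin 3 → Fin 3 → SpaceTime → ℝ),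
      FlowData W C u f G → WeakEq W u f → DB U et ((spaceMol hφ ε).avg (B.high u i)) C' := by
  set κ : R3 → ℝ := fun y => phiE φ ε (-y) with hκ
  have cκ : ContDiff ℝ ∞ κ := (contDiff_phiE hφ ε).comp contDiff_neg
  have sκ : HasCompactSupport κ := hasCompactSupport_neg (hasCompactSupport_phiE hφ ε)
  set T : TransKernel := spaceKer κ cκ sκ with hT
  set T' : Fin 3 → TransKernel := fun j => spaceKer (d3 j κ) (contDiff_d3 cκ j)
    (hasCompactSupport_d3 sκ j) with hT'
  have adjT : ∀ F : SpaceTime → ℝ, (spaceMol hφ ε).adj.avg F = T.avg F := fun F =>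
    spaceKer_adj_avg F
  refine ⟨(convConst C (kerSq κ) + convConst C (B.TR.mass ^ 2 * kerSq κ) +
    ∑ l, convConst C ((B.K l).mass ^ 2 * kerSq (d3 i κ))) +
    (∑ j, dhighConst B C j * (T' j).mass.toNNReal) +
    (C + B.TR.mass.toNNReal * C) * T.mass.toNNReal, fun u f G S hE θ hθ => ?_⟩
  have mv := B.memLp_high S.memU
  have tT : IsTest U' (T.avg θ) := by
    rw [← adjT]; exact hθ.avg hR.adj hU hR0
  -- Only the i-th component is non-zero, and it is θ convolved in space with the reflected kernel.
  -- All space derivatives then fall on the kernel, so every term is bounded by the L² norm of θ.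
  set Ψ : Fin 3 → SpaceTime → ℝ := fun l => if l = i then T.avg θ else fun _ => 0 with hΨ
  have tΨ : ∀ l, IsTest U' (Ψ l) := fun l => by
    by_cases h : l = i
    · simp only [hΨ, if_pos h]; exact tT
    · simp only [hΨ, if_neg h]; exact IsTest.zero
  have key := S.equation_sol hE B hr hU' tΨ
  have d0 : ∀ e : SpaceTime, dd e (fun _ : SpaceTime => (0 : ℝ)) = fun _ => 0 := fun e => by
    ext z; simp [dd]
  have dΨ : ∀ e l, dd e (Ψ l) = if l = i then dd e (T.avg θ) else fun _ => 0 := fun e l => by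
    by_cases h : l = i
    · simp only [hΨ, if_pos h]
    · simp only [hΨ, if_neg h, d0]
  have pick : ∀ (a : Fin 3 → SpaceTime → ℝ) (F : SpaceTime → ℝ),
      ∑ l, ∫ z, a l z * (if l = i then F else fun _ => 0) z = ∫ z, a i z * F z := fun a F => by
    rw [Finset.sum_eq_single i]
    · simp
    · intro l _ hl; simp [hl]
    · simp
  have hdd : ∀ j, dd (ej j) (T.avg θ) = (T' j).avg θ := fun j => by
    ext z
    rw [hθ.dd_avg]
    exact spaceKer_avg_dd hθ j z
  have hdiv : (fun w => ∑ j, dd (ej j) (Ψ j) w) = (T' i).avg θ := by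
    ext w
    simp only [dΨ]
    rw [Finset.sum_eq_single i]
    · simp only [if_true, hdd]
    · intro l _ hl; simp [hl]
    · simp
  have e1 : ∑ l, ∫ z, B.high u l z * dd et (Ψ l) z = ∫ z, B.high u i z * dd et (T.avg θ) z := by
    simp only [dΨ]; exact pick _ _
  have e2 : ∑ l, ∑ j, ∫ z, B.dhigh u G j l z * dd (ej j) (Ψ l) z =
      ∑ j, ∫ z, B.dhigh u G j i z * (T' j).avg θ z := by
    rw [Finset.sum_comm]
    refine Finset.sum_congr rfl fun j _ => ?_
    simp only [dΨ, hdd]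
    exact pick (fun l => B.dhigh u G j l) _
  have e3 : ∑ l, ∫ z, B.high f l z * Ψ l z = ∫ z, B.high f i z * T.avg θ z := pick _ _
  have e4 : ∑ l, ∫ z, conv u G l z * B.sol Ψ l z = (∫ z, conv u G i z * T.avg θ z) -
      (∫ z, conv u G i z * B.TR.avg (T.avg θ) z) -
      ∑ l, ∫ z, conv u G l z * (B.K l).avg ((T' i).avg θ) z := by
    have ga := S.conv_aesm
    have hg := S.nL21_conv_ne_top
    have tR0 : ∀ l, B.TR.avg (Ψ l) = if l = i then B.TR.avg (T.avg θ) else fun _ => 0 := fun l => by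
      by_cases h : l = i
      · simp only [hΨ, if_pos h]
      · simp only [hΨ, if_neg h]; ext z; simp [TransKernel.avg]
    have sp : ∀ l, ∫ z, conv u G l z * B.sol Ψ l z = (∫ z, conv u G l z * Ψ l z) -
        (∫ z, conv u G l z * B.TR.avg (Ψ l) z) -
        ∫ z, conv u G l z * (B.K l).avg ((T' i).avg θ) z := fun l => by
      obtain ⟨M, hM⟩ := (tΨ l).ae_bdd
      have j1 : Integrable (fun z => conv u G l z * Ψ l z) :=
        (S.integrable_conv l).mul_bdd (tΨ l).aesm hM
      have j2 : Integrable (fun z => conv u G l z * B.TR.avg (Ψ l) z) :=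
        integrable_mul_spaceKer (ga l) (hg l) (tΨ l).memLp
      have j3 : Integrable (fun z => conv u G l z * (B.K l).avg ((T' i).avg θ) z) := by
        rw [← hdiv]
        exact integrable_mul_K B l (ga l) (hg l) (RadialBump.isTest_div tΨ).isH1
      rw [← integral_sub j1 j2, ← integral_sub (f := fun z => conv u G l z * Ψ l z -
        conv u G l z * B.TR.avg (Ψ l) z) (j1.sub j2) j3]
      refine integral_congr_ae (Eventually.of_forall fun z => ?_)
      simp only [RadialBump.sol, hdiv]
      ring
    simp only [sp, Finset.sum_sub_distrib, tR0]
    rw [pick (fun l => conv u G l) (B.TR.avg (T.avg θ)), pick (fun l => conv u G l) (T.avg θ)]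
  rw [e1, e2, e3, e4] at key
  have e5 : ∫ z, (spaceMol hφ ε).avg (B.high u i) z * dd et θ z =
      ∫ z, B.high u i z * dd et (T.avg θ) z := by
    rw [(spaceMol hφ ε).integral_avg_mul_of_memLp (mv i) (hθ.dd et).memLp, adjT]
    simp only [hθ.dd_avg]
  rw [e5]
  have b1 : |∫ z, conv u G i z * T.avg θ z| ≤ _ :=
    S.abs_integral_conv_spaceKer_le (h := cκ) (hc := sκ) hθ.memLp i
  have b2 : |∫ z, conv u G i z * B.TR.avg (T.avg θ) z| ≤ _ :=
    S.abs_integral_conv_avg_le (h := cκ) (hc := sκ) hθ.memLp B.TR (fun _ => rfl) i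
  have b3 : |∑ l, ∫ z, conv u G l z * (B.K l).avg ((T' i).avg θ) z| ≤
      (∑ l, convConst C ((B.K l).mass ^ 2 * kerSq (d3 i κ)) : ℝ≥0) *
        (eLpNorm θ 2 volume).toReal := by
    refine (Finset.abs_sum_le_sum_abs _ _).trans ?_
    rw [NNReal.coe_sum, Finset.sum_mul]
    exact Finset.sum_le_sum fun l _ => S.abs_integral_conv_avg_le hθ.memLp (B.K l) (fun _ => rfl) l
  have b4 : |∑ j, ∫ z, B.dhigh u G j i z * (T' j).avg θ z| ≤
      (∑ j, dhighConst B C j * (T' j).mass.toNNReal : ℝ≥0) * (eLpNorm θ 2 volume).toReal := by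
    refine (Finset.abs_sum_le_sum_abs _ _).trans ?_
    rw [NNReal.coe_sum, Finset.sum_mul]
    exact Finset.sum_le_sum fun j _ => abs_integral_mul_avg_le (S.memLp_dhigh B j i)
      (S.eLpNorm_dhigh_le B j i) hθ.memLp _
  have b5 := abs_integral_mul_avg_le (B.memLp_high S.memF i) (S.eLpNorm_high_force_le B i)
    hθ.memLp T
  rw [NNReal.coe_add, NNReal.coe_add, NNReal.coe_add, NNReal.coe_add, add_mul, add_mul, add_mul,
    add_mul]
  rw [abs_le] at b1 b2 b3 b4 b5 ⊢
  constructor <;> linarith [b1.1, b1.2, b2.1, b2.2, b3.1, b3.2, b4.1, b4.2, b5.1, b5.2]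

theorem abs_integral_mul_avg_avg_le {a θ : SpaceTime → ℝ} (ha : MemLp a 2)
    (hC : eLpNorm a 2 volume ≤ C) (hθ : MemLp θ 2) (k k' : TransKernel) :
    |∫ z, a z * k.avg (k'.avg θ) z| ≤
      (C * k.mass.toNNReal * k'.mass.toNNReal : ℝ≥0) * (eLpNorm θ 2 volume).toReal := by
  refine (abs_integral_mul_avg_le ha hC (k'.memLp_avg hθ) k).trans ?_
  rw [NNReal.coe_mul (C * k.mass.toNNReal), mul_assoc]
  gcongr
  exact eLpNorm_avg_toReal_le k' hθ

theorem sum_integral_rotated {X : Fin 3 → SpaceTime → ℝ} {a b : SpaceTime → ℝ}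
    (ha : ∀ l, Integrable fun z => X l z * a z) (hb : ∀ l, Integrable fun z => X l z * b z)
    (i j : Fin 3) : ∑ l, ∫ z, X l z * ((if l = j then 1 else 0) * a z -
      (if l = i then 1 else 0) * b z) = (∫ z, X j z * a z) - ∫ z, X i z * b z := by
  have h : ∀ l, ∫ z, X l z * ((if l = j then 1 else 0) * a z - (if l = i then 1 else 0) * b z) =
      (if l = j then ∫ z, X l z * a z else 0) - if l = i then ∫ z, X l z * b z else 0 := fun l => by
    have := integral_sub ((ha l).const_mul (if l = j then 1 else 0))
      ((hb l).const_mul (if l = i then 1 else 0))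
    rw [integral_const_mul, integral_const_mul] at this
    simp only [ite_mul, one_mul, zero_mul] at this
    rw [← this]
    refine integral_congr_ae (Eventually.of_forall fun z => ?_)
    simp only [mul_sub, mul_ite, mul_zero, ite_mul, one_mul, zero_mul]
  simp only [h, Finset.sum_sub_distrib, Finset.sum_ite_eq', Finset.mem_univ, if_true]

/-- The equation for the rotational of the low part. -/
theorem integral_curl_dt {u f : Fin 3 → SpaceTime → ℝ} {G : Fin 3 → Fin 3 → SpaceTime → ℝ}
    (S : FlowData W C u f G) (hE : WeakEq W u f) (B : RadialBump r) (hr : 0 ≤ r)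
    {U : Set SpaceTime} (hU : Near r U W) {θ : SpaceTime → ℝ} (hθ : IsTest U θ) (j i : Fin 3) :
    ∫ z, B.curl u j i z * dd et θ z =
      ((∫ z, conv u G j z * B.TR.avg (dd (ej i) θ) z) -
        ∫ z, conv u G i z * B.TR.avg (dd (ej j) θ) z) -
      (∑ k, ((∫ z, u j z * B.TR.avg (dd (ej k) (dd (ej k) (dd (ej i) θ))) z) -
        ∫ z, u i z * B.TR.avg (dd (ej k) (dd (ej k) (dd (ej j) θ))) z)) -
      ((∫ z, f j z * B.TR.avg (dd (ej i) θ) z) - ∫ z, f i z * B.TR.avg (dd (ej j) θ) z) := by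
  -- The field R * (∂ᵢθ eⱼ − ∂ⱼθ eᵢ) is divergence-free because derivatives commute. It is tested
  -- without any projection, and its pairing with u is the curl of R * u tested with θ.
  set φ : Fin 3 → SpaceTime → ℝ := fun l z => (if l = j then 1 else 0) * B.TR.avg (dd (ej i) θ) z -
    (if l = i then 1 else 0) * B.TR.avg (dd (ej j) θ) z with hφ
  have ta : ∀ {χ}, IsTest U χ → IsTest W (B.TR.avg χ) := fun h => h.avg B.inBall_TR hU hr
  have tφ : ∀ l, IsTest W (φ l) := fun l =>
    ((ta (hθ.dd (ej i))).const_mul _).sub ((ta (hθ.dd (ej j))).const_mul _)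
  have dφ : ∀ (e : SpaceTime) (c d : ℝ) {a b : SpaceTime → ℝ}, IsTest U a → IsTest U b →
      dd e (fun z => c * B.TR.avg a z - d * B.TR.avg b z) =
        fun z => c * B.TR.avg (dd e a) z - d * B.TR.avg (dd e b) z := by
    intro e c d a b ha hb
    ext z
    have h1 := ((ta ha).differentiable z).hasFDerivAt.const_mul c
    have h2 := ((ta hb).differentiable z).hasFDerivAt.const_mul d
    rw [← ha.dd_avg (k := B.TR), ← hb.dd_avg (k := B.TR)]
    have h3 : fderiv ℝ (fun z => c * B.TR.avg a z - d * B.TR.avg b z) z = _ := (h1.sub h2).fderiv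
    simp only [dd, h3]
    rfl
  have hd : ∀ z, ∑ l, dd (ej l) (φ l) z = 0 := fun z => by
    have h : ∀ l, dd (ej l) (φ l) z = (if l = j then B.TR.avg (dd (ej l) (dd (ej i) θ)) z else 0) -
        if l = i then B.TR.avg (dd (ej l) (dd (ej j) θ)) z else 0 := fun l => by
      rw [hφ]
      refine (congrFun (dφ (ej l) _ _ (hθ.dd (ej i)) (hθ.dd (ej j))) z).trans ?_
      simp only [ite_mul, one_mul, zero_mul]
    simp only [h, Finset.sum_sub_distrib, Finset.sum_ite_eq', Finset.mem_univ, if_true]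
    rw [sub_eq_zero]
    congr 1
    ext w
    exact dd_comm hθ.smooth _ _ _
  have key := S.equation_conv hE tφ hd
  have mi : ∀ {X : Fin 3 → SpaceTime → ℝ}, (∀ l, MemLp (X l) 2) → ∀ {χ}, IsTest U χ → ∀ l,
      Integrable fun z => X l z * B.TR.avg χ z := fun hX χ hχ l =>
    integrable_mul_of_memLp (hX l) (ta hχ).memLp
  have mc : ∀ {χ}, IsTest U χ → ∀ l, Integrable fun z => conv u G l z * B.TR.avg χ z :=
    fun hχ l => integrable_mul_spaceKer (S.conv_aesm l) (S.nL21_conv_ne_top l) hχ.memLp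
  have ti := hθ.dd (ej i)
  have tj := hθ.dd (ej j)
  have e1 := sum_integral_rotated (mc ti) (mc tj) i j
  have e2 := sum_integral_rotated (mi S.memU (ti.dd et)) (mi S.memU (tj.dd et)) i j
  have e3 : ∀ k : Fin 3, _ := fun k => sum_integral_rotated (mi S.memU ((ti.dd (ej k)).dd (ej k)))
    (mi S.memU ((tj.dd (ej k)).dd (ej k))) i j
  have e4 := sum_integral_rotated (mi S.memF ti) (mi S.memF tj) i j
  have e5 : ∫ z, B.curl u j i z * dd et θ z =
      (∫ z, u j z * B.TR.avg (dd et (dd (ej i) θ)) z) -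
        ∫ z, u i z * B.TR.avg (dd et (dd (ej j) θ)) z := by
    have h : ∀ a b, ∫ z, B.dlow u a b z * dd et θ z =
        -∫ z, u b z * B.TR.avg (dd et (dd (ej a) θ)) z := fun a b => by
      rw [RadialBump.dlow, (B.TD a).integral_avg_mul_of_memLp (S.memU b) (hθ.dd et).memLp,
        ← integral_neg]
      refine integral_congr_ae (Eventually.of_forall fun z => ?_)
      have h1 := spaceKer_adj_avg_dd (hκ := B.smooth) (hcκ := B.compact) (hθ.dd et) a z
      have h2 : dd et (dd (ej a) θ) = dd (ej a) (dd et θ) := by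
        ext w; exact dd_comm hθ.smooth _ _ _
      have h3 := B.TR_adj_avg (dd (ej a) (dd et θ)) z
      simp only [h2, ← h3]
      change _ * (B.TD a).adj.avg (dd et θ) z = -(u b z * B.TR.adj.avg (dd (ej a) (dd et θ)) z)
      rw [show B.TR.adj.avg (dd (ej a) (dd et θ)) z = -(B.TD a).adj.avg (dd et θ) z from h1]
      ring
    have h1 := integral_sub (integrable_mul_of_memLp (B.memLp_dlow S.memU j i) (hθ.dd et).memLp)
      (integrable_mul_of_memLp (B.memLp_dlow S.memU i j) (hθ.dd et).memLp)
    rw [h, h] at h1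
    rw [show (∫ z, u j z * B.TR.avg (dd et (dd (ej i) θ)) z) -
      (∫ z, u i z * B.TR.avg (dd et (dd (ej j) θ)) z) =
      (-∫ z, u i z * B.TR.avg (dd et (dd (ej j) θ)) z) -
      -∫ z, u j z * B.TR.avg (dd et (dd (ej i) θ)) z by ring, ← h1]
    refine integral_congr_ae (Eventually.of_forall fun z => ?_)
    simp only [RadialBump.curl]
    ring
  rw [Finset.sum_comm (f := fun l k => ∫ z, u l z * dd (ej k) (dd (ej k) (φ l)) z)] at key
  have d2 : ∀ k l, dd (ej k) (dd (ej k) (φ l)) = fun z =>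
      (if l = j then 1 else 0) * B.TR.avg (dd (ej k) (dd (ej k) (dd (ej i) θ))) z -
      (if l = i then 1 else 0) * B.TR.avg (dd (ej k) (dd (ej k) (dd (ej j) θ))) z := fun k l => by
    rw [hφ]
    simp only [dφ (ej k) _ _ ti tj]
    exact dφ _ _ _ (ti.dd _) (tj.dd _)
  simp only [d2, e3] at key
  simp only [hφ, dφ et _ _ ti tj] at key
  rw [e1, e2, e4] at key
  rw [e5]
  linarith

/-- Bound for the time derivative of the space mollifications of the rotational of the low part,
uniform over flows with the same bounds. -/
theorem exists_db_curl (B : RadialBump r) (hr : 0 ≤ r) (hφ : IsMollifier φ) {ε R : ℝ}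
    (hR : (spaceMol hφ ε).InBall R) (hR0 : 0 ≤ R) {U U' : Set SpaceTime}
    (hU : Near R U U') (hU' : Near r U' W) (j i : Fin 3) :
    ∃ C' : ℝ≥0, ∀ (u f : Fin 3 → SpaceTime → ℝ) (G : Fin 3 → Fin 3 → SpaceTime → ℝ),
      FlowData W C u f G → WeakEq W u f → DB U et ((spaceMol hφ ε).avg (B.curl u j i)) C' := by
  set κ : R3 → ℝ := fun y => phiE φ ε (-y) with hκ
  have cκ : ContDiff ℝ ∞ κ := (contDiff_phiE hφ ε).comp contDiff_neg
  have sκ : HasCompactSupport κ := hasCompactSupport_neg (hasCompactSupport_phiE hφ ε)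
  set T : TransKernel := spaceKer κ cκ sκ with hT
  have c1 : ∀ j, ContDiff ℝ ∞ (d3 j κ) := fun j => contDiff_d3 cκ j
  have s1 : ∀ j, HasCompactSupport (d3 j κ) := fun j => hasCompactSupport_d3 sκ j
  set T1 : Fin 3 → TransKernel := fun j => spaceKer (d3 j κ) (c1 j) (s1 j) with hT1
  set T3 : Fin 3 → Fin 3 → TransKernel := fun k j => spaceKer (d3 k (d3 k (d3 j κ)))
    (contDiff_d3 (contDiff_d3 (c1 j) k) k)
    (hasCompactSupport_d3 (hasCompactSupport_d3 (s1 j) k) k) with hT3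
  have adjT : ∀ F : SpaceTime → ℝ, (spaceMol hφ ε).adj.avg F = T.avg F := fun F =>
    spaceKer_adj_avg F
  set c : Fin 3 → ℝ≥0 := fun l => convConst C (B.TR.mass ^ 2 * kerSq (d3 l κ)) +
    (∑ k, C * B.TR.mass.toNNReal * (T3 k l).mass.toNNReal) +
    C * B.TR.mass.toNNReal * (T1 l).mass.toNNReal with hc
  refine ⟨c i + c j, fun u f G S hE θ hθ => ?_⟩
  have mcurl : MemLp (B.curl u j i) 2 := memLp_sub (B.memLp_dlow S.memU j i) (B.memLp_dlow S.memU i j)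
  have tT : IsTest U' (T.avg θ) := by
    rw [← adjT]; exact hθ.avg hR.adj hU hR0
  have d1 : ∀ j, dd (ej j) (T.avg θ) = (T1 j).avg θ := fun j => by
    ext z
    rw [hθ.dd_avg]
    exact spaceKer_avg_dd hθ j z
  have d3' : ∀ k j, dd (ej k) (dd (ej k) ((T1 j).avg θ)) = (T3 k j).avg θ := fun k j => by
    have h : dd (ej k) ((T1 j).avg θ) = (T1 j).avg (dd (ej k) θ) := by
      ext z; exact hθ.dd_avg z
    ext z
    rw [h, (hθ.dd (ej k)).dd_avg]
    refine (spaceKer_avg_dd (hθ.dd (ej k)) k z).trans (spaceKer_avg_dd hθ k z)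
  have key := S.integral_curl_dt hE B hr hU' tT j i
  simp only [d1, d3'] at key
  have e5 : ∫ z, (spaceMol hφ ε).avg (B.curl u j i) z * dd et θ z =
      ∫ z, B.curl u j i z * dd et (T.avg θ) z := by
    rw [(spaceMol hφ ε).integral_avg_mul_of_memLp mcurl (hθ.dd et).memLp, adjT]
    simp only [hθ.dd_avg]
  have b1 : ∀ l m, |∫ z, conv u G m z * B.TR.avg ((T1 l).avg θ) z| ≤
      convConst C (B.TR.mass ^ 2 * kerSq (d3 l κ)) * (eLpNorm θ 2 volume).toReal := fun l m =>
    S.abs_integral_conv_avg_le (h := c1 l) (hc := s1 l) hθ.memLp B.TR (fun _ => rfl) m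
  have b2 : ∀ l m, |∑ k, ∫ z, u m z * B.TR.avg ((T3 k l).avg θ) z| ≤
      (∑ k, C * B.TR.mass.toNNReal * (T3 k l).mass.toNNReal : ℝ≥0) *
        (eLpNorm θ 2 volume).toReal := fun l m => by
    refine (Finset.abs_sum_le_sum_abs _ _).trans ?_
    rw [NNReal.coe_sum, Finset.sum_mul]
    exact Finset.sum_le_sum fun k _ =>
      abs_integral_mul_avg_avg_le (S.memU m) (S.normU m) hθ.memLp _ _
  have b3 : ∀ l m, |∫ z, f m z * B.TR.avg ((T1 l).avg θ) z| ≤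
      (C * B.TR.mass.toNNReal * (T1 l).mass.toNNReal : ℝ≥0) * (eLpNorm θ 2 volume).toReal :=
    fun l m => abs_integral_mul_avg_avg_le (S.memF m) (S.normF m) hθ.memLp _ _
  have b : ∀ l m, |(∫ z, conv u G m z * B.TR.avg ((T1 l).avg θ) z) -
      (∑ k, ∫ z, u m z * B.TR.avg ((T3 k l).avg θ) z) -
      ∫ z, f m z * B.TR.avg ((T1 l).avg θ) z| ≤ c l * (eLpNorm θ 2 volume).toReal := fun l m => by
    have h1 := b1 l m
    have h2 := b2 l m
    have h3 := b3 l m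
    simp only [hc]
    rw [NNReal.coe_add, NNReal.coe_add, add_mul, add_mul]
    rw [abs_le] at h1 h2 h3 ⊢
    constructor <;> linarith [h1.1, h1.2, h2.1, h2.2, h3.1, h3.2]
  have h1 := b i j
  have h2 := b j i
  rw [e5, key, NNReal.coe_add, add_mul, Finset.sum_sub_distrib]
  rw [abs_le] at h1 h2 ⊢
  constructor <;> linarith [h1.1, h1.2, h2.1, h2.2]

end FlowData

/-! ### Points lying deep inside an open set -/

section Core

/-- The interior of the set of points whose closed ball of radius `ρ` lies in `W`. -/
def core (ρ : ℝ) (W : Set SpaceTime) : Set SpaceTime := interior {w | ∀ y, ‖w - y‖ ≤ ρ → y ∈ W}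

theorem isOpen_core (ρ : ℝ) (W : Set SpaceTime) : IsOpen (core ρ W) := isOpen_interior

theorem near_core (ρ : ℝ) (W : Set SpaceTime) : Near ρ (core ρ W) W :=
  fun _ hz w hw => interior_subset hz w hw

theorem Near.near_core {K W : Set SpaceTime} {a b c : ℝ} (h : Near c K W) (hc : a + b < c) :
    Near a K (core b W) := by
  intro z hz w hw
  refine mem_interior_iff_mem_nhds.2 (Metric.mem_nhds_iff.2 ⟨c - (a + b), by linarith, ?_⟩)
  intro w' hw' y hy
  refine h z hz y ?_
  rw [Metric.mem_ball, dist_comm, dist_eq_norm] at hw'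
  calc ‖z - y‖ = ‖(z - w) + (w - w') + (w' - y)‖ := by congr 1; abel
    _ ≤ ‖z - w‖ + ‖w - w'‖ + ‖w' - y‖ := norm_add₃_le
    _ ≤ c := by linarith

theorem near_core_core {W : Set SpaceTime} (a b : ℝ) : Near a (core (a + b) W) (core b W) := by
  intro z hz w hw
  obtain ⟨δ, hδ, hb⟩ := Metric.mem_nhds_iff.1 (mem_interior_iff_mem_nhds.1 hz)
  refine mem_interior_iff_mem_nhds.2 (Metric.mem_nhds_iff.2 ⟨δ, hδ, ?_⟩)
  intro w' hw' y hy
  have hw2 : w' - w + z ∈ Metric.ball z δ := by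
    rw [Metric.mem_ball, dist_eq_norm] at hw' ⊢
    simpa using hw'
  refine hb hw2 y ?_
  calc ‖w' - w + z - y‖ = ‖(z - w) + (w' - y)‖ := by congr 1; abel
    _ ≤ ‖z - w‖ + ‖w' - y‖ := norm_add_le _ _
    _ ≤ a + b := by linarith

end Core

/-! ### Approximation by test functions, uniformly over bounded families -/

section Approximation

theorem WeakL2.sum {X ι κ : Type*} [MeasurableSpace X] {μ : Measure X} {l : Filter ι}
    (s : Finset κ) {a : κ → ι → X → ℝ} {a0 : κ → X → ℝ} (ha : ∀ k, WeakL2 μ l (a k) (a0 k)) :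
    WeakL2 μ l (fun n x => ∑ k ∈ s, a k n x) (fun x => ∑ k ∈ s, a0 k x) := by
  classical
  induction s using Finset.induction_on with
  | empty =>
    simp only [Finset.sum_empty]
    exact (StrongL2.const MemLp.zero').weak
  | insert k s hk ih =>
    simp only [Finset.sum_insert hk]
    exact (ha k).add ih

theorem IsH1.exists_test_approx {θ : SpaceTime → ℝ} {D : Fin 3 → SpaceTime → ℝ} (h : IsH1 θ D)
    {V U : Set SpaceTime} {r : ℝ} (hV : Bornology.IsBounded V) (h0 : ∀ z, z ∉ V → θ z = 0)
    (hr : 0 < r) (hVU : Near r V U) :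
    ∃ (β : ℕ → SpaceTime → ℝ) (Dβ : ℕ → Fin 3 → SpaceTime → ℝ),
      (∀ n, IsTest U (β n)) ∧ H1Conv atTop β Dβ θ D := by
  obtain ⟨φ, hφ⟩ := exists_isMollifier
  obtain ⟨ρ0, hρ0, h1⟩ := exists_radius hφ
  have ht : Tendsto (fun n => max (scale n) (scale n * ρ0)) atTop (𝓝 0) := by
    simpa using tendsto_scale.max (tendsto_scale.mul_const ρ0)
  obtain ⟨N, hN⟩ := eventually_atTop.1 (ht.eventually (gt_mem_nhds hr))
  set m : ℕ → TransKernel := fun n => mol hφ (scale (n + N)) (scale (n + N)) with hm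
  have hb : ∀ n, (m n).InBall (max (scale (n + N)) (scale (n + N) * ρ0)) := fun n =>
    mol_inBall hφ h1 (scale_pos _) (scale_pos _)
  have hb0 : ∀ n, 0 ≤ max (scale (n + N)) (scale (n + N) * ρ0) := fun n =>
    le_max_of_le_left (scale_pos _).le
  have hS : ∀ {F : SpaceTime → ℝ}, MemLp F 2 → StrongL2 volume atTop (fun n => (m n).avg F) F :=
    fun hF => strongL2_avg_seq hb ((tendsto_add_atTop_iff_nat
      (f := fun n => max (scale n) (scale n * ρ0)) N).2 ht) (C := molMass φ)
      (fun n => (mol_mass hφ (scale_pos _) (scale_pos _)).le)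
      (fun n => mol_integral hφ (scale_pos _) (scale_pos _)) hF
  choose Cb hCb using fun j => (hS (h.memD j)).bdd
  refine ⟨fun n => (m n).avg θ, fun n j => (m n).avg (D j), fun n => ?_,
    fun n => h.avg (hb n) (hb0 n), h, hS h.mem, Finset.univ.sup Cb, ?_⟩
  · exact isTest_mol hφ h.mem hV h0 hVU (hb n) (hN _ (by omega)) (hb0 n)
  · filter_upwards [eventually_all.2 hCb] with n hn j
    exact (hn j).trans (by exact_mod_cast Finset.le_sup (Finset.mem_univ j))

theorem H1Conv.const {ι : Type*} {l : Filter ι} {θ : SpaceTime → ℝ} {D : Fin 3 → SpaceTime → ℝ}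
    (h : IsH1 θ D) : H1Conv l (fun _ => θ) (fun _ => D) θ D := by
  refine ⟨fun _ => h, h, StrongL2.const h.mem,
    Finset.univ.sup fun j => (eLpNorm (D j) 2 volume).toNNReal, Eventually.of_forall fun _ j => ?_⟩
  rw [← ENNReal.coe_toNNReal (h.memD j).2.ne]
  exact_mod_cast Finset.le_sup (f := fun j => (eLpNorm (D j) 2 volume).toNNReal) (Finset.mem_univ j)

theorem H1Conv.nL24_bdd {ι : Type*} {l : Filter ι} {θ : ι → SpaceTime → ℝ}
    {D : ι → Fin 3 → SpaceTime → ℝ} {θ0 : SpaceTime → ℝ} {D0 : Fin 3 → SpaceTime → ℝ}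
    (h : H1Conv l θ D θ0 D0) : ∃ M : ℝ≥0∞, M ≠ ⊤ ∧ ∀ᶠ n in l, nL24 (θ n) ≤ M := by
  obtain ⟨C1, h1⟩ := h.strong.bdd
  obtain ⟨C2, h2⟩ := h.bdd
  have hc := nL24Const_ne_top
  refine ⟨max 1 (nL24Const * (C1 : ℝ≥0∞) ^ 2 * (∑ _j : Fin 3, (C2 : ℝ≥0∞) ^ 2) ^ 3), ?_, ?_⟩
  · have h3 : (∑ _j : Fin 3, (C2 : ℝ≥0∞) ^ 2) ≠ ⊤ := ENNReal.sum_ne_top.2 fun _ _ => by finiteness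
    exact (max_lt ENNReal.one_lt_top (by finiteness)).ne
  · filter_upwards [h1, h2] with n hn1 hn2
    have h3 : nL24 (θ n) ^ 4 ≤ nL24Const * (C1 : ℝ≥0∞) ^ 2 * (∑ _j : Fin 3, (C2 : ℝ≥0∞) ^ 2) ^ 3 :=
      (h.isH1 n).nL24_pow_le.trans (by gcongr with j; exact hn2 j)
    rcases le_total (nL24 (θ n)) 1 with h4 | h4
    · exact h4.trans (le_max_left _ _)
    · exact (le_self_pow h4 (by norm_num)).trans (h3.trans (le_max_right _ _))

theorem integrable_three_of_slice {a b c : SpaceTime → ℝ} {C : ℝ≥0} {Db Dc : Fin 3 → SpaceTime → ℝ}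
    (ha : AEStronglyMeasurable a volume) (hC : ∀ᵐ t : ℝ, ∫⁻ x : R3, ‖a (t, x)‖ₑ ^ 2 ≤ C)
    (hb : IsH1 b Db) (hc : IsH1 c Dc) : Integrable fun z => a z * (b z * c z) := by
  refine integrable_of_sq_lintegral_le (ha.mul (hb.mem.1.mul hc.mem.1))
    (sq_lintegral_three_le ha hb.mem.1 hc.mem.1 hC) ?_
  have := hb.nL24_ne_top
  have := hc.nL24_ne_top
  finiteness

/-- One factor is changed at a time. The threshold depends on c only through its bound in L^∞ₜL²ₓ,
so that c may be a component of the varying velocity. -/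
theorem eventually_integral_three {ι : Type*} {l : Filter ι} {a b : ι → SpaceTime → ℝ}
    {Da Db : ι → Fin 3 → SpaceTime → ℝ} {a0 b0 : SpaceTime → ℝ} {Da0 Db0 : Fin 3 → SpaceTime → ℝ}
    (ha : H1Conv l a Da a0 Da0) (hb : H1Conv l b Db b0 Db0) (C : ℝ≥0) {η : ℝ} (hη : 0 < η) :
    ∀ᶠ n in l, ∀ c : SpaceTime → ℝ, AEStronglyMeasurable c volume →
      (∀ᵐ t : ℝ, ∫⁻ x : R3, ‖c (t, x)‖ₑ ^ 2 ≤ C) →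
      |(∫ z, c z * (a n z * b n z)) - ∫ z, c z * (a0 z * b0 z)| ≤ η := by
  obtain ⟨M, hM, hMb⟩ := ha.nL24_bdd
  have t1 : Tendsto (fun n => (C : ℝ≥0∞) * (M * nL24 (fun z => b n z - b0 z))) l (𝓝 0) := by
    have h1 := ENNReal.Tendsto.const_mul (a := M) hb.tendsto_nL24 (Or.inr hM)
    have h2 := ENNReal.Tendsto.const_mul (a := (C : ℝ≥0∞)) h1 (Or.inr ENNReal.coe_ne_top)
    simpa using h2
  have t2 : Tendsto (fun n => (C : ℝ≥0∞) * (nL24 b0 * nL24 (fun z => a n z - a0 z))) l (𝓝 0) := by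
    have h1 := ENNReal.Tendsto.const_mul (a := nL24 b0) ha.tendsto_nL24
      (Or.inr hb.isH1_lim.nL24_ne_top)
    have h2 := ENNReal.Tendsto.const_mul (a := (C : ℝ≥0∞)) h1 (Or.inr ENNReal.coe_ne_top)
    simpa using h2
  filter_upwards [eventually_abs_integral_sub_le (X := SpaceTime) (μ := volume) t1 (half_pos hη),
    eventually_abs_integral_sub_le (X := SpaceTime) (μ := volume) t2 (half_pos hη), hMb]
    with n h1 h2 h3 c hc hC
  have i1 := integrable_three_of_slice hc hC (ha.isH1 n) (hb.isH1 n)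
  have i2 := integrable_three_of_slice hc hC (ha.isH1 n) hb.isH1_lim
  have i3 := integrable_three_of_slice hc hC ha.isH1_lim hb.isH1_lim
  have k1 := h1 _ _ i1 i2 (by
    refine le_trans (le_of_eq ?_) ((sq_lintegral_three_le hc (ha.isH1 n).mem.1
      ((hb.isH1 n).sub hb.isH1_lim).mem.1 hC).trans (by gcongr))
    congr 1
    exact lintegral_congr fun z => by congr 1; ring)
  have k2 := h2 _ _ i2 i3 (by
    refine le_trans (le_of_eq ?_) (sq_lintegral_three_le hc hb.isH1_lim.mem.1
      ((ha.isH1 n).sub ha.isH1_lim).mem.1 hC)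
    congr 1
    exact lintegral_congr fun z => by congr 1; ring)
  rw [abs_le] at k1 k2 ⊢
  constructor <;> linarith [k1.1, k1.2, k2.1, k2.2]

theorem eventually_integral_mul_of_strong {ι : Type*} {l : Filter ι} {F : ι → SpaceTime → ℝ}
    {F0 : SpaceTime → ℝ} (hF : StrongL2 volume l F F0) (M : ℝ≥0) {η : ℝ} (hη : 0 < η) :
    ∀ᶠ n in l, ∀ g : SpaceTime → ℝ, MemLp g 2 → eLpNorm g 2 volume ≤ M →
      |(∫ z, g z * F n z) - ∫ z, g z * F0 z| ≤ η := by
  have t1 := ENNReal.Tendsto.const_mul (a := (M : ℝ≥0∞)) hF.tendsto (Or.inr ENNReal.coe_ne_top)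
  rw [mul_zero] at t1
  filter_upwards [t1.eventually (gt_mem_nhds (ENNReal.ofReal_pos.2 hη))] with n hn g hg hM
  have hd := memLp_sub (hF.mem n) hF.mem0
  rw [← integral_sub (integrable_mul_of_memLp hg (hF.mem n)) (integrable_mul_of_memLp hg hF.mem0)]
  simp only [← mul_sub]
  refine (abs_integral_mul_le hg hd).trans ?_
  rw [← ENNReal.toReal_mul]
  refine ENNReal.toReal_le_of_le_ofReal hη.le (le_trans (by gcongr) hn.le)

variable {r : ℝ} (B : RadialBump r)

/-- The two pieces have different integrability: g lies only in L²ₜL¹ₓ and requires the estimate of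
each kernel separately, whereas g' lies in L². -/
theorem integral_sub_mul_pair (i : Fin 3) {F θ g g' : SpaceTime → ℝ} {D : Fin 3 → SpaceTime → ℝ}
    (hF : MemLp F 2) (hθ : IsH1 θ D) (ga : AEStronglyMeasurable g volume) (hg : nL21 g ≠ ⊤)
    (hg' : MemLp g' 2) :
    ∫ z, (g z - g' z) * (B.TR.avg F z + (B.K i).avg θ z) =
      (∫ z, g z * B.TR.avg F z) + (∫ z, g z * (B.K i).avg θ z) -
        ∫ z, g' z * (B.TR.avg F z + (B.K i).avg θ z) := by
  have i1 : Integrable (fun z => g z * B.TR.avg F z) := integrable_mul_spaceKer ga hg hF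
  have i2 : Integrable (fun z => g z * (B.K i).avg θ z) := integrable_mul_K B i ga hg hθ
  have i3 := integrable_mul_of_memLp hg' (memLp_add (B.TR.memLp_avg hF) ((B.K i).memLp_avg hθ.mem))
  rw [← integral_add i1 i2, ← integral_sub (integrable_add_fun i1 i2) i3]
  refine integral_congr_ae (Eventually.of_forall fun z => ?_)
  simp only
  ring

/-- Uniform convergence of pairings with `TR F + K θ`. -/
theorem eventually_integral_pair {ι : Type*} {l : Filter ι} (i : Fin 3) {F θ : ι → SpaceTime → ℝ}
    {D : ι → Fin 3 → SpaceTime → ℝ} {F0 θ0 : SpaceTime → ℝ} {D0 : Fin 3 → SpaceTime → ℝ}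
    (hF : StrongL2 volume l F F0) (hθ : H1Conv l θ D θ0 D0) {N : ℝ≥0∞} (hN : N ≠ ⊤) (M : ℝ≥0)
    {η : ℝ} (hη : 0 < η) :
    ∀ᶠ n in l, ∀ g g' : SpaceTime → ℝ, AEStronglyMeasurable g volume → nL21 g ≤ N → MemLp g' 2 →
      eLpNorm g' 2 volume ≤ M →
      |(∫ z, (g z - g' z) * (B.TR.avg (F n) z + (B.K i).avg (θ n) z)) -
        ∫ z, (g z - g' z) * (B.TR.avg F0 z + (B.K i).avg θ0 z)| ≤ η := by
  have h3 : 0 < η / 3 := by positivity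
  filter_upwards [eventually_integral_mul_spaceKer (h := B.smooth) (hc := B.compact) hF hN h3,
    eventually_integral_mul_K B i hθ hN h3, eventually_integral_mul_of_strong
      ((B.TR.strongL2_avg hF).add ((B.K i).strongL2_avg hθ.strong)) M h3]
    with n e1 e2 e3 g g' ga hg mg' hg'
  have hgt := ne_top_of_le_ne_top hN hg
  rw [integral_sub_mul_pair B i (hF.mem n) (hθ.isH1 n) ga hgt mg',
    integral_sub_mul_pair B i hF.mem0 hθ.isH1_lim ga hgt mg']
  have k1 : |(∫ z, g z * B.TR.avg (F n) z) - ∫ z, g z * B.TR.avg F0 z| ≤ η / 3 := e1 g ga hg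
  have k2 := e2 g ga hg
  have k3 := e3 g' mg' hg'
  rw [abs_le] at k1 k2 k3 ⊢
  constructor <;> linarith [k1.1, k1.2, k2.1, k2.2, k3.1, k3.2]

end Approximation

/-! ### Weakly convergent sequences of solutions: strong convergence and the limit equation -/

/-- A sequence of solutions with uniform bounds, converging weakly. -/
structure FlowSeq (W : Set SpaceTime) (C : ℝ≥0) (u f : ℕ → Fin 3 → SpaceTime → ℝ)
    (G : ℕ → Fin 3 → Fin 3 → SpaceTime → ℝ) (u0 f0 : Fin 3 → SpaceTime → ℝ)
    (G0 : Fin 3 → Fin 3 → SpaceTime → ℝ) : Prop where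
  flow : ∀ n, FlowData W C (u n) (f n) (G n)
  equation : ∀ n, WeakEq W (u n) (f n)
  flow0 : FlowData W C u0 f0 G0
  weakU : ∀ i, WeakL2 volume atTop (fun n => u n i) (u0 i)
  weakF : ∀ i, WeakL2 volume atTop (fun n => f n i) (f0 i)
  weakG : ∀ j i, WeakL2 volume atTop (fun n => G n j i) (G0 j i)

namespace FlowSeq
variable {W : Set SpaceTime} {C : ℝ≥0} {u f : ℕ → Fin 3 → SpaceTime → ℝ}
  {G : ℕ → Fin 3 → Fin 3 → SpaceTime → ℝ} {u0 f0 : Fin 3 → SpaceTime → ℝ}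
  {G0 : Fin 3 → Fin 3 → SpaceTime → ℝ} {r : ℝ}

theorem weak_low (S : FlowSeq W C u f G u0 f0 G0) (B : RadialBump r) (i : Fin 3) :
    WeakL2 volume atTop (fun n => B.low (u n) i) (B.low u0 i) := B.TR.weakL2_avg (S.weakU i)

theorem weak_dlow (S : FlowSeq W C u f G u0 f0 G0) (B : RadialBump r) (j i : Fin 3) :
    WeakL2 volume atTop (fun n => B.dlow (u n) j i) (B.dlow u0 j i) :=
  (B.TD j).weakL2_avg (S.weakU i)

theorem weak_high (S : FlowSeq W C u f G u0 f0 G0) (B : RadialBump r) (i : Fin 3) :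
    WeakL2 volume atTop (fun n => B.high (u n) i) (B.high u0 i) := (S.weakU i).sub (S.weak_low B i)

theorem weak_high_force (S : FlowSeq W C u f G u0 f0 G0) (B : RadialBump r) (i : Fin 3) :
    WeakL2 volume atTop (fun n => B.high (f n) i) (B.high f0 i) :=
  (S.weakF i).sub (B.TR.weakL2_avg (S.weakF i))

theorem weak_dhigh (S : FlowSeq W C u f G u0 f0 G0) (B : RadialBump r) (j i : Fin 3) :
    WeakL2 volume atTop (fun n => B.dhigh (u n) (G n) j i) (B.dhigh u0 G0 j i) :=
  (S.weakG j i).sub (S.weak_dlow B j i)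

theorem weak_curl (S : FlowSeq W C u f G u0 f0 G0) (B : RadialBump r) (j i : Fin 3) :
    WeakL2 volume atTop (fun n => B.curl (u n) j i) (B.curl u0 j i) :=
  (S.weak_dlow B j i).sub (S.weak_dlow B i j)

/-- Space derivatives of v are bounded in L² through the gradient of u; time derivatives are
bounded, after mollification in space, through the equation tested with projected fields. -/
theorem strong_high (S : FlowSeq W C u f G u0 f0 G0) (B : RadialBump r) (hr : 0 < r)
    {V : Set SpaceTime} (hVm : MeasurableSet V) (hV : Near (3 * r) V W) (i : Fin 3) :
    StrongL2 volume atTop (fun n => V.indicator (B.high (u n) i)) (V.indicator (B.high u0 i)) := by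
  obtain ⟨φ, hφ⟩ := exists_isMollifier
  obtain ⟨ρ0, hρ0, h0⟩ := exists_radius hφ
  -- The margin 3r is spent in three equal parts: the compactness argument, the space mollification
  -- and the projection. The bound r/ρ0 on ε keeps the radius of the mollifier below r.
  have n1 : Near (2 * r) (nbhd r V) W := hV.nbhd (by linarith)
  have n2 : Near r (nbhd r (nbhd r V)) W := n1.nbhd (by linarith)
  refine (S.weak_high B i).strongL2_of_db hφ (U := nbhd r V) (r := r) (ε0 := r / ρ0)
    (C := Finset.univ.sup fun j => FlowData.dhighConst B C j)
    ((S.flow0.bounded).subset (hV.subset (by linarith))) hVm hr (by positivity) (near_nbhd r V)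
    (fun n j => ?_) fun ε hε hε1 => ?_
  · refine (((S.flow n).wd_high B j i).mono (n1.subset (by linarith))).db
      ((S.flow n).memLp_dhigh B j i) (((S.flow n).eLpNorm_dhigh_le B j i).trans ?_)
    exact_mod_cast Finset.le_sup (f := fun j => FlowData.dhighConst B C j) (Finset.mem_univ j)
  · have hR : (spaceMol hφ ε).InBall r := fun α hα =>
      (spaceMol_inBall hφ h0 hε α hα).trans ((lt_div_iff₀ hρ0).1 hε1).le
    obtain ⟨C', h⟩ := FlowData.exists_db_high (C := C) B hr.le hφ hR hr.le
      (near_nbhd r (nbhd r V)) n2 i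
    exact ⟨C', fun n => h _ _ _ (S.flow n) (S.equation n)⟩

/-- The unknown gradient in the equation disappears under the curl, so this combination of
derivatives of the low part is compact even though the low part itself need not be. -/
theorem strong_curl (S : FlowSeq W C u f G u0 f0 G0) (B : RadialBump r) (hr : 0 < r)
    {V : Set SpaceTime} (hVm : MeasurableSet V) (hV : Near (3 * r) V W) (j i : Fin 3) :
    StrongL2 volume atTop (fun n => V.indicator (B.curl (u n) j i))
      (V.indicator (B.curl u0 j i)) := by
  obtain ⟨φ, hφ⟩ := exists_isMollifier
  obtain ⟨ρ0, hρ0, h0⟩ := exists_radius hφ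
  have n1 : Near (2 * r) (nbhd r V) W := hV.nbhd (by linarith)
  have n2 : Near r (nbhd r (nbhd r V)) W := n1.nbhd (by linarith)
  set T : Fin 3 → Fin 3 → TransKernel := fun k j => spaceKer (d3 k (d3 j B.R))
    (contDiff_d3 (contDiff_d3 B.smooth j) k)
    (hasCompactSupport_d3 (hasCompactSupport_d3 B.compact j) k) with hT
  refine (S.weak_curl B j i).strongL2_of_db hφ (U := nbhd r V) (r := r) (ε0 := r / ρ0)
    (C := Finset.univ.sup fun k => (T k j).mass.toNNReal * C + (T k i).mass.toNNReal * C)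
    ((S.flow0.bounded).subset (hV.subset (by linarith))) hVm hr (by positivity) (near_nbhd r V)
    (fun n k => ?_) fun ε hε hε1 => ?_
  · have mu := (S.flow n).memU
    have nu := (S.flow n).normU
    have w : ∀ j i, WD univ (ej k) (B.dlow (u n) j i) ((T k j).avg (u n i)) := fun j i =>
      wd_spaceKer (mu i) k
    have m := fun j i => (T k j).memLp_avg (mu i)
    refine (((w j i).sub (w i j) (B.memLp_dlow mu j i) (m j i) (B.memLp_dlow mu i j)
      (m i j)).mono (subset_univ _)).db (memLp_sub (m j i) (m i j)) ?_
    refine (eLpNorm_sub_le (m j i).1 (m i j).1 one_le_two).trans ((add_le_add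
      (FlowData.eLpNorm_avg_le_coe (mu i) (nu i) _)
      (FlowData.eLpNorm_avg_le_coe (mu j) (nu j) _)).trans ?_)
    exact_mod_cast Finset.le_sup (f := fun k => (T k j).mass.toNNReal * C +
      (T k i).mass.toNNReal * C) (Finset.mem_univ k)
  · have hR : (spaceMol hφ ε).InBall r := fun α hα =>
      (spaceMol_inBall hφ h0 hε α hα).trans ((lt_div_iff₀ hρ0).1 hε1).le
    obtain ⟨C', h⟩ := FlowData.exists_db_curl (C := C) B hr.le hφ hR hr.le
      (near_nbhd r (nbhd r V)) n2 j i
    exact ⟨C', fun n => h _ _ _ (S.flow n) (S.equation n)⟩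

theorem _root_.NavierStokes.StrongL2.indicator_mul_test {V : Set SpaceTime}
    {a : ℕ → SpaceTime → ℝ} {a0 χ : SpaceTime → ℝ}
    (h : StrongL2 volume atTop (fun n => V.indicator (a n)) (V.indicator a0)) (hχ : IsTest V χ) :
    StrongL2 volume atTop (fun n z => a n z * χ z) (fun z => a0 z * χ z) := by
  obtain ⟨M, hM⟩ := hχ.ae_bdd
  have e : ∀ (b : SpaceTime → ℝ) z, V.indicator b z * χ z = b z * χ z := fun b z => by
    by_cases hz : z ∈ V
    · rw [indicator_of_mem hz]
    · rw [hχ.eq_zero hz, mul_zero, mul_zero]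
  have := h.mul_bdd hχ.aesm hM
  simpa only [e] using this

theorem strong_high_mul (S : FlowSeq W C u f G u0 f0 G0) (B : RadialBump r) (hr : 0 < r)
    {V : Set SpaceTime} (hVo : IsOpen V) (hV : Near (3 * r) V W) (i : Fin 3) {χ : SpaceTime → ℝ}
    (hχ : IsTest V χ) :
    StrongL2 volume atTop (fun n z => B.high (u n) i z * χ z) (fun z => B.high u0 i z * χ z) :=
  (S.strong_high B hr hVo.measurableSet hV i).indicator_mul_test hχ

theorem strong_curl_mul (S : FlowSeq W C u f G u0 f0 G0) (B : RadialBump r) (hr : 0 < r)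
    {V : Set SpaceTime} (hVo : IsOpen V) (hV : Near (3 * r) V W) (j i : Fin 3) {χ : SpaceTime → ℝ}
    (hχ : IsTest V χ) :
    StrongL2 volume atTop (fun n z => B.curl (u n) j i z * χ z) (fun z => B.curl u0 j i z * χ z) :=
  (S.strong_curl B hr hVo.measurableSet hV j i).indicator_mul_test hχ

/-- Each summand contains the high part, its gradient or the curl. These are the places where
compactness can enter. -/
theorem conv_sub_lowGrad (B : RadialBump r) (u : Fin 3 → SpaceTime → ℝ)
    (G : Fin 3 → Fin 3 → SpaceTime → ℝ) (i : Fin 3) (z : SpaceTime) :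
    conv u G i z - B.lowGrad u i z = ∑ j, (B.high u j z * G j i z +
      B.low u j z * B.dhigh u G j i z + B.curl u j i z * B.low u j z) := by
  simp only [conv, RadialBump.lowGrad, ← Finset.sum_sub_distrib]
  refine Finset.sum_congr rfl fun j _ => ?_
  simp only [RadialBump.high, RadialBump.dhigh, RadialBump.curl]
  ring

/-- The middle term contains low and ∇v, both only weakly convergent. Since div low = 0, the
derivative is moved to χ and the compact factor v appears. -/
theorem integral_conv_test {u f : Fin 3 → SpaceTime → ℝ} {G : Fin 3 → Fin 3 → SpaceTime → ℝ}
    (S : FlowData W C u f G) (B : RadialBump r) (hr : 0 ≤ r) {V : Set SpaceTime} (hVo : IsOpen V)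
    (hV : Near r V W) {χ : SpaceTime → ℝ} (hχ : IsTest V χ) (i : Fin 3) :
    ∫ z, (conv u G i z - B.lowGrad u i z) * χ z =
      (∑ j, ∫ z, (B.high u j z * χ z) * G j i z) -
      (∑ j, ∫ z, B.low u j z * (B.high u i z * dd (ej j) χ z)) +
      ∑ j, ∫ z, (B.curl u j i z * χ z) * B.low u j z := by
  obtain ⟨M, hM⟩ := hχ.ae_bdd
  have mv := B.memLp_high S.memU
  have ml := B.memLp_low S.memU
  have md := fun j i => S.memLp_dhigh B j i
  have p := (B.divFree_low S.memU S.divU hr hV).parts hVo ml (mv i) (fun j => md j i)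
    (fun j => (S.wd_high B j i).mono (hV.subset hr)) hχ
  have mc : ∀ j, MemLp (B.curl u j i) 2 := fun j =>
    memLp_sub (B.memLp_dlow S.memU j i) (B.memLp_dlow S.memU i j)
  have i1 : ∀ j, Integrable (fun z => (B.high u j z * χ z) * G j i z) := fun j =>
    integrable_mul_of_memLp (memLp_mul_bdd (mv j) hχ.aesm hM) (S.memG j i)
  have i2 : ∀ j, Integrable (fun z => B.low u j z * (B.dhigh u G j i z * χ z)) := fun j =>
    integrable_mul_of_memLp (ml j) (memLp_mul_bdd (md j i) hχ.aesm hM)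
  have i3 : ∀ j, Integrable (fun z => (B.curl u j i z * χ z) * B.low u j z) := fun j =>
    integrable_mul_of_memLp (memLp_mul_bdd (mc j) hχ.aesm hM) (ml j)
  rw [p, sub_neg_eq_add, ← Finset.sum_add_distrib, ← Finset.sum_add_distrib]
  have e : ∀ j, (∫ z, (B.high u j z * χ z) * G j i z) +
      (∫ z, B.low u j z * (B.dhigh u G j i z * χ z)) + (∫ z, (B.curl u j i z * χ z) * B.low u j z) =
      ∫ z, (B.high u j z * G j i z + B.low u j z * B.dhigh u G j i z +
        B.curl u j i z * B.low u j z) * χ z := fun j => by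
    rw [← integral_add (i1 j) (i2 j), ← integral_add (integrable_add_fun (i1 j) (i2 j)) (i3 j)]
    refine integral_congr_ae (Eventually.of_forall fun z => ?_)
    simp only
    ring
  simp only [e]
  rw [← integral_finsetSum]
  · simp only [conv_sub_lowGrad, Finset.sum_mul]
  · intro j _
    refine (integrable_add_fun (integrable_add_fun (i1 j) (i2 j)) (i3 j)).congr
      (Eventually.of_forall fun z => ?_)
    simp only
    ring

/-- The convection minus the gradient of its low part converges in the sense of distributions. -/
theorem tendsto_conv_test (S : FlowSeq W C u f G u0 f0 G0) (B : RadialBump r) (hr : 0 < r)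
    {V : Set SpaceTime} (hVo : IsOpen V) (hV : Near (3 * r) V W) {χ : SpaceTime → ℝ}
    (hχ : IsTest V χ) (i : Fin 3) :
    Tendsto (fun n => ∫ z, (conv (u n) (G n) i z - B.lowGrad (u n) i z) * χ z) atTop
      (𝓝 (∫ z, (conv u0 G0 i z - B.lowGrad u0 i z) * χ z)) := by
  have hV1 : Near r V W := hV.mono (by linarith)
  simp only [fun n => integral_conv_test (S.flow n) B hr.le hVo hV1 hχ i]
  rw [integral_conv_test S.flow0 B hr.le hVo hV1 hχ i]
  refine ((tendsto_finsetSum _ fun j _ => ?_).sub (tendsto_finsetSum _ fun j _ => ?_)).add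
    (tendsto_finsetSum _ fun j _ => ?_)
  · exact (S.strong_high_mul B hr hVo hV j hχ).integral_mul_weak (S.weakG j i)
  · exact (S.weak_low B j).integral_mul (S.strong_high_mul B hr hVo hV i (hχ.dd (ej j)))
  · exact (S.strong_curl_mul B hr hVo hV j i hχ).integral_mul_weak (S.weak_low B j)

/-- The limit satisfies the equation. -/
theorem weakEq (S : FlowSeq W C u f G u0 f0 G0) : WeakEq W u0 f0 := by
  intro Φ hΦ hd
  choose ρ hρ hρn using fun i => (hΦ i).exists_near S.flow0.isOpen
  set c := Finset.univ.inf' ⟨0, Finset.mem_univ _⟩ ρ with hc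
  have hc0 : 0 < c := (Finset.lt_inf'_iff _).2 fun i _ => hρ i
  -- Any choice with 3r < c would do: the supports of the components must lie in the region where
  -- strong convergence is available.
  set r : ℝ := c / 6 with hr
  have hr0 : 0 < r := by positivity
  obtain ⟨B⟩ := exists_radialBump hr0
  have tΦ : ∀ i, IsTest (core (3 * r) W) (Φ i) := fun i => by
    refine ⟨(hΦ i).smooth, (hΦ i).compact, ?_⟩
    have h1 : Near c (tsupport (Φ i)) W := (hρn i).mono (Finset.inf'_le _ (Finset.mem_univ i))
    exact (h1.near_core (a := 0) (b := 3 * r) (by rw [hr]; linarith)).subset le_rfl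
  have hE := fun n => S.equation n Φ hΦ hd
  have hk : ∀ {u f G}, FlowData W C u f G →
      ∑ i, ∑ j, ∫ z, u j z * (u i z * dd (ej j) (Φ i) z) =
        -∑ i, ∫ z, (conv u G i z - B.lowGrad u i z) * Φ i z := fun {u f G} T => by
    rw [T.sum_integral_conv hΦ]
    have h1 := T.sum_integral_lowGrad_eq_zero B hΦ hd
    have h2 : ∀ i, ∫ z, (conv u G i z - B.lowGrad u i z) * Φ i z =
        (∫ z, conv u G i z * Φ i z) - ∫ z, B.lowGrad u i z * Φ i z := fun i => by
      obtain ⟨M, hM⟩ := (hΦ i).ae_bdd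
      rw [← integral_sub ((T.integrable_conv i).mul_bdd (hΦ i).aesm hM)
        (integrable_mul_of_memLp (T.memLp_lowGrad B i) (hΦ i).memLp)]
      simp only [sub_mul]
    simp only [h2, Finset.sum_sub_distrib, h1, sub_zero]
  simp only [fun n => hk (S.flow n)] at hE
  rw [hk S.flow0]
  refine tendsto_nhds_unique (l := atTop) (Tendsto.congr hE ?_) tendsto_const_nhds
  refine (((tendsto_finsetSum _ fun i _ => ?_).add (tendsto_finsetSum _ fun i _ =>
    tendsto_finsetSum _ fun j _ => ?_)).add (tendsto_finsetSum _ fun i _ => ?_).neg).add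
    (tendsto_finsetSum _ fun i _ => ?_)
  · exact (S.weakU i).tendsto _ ((hΦ i).dd et).memLp
  · exact (S.weakU i).tendsto _ (((hΦ i).dd _).dd _).memLp
  · exact S.tendsto_conv_test B hr0 (isOpen_core _ _) (near_core _ _) (tΦ i) i
  · exact (S.weakF i).tendsto _ (hΦ i).memLp

end FlowSeq

/-! ### Passage to the limit in the energy defect -/

theorem FlowData.exists_lowGrad_le {r : ℝ} (W : Set SpaceTime) (C : ℝ≥0) (B : RadialBump r)
    (i : Fin 3) : ∃ M : ℝ≥0, ∀ (u f : Fin 3 → SpaceTime → ℝ) (G : Fin 3 → Fin 3 → SpaceTime → ℝ),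
      FlowData W C u f G → eLpNorm (B.lowGrad u i) 2 volume ≤ M := by
  refine ⟨∑ _j : Fin 3, (kerBound (d3 i B.R) C).toNNReal * (B.TR.mass.toNNReal * C),
    fun u f G S => ?_⟩
  have e : B.lowGrad u i = ∑ j, fun z => B.low u j z * B.dlow u i j z := by
    ext z; simp [RadialBump.lowGrad]
  rw [e, ENNReal.ofNNReal_finsetSum]
  refine (eLpNorm_sum_le (fun j _ => (S.memLp_dlow_mul B i j (B.memLp_low S.memU j)).1)
    one_le_two).trans (Finset.sum_le_sum fun j _ => ?_)
  rw [ENNReal.coe_mul]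
  refine (eLpNorm_mul_bdd_le (S.abs_dlow_le B i j)).trans ?_
  exact mul_le_mul' le_rfl (FlowData.eLpNorm_avg_le_coe (S.memU j) (S.normU j) _)

theorem H1Conv.of_weak {θ : ℕ → SpaceTime → ℝ} {D : ℕ → Fin 3 → SpaceTime → ℝ}
    {θ0 : SpaceTime → ℝ} {D0 : Fin 3 → SpaceTime → ℝ} (h : ∀ n, IsH1 (θ n) (D n))
    (h0 : IsH1 θ0 D0) (hs : StrongL2 volume atTop θ θ0)
    (hw : ∀ j, WeakL2 volume atTop (fun n => D n j) (D0 j)) : H1Conv atTop θ D θ0 D0 := by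
  choose Cb hCb using fun j => (hw j).bdd
  refine ⟨h, h0, hs, Finset.univ.sup Cb, ?_⟩
  filter_upwards [eventually_all.2 hCb] with n hn j
  exact (hn j).trans (by exact_mod_cast Finset.le_sup (Finset.mem_univ j))

theorem WeakL2.mul_test {U : Set SpaceTime} {a : ℕ → SpaceTime → ℝ} {a0 χ : SpaceTime → ℝ}
    (h : WeakL2 volume atTop a a0) (hχ : IsTest U χ) :
    WeakL2 volume atTop (fun n z => a n z * χ z) (fun z => a0 z * χ z) := by
  obtain ⟨M, hM⟩ := hχ.ae_bdd
  exact h.mul_bdd hχ.aesm hM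

namespace FlowSeq
variable {W : Set SpaceTime} {C : ℝ≥0} {u f : ℕ → Fin 3 → SpaceTime → ℝ}
  {G : ℕ → Fin 3 → Fin 3 → SpaceTime → ℝ} {u0 f0 : Fin 3 → SpaceTime → ℝ}
  {G0 : Fin 3 → Fin 3 → SpaceTime → ℝ} {r : ℝ} {ψ : SpaceTime → ℝ}

theorem h1Conv_high (S : FlowSeq W C u f G u0 f0 G0) (B : RadialBump r) (hr : 0 < r)
    {V : Set SpaceTime} (hVo : IsOpen V) (hV : Near (3 * r) V W) (i : Fin 3) {χ : SpaceTime → ℝ}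
    (hχ : IsTest V χ) :
    H1Conv atTop (fun n z => B.high (u n) i z * χ z)
      (fun n j z => B.dhigh (u n) (G n) j i z * χ z + B.high (u n) i z * dd (ej j) χ z)
      (fun z => B.high u0 i z * χ z)
      (fun j z => B.dhigh u0 G0 j i z * χ z + B.high u0 i z * dd (ej j) χ z) :=
  have hW : IsTest W χ := hχ.mono (hV.subset (by linarith))
  H1Conv.of_weak (fun n => (S.flow n).isH1_high B i hW) (S.flow0.isH1_high B i hW)
    (S.strong_high_mul B hr hVo hV i hχ) fun j =>
    ((S.weak_dhigh B j i).mul_test hχ).add ((S.weak_high B i).mul_test (hχ.dd _))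

theorem h1Conv_flux (S : FlowSeq W C u f G u0 f0 G0) (B : RadialBump r) (hr : 0 < r)
    {V : Set SpaceTime} (hVo : IsOpen V) (hV : Near (3 * r) V W) (hψ : IsTest V ψ) :
    H1Conv atTop (fun n => B.flux (u n) ψ)
      (fun n l z => ∑ j, (B.dhigh (u n) (G n) l j z * dd (ej j) ψ z +
        B.high (u n) j z * dd (ej l) (dd (ej j) ψ) z))
      (B.flux u0 ψ)
      (fun l z => ∑ j, (B.dhigh u0 G0 l j z * dd (ej j) ψ z +
        B.high u0 j z * dd (ej l) (dd (ej j) ψ) z)) :=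
  have hW : IsTest W ψ := hψ.mono (hV.subset (by linarith))
  H1Conv.of_weak (fun n => (S.flow n).isH1_flux B hW) (S.flow0.isH1_flux B hW)
    (StrongL2.sum Finset.univ fun j => S.strong_high_mul B hr hVo hV j (hψ.dd (ej j))) fun l =>
    WeakL2.sum Finset.univ fun j => ((S.weak_dhigh B l j).mul_test (hψ.dd _)).add
      ((S.weak_high B j).mul_test ((hψ.dd _).dd _))

/-- The first factor converges only as a distribution, and the correction is not a test function and
varies with n. Uniform estimates replace it by that of the limit, and then its two ingredients by
test functions, whose images under R and K are again test functions; the margins around the supports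
leave room for these kernels. -/
theorem tendsto_conv_corr (S : FlowSeq W C u f G u0 f0 G0) (B : RadialBump r) (hr : 0 < r)
    {V0 V : Set SpaceTime} (hVo : IsOpen V) (hV : Near (3 * r) V W) (hV0 : Near r V0 V)
    (hψ : IsTest V ψ) (hψ0 : Near r (tsupport ψ) V0) (i : Fin 3) :
    Tendsto (fun n => ∫ z, (conv (u n) (G n) i z - B.lowGrad (u n) i z) * B.corr (u n) ψ i z) atTop
      (𝓝 (∫ z, (conv u0 G0 i z - B.lowGrad u0 i z) * B.corr u0 ψ i z)) := by
  have hF := S.strong_high_mul B hr hVo hV i hψ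
  have hθ := S.h1Conv_flux B hr hVo hV hψ
  have bd : Bornology.IsBounded (tsupport ψ) := hψ.compact.isCompact.isBounded
  obtain ⟨θ, tθ, sθ⟩ := exists_test_approx hF.mem0 bd
    (fun z hz => by rw [IsTest.eq_zero' hz, mul_zero]) hr hψ0
  obtain ⟨β, Dβ, tβ, sβ⟩ := hθ.isH1_lim.exists_test_approx bd (fun z hz => by
    refine Finset.sum_eq_zero fun j _ => ?_
    rw [(hψ.tsupport.dd (ej j)).eq_zero hz, mul_zero]) hr hψ0
  have hN : (9 * ((C : ℝ≥0∞) * (C : ℝ≥0∞) ^ 2)) ≠ ⊤ := by finiteness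
  obtain ⟨M, hM⟩ := FlowData.exists_lowGrad_le W C B i
  refine tendsto_of_approx fun η hη => ?_
  obtain ⟨k, hk⟩ := (eventually_integral_pair B i sθ sβ hN M (half_pos hη)).exists
  have tY : IsTest V (fun z => B.TR.avg (θ k) z + (B.K i).avg (β k) z) :=
    ((tθ k).avg B.inBall_TR hV0 hr.le).add ((tβ k).avg (B.inBall_K i) hV0 hr.le)
  refine ⟨_, _, S.tendsto_conv_test B hr hVo hV tY i, ?_, ?_⟩
  · filter_upwards [eventually_integral_pair B i hF hθ hN M (half_pos hη)] with n hn
    have T := S.flow n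
    have h1 := hn _ _ (T.conv_aesm i) (T.nL21_conv_le i) (T.memLp_lowGrad B i) (hM _ _ _ T)
    have h2 := hk _ _ (T.conv_aesm i) (T.nL21_conv_le i) (T.memLp_lowGrad B i) (hM _ _ _ T)
    simp only [RadialBump.corr]
    rw [abs_le] at h1 h2 ⊢
    constructor <;> linarith [h1.1, h1.2, h2.1, h2.2]
  · have T := S.flow0
    have h2 := hk _ _ (T.conv_aesm i) (T.nL21_conv_le i) (T.memLp_lowGrad B i) (hM _ _ _ T)
    simp only [RadialBump.corr]
    rw [abs_sub_comm]
    exact h2.trans (by linarith)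

/-- The two high factors converge strongly in L²ₜL⁴ₓ, the velocity only weakly in L². After one high
factor is replaced by a test function, the product of the other two is a fixed element of L² and
weak convergence suffices. -/
theorem tendsto_three (S : FlowSeq W C u f G u0 f0 G0) (B : RadialBump r) (hr : 0 < r)
    {V0 V : Set SpaceTime} (hVo : IsOpen V) (hV : Near (3 * r) V W) (hV0 : Near r V0 V)
    (hψ : IsTest V0 ψ) (i j : Fin 3) :
    Tendsto (fun n => ∫ z, u n j z * (B.high (u n) i z * (B.high (u n) i z * dd (ej j) ψ z))) atTop
      (𝓝 (∫ z, u0 j z * (B.high u0 i z * (B.high u0 i z * dd (ej j) ψ z)))) := by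
  have hψV : IsTest V ψ := hψ.mono (hV0.subset hr.le)
  obtain ⟨χ, tχ, -, -, hχ1⟩ := exists_cutoff hψ.compact.isCompact hVo hψV.supp
  have e : ∀ u : Fin 3 → SpaceTime → ℝ,
      ∫ z, u j z * (B.high u i z * (B.high u i z * dd (ej j) ψ z)) =
      ∫ z, u j z * ((B.high u i z * χ z) * (B.high u i z * dd (ej j) ψ z)) := fun u => by
    refine integral_congr_ae (Eventually.of_forall fun z => ?_)
    by_cases hz : z ∈ tsupport ψ
    · simp only [hχ1 z hz, mul_one]
    · simp only [(hψ.tsupport.dd (ej j)).eq_zero hz, mul_zero]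
  simp only [e]
  have ha := S.h1Conv_high B hr hVo hV i tχ
  have hb := S.h1Conv_high B hr hVo hV i (hψV.dd (ej j))
  obtain ⟨β, Dβ, tβ, sβ⟩ := hb.isH1_lim.exists_test_approx (V := tsupport ψ)
    hψ.compact.isCompact.isBounded (fun z hz => by
      rw [(hψ.tsupport.dd (ej j)).eq_zero hz, mul_zero]) hr
      (fun z hz w hw => hV0 z (hψ.supp hz) w hw)
  refine tendsto_of_approx fun η hη => ?_
  obtain ⟨k, hk⟩ := (eventually_integral_three (H1Conv.const ha.isH1_lim) sβ C (half_pos hη)).exists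
  obtain ⟨M, hM⟩ := (tβ k).ae_bdd
  refine ⟨_, _, (S.weakU j).tendsto _ (memLp_mul_bdd ha.isH1_lim.mem (tβ k).aesm hM), ?_, ?_⟩
  · filter_upwards [eventually_integral_three ha hb C (half_pos hη)] with n hn
    have T := S.flow n
    have h1 := hn _ (T.memU j).1 (T.slice j)
    have h2 := hk _ (T.memU j).1 (T.slice j)
    rw [abs_le] at h1 h2 ⊢
    constructor <;> linarith [h1.1, h1.2, h2.1, h2.2]
  · have T := S.flow0
    have h2 := hk _ (T.memU j).1 (T.slice j)
    rw [abs_sub_comm]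
    exact h2.trans (by linarith)

/-- The non-negativity of the defect passes to the limit. -/
theorem defect_nonneg (S : FlowSeq W C u f G u0 f0 G0) (B : RadialBump r) (hr : 0 < r)
    {V0 V : Set SpaceTime} (hVo : IsOpen V) (hV : Near (3 * r) V W) (hV0 : Near r V0 V)
    (hψ : IsTest V0 ψ) (hψ0 : Near r (tsupport ψ) V0) (h0 : ∀ z, 0 ≤ ψ z)
    (h : ∀ n, 0 ≤ B.defect (u n) (f n) (G n) ψ) : 0 ≤ B.defect u0 f0 G0 ψ := by
  have hψV : IsTest V ψ := hψ.mono (hV0.subset hr.le)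
  obtain ⟨M, hM⟩ := hψ.bdd
  obtain ⟨χ, tχ, -, -, hχ1⟩ := exists_cutoff hψ.compact.isCompact hVo hψV.supp
  have sv : ∀ i {χ}, IsTest V χ → _ := fun i {χ} hχ => S.strong_high_mul B hr hVo hV i hχ
  have vt : ∀ {χ}, IsTest V χ → ∀ i, Tendsto (fun n => ∫ z, B.high (u n) i z *
      (B.high (u n) i z * χ z)) atTop (𝓝 (∫ z, B.high u0 i z * (B.high u0 i z * χ z))) :=
    fun hχ i => (S.weak_high B i).integral_mul (sv i hχ)
  have t1 := tendsto_finsetSum Finset.univ fun i _ => vt (hψV.dd et) i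
  have t2 : ∀ i j, Tendsto (fun n => ∫ z, B.dhigh (u n) (G n) j i z *
      (B.high (u n) i z * dd (ej j) ψ z)) atTop
      (𝓝 (∫ z, B.dhigh u0 G0 j i z * (B.high u0 i z * dd (ej j) ψ z))) := fun i j =>
    (S.weak_dhigh B j i).integral_mul (sv i (hψV.dd _))
  -- The square of the gradient is replaced by its tangent at the limit, which is linear in the
  -- sequence and has the correct limit. The square enters the defect with a minus sign, so this
  -- replacement only increases the defect.
  have t2' : ∀ i j, Tendsto (fun n => 2 * (∫ z, B.dhigh (u n) (G n) j i z *
      (B.dhigh u0 G0 j i z * ψ z)) - ∫ z, B.dhigh u0 G0 j i z * (B.dhigh u0 G0 j i z * ψ z)) atTop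
      (𝓝 (∫ z, B.dhigh u0 G0 j i z * (B.dhigh u0 G0 j i z * ψ z))) := fun i j => by
    have := (((S.weak_dhigh B j i).tendsto _ (memLp_mul_bdd (S.flow0.memLp_dhigh B j i) hψ.aesm
      (Eventually.of_forall hM))).const_mul 2).sub_const
      (∫ z, B.dhigh u0 G0 j i z * (B.dhigh u0 G0 j i z * ψ z))
    convert this using 2
    ring
  have t3 := tendsto_finsetSum Finset.univ fun i _ =>
    (S.weak_high_force B i).integral_mul (sv i hψV)
  have t4 := tendsto_finsetSum Finset.univ fun i _ => S.tendsto_conv_corr B hr hVo hV hV0 hψV hψ0 i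
  have t5 := tendsto_finsetSum Finset.univ fun i _ =>
    tendsto_finsetSum Finset.univ fun j _ => S.tendsto_three B hr hVo hV hV0 hψ i j
  have t6 : ∀ i j, Tendsto (fun n => ∫ z, (B.low (u n) j z * B.curl (u n) j i z +
      B.high (u n) j z * B.dlow (u n) j i z) * (B.high (u n) i z * ψ z)) atTop
      (𝓝 (∫ z, (B.low u0 j z * B.curl u0 j i z + B.high u0 j z * B.dlow u0 j i z) *
        (B.high u0 i z * ψ z))) := fun i j => by
    -- The low part and its gradient converge weakly but are uniformly bounded, so their products
    -- with compact factors converge weakly in L²; these are then paired with the strongly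
    -- convergent vψ. The cut-off χ localizes the compact factors.
    have w1 := (S.strong_curl_mul B hr hVo hV j i tχ).mul_weak_bdd (S.weak_low B j)
      (fun n => (S.flow n).abs_low_le B j) (S.flow0.abs_low_le B j)
    have w2 := (S.strong_high_mul B hr hVo hV j tχ).mul_weak_bdd (S.weak_dlow B j i)
      (fun n => (S.flow n).abs_dlow_le B j i) (S.flow0.abs_dlow_le B j i)
    have e : ∀ u : Fin 3 → SpaceTime → ℝ, ∫ z, (B.low u j z * B.curl u j i z +
        B.high u j z * B.dlow u j i z) * (B.high u i z * ψ z) =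
        ∫ z, ((B.curl u j i z * χ z) * B.low u j z + (B.high u j z * χ z) * B.dlow u j i z) *
        (B.high u i z * ψ z) := fun u => by
      refine integral_congr_ae (Eventually.of_forall fun z => ?_)
      by_cases hz : z ∈ tsupport ψ
      · simp only [hχ1 z hz, mul_one]
        ring
      · simp only [IsTest.eq_zero' hz, mul_zero]
    simp only [e]
    exact (w1.add w2).integral_mul (sv i hψV)
  have T := ((((t1.sub ((tendsto_finsetSum Finset.univ fun i _ =>
    tendsto_finsetSum Finset.univ fun j _ => (t2' i j).add (t2 i j)).const_mul 2)).add
    (t3.const_mul 2)).add (t4.const_mul 2)).add t5).sub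
    ((tendsto_finsetSum Finset.univ fun i _ =>
      tendsto_finsetSum Finset.univ fun j _ => t6 i j).const_mul 2)
  refine ge_of_tendsto T (Eventually.of_forall fun n => (h n).trans ?_)
  unfold RadialBump.defect
  gcongr with i _ j _
  exact two_mul_integral_sub_le ((S.flow n).memLp_dhigh B j i) (S.flow0.memLp_dhigh B j i)
    hψ.aesm hM h0

end FlowSeq

/-! ### Translation between vector fields and components -/

section Components

/-- The components of a vector field on `W`, extended by zero. -/
def comp (W : Set SpaceTime) (v : SpaceTime → R3) (i : Fin 3) : SpaceTime → ℝ :=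
  W.indicator fun z => v z i

variable {W : Set SpaceTime} {v : SpaceTime → R3}

theorem comp_of_mem {z : SpaceTime} (hz : z ∈ W) (i : Fin 3) : comp W v i z = v z i :=
  indicator_of_mem hz _

theorem comp_of_notMem {z : SpaceTime} (hz : z ∉ W) (i : Fin 3) : comp W v i z = 0 :=
  indicator_of_notMem hz _

theorem memLp_comp (hW : IsOpen W) (hv : MemLp v 2 (volume.restrict W)) (i : Fin 3) :
    MemLp (comp W v i) 2 :=
  (memLp_indicator_iff_restrict hW.measurableSet).2 (hv.eval_piLp i)

theorem integral_comp_mul (hW : IsOpen W) (i : Fin 3) (b : SpaceTime → ℝ) :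
    ∫ z, comp W v i z * b z = ∫ z in W, v z i * b z := by
  rw [← integral_indicator hW.measurableSet]
  refine integral_congr_ae (Eventually.of_forall fun z => ?_)
  by_cases hz : z ∈ W
  · simp [comp, hz]
  · simp [comp, hz]

theorem inner_eq_sum (x y : R3) : inner ℝ x y = ∑ i, x i * y i := by
  rw [PiLp.inner_apply]
  exact Finset.sum_congr rfl fun i _ => by simp [mul_comm]

theorem enorm_sq_eq_sum (x : R3) : ‖x‖ₑ ^ 2 = ∑ i, ‖x i‖ₑ ^ 2 := by
  have h : ‖x‖₊ ^ 2 = ∑ i, ‖x i‖₊ ^ 2 := by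
    have h1 := EuclideanSpace.norm_sq_eq x
    rw [← NNReal.coe_inj]
    push_cast
    exact h1
  simp only [enorm_eq_nnnorm]
  exact_mod_cast congrArg ((↑) : ℝ≥0 → ℝ≥0∞) h

theorem isTest_coe {Ω : Opens SpaceTime} (ψ : 𝓓(Ω, ℝ)) : IsTest (Ω : Set SpaceTime) ψ :=
  ⟨ψ.contDiff, ψ.hasCompactSupport, ψ.tsupport_subset⟩

/-- A smooth function with compact support in `Ω`, as a bundled test function. -/
def IsTest.toTest {Ω : Opens SpaceTime} {ψ : SpaceTime → ℝ} (h : IsTest (Ω : Set SpaceTime) ψ) :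
    𝓓(Ω, ℝ) := ⟨ψ, h.smooth, h.compact, h.supp⟩

theorem contDiff_apply3 {φ : SpaceTime → R3} (h : ContDiff ℝ ∞ φ) (i : Fin 3) :
    ContDiff ℝ ∞ fun z => φ z i :=
  (EuclideanSpace.proj (𝕜 := ℝ) (ι := Fin 3) i).contDiff.comp h

theorem fderiv_apply3 {φ : SpaceTime → R3} (h : Differentiable ℝ φ) (i : Fin 3)
    (e z : SpaceTime) : fderiv ℝ φ z e i = dd e (fun w => φ w i) z := by
  have h1 := ((EuclideanSpace.proj (𝕜 := ℝ) (ι := Fin 3) i).hasFDerivAt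
    (x := φ z)).comp z (h z).hasFDerivAt
  have h2 : fderiv ℝ (fun w => φ w i) z = _ := h1.fderiv
  rw [dd, h2]
  rfl

theorem isTest_apply {Ω : Opens SpaceTime} (φ : 𝓓(Ω, R3)) (i : Fin 3) :
    IsTest (Ω : Set SpaceTime) fun z => φ z i := by
  have h : tsupport (fun z => φ z i) ⊆ tsupport φ :=
    closure_mono fun z hz h => hz (by simp [h])
  exact ⟨contDiff_apply3 φ.contDiff i, φ.hasCompactSupport.mono' (subset_closure.trans h),
    h.trans φ.tsupport_subset⟩

/-- A vector field with test function components, as a bundled test function. -/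
def vecTest {Ω : Opens SpaceTime} {Φ : Fin 3 → SpaceTime → ℝ}
    (h : ∀ i, IsTest (Ω : Set SpaceTime) (Φ i)) : 𝓓(Ω, R3) where
  toFun z := WithLp.toLp 2 fun i => Φ i z
  contDiff' := contDiff_euclidean.2 fun i => (h i).smooth
  hasCompactSupport' := by
    refine HasCompactSupport.intro (K := ⋃ i, tsupport (Φ i))
      (isCompact_iUnion fun i => (h i).compact) fun z hz => ?_
    ext i
    exact IsTest.eq_zero' fun hi => hz (mem_iUnion.2 ⟨i, hi⟩)
  tsupport_subset' := by
    have h1 : IsClosed (⋃ i, tsupport (Φ i)) := isClosed_iUnion_of_finite fun i => isClosed_tsupport _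
    refine (closure_minimal (fun z hz => ?_) h1).trans (iUnion_subset fun i => (h i).supp)
    by_contra hz'
    refine hz ?_
    ext i
    exact IsTest.eq_zero' fun hi => hz' (mem_iUnion.2 ⟨i, hi⟩)

theorem differentiable_test {Ω : Opens SpaceTime} (φ : 𝓓(Ω, R3)) : Differentiable ℝ φ :=
  φ.contDiff.differentiable (by simp)

theorem divergence_eq {Ω : Opens SpaceTime} (φ : 𝓓(Ω, R3)) (z : SpaceTime) :
    divergence φ z = ∑ i, dd (ej i) (fun w => φ w i) z :=
  Finset.sum_congr rfl fun i _ => fderiv_apply3 (differentiable_test φ) i _ z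

theorem integrand_eq {Ω : Opens SpaceTime} (φ : 𝓓(Ω, R3)) (u f : SpaceTime → R3) (z : SpaceTime) :
    inner ℝ (u z) (timeDeriv φ z + laplacian φ z) + inner ℝ (u z) (advection u φ z) +
      inner ℝ (f z) (φ z) =
    (∑ i, u z i * dd et (fun w => φ w i) z) +
      (∑ i, ∑ j, u z i * dd (ej j) (dd (ej j) fun w => φ w i) z) +
      (∑ i, ∑ j, u z j * (u z i * dd (ej j) (fun w => φ w i) z)) + ∑ i, f z i * φ z i := by
  have hd := differentiable_test φ
  have h1 : ∀ i, timeDeriv φ z i = dd et (fun w => φ w i) z := fun i => fderiv_apply3 hd i _ z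
  have h2 : ∀ j i, spaceDeriv j φ z i = dd (ej j) (fun w => φ w i) z := fun j i =>
    fderiv_apply3 hd i _ z
  have h3 : ∀ i, laplacian φ z i = ∑ j, dd (ej j) (dd (ej j) fun w => φ w i) z := fun i => by
    have hs : ∀ j, Differentiable ℝ (spaceDeriv j φ) := fun j => by
      have : ContDiff ℝ ∞ (spaceDeriv j φ) :=
        (φ.contDiff.fderiv_right (m := ∞) (by simp)).clm_apply contDiff_const
      exact this.differentiable (by simp)
    simp only [laplacian, WithLp.ofLp_sum, Finset.sum_apply]
    refine Finset.sum_congr rfl fun j _ => ?_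
    refine (fderiv_apply3 (hs j) i _ z).trans ?_
    congr 1
    ext w
    exact fderiv_apply3 hd i _ w
  have h4 : ∀ i, advection u φ z i = ∑ j, u z j * dd (ej j) (fun w => φ w i) z := fun i => by
    simp only [advection, WithLp.ofLp_sum, Finset.sum_apply, PiLp.smul_apply, smul_eq_mul, h2]
  simp only [inner_eq_sum, PiLp.add_apply, h1, h3, h4, mul_add, Finset.sum_add_distrib,
    Finset.mul_sum]
  congr 2
  refine Finset.sum_congr rfl fun i _ => Finset.sum_congr rfl fun j _ => ?_
  ring

/-- The weak form of the equation in terms of the components. -/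
theorem integral_equation {Ω : Opens SpaceTime} (φ : 𝓓(Ω, R3)) {u f : SpaceTime → R3}
    (hu : MemLp u 2 (volume.restrict (Ω : Set SpaceTime)))
    (hf : MemLp f 2 (volume.restrict (Ω : Set SpaceTime))) :
    ∫ z in (Ω : Set SpaceTime), (inner ℝ (u z) (timeDeriv φ z + laplacian φ z) +
      inner ℝ (u z) (advection u φ z) + inner ℝ (f z) (φ z)) =
    (∑ i, ∫ z, comp Ω u i z * dd et (fun w => φ w i) z) +
      (∑ i, ∑ j, ∫ z, comp Ω u i z * dd (ej j) (dd (ej j) fun w => φ w i) z) +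
      (∑ i, ∑ j, ∫ z, comp Ω u j z * (comp Ω u i z * dd (ej j) (fun w => φ w i) z)) +
      ∑ i, ∫ z, comp Ω f i z * φ z i := by
  have mu := fun i => memLp_comp Ω.isOpen hu i
  have mf := fun i => memLp_comp Ω.isOpen hf i
  have t := fun i => isTest_apply φ i
  have i1 : ∀ i, Integrable fun z => comp Ω u i z * dd et (fun w => φ w i) z := fun i =>
    integrable_mul_of_memLp (mu i) ((t i).dd et).memLp
  have i2 : ∀ i j, Integrable fun z => comp Ω u i z * dd (ej j) (dd (ej j) fun w => φ w i) z :=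
    fun i j => integrable_mul_of_memLp (mu i) (((t i).dd _).dd _).memLp
  have i3 : ∀ i j, Integrable fun z =>
      comp Ω u j z * (comp Ω u i z * dd (ej j) (fun w => φ w i) z) := fun i j => by
    obtain ⟨M, hM⟩ := ((t i).dd (ej j)).ae_bdd
    exact integrable_mul_of_memLp (mu j) (memLp_mul_bdd (mu i) ((t i).dd _).aesm hM)
  have i4 : ∀ i, Integrable fun z => comp Ω f i z * φ z i := fun i =>
    integrable_mul_of_memLp (mf i) (t i).memLp
  have s1 := integrable_finsetSum Finset.univ fun i _ => i1 i
  have s2 := integrable_finsetSum Finset.univ fun i _ =>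
    integrable_finsetSum Finset.univ fun j _ => i2 i j
  have s3 := integrable_finsetSum Finset.univ fun i _ =>
    integrable_finsetSum Finset.univ fun j _ => i3 i j
  have s4 := integrable_finsetSum Finset.univ fun i _ => i4 i
  rw [← integral_finsetSum _ fun i _ => i1 i, ← integral_finsetSum _ fun i _ => i4 i]
  simp only [← integral_finsetSum Finset.univ fun j _ => i2 _ j,
    ← integral_finsetSum Finset.univ fun j _ => i3 _ j]
  rw [← integral_finsetSum _ fun i _ => integrable_finsetSum Finset.univ fun j _ => i2 i j,
    ← integral_finsetSum _ fun i _ => integrable_finsetSum Finset.univ fun j _ => i3 i j,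
    ← integral_add s1 s2, ← integral_add (integrable_add_fun s1 s2) s3,
    ← integral_add (integrable_add_fun (integrable_add_fun s1 s2) s3) s4,
    ← integral_indicator Ω.isOpen.measurableSet]
  refine integral_congr_ae (Eventually.of_forall fun z => ?_)
  by_cases hz : z ∈ (Ω : Set SpaceTime)
  · simp only [indicator_of_mem hz, integrand_eq, comp_of_mem hz]
  · simp only [indicator_of_notMem hz, comp_of_notMem hz, zero_mul, Finset.sum_const_zero, add_zero]

theorem divFree_comp_iff {Ω : Opens SpaceTime} {v : SpaceTime → R3}
    (hv : MemLp v 2 (volume.restrict (Ω : Set SpaceTime))) :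
    DivFree Ω (comp Ω v) ↔ WeaklyDivFree Ω v := by
  have e : ∀ ψ, IsTest (Ω : Set SpaceTime) ψ → ∑ j, ∫ z, comp Ω v j z * dd (ej j) ψ z =
      ∫ z in (Ω : Set SpaceTime), ∑ j, v z j * spaceDeriv j ψ z := fun ψ hψ => by
    rw [← integral_finsetSum _ fun j _ =>
      integrable_mul_of_memLp (memLp_comp Ω.isOpen hv j) (hψ.dd (ej j)).memLp,
      ← integral_indicator Ω.isOpen.measurableSet]
    refine integral_congr_ae (Eventually.of_forall fun z => ?_)
    by_cases hz : z ∈ (Ω : Set SpaceTime)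
    · simp only [indicator_of_mem hz, comp_of_mem hz]; rfl
    · simp only [indicator_of_notMem hz, comp_of_notMem hz, zero_mul, Finset.sum_const_zero]
  exact ⟨fun h ψ => by rw [← e ψ (isTest_coe ψ)]; exact h ψ (isTest_coe ψ),
    fun h ψ hψ => by rw [e ψ hψ]; exact h hψ.toTest⟩

theorem wd_comp {Ω : Opens SpaceTime} {v : SpaceTime → R3} {G : Fin 3 → SpaceTime → R3}
    (h : HasL2H1Gradient Ω v G) (j i : Fin 3) :
    WD Ω (ej j) (comp Ω v i) (comp Ω (G j) i) := by
  intro ψ hψ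
  have h1 := h.weakDeriv j hψ.toTest
  have i1 : ∀ {w : SpaceTime → R3} {χ : SpaceTime → ℝ},
      MemLp w 2 (volume.restrict (Ω : Set SpaceTime)) → IsTest (Ω : Set SpaceTime) χ →
      (∫ z in (Ω : Set SpaceTime), χ z • w z) i = ∫ z, comp Ω w i z * χ z := fun {w χ} hw hχ => by
    rw [eval_integral_piLp, integral_comp_mul Ω.isOpen]
    · refine integral_congr_ae (Eventually.of_forall fun z => ?_)
      simp [mul_comm]
    · intro k
      simp only [PiLp.smul_apply, smul_eq_mul]
      exact integrable_mul_of_memLp (hχ.memLp.restrict _) (hw.eval_piLp k)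
  rw [← i1 h.memLp (hψ.dd (ej j)), ← i1 (h.memLp_grad j) hψ]
  have h2 := congrArg (fun x : R3 => x i) h1
  exact h2

end Components

/-! ### Bounds implied by weak convergence -/

section WeakBounds

/-- The Banach–Steinhaus theorem, applied to the functionals given by pairing with a n on L². -/
theorem exists_bound_of_weak {a : ℕ → SpaceTime → ℝ} (ha : ∀ n, MemLp (a n) 2)
    (h : ∀ b : SpaceTime → ℝ, MemLp b 2 → ∃ x, Tendsto (fun n => ∫ z, a n z * b z) atTop (𝓝 x)) :
    ∃ C : ℝ≥0, ∀ n, eLpNorm (a n) 2 volume ≤ C := by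
  set g : ℕ → Lp ℝ 2 (volume : Measure SpaceTime) →L[ℝ] ℝ := fun n => innerSL ℝ ((ha n).toLp (a n))
    with hg
  have hb : ∀ x, ∃ C, ∀ n, ‖g n x‖ ≤ C := fun x => by
    obtain ⟨y, hy⟩ := h x (Lp.memLp x)
    have e : ∀ n, g n x = ∫ z, a n z * x z := fun n => by
      rw [hg]
      simp only [innerSL_apply_apply]
      rw [L2.inner_def]
      refine integral_congr_ae ?_
      filter_upwards [(ha n).coeFn_toLp] with z hz
      rw [hz]
      simp [mul_comm]
    obtain ⟨C, hC⟩ := hy.norm.bddAbove_range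
    exact ⟨C, fun n => by rw [e n]; exact hC ⟨n, rfl⟩⟩
  obtain ⟨C, hC⟩ := banach_steinhaus hb
  refine ⟨C.toNNReal, fun n => ?_⟩
  have h1 := hC n
  rw [hg] at h1
  simp only [innerSL_apply_norm, Lp.norm_toLp] at h1
  rw [← ENNReal.ofReal_toReal (ha n).2.ne]
  exact ENNReal.ofReal_le_ofReal h1

theorem lintegral_indicator_fst {A : Set ℝ} (hA : MeasurableSet A) {b : SpaceTime → ℝ}
    (hb : AEStronglyMeasurable b volume) :
    ∫⁻ z, ‖(Prod.fst ⁻¹' A).indicator b z‖ₑ ^ 2 = ∫⁻ t in A, ∫⁻ x : R3, ‖b (t, x)‖ₑ ^ 2 := by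
  have hm : MeasurableSet (Prod.fst ⁻¹' A : Set SpaceTime) := measurable_fst hA
  rw [lintegral_slice ((hb.indicator hm).enorm.pow_const 2), ← lintegral_indicator hA]
  refine lintegral_congr fun t => ?_
  by_cases ht : t ∈ A
  · rw [indicator_of_mem ht]
    exact lintegral_congr fun x => by rw [indicator_of_mem (show (t, x) ∈ Prod.fst ⁻¹' A from ht)]
  · rw [indicator_of_notMem ht]
    refine (lintegral_congr fun x => ?_).trans lintegral_zero
    rw [indicator_of_notMem (show (t, x) ∉ Prod.fst ⁻¹' A from ht)]
    simp

/-- It is enough to integrate in time over sets A of finite measure. Testing with a0 restricted to A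
bounds the square of its norm by that norm times the square root of C|A|, hence the integral over A
by C|A|. -/
theorem WeakL2.slice_le {a : ℕ → SpaceTime → ℝ} {a0 : SpaceTime → ℝ} {C : ℝ≥0}
    (h : WeakL2 volume atTop a a0) (hC : ∀ n, ∀ᵐ t : ℝ, ∫⁻ x : R3, ‖a n (t, x)‖ₑ ^ 2 ≤ C) :
    ∀ᵐ t : ℝ, ∫⁻ x : R3, ‖a0 (t, x)‖ₑ ^ 2 ≤ C := by
  refine ae_le_of_forall_setLIntegral_le_of_sigmaFinite₀
    (aemeasurable_slice_lintegral (h.mem0.1.enorm.pow_const 2)) fun A hA hA' => ?_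
  have hm : MeasurableSet (Prod.fst ⁻¹' A : Set SpaceTime) := measurable_fst hA
  set b : SpaceTime → ℝ := (Prod.fst ⁻¹' A).indicator a0 with hb
  have mb : MemLp b 2 := h.mem0.indicator hm
  rw [← lintegral_indicator_fst hA h.mem0.1, ← eLpNorm_two_sq, lintegral_const,
    Measure.restrict_apply_univ]
  set K : ℝ≥0∞ := C * volume A with hK
  have hKt : K ≠ ⊤ := by finiteness
  have bn : ∀ n, eLpNorm ((Prod.fst ⁻¹' A).indicator (a n)) 2 volume ^ 2 ≤ K := fun n => by
    rw [eLpNorm_two_sq, lintegral_indicator_fst hA (h.mem n).1, hK, ← setLIntegral_const]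
    exact lintegral_mono_ae (ae_restrict_of_ae (hC n))
  have t := h.tendsto b mb
  have e : ∀ c : SpaceTime → ℝ, ∫ z, c z * b z = ∫ z, (Prod.fst ⁻¹' A).indicator c z * b z :=
    fun c => by
      refine integral_congr_ae (Eventually.of_forall fun z => ?_)
      by_cases hz : z ∈ (Prod.fst ⁻¹' A : Set SpaceTime)
      · simp only [indicator_of_mem hz]
      · simp only [hb, indicator_of_notMem hz, mul_zero]
  have sq : ∀ n, eLpNorm ((Prod.fst ⁻¹' A).indicator (a n)) 2 volume ≤ K ^ (1 / 2 : ℝ) := fun n => by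
    have := ENNReal.rpow_le_rpow (bn n) (by norm_num : (0 : ℝ) ≤ 1 / 2)
    rwa [← ENNReal.rpow_natCast, ← ENNReal.rpow_mul, show ((2 : ℕ) : ℝ) * (1 / 2) = 1 by norm_num,
      ENNReal.rpow_one] at this
  have le : ∫ z, a0 z * b z ≤ (K ^ (1 / 2 : ℝ)).toReal * (eLpNorm b 2 volume).toReal := by
    refine le_of_tendsto t (Eventually.of_forall fun n => ?_)
    rw [e]
    refine (le_abs_self _).trans ((abs_integral_mul_le ((h.mem n).indicator hm) mb).trans ?_)
    gcongr
    · exact ENNReal.rpow_ne_top_of_nonneg (by norm_num) hKt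
    · exact sq n
  have eq : ∫ z, a0 z * b z = (eLpNorm b 2 volume).toReal ^ 2 := by
    rw [e, ← ENNReal.toReal_pow, eLpNorm_two_sq, integral_eq_lintegral_of_nonneg_ae
      (Eventually.of_forall fun z => mul_self_nonneg _) (mb.1.mul mb.1)]
    congr 1
    refine lintegral_congr fun z => ?_
    rw [← pow_two, ← sq_abs, ENNReal.ofReal_pow (abs_nonneg _), ← Real.enorm_eq_ofReal_abs]
  rw [eq, pow_two] at le
  have le2 : (eLpNorm b 2 volume).toReal ≤ (K ^ (1 / 2 : ℝ)).toReal := by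
    rcases (ENNReal.toReal_nonneg (a := eLpNorm b 2 volume)).eq_or_lt with h0 | h0
    · rw [← h0]; exact ENNReal.toReal_nonneg
    · exact le_of_mul_le_mul_right le h0
  have le3 := (ENNReal.toReal_le_toReal mb.2.ne
    (ENNReal.rpow_ne_top_of_nonneg (by norm_num) hKt)).1 le2
  calc eLpNorm b 2 volume ^ 2 ≤ (K ^ (1 / 2 : ℝ)) ^ 2 := by gcongr
    _ = K := by
      rw [← ENNReal.rpow_natCast, ← ENNReal.rpow_mul]
      norm_num

end WeakBounds

/-! ### Componentwise form of the convergences and bounds -/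

section Sequences
variable {W : Opens SpaceTime} {vs : ℕ → SpaceTime → R3} {v : SpaceTime → R3}

theorem inner_smul_single (x : R3) (c : ℝ) (i : Fin 3) :
    inner ℝ x (c • (EuclideanSpace.single i (1 : ℝ) : R3)) = x i * c := by
  rw [inner_smul_right, EuclideanSpace.inner_single_right]
  simp [mul_comm]

theorem memLp_smul_single {b : SpaceTime → ℝ} (hb : MemLp b 2) (i : Fin 3) (s : Set SpaceTime) :
    MemLp (fun z => b z • (EuclideanSpace.single i (1 : ℝ) : R3)) 2 (volume.restrict s) := by
  refine memLp_piLp_iff.2 fun k => ?_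
  by_cases hk : k = i
  · subst hk
    simpa using hb.restrict s
  · simp [hk]

/-- Weak convergence of components. -/
theorem WeakTendstoL2H1.exists_weakL2 (h : WeakTendstoL2H1 W vs v) :
    ∃ (Gs : ℕ → Fin 3 → SpaceTime → R3) (G : Fin 3 → SpaceTime → R3),
      (∀ n, HasL2H1Gradient W (vs n) (Gs n)) ∧ HasL2H1Gradient W v G ∧
      (∀ i, WeakL2 volume atTop (fun n => comp W (vs n) i) (comp W v i)) ∧
      (∀ i, ∃ C : ℝ≥0, ∀ n, eLpNorm (comp W (vs n) i) 2 volume ≤ C) ∧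
      (∀ j i, WeakL2 volume atTop (fun n => comp W (Gs n j) i) (comp W (G j) i)) ∧
      ∀ j i, ∃ C : ℝ≥0, ∀ n, eLpNorm (comp W (Gs n j) i) 2 volume ≤ C := by
  obtain ⟨Gs, G, hGs, hG, ht⟩ := h
  have mk : ∀ {a : ℕ → SpaceTime → ℝ} {a0 : SpaceTime → ℝ}, (∀ n, MemLp (a n) 2) → MemLp a0 2 →
      (∀ b, MemLp b 2 → Tendsto (fun n => ∫ z, a n z * b z) atTop (𝓝 (∫ z, a0 z * b z))) →
      WeakL2 volume atTop a a0 ∧ ∃ C : ℝ≥0, ∀ n, eLpNorm (a n) 2 volume ≤ C := by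
    intro a a0 ma m0 h
    obtain ⟨C, hC⟩ := exists_bound_of_weak ma fun b hb => ⟨_, h b hb⟩
    exact ⟨⟨ma, m0, ⟨C, Eventually.of_forall hC⟩, h⟩, C, hC⟩
  have p : ∀ i, _ := fun i => mk (fun n => memLp_comp W.isOpen (hGs n).memLp i)
    (memLp_comp W.isOpen hG.memLp i) fun b hb => by
      have := ht _ (fun _ _ => 0) (memLp_smul_single hb i _) fun _ => MemLp.zero'
      simpa only [inner_smul_single, inner_zero_right, Finset.sum_const_zero, add_zero,
        ← integral_comp_mul W.isOpen] using this
  have q : ∀ j i, _ := fun j i => mk (fun n => memLp_comp W.isOpen ((hGs n).memLp_grad j) i)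
    (memLp_comp W.isOpen (hG.memLp_grad j) i) fun b hb => by
      have h1 : ∀ g : Fin 3 → SpaceTime → R3, ∀ z, ∑ k, inner ℝ (g k z)
          ((if k = j then b z else 0) • (EuclideanSpace.single i (1 : ℝ) : R3)) = g j z i * b z :=
        fun g z => by simp only [inner_smul_single, mul_ite, mul_zero]; simp
      have := ht (fun _ => 0) (fun k z => (if k = j then b z else 0) •
        (EuclideanSpace.single i (1 : ℝ) : R3)) MemLp.zero' fun k => by
          by_cases hk : k = j
          · simp only [hk, if_true]; exact memLp_smul_single hb i _
          · simp only [hk, if_false, zero_smul]; exact MemLp.zero'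
      simpa only [h1, inner_zero_right, zero_add, ← integral_comp_mul W.isOpen] using this
  exact ⟨Gs, G, hGs, hG, fun i => (p i).1, fun i => (p i).2, fun j i => (q j i).1,
    fun j i => (q j i).2⟩

theorem slice_comp {Ω : Opens SpaceTime} {Q : Cylinder Ω} {v : SpaceTime → R3} {C : ℝ≥0}
    (h : LinftyL2SqNormLE Q v C) (i : Fin 3) :
    ∀ᵐ t : ℝ, ∫⁻ x : R3, ‖comp Q.toOpens v i (t, x)‖ₑ ^ 2 ≤ C := by
  rw [LinftyL2SqNormLE, ae_restrict_iff' measurableSet_Ioo] at h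
  filter_upwards [h] with t ht
  by_cases hI : t ∈ Ioo Q.a Q.b
  · refine le_trans ?_ (ht hI)
    rw [← lintegral_indicator Q.O.isOpen.measurableSet]
    refine lintegral_mono fun x => ?_
    by_cases hx : x ∈ (Q.O : Set R3)
    · rw [comp_of_mem (show (t, x) ∈ (Q.toOpens : Set SpaceTime) from ⟨hI, hx⟩),
        indicator_of_mem hx, enorm_sq_eq_sum]
      exact Finset.single_le_sum (f := fun i => ‖v (t, x) i‖ₑ ^ 2) (fun _ _ => zero_le)
        (Finset.mem_univ i)
    · rw [comp_of_notMem (fun h => hx h.2)]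
      simp
  · refine le_trans (le_of_eq ?_) zero_le
    refine (lintegral_congr fun x => ?_).trans lintegral_zero
    rw [comp_of_notMem (fun h => hI h.1)]
    simp

theorem linftyL2_of_slice {Ω : Opens SpaceTime} {Q : Cylinder Ω} {v : SpaceTime → R3} {C : ℝ≥0}
    (hm : ∀ i, AEStronglyMeasurable (comp Q.toOpens v i) volume)
    (h : ∀ i, ∀ᵐ t : ℝ, ∫⁻ x : R3, ‖comp Q.toOpens v i (t, x)‖ₑ ^ 2 ≤ C) :
    LinftyL2SqNormLE Q v (3 * C) := by
  rw [LinftyL2SqNormLE, ae_restrict_iff' measurableSet_Ioo]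
  have hm' : ∀ᵐ t : ℝ, ∀ i, AEMeasurable fun x : R3 => ‖comp Q.toOpens v i (t, x)‖ₑ ^ 2 :=
    ae_all_iff.2 fun i => ((hm i).prodMk_left).mono fun t ht => ht.enorm.pow_const 2
  filter_upwards [ae_all_iff.2 h, hm'] with t ht hmt hI
  calc ∫⁻ x in (Q.O : Set R3), ‖v (t, x)‖ₑ ^ 2
      = ∫⁻ x in (Q.O : Set R3), ∑ i, ‖comp Q.toOpens v i (t, x)‖ₑ ^ 2 := by
        refine setLIntegral_congr_fun Q.O.isOpen.measurableSet fun x hx => ?_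
        simp only [enorm_sq_eq_sum,
          comp_of_mem (show (t, x) ∈ (Q.toOpens : Set SpaceTime) from ⟨hI, hx⟩)]
    _ ≤ ∫⁻ x, ∑ i, ‖comp Q.toOpens v i (t, x)‖ₑ ^ 2 := setLIntegral_le_lintegral _ _
    _ = ∑ i, ∫⁻ x, ‖comp Q.toOpens v i (t, x)‖ₑ ^ 2 := lintegral_finsetSum' _ fun i _ => hmt i
    _ ≤ ∑ _i : Fin 3, (C : ℝ≥0∞) := Finset.sum_le_sum fun i _ => ht i
    _ = (3 * C : ℝ≥0) := by simp

end Sequences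

/-! ### From solutions on Ω to flow data on a cylinder -/

section Setup

theorem WeaklyDivFree.mono {W Ω : Opens SpaceTime} {v : SpaceTime → R3} (h : WeaklyDivFree Ω v)
    (hW : (W : Set SpaceTime) ⊆ Ω) : WeaklyDivFree W v := by
  intro ψ
  have e : ∀ U : Opens SpaceTime, (W : Set SpaceTime) ⊆ U →
      ∫ z in (U : Set SpaceTime), ∑ j, v z j * spaceDeriv j ψ z =
        ∫ z, ∑ j, v z j * spaceDeriv j ψ z := fun U hU =>
    setIntegral_eq_integral_of_forall_compl_eq_zero fun z hz => by
      refine Finset.sum_eq_zero fun j _ => ?_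
      rw [show spaceDeriv j ψ z = 0 from ((isTest_coe ψ).dd (ej j)).eq_zero fun h => hz (hU h),
        mul_zero]
  rw [e W subset_rfl, ← e Ω hW]
  exact h ((isTest_coe ψ).mono hW).toTest

theorem DivFree.of_weak {U : Set SpaceTime} {a : ℕ → Fin 3 → SpaceTime → ℝ}
    {a0 : Fin 3 → SpaceTime → ℝ} (h : ∀ n, DivFree U (a n))
    (hw : ∀ i, WeakL2 volume atTop (fun n => a n i) (a0 i)) : DivFree U a0 := fun ψ hψ =>
  tendsto_nhds_unique
    (tendsto_finsetSum Finset.univ fun j _ => (hw j).tendsto _ (hψ.dd (ej j)).memLp)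
    (tendsto_const_nhds.congr fun n => (h n ψ hψ).symm)

theorem Cylinder.subset {Ω : Opens SpaceTime} (Q : Cylinder Ω) :
    (Q.toOpens : Set SpaceTime) ⊆ Ω := subset_closure.trans Q.closure_subset

theorem exists_flowSeq {Ω : Opens SpaceTime} {f u : SpaceTime → R3} {fs us : ℕ → SpaceTime → R3}
    (hsol : ∀ n, IsLocalWeakSolution Ω (fs n) (us n)) (Q : Cylinder Ω)
    (hf : WeakTendstoL2H1 Q.toOpens fs f) (hb : ∃ C : ℝ≥0, ∀ n, LinftyL2SqNormLE Q (us n) C)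
    (hu : WeakTendstoL2H1 Q.toOpens us u) :
    ∃ (C : ℝ≥0) (Gs : ℕ → Fin 3 → SpaceTime → R3) (G : Fin 3 → SpaceTime → R3),
      (∀ n, HasL2H1Gradient Q.toOpens (us n) (Gs n)) ∧ HasL2H1Gradient Q.toOpens u G ∧
      FlowSeq Q.toOpens C (fun n => comp Q.toOpens (us n)) (fun n => comp Q.toOpens (fs n))
        (fun n j => comp Q.toOpens (Gs n j)) (comp Q.toOpens u) (comp Q.toOpens f)
        (fun j => comp Q.toOpens (G j)) := by
  obtain ⟨Gs, G, hGs, hG, wU, bU, wG, bG⟩ := hu.exists_weakL2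
  obtain ⟨Hs, H, hHs, hH, wF, bF, -, -⟩ := hf.exists_weakL2
  obtain ⟨Cs, hCs⟩ := hb
  -- Every required bound is monotone in the constant, hence valid for all large constants; finitely
  -- many such conditions hold simultaneously for one of them.
  have ev : ∀ {p : ℝ≥0 → Prop}, (∃ C, p C) → (∀ C C', C ≤ C' → p C → p C') →
      ∀ᶠ C in (atTop : Filter ℝ≥0), p C := fun ⟨C, hC⟩ hm =>
    (eventually_ge_atTop C).mono fun C' h => hm C C' h hC
  have evn : ∀ {a : ℕ → SpaceTime → ℝ}, (∃ C : ℝ≥0, ∀ n, eLpNorm (a n) 2 volume ≤ C) →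
      ∀ᶠ C : ℝ≥0 in atTop, ∀ n, eLpNorm (a n) 2 volume ≤ C := fun {a} h =>
    ev (p := fun C => ∀ n, eLpNorm (a n) 2 volume ≤ C) h
      fun C C' hC h n => (h n).trans (by exact_mod_cast hC)
  have ev1 : ∀ {a : SpaceTime → ℝ}, MemLp a 2 →
      ∀ᶠ C : ℝ≥0 in atTop, eLpNorm a 2 volume ≤ C := fun {a} h =>
    ev (p := fun C => eLpNorm a 2 volume ≤ C) ⟨(eLpNorm a 2 volume).toNNReal, by rw [ENNReal.coe_toNNReal h.2.ne]⟩
      fun C C' hC h => h.trans (by exact_mod_cast hC)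
  obtain ⟨C, c1, c2, c3, c4, c5, c6, c7⟩ := ((eventually_all.2 fun i => evn (bU i)).and
    ((eventually_all.2 fun i => evn (bF i)).and ((eventually_all.2 fun j =>
      eventually_all.2 fun i => evn (bG j i)).and ((eventually_all.2 fun i => ev1 (wU i).mem0).and
      ((eventually_all.2 fun i => ev1 (wF i).mem0).and ((eventually_all.2 fun j =>
        eventually_all.2 fun i => ev1 (wG j i).mem0).and (eventually_ge_atTop Cs))))))).exists
  have hbd : Bornology.IsBounded (Q.toOpens : Set SpaceTime) :=
    Q.isCompact_closure.isBounded.subset subset_closure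
  have dU : ∀ n, DivFree Q.toOpens (comp Q.toOpens (us n)) := fun n =>
    (divFree_comp_iff (hGs n).memLp).2 ((hsol n).divFree Q)
  have dF : ∀ n, DivFree Q.toOpens (comp Q.toOpens (fs n)) := fun n =>
    (divFree_comp_iff (hHs n).memLp).2 ((hsol n).force_divFree.mono Q.subset)
  have sl : ∀ n i, ∀ᵐ t : ℝ, ∫⁻ x : R3, ‖comp Q.toOpens (us n) i (t, x)‖ₑ ^ 2 ≤ C := fun n i =>
    (slice_comp (hCs n) i).mono fun t ht => ht.trans (by exact_mod_cast c7)
  refine ⟨C, Gs, G, hGs, hG, ⟨fun n => ?_, fun n => ?_, ?_, wU, wF, wG⟩⟩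
  · exact ⟨Q.toOpens.isOpen, hbd, fun i => (wU i).mem n, fun i => (wF i).mem n,
      fun j i => (wG j i).mem n, fun i => c1 i n, fun i => c2 i n, fun j i => c3 j i n,
      fun i z hz => comp_of_notMem hz i, fun j i => wd_comp (hGs n) j i, dU n, dF n, sl n⟩
  · intro Φ hΦ hd
    have h1 := (hsol n).equation Q (vecTest hΦ) fun z => by rw [divergence_eq]; exact hd z
    rw [integral_equation _ (hGs n).memLp (hHs n).memLp] at h1
    exact h1
  · exact ⟨Q.toOpens.isOpen, hbd, fun i => (wU i).mem0, fun i => (wF i).mem0,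
      fun j i => (wG j i).mem0, c4, c5, c6, fun i z hz => comp_of_notMem hz i,
      fun j i => wd_comp hG j i, DivFree.of_weak dU wU, DivFree.of_weak dF wF,
      fun i => (wU i).slice_le fun n => sl n i⟩

/-- The energy defect and the weak convergence each bring their own gradient of the same field.
Almost everywhere equality makes them interchangeable under integrals. -/
theorem gradient_unique {W : Opens SpaceTime} {v : SpaceTime → R3} {G G' : Fin 3 → SpaceTime → R3}
    (h : HasL2H1Gradient W v G) (h' : HasL2H1Gradient W v G') (j i : Fin 3) :
    comp W (G j) i =ᵐ[volume] comp W (G' j) i := by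
  have m := memLp_comp W.isOpen (h.memLp_grad j) i
  have m' := memLp_comp W.isOpen (h'.memLp_grad j) i
  have h1 := W.isOpen.ae_eq_zero_of_integral_contDiff_smul_eq_zero (μ := volume)
    (f := fun z => comp W (G j) i z - comp W (G' j) i z)
    (((memLp_sub m m').locallyIntegrable one_le_two).locallyIntegrableOn _) fun g hg hc hs => by
      have t : IsTest (W : Set SpaceTime) g := ⟨hg, hc, hs⟩
      have e1 := wd_comp h j i g t
      have e2 := wd_comp h' j i g t
      have e3 := integral_sub (integrable_mul_of_memLp m t.memLp) (integrable_mul_of_memLp m' t.memLp)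
      rw [show ∫ z, g z • (comp W (G j) i z - comp W (G' j) i z) =
        ∫ z, comp W (G j) i z * g z - comp W (G' j) i z * g z from
        integral_congr_ae (Eventually.of_forall fun z => by simp only [smul_eq_mul]; ring), e3]
      linarith
  filter_upwards [h1] with z hz
  by_cases hW : z ∈ (W : Set SpaceTime)
  · exact sub_eq_zero.1 (hz hW)
  · rw [comp_of_notMem hW, comp_of_notMem hW]

end Setup

/-! ### The mollified energy defect and its limit on a cylinder -/

section EnergyDefect

theorem FlowData.integrable_cubic {W : Set SpaceTime} {C : ℝ≥0} {u f : Fin 3 → SpaceTime → ℝ}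
    {G : Fin 3 → Fin 3 → SpaceTime → ℝ} (S : FlowData W C u f G) {ψ : SpaceTime → ℝ}
    (hψ : IsTest W ψ) (i j : Fin 3) : Integrable fun z => u j z * (u i z * (u i z * ψ z)) := by
  obtain ⟨χ, hχ, _, _, h1⟩ := exists_cutoff hψ.compact.isCompact S.isOpen hψ.supp
  have hh : ∀ {χ}, IsTest W χ → IsH1 (fun z => u i z * χ z) _ := fun hχ =>
    WD.isH1 (fun l => S.wd l i) (S.memU i) (fun l => S.memG l i) hχ
  refine (S.integrable_three (hh hχ) (hh hψ) j).congr (Eventually.of_forall fun z => ?_)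
  by_cases hz : z ∈ tsupport ψ
  · simp only [h1 z hz, mul_one]
  · simp only [IsTest.eq_zero' hz, mul_zero]

variable {φ : R3 → ℝ}

/-- The mollified energy defect in terms of components. -/
def defectApprox (hφ : IsMollifier φ) (u : Fin 3 → SpaceTime → ℝ)
    (G : Fin 3 → Fin 3 → SpaceTime → ℝ) (ε : ℝ) (ψ : SpaceTime → ℝ) : ℝ :=
  (∑ i, ∑ j, ∫ z, u j z * (u i z * (u i z * dd (ej j) ψ z))) +
    2 * ∑ i, ∫ z, (spaceMol hφ ε).avg (conv u G i) z * ((spaceMol hφ ε).avg (u i) z * ψ z)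

theorem FlowData.defectApprox_smul_add {W : Set SpaceTime} {C : ℝ≥0} {u f : Fin 3 → SpaceTime → ℝ}
    {G : Fin 3 → Fin 3 → SpaceTime → ℝ} (S : FlowData W C u f G) (hφ : IsMollifier φ) {ε : ℝ}
    (hε : 0 < ε) {ψ χ : SpaceTime → ℝ} (hψ : IsTest W ψ) (hχ : IsTest W χ) (c : ℝ) :
    defectApprox hφ u G ε (fun z => c * ψ z + χ z) =
      c * defectApprox hφ u G ε ψ + defectApprox hφ u G ε χ := by
  have hd : ∀ e z, dd e (fun z => c * ψ z + χ z) z = c * dd e ψ z + dd e χ z := fun e z => by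
    have h2 : fderiv ℝ (fun z => c * ψ z + χ z) z = _ :=
      (((hψ.differentiable z).hasFDerivAt.const_mul c).add (hχ.differentiable z).hasFDerivAt).fderiv
    simp only [dd, h2]
    rfl
  have e1 : ∀ i j, ∫ z, u j z * (u i z * (u i z * dd (ej j) (fun z => c * ψ z + χ z) z)) =
      c * (∫ z, u j z * (u i z * (u i z * dd (ej j) ψ z))) +
        ∫ z, u j z * (u i z * (u i z * dd (ej j) χ z)) := fun i j => by
    rw [← integral_const_mul, ← integral_add
      ((S.integrable_cubic (hψ.dd (ej j)) i j).const_mul c) (S.integrable_cubic (hχ.dd (ej j)) i j)]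
    refine integral_congr_ae (Eventually.of_forall fun z => ?_)
    simp only [hd]
    ring
  have e2 : ∀ i, ∫ z, (spaceMol hφ ε).avg (conv u G i) z *
      ((spaceMol hφ ε).avg (u i) z * (c * ψ z + χ z)) =
      c * (∫ z, (spaceMol hφ ε).avg (conv u G i) z * ((spaceMol hφ ε).avg (u i) z * ψ z)) +
        ∫ z, (spaceMol hφ ε).avg (conv u G i) z * ((spaceMol hφ ε).avg (u i) z * χ z) := fun i => by
    have hi : ∀ {θ}, IsTest W θ → Integrable fun z => (spaceMol hφ ε).avg (conv u G i) z *
        ((spaceMol hφ ε).avg (u i) z * θ z) := fun hθ => by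
      obtain ⟨M, hM⟩ := hθ.ae_bdd
      exact integrable_mul_of_memLp (S.memLp_spaceMol_conv hφ hε i)
        (memLp_mul_bdd ((spaceMol hφ ε).memLp_avg (S.memU i)) hθ.aesm hM)
    rw [← integral_const_mul, ← integral_add ((hi hψ).const_mul c) (hi hχ)]
    refine integral_congr_ae (Eventually.of_forall fun z => ?_)
    simp only
    ring
  simp only [defectApprox, e1, e2, Finset.sum_add_distrib, ← Finset.mul_sum]
  ring

/-- The mollification uses the values of v everywhere, while only those in W are controlled. At
points whose ρ-ball lies in W it agrees with that of the extension by zero. -/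
theorem avg_apply_of_near {W : Set SpaceTime} {v : SpaceTime → R3} {k : TransKernel} {ρ : ℝ}
    (hk : k.InBall ρ) {z : SpaceTime} (hz : ∀ w, ‖z - w‖ ≤ ρ → w ∈ W)
    (hi : ∀ i, Integrable (fun α => k.m α • comp W v i (z - k.τ α)) k.ν) (i : Fin 3) :
    k.avg v z i = k.avg (comp W v i) z := by
  have e : ∀ w i, (W.indicator v w) i = comp W v i w := fun w i => by
    by_cases hw : w ∈ W
    · rw [indicator_of_mem hw, comp_of_mem hw]
    · rw [indicator_of_notMem hw, comp_of_notMem hw]; rfl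
  rw [k.avg_congr_of_forall hk (F := v) (H := W.indicator v) fun w hw => by
    rw [indicator_of_mem (hz w hw)]]
  simp only [TransKernel.avg]
  rw [eval_integral_piLp]
  · simp only [PiLp.smul_apply, e]
  · intro l
    simpa only [PiLp.smul_apply, e] using hi l

theorem energyDefectApprox_eq {W : Opens SpaceTime} {C : ℝ≥0} {u : SpaceTime → R3}
    {Gv : Fin 3 → SpaceTime → R3} {f : Fin 3 → SpaceTime → ℝ} {G : Fin 3 → Fin 3 → SpaceTime → ℝ}
    (S : FlowData W C (comp W u) f G) (hG : ∀ j i, comp W (Gv j) i =ᵐ[volume] G j i)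
    (hφ : IsMollifier φ) {ε ρ : ℝ} (hε : 0 < ε) (hρ : (spaceMol hφ ε).InBall ρ) (ψ : 𝓓(W, ℝ))
    (hψ : Near ρ (tsupport ψ) W) :
    energyDefectApprox φ W u Gv ε ψ = defectApprox hφ (comp W u) G ε ψ := by
  have tψ := isTest_coe ψ
  obtain ⟨M, hM⟩ := tψ.ae_bdd
  have hconv : ∀ i, comp W (fun y => ∑ j, u y j • Gv j y) i =ᵐ[volume] conv (comp W u) G i :=
    fun i => by
      filter_upwards [ae_all_iff.2 fun j => hG j i] with z hz
      by_cases hW : z ∈ (W : Set SpaceTime)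
      · simp only [comp_of_mem hW] at hz
        simp only [comp_of_mem hW, conv, ← hz, WithLp.ofLp_sum, Finset.sum_apply, PiLp.smul_apply,
          smul_eq_mul]
      · simp only [comp_of_notMem hW, conv, zero_mul, Finset.sum_const_zero]
  have ic : ∀ i, Integrable (comp W (fun y => ∑ j, u y j • Gv j y) i) := fun i =>
    (S.integrable_conv i).congr (hconv i).symm
  have i2 : ∀ i, Integrable fun z => (spaceMol hφ ε).avg (conv (comp W u) G i) z *
      ((spaceMol hφ ε).avg (comp W u i) z * ψ z) := fun i =>
    integrable_mul_of_memLp (S.memLp_spaceMol_conv hφ hε i)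
      (memLp_mul_bdd ((spaceMol hφ ε).memLp_avg (S.memU i)) tψ.aesm hM)
  unfold energyDefectApprox defectApprox
  congr 1
  · simp only [← integral_finsetSum Finset.univ fun j _ => S.integrable_cubic (tψ.dd (ej j)) _ j]
    rw [← integral_finsetSum Finset.univ fun i _ => integrable_finsetSum Finset.univ fun j _ =>
      S.integrable_cubic (tψ.dd (ej j)) i j, ← integral_indicator W.isOpen.measurableSet]
    refine integral_congr_ae (Eventually.of_forall fun z => ?_)
    by_cases hz : z ∈ (W : Set SpaceTime)
    · simp only [indicator_of_mem hz, comp_of_mem hz, EuclideanSpace.real_norm_sq_eq,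
        Finset.sum_mul_sum]
      refine Finset.sum_congr rfl fun i _ => Finset.sum_congr rfl fun j _ => ?_
      change u z i ^ 2 * (u z j * dd (ej j) ψ z) = _
      ring
    · simp only [indicator_of_notMem hz, comp_of_notMem hz, zero_mul, Finset.sum_const_zero]
  · rw [← integral_finsetSum _ fun i _ => i2 i, ← integral_const_mul,
      ← integral_indicator W.isOpen.measurableSet]
    refine integral_congr_ae ?_
    filter_upwards [ae_all_iff.2 fun i => (spaceMol hφ ε).ae_integrable (S.memU i),
      ae_all_iff.2 fun i => (spaceMol hφ ε).ae_integrable_of_integrable (ic i),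
      ae_all_iff.2 fun i => (spaceMol hφ ε).avg_congr_ae (hconv i)] with z h1 h2 h3
    by_cases hz : z ∈ tsupport ψ
    · rw [indicator_of_mem (tψ.supp hz), inner_eq_sum]
      simp only [mollify_eq hφ, avg_apply_of_near hρ (hψ z hz) h1,
        avg_apply_of_near hρ (hψ z hz) h2, h3, Finset.mul_sum]
      refine Finset.sum_congr rfl fun i _ => ?_
      ring
    · have h0 : ψ z = 0 := IsTest.eq_zero' hz
      simp only [h0, mul_zero, Finset.sum_const_zero]
      by_cases hW : z ∈ (W : Set SpaceTime)
      · simp only [indicator_of_mem hW, h0, zero_mul]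
      · rw [indicator_of_notMem hW]

theorem tendsto_nhdsGT_of_seq {E : ℝ → ℝ} {x : ℝ}
    (h : ∀ ε : ℕ → ℝ, (∀ k, 0 < ε k) → Tendsto ε atTop (𝓝 0) →
      Tendsto (fun k => E (ε k)) atTop (𝓝 x)) : Tendsto E (𝓝[>] 0) (𝓝 x) := by
  refine tendsto_of_seq_tendsto fun ε hε => ?_
  rw [tendsto_nhdsWithin_iff] at hε
  -- The sequence is positive only eventually; replacing its other terms by 1 does not affect the
  -- limit.
  have hev : ∀ᶠ k in atTop, (if 0 < ε k then ε k else 1) = ε k := hε.2.mono fun k hk => if_pos hk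
  refine (h (fun k => if 0 < ε k then ε k else 1) (fun k => ?_) (hε.1.congr' ?_)).congr' ?_
  · split_ifs with hk
    · exact hk
    · exact one_pos
  · exact hev.mono fun k hk => hk.symm
  · exact hev.mono fun k hk => by simp only [hk, Function.comp_apply]

/-- The energy defect is the limit of its approximations. -/
theorem tendsto_energyDefectApprox {W : Opens SpaceTime} {C : ℝ≥0} {u : SpaceTime → R3}
    {Gv : Fin 3 → SpaceTime → R3} {f : Fin 3 → SpaceTime → ℝ} {G : Fin 3 → Fin 3 → SpaceTime → ℝ}
    (S : FlowData W C (comp W u) f G) (hE : WeakEq W (comp W u) f)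
    (hG : ∀ j i, comp W (Gv j) i =ᵐ[volume] G j i) (hφ : IsMollifier φ) {r : ℝ}
    (B : RadialBump r) (hr : 0 < r) {V0 V : Set SpaceTime} (hV : Near r V W) (hV0 : Near r V0 V)
    (ψ : 𝓓(W, ℝ)) (hψ : tsupport ψ ⊆ V0) :
    Tendsto (fun ε => energyDefectApprox φ W u Gv ε ψ) (𝓝[>] 0)
      (𝓝 (B.defect (comp W u) f G ψ)) := by
  obtain ⟨ρ0, hρ0, h0⟩ := exists_radius hφ
  have tψ : IsTest V0 ψ := ⟨ψ.contDiff, ψ.hasCompactSupport, hψ⟩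
  refine tendsto_nhdsGT_of_seq fun ε hε tε => ?_
  have t1 := ((S.tendsto_space hE B hr.le hφ hr hV0 hV tψ hε tε).const_mul 2).const_add
    (∑ i, ∑ j, ∫ z, comp W u j z * (comp W u i z * (comp W u i z * dd (ej j) ψ z)))
  rw [S.defect_eq B hr.le hr hV0 hV tψ] at t1
  refine t1.congr' ?_
  have t2 : Tendsto (fun k => ε k * ρ0) atTop (𝓝 0) := by simpa using tε.mul_const ρ0
  filter_upwards [t2.eventually (gt_mem_nhds hr)] with k hk
  refine (energyDefectApprox_eq S hG hφ (hε k) (ρ := r) (fun α hα =>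
    (spaceMol_inBall hφ h0 (hε k) α hα).trans hk.le) ψ fun z hz w hw => ?_).symm
  exact hV.subset hr.le (hV0 z (hψ hz) w hw)

end EnergyDefect

/-! ### Non-negative functionals and existence of the defect as a distribution -/

section Positivity

variable {W : Opens SpaceTime}

/-- A non-negative linear form on test functions is a distribution. -/
theorem exists_distribution_of_nonneg {L : 𝓓(W, ℝ) → ℝ}
    (hlin : ∀ (c : ℝ) (ψ χ : 𝓓(W, ℝ)), L (c • ψ + χ) = c * L ψ + L χ)
    (hpos : ∀ ψ : 𝓓(W, ℝ), (∀ z, 0 ≤ ψ z) → 0 ≤ L ψ) : ∃ T : 𝓓'(W, ℝ), ∀ ψ, T ψ = L ψ := by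
  have hadd : ∀ ψ χ, L (ψ + χ) = L ψ + L χ := fun ψ χ => by simpa using hlin 1 ψ χ
  have h0 : L 0 = 0 := by simpa using hadd 0 0
  have hsmul : ∀ (c : ℝ) ψ, L (c • ψ) = c * L ψ := fun c ψ => by simpa [h0] using hlin c ψ 0
  refine ⟨TestFunction.mkCLM ℝ L hadd hsmul fun K hK => ?_, fun ψ => rfl⟩
  -- With χ equal to one on K, the functions ‖g‖χ ± g are non-negative, so |L g| ≤ ‖g‖ L χ for the
  -- uniform norm: the functional has order zero, which gives continuity.
  obtain ⟨χ, hχ, h0χ, -, h1χ⟩ := exists_cutoff K.isCompact W.isOpen hK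
  have key : ∀ g : 𝓓_{K}(SpaceTime, ℝ), |L (TestFunction.ofSupportedIn hK g)| ≤
      ‖ContDiffMapSupportedIn.toBoundedContinuousFunctionCLM ℝ g‖ * L hχ.toTest := fun g => by
    set N := ‖ContDiffMapSupportedIn.toBoundedContinuousFunctionCLM ℝ g‖
    have hb : ∀ z, |g z| ≤ N * χ z := fun z => by
      by_cases hz : z ∈ (K : Set SpaceTime)
      · rw [h1χ z hz, mul_one]
        exact (ContDiffMapSupportedIn.toBoundedContinuousFunctionCLM ℝ g).norm_coe_le_norm z
      · rw [g.zero_on_compl hz]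
        simpa using mul_nonneg (norm_nonneg _) (h0χ z)
    have h1 := hpos (N • hχ.toTest + TestFunction.ofSupportedIn hK g) fun z =>
      show 0 ≤ N * χ z + g z by linarith [neg_abs_le (g z), hb z]
    have h2 := hpos ((-1 : ℝ) • TestFunction.ofSupportedIn hK g + N • hχ.toTest) fun z =>
      show 0 ≤ -1 * g z + N * χ z by linarith [le_abs_self (g z), hb z]
    rw [hlin] at h1
    rw [hlin, hsmul] at h2
    rw [abs_le]
    constructor <;> linarith
  refine continuous_iff_continuousAt.2 fun g => ?_
  refine tendsto_iff_norm_sub_tendsto_zero.2 (squeeze_zero (fun _ => norm_nonneg _) (fun g' => ?_)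
    (?_ : Tendsto (fun g' => ‖ContDiffMapSupportedIn.toBoundedContinuousFunctionCLM ℝ (g' - g)‖ *
      L hχ.toTest) (𝓝 g) (𝓝 0)))
  · have e : L (TestFunction.ofSupportedIn hK g') = L (TestFunction.ofSupportedIn hK (g' - g)) +
        L (TestFunction.ofSupportedIn hK g) := by
      rw [← hadd]
      congr 1
      ext z
      change g' z = g' z - g z + g z
      ring
    simp only [Function.comp_apply, e, add_sub_cancel_right]
    exact key _
  · have c : Continuous fun g' : 𝓓_{K}(SpaceTime, ℝ) =>
        ‖ContDiffMapSupportedIn.toBoundedContinuousFunctionCLM ℝ (g' - g)‖ * L hχ.toTest :=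
      (((ContDiffMapSupportedIn.toBoundedContinuousFunctionCLM ℝ).continuous.comp
        (continuous_id.sub continuous_const)).norm).mul_const _
    have t := c.tendsto g
    simp only [sub_self, map_zero, norm_zero, zero_mul] at t
    exact t

theorem exists_near_tower {ψ : SpaceTime → ℝ} (hψ : IsTest (W : Set SpaceTime) ψ) :
    ∃ r > 0, ∃ V0 V : Set SpaceTime, IsOpen V ∧ Near (3 * r) V W ∧ Near r V0 V ∧
      Near r (tsupport ψ) V0 := by
  obtain ⟨ρ, hρ, hn⟩ := hψ.exists_near W.isOpen
  -- With r = ρ/6, the three nested margins use r + r + 3r = 5r, which is less than ρ.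
  refine ⟨ρ / 6, by positivity, core (ρ / 6 + 3 * (ρ / 6)) W, core (3 * (ρ / 6)) W, isOpen_core _ _,
    near_core _ _, near_core_core _ _, hn.near_core (by linarith)⟩

variable {φ : R3 → ℝ}

theorem eventually_energyDefectApprox_eq {C : ℝ≥0} {u : SpaceTime → R3}
    {Gv : Fin 3 → SpaceTime → R3} {f : Fin 3 → SpaceTime → ℝ} {G : Fin 3 → Fin 3 → SpaceTime → ℝ}
    (S : FlowData W C (comp W u) f G) (hG : ∀ j i, comp W (Gv j) i =ᵐ[volume] G j i)
    (hφ : IsMollifier φ) (ψ : 𝓓(W, ℝ)) :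
    ∀ᶠ ε in 𝓝[>] 0, energyDefectApprox φ W u Gv ε ψ = defectApprox hφ (comp W u) G ε ψ := by
  obtain ⟨ρ0, hρ0, h0⟩ := exists_radius hφ
  obtain ⟨ρ, hρ, hn⟩ := (isTest_coe ψ).exists_near W.isOpen
  have t : Tendsto (fun ε => ε * ρ0) (𝓝[>] 0) (𝓝 0) :=
    tendsto_nhdsWithin_of_tendsto_nhds (by simpa using (continuous_mul_const ρ0).tendsto (0 : ℝ))
  filter_upwards [t.eventually (gt_mem_nhds hρ), self_mem_nhdsWithin] with ε h1 h2
  exact energyDefectApprox_eq S hG hφ h2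
    (fun α hα => (spaceMol_inBall hφ h0 h2 α hα).trans h1.le) ψ hn

/-- The energy defect exists as a distribution as soon as it is non-negative. -/
theorem exists_isEnergyDefect {C : ℝ≥0} {u : SpaceTime → R3} {Gv : Fin 3 → SpaceTime → R3}
    {f : Fin 3 → SpaceTime → ℝ} (S : FlowData W C (comp W u) f fun j => comp W (Gv j))
    (hE : WeakEq W (comp W u) f) (hG : HasL2H1Gradient W u Gv) (hφ : IsMollifier φ)
    (hpos : ∀ (ψ : 𝓓(W, ℝ)) (x : ℝ), (∀ z, 0 ≤ ψ z) →
      Tendsto (fun ε => energyDefectApprox φ W u Gv ε ψ) (𝓝[>] 0) (𝓝 x) → 0 ≤ x) :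
    ∃ T : 𝓓'(W, ℝ), IsEnergyDefect φ W u T ∧ ∀ ψ : 𝓓(W, ℝ), (∀ z, 0 ≤ ψ z) → 0 ≤ T ψ := by
  have hG' : ∀ j i, comp W (Gv j) i =ᵐ[volume] comp W (Gv j) i := fun j i => .rfl
  have hlim : ∀ ψ : 𝓓(W, ℝ), ∃ x,
      Tendsto (fun ε => energyDefectApprox φ W u Gv ε ψ) (𝓝[>] 0) (𝓝 x) := fun ψ => by
    obtain ⟨r, hr, V0, V, -, hV, hV0, hψ⟩ := exists_near_tower (isTest_coe ψ)
    obtain ⟨B⟩ := exists_radialBump hr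
    exact ⟨_, tendsto_energyDefectApprox S hE hG' hφ B hr (hV.mono (by linarith)) hV0 ψ
      (hψ.subset hr.le)⟩
  choose L hL using hlim
  obtain ⟨T, hT⟩ := exists_distribution_of_nonneg (L := L) (fun c ψ χ => by
    refine tendsto_nhds_unique (hL _) ((((hL ψ).const_mul c).add (hL χ)).congr' ?_)
    filter_upwards [eventually_energyDefectApprox_eq S hG' hφ ψ,
      eventually_energyDefectApprox_eq S hG' hφ χ,
      eventually_energyDefectApprox_eq S hG' hφ (c • ψ + χ), self_mem_nhdsWithin] with ε h1 h2 h3 h4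
    rw [h1, h2, h3]
    exact (S.defectApprox_smul_add hφ h4 (isTest_coe ψ) (isTest_coe χ) c).symm)
    fun ψ hψ => hpos ψ _ hψ (hL ψ)
  exact ⟨T, ⟨Gv, hG, fun ψ => by rw [hT]; exact hL ψ⟩, fun ψ hψ => by
    rw [hT]; exact hpos ψ _ hψ (hL ψ)⟩

end Positivity

/-! ### From cylinders to the whole open set -/

section Localization

variable {Ω : Opens SpaceTime}

theorem exists_cylinder {z : SpaceTime} (hz : z ∈ Ω) :
    ∃ Q : Cylinder Ω, z ∈ (Q.toOpens : Set SpaceTime) := by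
  obtain ⟨r, hr, h⟩ := Metric.nhds_basis_closedBall.mem_iff.1 (Ω.isOpen.mem_nhds hz)
  have e : Ioo (z.1 - r) (z.1 + r) ×ˢ Metric.ball z.2 r = Metric.ball z r := by
    rw [← Real.ball_eq_Ioo, ball_prod_same]
  have hs : closure (Ioo (z.1 - r) (z.1 + r) ×ˢ Metric.ball z.2 r) ⊆ Metric.closedBall z r := by
    rw [e]
    exact Metric.closure_ball_subset_closedBall
  refine ⟨⟨z.1 - r, z.1 + r, ⟨Metric.ball z.2 r, Metric.isOpen_ball⟩,
    (isCompact_closedBall z r).of_isClosed_subset isClosed_closure hs, hs.trans h⟩, ?_⟩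
  change z ∈ Ioo (z.1 - r) (z.1 + r) ×ˢ Metric.ball z.2 r
  rw [e]
  exact Metric.mem_ball_self hr

theorem memL2Loc_of_cylinder {v : SpaceTime → R3}
    (h : ∀ Q : Cylinder Ω, MemLp v 2 (volume.restrict (Q.toOpens : Set SpaceTime))) :
    MemL2Loc Ω v := fun K hK hKΩ => by
  refine hK.induction_on (p := fun s => MemLp v 2 (volume.restrict s)) (by simp)
    (fun s t hst ht => ht.mono_measure (Measure.restrict_mono hst le_rfl)) (fun s t hs ht => ?_)
    fun z hz => ?_
  · have hm := aestronglyMeasurable_union_iff.2 ⟨hs.1, ht.1⟩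
    exact (memLp_two_iff_integrable_sq_norm hm).2 (IntegrableOn.union
      ((memLp_two_iff_integrable_sq_norm hs.1).1 hs) ((memLp_two_iff_integrable_sq_norm ht.1).1 ht))
  · obtain ⟨Q, hQ⟩ := exists_cylinder (hKΩ hz)
    exact ⟨_, mem_nhdsWithin_of_mem_nhds (Q.toOpens.isOpen.mem_nhds hQ), h Q⟩

/-- Convergence of integrals over small measurable sets gives convergence over compact sets. -/
theorem tendsto_setIntegral_of_local {K : Set SpaceTime} (hK : IsCompact K)
    {a : ℕ → SpaceTime → ℝ} {a0 : SpaceTime → ℝ}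
    (h : ∀ z ∈ K, ∃ t ∈ 𝓝 z, MeasurableSet t ∧ (∀ n, IntegrableOn (a n) t) ∧ IntegrableOn a0 t ∧
      ∀ A ⊆ t, MeasurableSet A → Tendsto (fun n => ∫ z in A, a n z) atTop (𝓝 (∫ z in A, a0 z))) :
    Tendsto (fun n => ∫ z in K, a n z) atTop (𝓝 (∫ z in K, a0 z)) := by
  have e : ∀ {t t' A : Set SpaceTime} {b : SpaceTime → ℝ}, MeasurableSet t → A ⊆ t ∪ t' →
      IntegrableOn b t → IntegrableOn b t' →
      (∫ z in A ∩ t, b z) + ∫ z in A \ t, b z = ∫ z in A, b z := fun m hA hb hb' =>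
    integral_inter_add_sdiff m ((hb.union hb').mono_set hA)
  suffices hp : ∃ t, K ⊆ t ∧ MeasurableSet t ∧ (∀ n, IntegrableOn (a n) t) ∧ IntegrableOn a0 t ∧
      ∀ A ⊆ t, MeasurableSet A →
        Tendsto (fun n => ∫ z in A, a n z) atTop (𝓝 (∫ z in A, a0 z)) by
    obtain ⟨t, ht, -, -, -, h2⟩ := hp
    exact h2 K ht hK.measurableSet
  refine hK.induction_on (p := fun s => ∃ t, s ⊆ t ∧ MeasurableSet t ∧
    (∀ n, IntegrableOn (a n) t) ∧ IntegrableOn a0 t ∧ ∀ A ⊆ t, MeasurableSet A →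
      Tendsto (fun n => ∫ z in A, a n z) atTop (𝓝 (∫ z in A, a0 z))) ?_ ?_ ?_ ?_
  · refine ⟨∅, subset_rfl, .empty, fun n => integrableOn_empty, integrableOn_empty, fun A hA _ => ?_⟩
    rw [subset_empty_iff.1 hA]
    simp
  · rintro s s' hs ⟨t, ht, h⟩
    exact ⟨t, hs.trans ht, h⟩
  · rintro s s' ⟨t, ht, m, i, i0, l⟩ ⟨t', ht', m', i', i0', l'⟩
    refine ⟨t ∪ t', union_subset_union ht ht', m.union m', fun n => (i n).union (i' n),
      i0.union i0', fun A hA mA => ?_⟩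
    rw [← e m hA i0 i0']
    exact ((l _ inter_subset_right (mA.inter m)).add
      (l' _ (fun z hz => (hA hz.1).resolve_left hz.2) (mA.diff m))).congr
        fun n => e m hA (i n) (i' n)
  · intro z hz
    obtain ⟨t, ht, h⟩ := h z hz
    exact ⟨t, mem_nhdsWithin_of_mem_nhds ht, t, subset_rfl, h⟩

/-- Convergence is known on each cylinder only. The support of ψ is covered by finitely many
cylinders, and the domain of integration is cut into measurable pieces, each inside one of them; on
each piece an indicator times ∂ψ is an admissible L² weight. -/
theorem weaklyDivFree_of_weakTendsto {fs : ℕ → SpaceTime → R3} {f : SpaceTime → R3}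
    (hd : ∀ n, WeaklyDivFree Ω (fs n)) (hf : ∀ Q : Cylinder Ω, WeakTendstoL2H1 Q.toOpens fs f) :
    WeaklyDivFree Ω f := fun ψ => by
  have tψ := isTest_coe ψ
  have hs : ∀ v : SpaceTime → R3, ∫ z in (Ω : Set SpaceTime), ∑ j, v z j * spaceDeriv j ψ z =
      ∫ z in tsupport ψ, ∑ j, v z j * spaceDeriv j ψ z := fun v =>
    setIntegral_eq_of_subset_of_forall_sdiff_eq_zero Ω.isOpen.measurableSet tψ.supp fun z hz => by
      refine Finset.sum_eq_zero fun j _ => ?_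
      rw [show spaceDeriv j ψ z = 0 from (IsTest.dd (U := tsupport ψ)
        ⟨ψ.contDiff, ψ.hasCompactSupport, subset_rfl⟩ (ej j)).eq_zero hz.2, mul_zero]
  rw [hs]
  refine tendsto_nhds_unique (tendsto_setIntegral_of_local tψ.compact.isCompact fun z hz => ?_)
    (tendsto_const_nhds.congr fun n => ((hs (fs n)).symm.trans (hd n ψ)).symm)
  obtain ⟨Q, hQ⟩ := exists_cylinder (tψ.supp hz)
  obtain ⟨Gs, G, hGs, hG, w, -⟩ := (hf Q).exists_weakL2
  have hi : ∀ {v : SpaceTime → R3}, MemLp v 2 (volume.restrict (Q.toOpens : Set SpaceTime)) →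
      ∀ j, IntegrableOn (fun z => v z j * spaceDeriv j ψ z) Q.toOpens := fun {v} hv j => by
    have h1 := integrable_mul_of_memLp (memLp_comp Q.toOpens.isOpen hv j) (tψ.dd (ej j)).memLp
    refine h1.integrableOn.congr_fun (fun z hz => ?_) Q.toOpens.isOpen.measurableSet
    simp only [comp_of_mem hz]
    rfl
  have hi' : ∀ {v : SpaceTime → R3}, MemLp v 2 (volume.restrict (Q.toOpens : Set SpaceTime)) →
      IntegrableOn (fun z => ∑ j, v z j * spaceDeriv j ψ z) Q.toOpens := fun hv =>
    integrable_finsetSum _ fun j _ => hi hv j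
  refine ⟨Q.toOpens, Q.toOpens.isOpen.mem_nhds hQ, Q.toOpens.isOpen.measurableSet,
    fun n => hi' (hGs n).memLp, hi' hG.memLp, fun A hA mA => ?_⟩
  have e : ∀ {v : SpaceTime → R3}, MemLp v 2 (volume.restrict (Q.toOpens : Set SpaceTime)) →
      ∑ j, ∫ z, comp Q.toOpens v j z * A.indicator (dd (ej j) ψ) z =
        ∫ z in A, ∑ j, v z j * spaceDeriv j ψ z := fun {v} hv => by
    rw [integral_finsetSum _ fun j _ => (hi hv j).mono_set hA]
    refine Finset.sum_congr rfl fun j _ => ?_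
    rw [← integral_indicator mA]
    refine integral_congr_ae (Eventually.of_forall fun z => ?_)
    by_cases hz : z ∈ A
    · simp only [indicator_of_mem hz, comp_of_mem (hA hz)]
      rfl
    · simp only [indicator_of_notMem hz, mul_zero]
  rw [← e hG.memLp]
  exact (tendsto_finsetSum _ fun j _ => (w j).tendsto _
    ((tψ.dd (ej j)).memLp.indicator mA)).congr fun n => e (hGs n).memLp

end Localization

/-! ### Conclusion -/

section Limits

variable {Ω : Opens SpaceTime} {φ : R3 → ℝ} {f u : SpaceTime → R3} {fs us : ℕ → SpaceTime → R3}

theorem isLocalWeakSolution_of_weakTendsto (hsol : ∀ n, IsLocalWeakSolution Ω (fs n) (us n))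
    (hf : ∀ Q : Cylinder Ω, WeakTendstoL2H1 Q.toOpens fs f)
    (hb : ∀ Q : Cylinder Ω, ∃ C : ℝ≥0, ∀ n, LinftyL2SqNormLE Q (us n) C)
    (hu : ∀ Q : Cylinder Ω, WeakTendstoL2H1 Q.toOpens us u) : IsLocalWeakSolution Ω f u := by
  have hfm : ∀ Q : Cylinder Ω, MemLp f 2 (volume.restrict (Q.toOpens : Set SpaceTime)) :=
    fun Q => by
      obtain ⟨_, _, _, h, _⟩ := hf Q
      exact h.memLp
  refine ⟨memL2Loc_of_cylinder hfm, weaklyDivFree_of_weakTendsto (fun n => (hsol n).force_divFree) hf,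
    fun Q => ?_, fun Q => ?_, fun Q => ?_, fun Q Φ hd => ?_⟩ <;>
  obtain ⟨C, Gs, G, hGs, hG, S⟩ := exists_flowSeq hsol Q (hf Q) (hb Q) (hu Q)
  · exact ⟨_, linftyL2_of_slice (fun i => (S.flow0.memU i).1) S.flow0.slice⟩
  · exact ⟨G, hG⟩
  · exact (divFree_comp_iff hG.memLp).1 S.flow0.divU
  · rw [integral_equation Φ hG.memLp (hfm Q)]
    exact S.weakEq (fun i z => Φ z i) (isTest_apply Φ) fun z => by rw [← divergence_eq]; exact hd z

/-- By uniqueness of limits the explicit defect equals the given non-negative distribution for each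
solution of the sequence, and equals the limit of the mollified defects for u. Non-negativity is
transferred between the two explicit expressions. -/
theorem isDissipative_of_weakTendsto (hφ : IsMollifier φ)
    (hsol : ∀ n, IsLocalWeakSolution Ω (fs n) (us n))
    (hf : ∀ Q : Cylinder Ω, WeakTendstoL2H1 Q.toOpens fs f)
    (hb : ∀ Q : Cylinder Ω, ∃ C : ℝ≥0, ∀ n, LinftyL2SqNormLE Q (us n) C)
    (hu : ∀ Q : Cylinder Ω, WeakTendstoL2H1 Q.toOpens us u)
    (hdiss : ∀ n, IsDissipative φ Ω (us n)) : IsDissipative φ Ω u := fun Q => by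
  obtain ⟨C, Gs, G, hGs, hG, S⟩ := exists_flowSeq hsol Q (hf Q) (hb Q) (hu Q)
  refine exists_isEnergyDefect S.flow0 S.weakEq hG hφ fun ψ x h0 hx => ?_
  obtain ⟨r, hr, V0, V, hVo, hV, hV0, hψ⟩ := exists_near_tower (isTest_coe ψ)
  obtain ⟨B⟩ := exists_radialBump hr
  have hψs : tsupport ψ ⊆ V0 := hψ.subset hr.le
  have hV' : Near r V Q.toOpens := hV.mono (by linarith)
  rw [tendsto_nhds_unique hx (tendsto_energyDefectApprox S.flow0 S.weakEq (fun j i => .rfl) hφ B hr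
    hV' hV0 ψ hψs)]
  refine S.defect_nonneg B hr hVo hV hV0 ⟨ψ.contDiff, ψ.hasCompactSupport, hψs⟩ hψ h0 fun n => ?_
  obtain ⟨T, ⟨G', hG', hT⟩, hpos⟩ := hdiss n Q
  rw [← tendsto_nhds_unique (hT ψ) (tendsto_energyDefectApprox (S.flow n) (S.equation n)
    (gradient_unique hG' (hGs n)) hφ B hr hV' hV0 ψ hψs)]
  exact hpos ψ h0

end Limits

end NavierStokes

end

theorem mainTheorem2
    (φ : NavierStokes.R3 → ℝ) (hφ : NavierStokes.IsMollifier φ)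
    (Ω : TopologicalSpace.Opens NavierStokes.SpaceTime)
    (f : NavierStokes.SpaceTime → NavierStokes.R3)
    (u : NavierStokes.SpaceTime → NavierStokes.R3)
    (fs : ℕ → NavierStokes.SpaceTime → NavierStokes.R3)
    (us : ℕ → NavierStokes.SpaceTime → NavierStokes.R3)
    (hsol : ∀ n, NavierStokes.IsLocalWeakSolution Ω (fs n) (us n))
    (hf : ∀ Q : NavierStokes.Cylinder Ω, ∀ n, NavierStokes.MemL2H1 Q.toOpens (fs n))
    (hf_lim : ∀ Q : NavierStokes.Cylinder Ω,
      NavierStokes.WeakTendstoL2H1 Q.toOpens fs f)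
    (hu_bdd : ∀ Q : NavierStokes.Cylinder Ω, ∃ C : NNReal, ∀ n,
      NavierStokes.LinftyL2SqNormLE Q (us n) C ∧
      NavierStokes.L2H1SqNormLE Q.toOpens (us n) C)
    (hu_lim : ∀ Q : NavierStokes.Cylinder Ω,
      NavierStokes.WeakTendstoL2H1 Q.toOpens us u)
    (hdiss : ∀ n, NavierStokes.IsDissipative φ Ω (us n)) :
    NavierStokes.IsLocalWeakSolution Ω f u ∧ NavierStokes.IsDissipative φ Ω u := by
  have hb : ∀ Q : NavierStokes.Cylinder Ω, ∃ C : NNReal, ∀ n,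
      NavierStokes.LinftyL2SqNormLE Q (us n) C := fun Q => by
    obtain ⟨C, hC⟩ := hu_bdd Q
    exact ⟨C, fun n => (hC n).1⟩
  exact ⟨NavierStokes.isLocalWeakSolution_of_weakTendsto hsol hf_lim hb hu_lim,
    NavierStokes.isDissipative_of_weakTendsto hφ hsol hf_lim hb hu_lim hdiss⟩
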